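/- Let $P_5=\mathbb F_2[x_1,\ldots,x_5]$, graded by $\deg x_i=1$, with its standard structure of a left module over the mod-2 Steenrod algebra $\mathcal A$: the Steenrod squares are determined by $Sq^0=\mathrm{id}$, $Sq^1(x_j)=x_j^2$, $Sq^i(x_j)=0$ for $i\geqslant 2$, $Sq^i(1)=0$ for $i\geqslant 1$, and the Cartan formula $Sq^n(fg)=\sum_{i=0}^n Sq^i(f)\,Sq^{n-i}(g)$. Let $\mathcal A^+$ be the augmentation ideal of $\mathcal A$ (the elements of positive degree), so that $\mathbb F_2\otimes_{\mathcal A}P_5=P_5/\mathcal A^+P_5$, and let $(\mathbb F_2\otimes_{\mathcal A}P_5)_d$ be the subspace of all classes represented by homogeneous polynomials of degree $d$. Then, for every positive integer $s$, $$\dim_{\mathbb F_2}(\mathbb F_2\otimes_{\mathcal A}P_5)_{5(2^s-1)}=\begin{cases}46,&\text{if } s=1,\\ 432,&\text{if } s=2,\\ 1117,&\text{if } s\geqslant 3.\end{cases}$$ -/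

import Mathlib

/-- The Adem relations, together with `Sq⁰ = 1`, on the free `𝔽₂`-algebra on symbols
`Sq⁰, Sq¹, Sq², …`. -/
inductive AdemRel : FreeAlgebra (ZMod 2) ℕ → FreeAlgebra (ZMod 2) ℕ → Prop
  | sq_zero : AdemRel (FreeAlgebra.ι (ZMod 2) 0) 1
  | adem (a b : ℕ) (ha : 0 < a) (hab : a < 2 * b) :
      AdemRel (FreeAlgebra.ι (ZMod 2) a * FreeAlgebra.ι (ZMod 2) b)
        (∑ j ∈ Finset.range (a / 2 + 1), ((b - 1 - j).choose (a - 2 * j) : ZMod 2) •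
          (FreeAlgebra.ι (ZMod 2) (a + b - j) * FreeAlgebra.ι (ZMod 2) j))

/-- The mod-2 Steenrod algebra: generators `Sqⁱ`, subject to `Sq⁰ = 1` and the Adem relations. -/
abbrev SteenrodAlgebra : Type := RingQuot AdemRel

namespace SteenrodAlgebra

/-- The augmentation `𝒜 → 𝔽₂`, which kills `Sqⁱ` for all `i > 0`. -/
noncomputable def augmentation : SteenrodAlgebra →ₐ[ZMod 2] ZMod 2 :=
  RingQuot.liftAlgHom (ZMod 2)
    ⟨FreeAlgebra.lift (ZMod 2) (fun i : ℕ => if i = 0 then (1 : ZMod 2) else 0), by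
      intro x y h
      cases h with
      | sq_zero => simp
      | adem a b ha hab =>
        have hb : b ≠ 0 := by omega
        simp only [map_mul, FreeAlgebra.lift_ι_apply, map_sum, map_smul, if_neg hb, mul_zero]
        symm
        apply Finset.sum_eq_zero
        intro j hj
        have : a + b - j ≠ 0 := by
          have := Finset.mem_range.1 hj
          omega
        simp [this]⟩

end SteenrodAlgebra

/-- The polynomial algebra `P_k = 𝔽₂[x₁, …, x_k]`. -/
abbrev PolyAlg (k : ℕ) : Type := MvPolynomial (Fin k) (ZMod 2)

namespace PolyAlg

variable {k : ℕ}

/-- The total Steenrod square `P_k → P_k[t]`, `f ↦ ∑ᵢ Sqⁱ(f) tⁱ`. It is multiplicative (the Cartan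
formula) and sends each generator `x_j` to `x_j + x_j² t`. -/
noncomputable def totalSq (k : ℕ) : PolyAlg k →ₐ[ZMod 2] Polynomial (PolyAlg k) :=
  MvPolynomial.aeval fun j =>
    Polynomial.C (MvPolynomial.X j) + Polynomial.C (MvPolynomial.X j ^ 2) * Polynomial.X

/-- The Steenrod square `Sqⁱ : P_k → P_k`. -/
noncomputable def sq (k i : ℕ) : PolyAlg k →ₗ[ZMod 2] PolyAlg k :=
  ((Polynomial.lcoeff (PolyAlg k) i).restrictScalars (ZMod 2)).comp (totalSq k).toLinearMap

theorem sq_apply (i : ℕ) (f : PolyAlg k) : sq k i f = (totalSq k f).coeff i := rfl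

theorem sq_X_mul (j : Fin k) (f : PolyAlg k) (i : ℕ) :
    sq k i (MvPolynomial.X j * f) = MvPolynomial.X j * sq k i f +
      if 1 ≤ i then MvPolynomial.X j ^ 2 * sq k (i - 1) f else 0 := by
  simp only [sq_apply, map_mul, totalSq, MvPolynomial.aeval_X, add_mul, Polynomial.coeff_add,
    Polynomial.coeff_C_mul, mul_assoc]
  cases i <;> simp

theorem sq_X_sq_mul (j : Fin k) (f : PolyAlg k) (i : ℕ) :
    sq k i (MvPolynomial.X j ^ 2 * f) = MvPolynomial.X j ^ 2 * sq k i f +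
      if 2 ≤ i then MvPolynomial.X j ^ 4 * sq k (i - 2) f else 0 := by
  have h2 : (2 : PolyAlg k) = 0 := CharTwo.two_eq_zero
  rw [pow_two, mul_assoc, sq_X_mul, sq_X_mul, sq_X_mul]
  rcases i with _ | _ | i
  · simp; ring
  · simp; linear_combination (MvPolynomial.X j ^ 3 * sq k 0 f) * h2
  · simp; linear_combination (MvPolynomial.X j ^ 3 * sq k (i + 1) f) * h2

theorem sq_one (i : ℕ) : sq k i 1 = if i = 0 then 1 else 0 := by
  simp [sq_apply, Polynomial.coeff_one]

theorem sq_zero (f : PolyAlg k) : sq k 0 f = f := by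
  induction f using MvPolynomial.induction_on with
  | C a =>
    rw [← mul_one (MvPolynomial.C a), ← MvPolynomial.smul_eq_C_mul, map_smul, sq_one, if_pos rfl]
  | add p q hp hq => rw [map_add, hp, hq]
  | mul_X p n h => rw [mul_comm, sq_X_mul, h]; simp

/-- Auxiliary for the proof of the Adem relations: `Sqⁿ` for `n : ℤ`, zero when `n < 0`. -/
noncomputable def sqZ (k : ℕ) (n : ℤ) : PolyAlg k →ₗ[ZMod 2] PolyAlg k :=
  if n < 0 then 0 else sq k n.toNat

/-- Auxiliary for the proof of the Adem relations: binomial coefficients with integer entries,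
zero when the lower entry is negative. -/
noncomputable def binomZ (n m : ℤ) : ℤ :=
  if m < 0 then 0 else Ring.choose n m.toNat

theorem binomZ_of_neg (n : ℤ) {m : ℤ} (hm : m < 0) : binomZ n m = 0 := by
  simp [binomZ, hm]

theorem binomZ_natCast (n m : ℕ) : binomZ n m = n.choose m := by
  simp [binomZ, Ring.choose_natCast]

theorem binomZ_pascal (n m : ℤ) : binomZ (n + 1) m = binomZ n m + binomZ n (m - 1) := by
  rcases lt_trichotomy m 0 with hm | rfl | hm
  · rw [binomZ_of_neg _ hm, binomZ_of_neg _ hm, binomZ_of_neg _ (by omega), add_zero]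
  · simp [binomZ]
  · obtain ⟨l, rfl⟩ : ∃ l : ℕ, m = l + 1 := ⟨(m - 1).toNat, by omega⟩
    have h1 : ¬ ((l : ℤ) + 1 < 0) := by omega
    have h2 : ((l : ℤ) + 1).toNat = l + 1 := by omega
    simp only [binomZ, add_sub_cancel_right, h1, h2, if_false, Int.toNat_natCast,
      Ring.choose_succ_succ]
    simp [add_comm]

theorem sqZ_of_neg {n : ℤ} (hn : n < 0) (f : PolyAlg k) : sqZ k n f = 0 := by
  simp [sqZ, hn]

theorem sqZ_natCast (n : ℕ) (f : PolyAlg k) : sqZ k n f = sq k n f := by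
  rw [sqZ, if_neg (by omega), Int.toNat_natCast]

theorem sqZ_zero (f : PolyAlg k) : sqZ k 0 f = f := by
  simp [sqZ, sq_zero]

theorem sqZ_one_of_ne {n : ℤ} (hn : n ≠ 0) : sqZ k n 1 = 0 := by
  by_cases h : n < 0
  · exact sqZ_of_neg h 1
  · have : n.toNat ≠ 0 := by omega
    simp [sqZ, h, sq_one, this]

theorem sqZ_X_mul (i : Fin k) (f : PolyAlg k) (n : ℤ) :
    sqZ k n (MvPolynomial.X i * f) =
      MvPolynomial.X i * sqZ k n f + MvPolynomial.X i ^ 2 * sqZ k (n - 1) f := by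
  rcases lt_trichotomy n 0 with hn | rfl | hn
  · simp [sqZ_of_neg hn, sqZ_of_neg (show n - 1 < 0 by omega)]
  · simp [sqZ_zero, sqZ_of_neg (show (-1 : ℤ) < 0 by omega)]
  · obtain ⟨l, rfl⟩ : ∃ l : ℕ, n = (l + 1 : ℕ) := ⟨(n - 1).toNat, by omega⟩
    have h : ((l + 1 : ℕ) : ℤ) - 1 = (l : ℕ) := by simp
    rw [h]
    simp only [sqZ_natCast, sq_X_mul]
    simp

theorem sqZ_X_sq_mul (i : Fin k) (f : PolyAlg k) (n : ℤ) :
    sqZ k n (MvPolynomial.X i ^ 2 * f) =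
      MvPolynomial.X i ^ 2 * sqZ k n f + MvPolynomial.X i ^ 4 * sqZ k (n - 2) f := by
  have h2 : (2 : PolyAlg k) = 0 := CharTwo.two_eq_zero
  have e : n - 1 - 1 = n - 2 := by ring
  rw [pow_two, mul_assoc, sqZ_X_mul, sqZ_X_mul, sqZ_X_mul, e]
  linear_combination (MvPolynomial.X i ^ 3 * sqZ k (n - 1) f) * h2

theorem sqZ_sqZ_X_mul (i : Fin k) (f : PolyAlg k) (a b : ℤ) :
    sqZ k a (sqZ k b (MvPolynomial.X i * f)) =
      MvPolynomial.X i * sqZ k a (sqZ k b f) +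
      MvPolynomial.X i ^ 2 * (sqZ k (a - 1) (sqZ k b f) + sqZ k a (sqZ k (b - 1) f)) +
      MvPolynomial.X i ^ 4 * sqZ k (a - 2) (sqZ k (b - 1) f) := by
  rw [sqZ_X_mul, map_add, sqZ_X_mul, sqZ_X_sq_mul]
  ring

/-- Right-hand side of the Adem relation for `Sqᵃ Sqᵇ`, with the sum truncated at `N`. -/
noncomputable def ademSum (k : ℕ) (a b : ℤ) (N : ℕ) (f : PolyAlg k) : PolyAlg k :=
  ∑ j ∈ Finset.range N,
    (binomZ (b - 1 - j) (a - 2 * j) : PolyAlg k) * sqZ k (a + b - j) (sqZ k j f)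

theorem ademSum_self (c : ℕ) (e : ℕ) (he : e ≤ 1) (N : ℕ) (hN : c < N) (f : PolyAlg k) :
    ademSum k (2 * c + e) c N f = sqZ k (2 * c + e) (sqZ k c f) := by
  rw [ademSum, Finset.sum_eq_single c]
  · have h1 : (2 * (c : ℤ) + e + c - c) = 2 * c + e := by ring
    have h2 : (2 * (c : ℤ) + e - 2 * c) = e := by ring
    have h3 : ((c : ℤ) - 1 - c) = -1 := by ring
    rw [h1, h2, h3]
    interval_cases e
    · simp [binomZ]
    · simp [binomZ, CharTwo.neg_eq]
  · intro j _ hj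
    rcases lt_or_gt_of_ne hj with h | h
    · obtain ⟨d, rfl⟩ : ∃ d, c = j + 1 + d := ⟨c - (j + 1), by omega⟩
      have h1 : (((j + 1 + d : ℕ) : ℤ) - 1 - j) = (d : ℕ) := by push_cast; ring
      have h2 : (2 * ((j + 1 + d : ℕ) : ℤ) + e - 2 * j) = (2 * d + 2 + e : ℕ) := by
        push_cast; ring
      rw [h1, h2, binomZ_natCast, Nat.choose_eq_zero_of_lt (by omega)]
      simp
    · rw [binomZ_of_neg _ (by omega)]
      simp
  · intro h
    exact absurd (Finset.mem_range.2 hN) h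

theorem ademSum_succ_of_lt (a b : ℤ) (N : ℕ) (h : a < 2 * N) (f : PolyAlg k) :
    ademSum k a b (N + 1) f = ademSum k a b N f := by
  rw [ademSum, Finset.sum_range_succ, binomZ_of_neg _ (by omega)]
  simp [ademSum]

theorem ademSum_X_mul (i : Fin k) (f : PolyAlg k) (a b : ℤ) (N : ℕ) (hN : a < 2 * (N + 1 : ℕ)) :
    ademSum k a b (N + 1) (MvPolynomial.X i * f) =
      MvPolynomial.X i * ademSum k a b (N + 1) f +
      MvPolynomial.X i ^ 2 * (ademSum k (a - 1) b (N + 1) f + ademSum k a (b - 1) (N + 1) f) +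
      MvPolynomial.X i ^ 4 * ademSum k (a - 2) (b - 1) N f := by
  have shift : ∀ (G : ℤ → PolyAlg k) (d : ℤ),
      ∑ j ∈ Finset.range (N + 1), G j * sqZ k (d - j) (sqZ k ((j : ℤ) - 1) f) =
        ∑ j ∈ Finset.range N, G (j + 1) * sqZ k (d - 1 - j) (sqZ k j f) := by
    intro G d
    rw [Finset.sum_range_succ']
    simp only [Nat.cast_add, Nat.cast_one, add_sub_cancel_right, Nat.cast_zero]
    rw [sqZ_of_neg (show (0 : ℤ) - 1 < 0 by omega)]
    simp [sub_sub, add_comm]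
  have e1 : ademSum k a b (N + 1) (MvPolynomial.X i * f) =
      MvPolynomial.X i * ademSum k a b (N + 1) f +
      MvPolynomial.X i ^ 2 *
        (∑ j ∈ Finset.range (N + 1), (binomZ (b - 1 - j) (a - 2 * j) : PolyAlg k) *
            sqZ k (a + b - 1 - j) (sqZ k j f) +
          ∑ j ∈ Finset.range (N + 1), (binomZ (b - 1 - j) (a - 2 * j) : PolyAlg k) *
            sqZ k (a + b - j) (sqZ k ((j : ℤ) - 1) f)) +
      MvPolynomial.X i ^ 4 *
        ∑ j ∈ Finset.range (N + 1), (binomZ (b - 1 - j) (a - 2 * j) : PolyAlg k) *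
            sqZ k (a + b - 2 - j) (sqZ k ((j : ℤ) - 1) f) := by
    simp only [ademSum, ← Finset.sum_add_distrib, Finset.mul_sum]
    refine Finset.sum_congr rfl fun j _ => ?_
    rw [sqZ_sqZ_X_mul, show a + b - (j : ℤ) - 1 = a + b - 1 - j by ring,
      show a + b - (j : ℤ) - 2 = a + b - 2 - j by ring]
    ring
  have e4 : ∑ j ∈ Finset.range (N + 1), (binomZ (b - 1 - j) (a - 2 * j) : PolyAlg k) *
        sqZ k (a + b - 2 - j) (sqZ k ((j : ℤ) - 1) f) = ademSum k (a - 2) (b - 1) N f := by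
    refine (shift (fun j => (binomZ (b - 1 - j) (a - 2 * j) : PolyAlg k)) _).trans ?_
    refine Finset.sum_congr rfl fun j _ => ?_
    rw [show b - 1 - (j + 1 : ℤ) = b - 1 - 1 - j by ring,
      show a - 2 * (j + 1 : ℤ) = a - 2 - 2 * j by ring,
      show a + b - 2 - 1 - (j : ℤ) = a - 2 + (b - 1) - j by ring]
  have e2 : ∑ j ∈ Finset.range (N + 1), (binomZ (b - 1 - j) (a - 2 * j) : PolyAlg k) *
        sqZ k (a + b - j) (sqZ k ((j : ℤ) - 1) f) =
      ∑ j ∈ Finset.range (N + 1),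
        (binomZ (b - 2 - j) (a - 2 - 2 * j) : PolyAlg k) *
          sqZ k (a + b - 1 - j) (sqZ k j f) := by
    refine (shift (fun j => (binomZ (b - 1 - j) (a - 2 * j) : PolyAlg k)) _).trans ?_
    rw [Finset.sum_range_succ,
      binomZ_of_neg _ (show a - 2 - 2 * (N : ℤ) < 0 by push_cast at hN; omega)]
    simp only [Int.cast_zero, zero_mul, add_zero]
    refine Finset.sum_congr rfl fun j _ => ?_
    rw [show b - 1 - (j + 1 : ℤ) = b - 2 - j by ring,
      show a - 2 * (j + 1 : ℤ) = a - 2 - 2 * j by ring]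
  have e5 : ∑ j ∈ Finset.range (N + 1), (binomZ (b - 1 - j) (a - 2 * j) : PolyAlg k) *
          sqZ k (a + b - 1 - j) (sqZ k j f) +
        ∑ j ∈ Finset.range (N + 1), (binomZ (b - 2 - j) (a - 2 - 2 * j) : PolyAlg k) *
          sqZ k (a + b - 1 - j) (sqZ k j f) =
      ademSum k (a - 1) b (N + 1) f + ademSum k a (b - 1) (N + 1) f := by
    simp only [ademSum, ← Finset.sum_add_distrib]
    refine Finset.sum_congr rfl fun j _ => ?_
    have p1 := binomZ_pascal (b - 2 - j) (a - 2 * j)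
    have p2 := binomZ_pascal (b - 2 - j) (a - 1 - 2 * j)
    rw [show b - 2 - (j : ℤ) + 1 = b - 1 - j by ring] at p1 p2
    rw [show a - 1 - 2 * (j : ℤ) - 1 = a - 2 - 2 * j by ring] at p2
    rw [show a - 2 * (j : ℤ) - 1 = a - 1 - 2 * j by ring] at p1
    rw [show a - 1 + b - (j : ℤ) = a + b - 1 - j by ring,
      show a + (b - 1) - (j : ℤ) = a + b - 1 - j by ring,
      show b - 1 - 1 - (j : ℤ) = b - 2 - j by ring, p1, p2]
    push_cast
    ring
  rw [e1, e4, e2, e5]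

theorem sqZ_sqZ_eq_ademSum (f : PolyAlg k) : ∀ (a b : ℤ) (N : ℕ), a < 2 * b → a < 2 * N →
    sqZ k a (sqZ k b f) = ademSum k a b N f := by
  have hneg : ∀ (g : PolyAlg k) (a b : ℤ) (N : ℕ), a < 0 →
      sqZ k a (sqZ k b g) = ademSum k a b N g := by
    intro g a b N ha
    rw [sqZ_of_neg ha, ademSum]
    refine (Finset.sum_eq_zero fun j _ => ?_).symm
    rw [binomZ_of_neg _ (by omega)]
    simp
  induction f using MvPolynomial.induction_on with
  | C r =>
    intro a b N hab _
    by_cases ha : a < 0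
    · exact hneg _ a b N ha
    have key : ∀ c d : ℤ, 0 < c ∨ 0 < d → sqZ k c (sqZ k d (MvPolynomial.C r)) = 0 := by
      intro c d h
      rw [← mul_one (MvPolynomial.C r), ← MvPolynomial.smul_eq_C_mul, map_smul, map_smul]
      by_cases hd : d = 0
      · subst hd
        rw [sqZ_zero, sqZ_one_of_ne (by omega), smul_zero]
      · rw [sqZ_one_of_ne hd, map_zero, smul_zero]
    rw [key a b (by omega), ademSum]
    refine (Finset.sum_eq_zero fun j _ => ?_).symm
    rw [key _ _ (by omega), mul_zero]
  | add p q hp hq =>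
    intro a b N hab hN
    rw [map_add, map_add, hp a b N hab hN, hq a b N hab hN]
    simp only [ademSum, map_add, mul_add, Finset.sum_add_distrib]
  | mul_X p i h =>
    intro a b N hab hN
    by_cases ha : a < 0
    · exact hneg _ a b N ha
    obtain ⟨M, rfl⟩ : ∃ M, N = M + 1 := ⟨N - 1, by omega⟩
    rw [mul_comm, ademSum_X_mul i p a b M hN, sqZ_sqZ_X_mul, h a b _ hab hN,
      h (a - 1) b (M + 1) (by omega) (by omega),
      h (a - 2) (b - 1) M (by omega) (by push_cast at hN; omega)]
    have h3 : sqZ k a (sqZ k (b - 1) p) = ademSum k a (b - 1) (M + 1) p := by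
      by_cases hab' : a < 2 * (b - 1)
      · exact h a (b - 1) _ hab' hN
      · obtain ⟨c, hc⟩ : ∃ c : ℕ, b - 1 = c := ⟨(b - 1).toNat, by omega⟩
        obtain ⟨e, he⟩ : ∃ e : ℕ, a = 2 * c + e := ⟨(a - 2 * c).toNat, by omega⟩
        rw [hc, he, ademSum_self c e (by omega) (M + 1) (by omega)]
    rw [h3]

/-- The Steenrod squares on `P_k` satisfy the Adem relations. -/
theorem sq_adem (a b : ℕ) (hab : a < 2 * b) (f : PolyAlg k) :
    sq k a (sq k b f) = ∑ j ∈ Finset.range (a / 2 + 1),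
      ((b - 1 - j).choose (a - 2 * j) : ZMod 2) • sq k (a + b - j) (sq k j f) := by
  rw [← sqZ_natCast, ← sqZ_natCast,
    sqZ_sqZ_eq_ademSum f a b (a / 2 + 1) (by omega) (by omega), ademSum]
  refine Finset.sum_congr rfl fun j hj => ?_
  have hj' := Finset.mem_range.1 hj
  have h1 : (b : ℤ) - 1 - j = (b - 1 - j : ℕ) := by omega
  have h2 : (a : ℤ) - 2 * j = (a - 2 * j : ℕ) := by omega
  have h3 : (a : ℤ) + b - j = (a + b - j : ℕ) := by omega
  rw [h1, h2, h3, binomZ_natCast, sqZ_natCast, sqZ_natCast, MvPolynomial.smul_eq_C_mul]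
  simp

/-- The action of the Steenrod algebra on `P_k`, in which the generator `Sqⁱ` acts as `sq k i`. -/
noncomputable def steenrodAction (k : ℕ) :
    SteenrodAlgebra →ₐ[ZMod 2] Module.End (ZMod 2) (PolyAlg k) :=
  RingQuot.liftAlgHom (ZMod 2)
    ⟨FreeAlgebra.lift (ZMod 2) (sq k), by
      intro x y h
      cases h with
      | sq_zero =>
        refine LinearMap.ext fun f => ?_
        simp [sq_zero]
      | adem a b ha hab =>
        refine LinearMap.ext fun f => ?_
        simpa using sq_adem a b hab f⟩

/-- `𝒜⁺ P_k`: the span of all `θ f` with `θ` in the augmentation ideal `𝒜⁺` of the Steenrod algebra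
and `f ∈ P_k`. -/
noncomputable def hit (k : ℕ) : Submodule (ZMod 2) (PolyAlg k) :=
  Submodule.span (ZMod 2)
    {g | ∃ θ : SteenrodAlgebra, SteenrodAlgebra.augmentation θ = 0 ∧
      ∃ f : PolyAlg k, g = steenrodAction k θ f}

/-- `𝔽₂ ⊗_𝒜 P_k = P_k / 𝒜⁺ P_k`. -/
abbrev Cohit (k : ℕ) : Type := PolyAlg k ⧸ hit k

/-- `(𝔽₂ ⊗_𝒜 P_k)_d`: the subspace of all classes represented by homogeneous polynomials of
degree `d`. -/
noncomputable def cohitDegree (k d : ℕ) : Submodule (ZMod 2) (Cohit k) :=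
  (MvPolynomial.homogeneousSubmodule (Fin k) (ZMod 2) d).map (hit k).mkQ

end PolyAlg

/-! ### Monomials, and generators of the hit polynomials. -/

namespace PolyAlg

open MvPolynomial

variable {k : ℕ}

/-! The degrees `n_s = 5(2^s - 1)` satisfy `n_{s+1} = 2 n_s + 5`. Kameko's map sends `x₁⋯x₅ y²` to
`y` and every monomial with an even exponent to `0`. It preserves hit polynomials, carries degree
`n_{s+1}` onto degree `n_s`, and on the quotient its kernel consists of the classes of polynomials
whose monomials all have an even exponent (`finrank_cohitDegree_kameko`, with `low` for these
monomials). Degree `0` contributes `1`, so everything reduces to the dimensions of the low parts.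
They are `45`, `386`, `685` in degrees `5`, `15`, `35`, and `0` from `s = 4` on; then `46 = 1 + 45`,
`432 = 46 + 386`, `1117 = 432 + 685`, and the value is stable.

Vanishing for `s ≥ 4` is Wood's argument (`low_mem_hit`). Modulo hits `u Sq^n v` equals `χ(Sq^n)u ·
v`. If `u` is a product of distinct variables, `χ(Sq^n)u` is a combination of monomials whose
exponents at these variables are powers of two, and for degree reasons no such monomial exists.

Upper bounds in the three remaining degrees: monomials are ordered by weight vector (the numbers of
exponents with a given binary digit), then by code. A monomial that is a sum of smaller ones modulo
hits can be discarded (`xp_mem_of_red`). Following Kameko and Sum, such a reduction can be inserted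
into larger monomials: if it holds for a block of consecutive rows of binary digits, using only
squares of index below `2^s` for `s` rows, it holds for every monomial containing the block
(`xp_context_mem`). An explicit list of hit equations for blocks of two to four rows, a row-by-row
search over all monomials avoiding these blocks (`search_spec`), and in degree `35` some equations
for single monomials leave exactly the listed candidates (`mem_or_red_of_search`).

Lower bounds: linear functionals that vanish on hit polynomials and form an invertible matrix on the
candidates. In the first type the functional adds the coefficients at a finite set of monomials; its
vanishing on hits is tested on `Sq^1, Sq^2, Sq^4, Sq^8, Sq^16` (`hit_le_ker_cf`), and permutations
of the variables give further functionals (`eq_zero_of_chkIndep`). In degree `35` these handle `65`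
candidates. The other `620`, of weight `(3,2,1,1,1)`, are separated by the coefficient of the spike
`x₁³¹x₂³x₃` after a linear substitution, which factors over the rows of the monomial
(`eq_zero_of_chkSubst`).

All finite checks are Boolean functions of numbers coding monomials in base `64`; their soundness is
proved once, and they are then evaluated on the data. -/

/-- The monomial with exponent vector `e`. -/
noncomputable def xp (e : Fin k → ℕ) : PolyAlg k := ∏ i, X i ^ e i

theorem xp_add (e f : Fin k → ℕ) : xp (e + f) = xp e * xp f := by
  simp [xp, pow_add, Finset.prod_mul_distrib]

theorem xp_smul (n : ℕ) (e : Fin k → ℕ) : xp (n • e) = xp e ^ n := by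
  simp only [xp, Pi.smul_apply, smul_eq_mul, ← Finset.prod_pow, ← pow_mul, mul_comm n]

theorem xp_eq_monomial (e : Fin k → ℕ) : xp e = monomial (Finsupp.equivFunOnFinite.symm e) 1 := by
  rw [monomial_eq, Finsupp.prod_fintype _ _ (by simp)]
  simp [xp]

theorem sq_mul (n : ℕ) (f g : PolyAlg k) :
    sq k n (f * g) = ∑ ij ∈ Finset.HasAntidiagonal.antidiagonal n, sq k ij.1 f * sq k ij.2 g := by
  simp only [sq_apply, map_mul, Polynomial.coeff_mul]

/-- In characteristic `2` the `2^r`-th power is Frobenius on the coefficients combined with `t ↦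
t^(2^r)`. Applied to the total square, this makes squares of index not divisible by `2^r` vanish on
`2^r`-th powers. -/
theorem coeff_pow_two_pow (g : Polynomial (PolyAlg k)) (r n : ℕ) :
    (g ^ 2 ^ r).coeff n = if 2 ^ r ∣ n then g.coeff (n / 2 ^ r) ^ 2 ^ r else 0 := by
  rw [← Polynomial.map_iterateFrobenius_expand (p := 2), Polynomial.coeff_map,
    Polynomial.coeff_expand (by positivity)]
  split_ifs <;> simp [iterateFrobenius_def]

theorem sq_pow_two_pow (r n : ℕ) (f : PolyAlg k) :
    sq k n (f ^ 2 ^ r) = if 2 ^ r ∣ n then sq k (n / 2 ^ r) f ^ 2 ^ r else 0 := by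
  simp only [sq_apply, map_pow, coeff_pow_two_pow]

theorem totalSq_xp (e : Fin k → ℕ) :
    totalSq k (xp e) = Polynomial.C (xp e) *
      ∏ i, (1 + Polynomial.C (X i) * Polynomial.X) ^ e i := by
  simp only [xp, totalSq, map_prod, map_pow, aeval_X, ← Finset.prod_mul_distrib, ← mul_pow]
  refine Finset.prod_congr rfl fun i _ => ?_
  ring

theorem coeff_one_add_C_mul_X_pow (a : PolyAlg k) (d b : ℕ) :
    ((1 + Polynomial.C a * Polynomial.X) ^ d : Polynomial (PolyAlg k)).coeff b =
      (d.choose b : PolyAlg k) * a ^ b := by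
  rw [add_comm, add_pow, Polynomial.finsetSum_coeff]
  simp only [mul_pow, one_pow, mul_one]
  rw [Finset.sum_eq_single b]
  · rw [mul_comm, ← mul_assoc, Polynomial.coeff_mul_X_pow', if_pos le_rfl]
    rw [Nat.sub_self, ← Polynomial.C_eq_natCast, ← Polynomial.C_pow, ← Polynomial.C_mul,
      Polynomial.coeff_C_zero]
  · intro c _ hc
    rw [mul_comm, ← mul_assoc, ← Polynomial.C_eq_natCast, ← Polynomial.C_pow, ← Polynomial.C_mul,
      Polynomial.coeff_C_mul_X_pow, if_neg (Ne.symm hc)]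
  · intro h
    have : d.choose b = 0 := Nat.choose_eq_zero_of_lt (by simpa using h)
    simp [this]

/-- The total square multiplies `x_i^{e_i}` by `(1 + x_i t)^{e_i}`; the coefficient of `t^p` in the
product is found by distributing `p` over the variables. -/
theorem sq_xp (p : ℕ) (e : Fin k → ℕ) :
    sq k p (xp e) = ∑ l ∈ Finset.finsuppAntidiag Finset.univ p,
      (∏ i, ((e i).choose (l i) : PolyAlg k)) * xp (e + ⇑l) := by
  have h : (∏ i, (1 + Polynomial.C (X i) * Polynomial.X) ^ e i : Polynomial (PolyAlg k)).coeff p =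
      ∑ l ∈ Finset.finsuppAntidiag Finset.univ p,
        ∏ i, (((e i).choose (l i) : PolyAlg k) * X i ^ l i) := by
    -- Read as a power series, a finite product has its coefficients indexed by the ways of
    -- splitting `p`.
    rw [← Polynomial.coeff_coe, ← Polynomial.coeToPowerSeries.ringHom_apply, map_prod,
      PowerSeries.coeff_prod]
    refine Finset.sum_congr rfl fun l _ => Finset.prod_congr rfl fun i _ => ?_
    rw [Polynomial.coeToPowerSeries.ringHom_apply, Polynomial.coeff_coe,
      coeff_one_add_C_mul_X_pow]
  rw [sq_apply, totalSq_xp, Polynomial.coeff_C_mul, h, Finset.mul_sum]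
  refine Finset.sum_congr rfl fun l _ => ?_
  rw [Finset.prod_mul_distrib, xp_add]
  simp only [xp]
  ring

theorem steenrodAction_mk_ι (i : ℕ) :
    steenrodAction k (RingQuot.mkAlgHom (ZMod 2) AdemRel (FreeAlgebra.ι (ZMod 2) i)) = sq k i := by
  simp [steenrodAction]

theorem sq_mem_hit {i : ℕ} (hi : i ≠ 0) (f : PolyAlg k) : sq k i f ∈ hit k := by
  refine Submodule.subset_span
    ⟨RingQuot.mkAlgHom (ZMod 2) AdemRel (FreeAlgebra.ι (ZMod 2) i), ?_, f, ?_⟩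
  · simp [SteenrodAlgebra.augmentation, hi]
  · rw [steenrodAction_mk_ι]

/-- The hit elements are spanned by the images of the squares `Sqⁱ` with `i > 0`. -/
theorem hit_le_of_sq_mem {S : Submodule (ZMod 2) (PolyAlg k)}
    (h : ∀ i ≠ 0, ∀ f, sq k i f ∈ S) : hit k ≤ S := by
  -- Subtracting the augmentation gives a statement that makes sense for every `θ`, not only for `θ`
  -- in the augmentation ideal, and can be proved by induction on expressions in the generators.
  have key : ∀ (a : FreeAlgebra (ZMod 2) ℕ) (f : PolyAlg k),
      steenrodAction k (RingQuot.mkAlgHom (ZMod 2) AdemRel a) f -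
        SteenrodAlgebra.augmentation (RingQuot.mkAlgHom (ZMod 2) AdemRel a) • f ∈ S := by
    intro a
    induction a using FreeAlgebra.induction with
    | grade0 r => intro f; simp
    | grade1 i =>
      intro f
      rw [steenrodAction_mk_ι]
      by_cases hi : i = 0
      · simp [hi, SteenrodAlgebra.augmentation, sq_zero]
      · simpa [hi, SteenrodAlgebra.augmentation] using h i hi f
    | mul a b ha hb =>
      intro f
      -- `θηf - ε(θη)f = (θ(ηf) - ε(θ)ηf) + ε(θ)(ηf - ε(η)f)`.
      have h1 := ha (steenrodAction k (RingQuot.mkAlgHom (ZMod 2) AdemRel b) f)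
      have h2 := S.smul_mem
        (SteenrodAlgebra.augmentation (RingQuot.mkAlgHom (ZMod 2) AdemRel a)) (hb f)
      have h3 := S.add_mem h1 h2
      simp only [map_mul, Module.End.mul_apply, smul_sub, mul_smul] at h3 ⊢
      simpa using h3
    | add a b ha hb =>
      intro f
      have h3 := S.add_mem (ha f) (hb f)
      simp only [map_add, LinearMap.add_apply, add_smul]
      convert h3 using 1
      abel
  refine Submodule.span_le.2 ?_
  rintro g ⟨θ, hθ, f, rfl⟩
  obtain ⟨a, rfl⟩ := RingQuot.mkAlgHom_surjective (ZMod 2) AdemRel θ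
  have := key a f
  rwa [hθ, zero_smul, sub_zero] at this

/-- The binomial coefficients of `2^r` strictly between the ends are even, so by Pascal's rule
neighbouring entries of row `2^r - 1` have the same parity, starting from the entry `1`. -/
theorem choose_two_pow_sub_one_odd (r a : ℕ) (ha : a < 2 ^ r) :
    ((2 ^ r - 1).choose a : ZMod 2) = 1 := by
  induction a with
  | zero => simp
  | succ a ih =>
    have h1 : (2 ^ r).choose (a + 1) =
        (2 ^ r - 1).choose a + (2 ^ r - 1).choose (a + 1) := by
      conv_lhs => rw [show 2 ^ r = (2 ^ r - 1) + 1 by have := Nat.one_le_two_pow (n := r); omega]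
      rw [Nat.choose_succ_succ]
    have h2 : ((2 ^ r).choose (a + 1) : ZMod 2) = 0 := by
      rw [ZMod.natCast_eq_zero_iff]
      exact Nat.Prime.dvd_choose_pow Nat.prime_two (by omega) (by omega)
    rw [h1, Nat.cast_add, ih (by omega)] at h2
    have h3 : ∀ x : ZMod 2, 1 + x = 0 → x = 1 := by decide
    exact h3 _ h2

/-- The hit elements are spanned by the images of the squares whose index is a power of two. -/
theorem hit_le_of_sq_two_pow_mem {S : Submodule (ZMod 2) (PolyAlg k)}
    (h : ∀ r f, sq k (2 ^ r) f ∈ S) : hit k ≤ S := by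
  refine hit_le_of_sq_mem fun n => ?_
  induction n using Nat.strong_induction_on with
  | _ n ih =>
    intro hn f
    obtain ⟨r, hle, hlt⟩ : ∃ r, 2 ^ r ≤ n ∧ n < 2 ^ (r + 1) :=
      ⟨Nat.log 2 n, Nat.pow_log_le_self 2 hn, Nat.lt_pow_succ_log_self (by norm_num) n⟩
    obtain ⟨a, rfl⟩ := Nat.exists_eq_add_of_le' hle
    rcases Nat.eq_zero_or_pos a with rfl | ha
    · rw [zero_add]; exact h r f
    have hab : a < 2 ^ r := by rw [pow_succ] at hlt; omega
    -- Here `n = a + 2^r` with `0 < a < 2^r`. The `j = 0` term of the Adem relation for `Sq^a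
    -- Sq^{2^r}` is `Sq^n` with odd coefficient. The left side and all other terms begin with a
    -- square of positive index smaller than `n`.
    have hadem := sq_adem a (2 ^ r) (by omega) f
    rw [Finset.sum_range_succ'] at hadem
    simp only [Nat.sub_zero, mul_zero, sq_zero, choose_two_pow_sub_one_odd r a hab,
      one_smul] at hadem
    have h1 : sq k a (sq k (2 ^ r) f) ∈ S := ih a (by omega) (by omega) _
    rw [hadem] at h1
    refine (S.add_mem_iff_right (S.sum_mem fun j hj => S.smul_mem _ ?_)).1 h1
    have := Finset.mem_range.1 hj
    exact ih _ (by omega) (by omega) _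

end PolyAlg

/-! ### Weight vectors, the order on monomials, and insertion of inadmissible blocks. -/

namespace PolyAlg

open MvPolynomial

variable {k : ℕ}

/-- The span of the monomials with exponent vector in `S`. -/
noncomputable def xspan (S : Set (Fin k → ℕ)) : Submodule (ZMod 2) (PolyAlg k) :=
  Submodule.span (ZMod 2) (xp '' S)

theorem xp_mem_xspan {S : Set (Fin k → ℕ)} {e : Fin k → ℕ} (he : e ∈ S) : xp e ∈ xspan S :=
  Submodule.subset_span ⟨e, he, rfl⟩

theorem xspan_mono {S T : Set (Fin k → ℕ)} (h : S ⊆ T) : xspan S ≤ xspan T :=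
  Submodule.span_mono (Set.image_mono h)

theorem xspan_le {S : Set (Fin k → ℕ)} {W : Submodule (ZMod 2) (PolyAlg k)} :
    xspan S ≤ W ↔ ∀ e ∈ S, xp e ∈ W := by
  rw [xspan, Submodule.span_le]
  exact ⟨fun h e he => h ⟨e, he, rfl⟩, by rintro h _ ⟨e, he, rfl⟩; exact h e he⟩

theorem mul_mem_xspan {S T U : Set (Fin k → ℕ)} (h : ∀ a ∈ S, ∀ b ∈ T, a + b ∈ U)
    {f g : PolyAlg k} (hf : f ∈ xspan S) (hg : g ∈ xspan T) : f * g ∈ xspan U := by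
  have h1 : f * g ∈ xspan S * xspan T := Submodule.mul_mem_mul hf hg
  rw [xspan, xspan, Submodule.span_mul_span] at h1
  refine Submodule.span_mono ?_ h1
  rintro _ ⟨_, ⟨a, ha, rfl⟩, _, ⟨b, hb, rfl⟩, rfl⟩
  exact ⟨a + b, h a ha b hb, xp_add a b⟩

/-- The additive map `f ↦ g * f ^ (2 ^ r)`. -/
noncomputable def mulPow (g : PolyAlg k) (r : ℕ) : PolyAlg k →ₗ[ZMod 2] PolyAlg k :=
  AddMonoidHom.toZModLinearMap 2
    ((AddMonoidHom.mulLeft g).comp (iterateFrobenius (PolyAlg k) 2 r).toAddMonoidHom)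

theorem mulPow_apply (g : PolyAlg k) (r : ℕ) (f : PolyAlg k) :
    mulPow g r f = g * f ^ 2 ^ r := by
  simp [mulPow, iterateFrobenius_def]

theorem mulPow_mem_xspan {S U : Set (Fin k → ℕ)} {x : Fin k → ℕ} {r : ℕ}
    (h : ∀ a ∈ S, x + 2 ^ r • a ∈ U) {f : PolyAlg k} (hf : f ∈ xspan S) :
    mulPow (xp x) r f ∈ xspan U := by
  have : xspan S ≤ (xspan U).comap (mulPow (xp x) r) := xspan_le.2 fun e he => by
    rw [Submodule.mem_comap, mulPow_apply, ← xp_smul, ← xp_add]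
    exact xp_mem_xspan (h e he)
  exact this hf

theorem pow_mem_xspan {S U : Set (Fin k → ℕ)} {r : ℕ}
    (h : ∀ a ∈ S, 2 ^ r • a ∈ U) {f : PolyAlg k} (hf : f ∈ xspan S) :
    f ^ 2 ^ r ∈ xspan U := by
  have := mulPow_mem_xspan (x := 0) (r := r) (U := U) (by simpa using h) hf
  rw [mulPow_apply] at this
  simpa [xp] using this

/-- The degree of the monomial with exponent vector `e`. -/
def dg (e : Fin k → ℕ) : ℕ := ∑ i, e i

theorem dg_add (e f : Fin k → ℕ) : dg (e + f) = dg e + dg f := by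
  simp [dg, Finset.sum_add_distrib]

theorem dg_smul (n : ℕ) (e : Fin k → ℕ) : dg (n • e) = n * dg e := by
  simp [dg, Finset.mul_sum]

/-- The weight vector: `om e u` is the number of exponents whose `u`-th binary digit is `1`. -/
def om (e : Fin k → ℕ) (u : ℕ) : ℕ := ∑ i, e i / 2 ^ u % 2

/-- `b` has smaller weight vector than `a` on account of the entries below `r`. -/
def PLt (r : ℕ) (b a : Fin k → ℕ) : Prop :=
  ∃ t < r, (∀ u < t, om b u = om a u) ∧ om b t < om a t

/-- A linear functional separating exponent vectors with small entries. -/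
def val (e : Fin k → ℕ) : ℕ := ∑ i : Fin k, e i * 64 ^ (i : ℕ)

theorem val_add (e f : Fin k → ℕ) : val (e + f) = val e + val f := by
  simp [val, Finset.sum_add_distrib, add_mul]

theorem val_smul (n : ℕ) (e : Fin k → ℕ) : val (n • e) = n * val e := by
  simp [val, Finset.mul_sum, mul_assoc]

/-- The order on monomials: by weight vector, then by `val`. -/
def Lt (b a : Fin k → ℕ) : Prop :=
  (∃ t, (∀ u < t, om b u = om a u) ∧ om b t < om a t) ∨
    ((∀ u, om b u = om a u) ∧ val b < val a)

/-- Lucas' theorem modulo `2`: the coefficient is odd exactly when the binary digits of `b` are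
among those of `a`, which is what `&&&` expresses. -/
theorem choose_cast_eq (a b : ℕ) :
    (a.choose b : ZMod 2) = if a &&& b = b then 1 else 0 := by
  induction a using Nat.strong_induction_on generalizing b with
  | _ a ih =>
    rcases Nat.eq_zero_or_pos a with rfl | ha
    · rcases Nat.eq_zero_or_pos b with rfl | hb
      · simp
      · rw [Nat.choose_eq_zero_of_lt hb]
        simp [hb.ne]
    · have h1 : (a.choose b : ZMod 2) =
          ((a % 2).choose (b % 2) * (a / 2).choose (b / 2) : ℕ) := by
        rw [ZMod.natCast_eq_natCast_iff]
        exact Choose.choose_modEq_choose_mod_mul_choose_div_nat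
      rw [h1, Nat.cast_mul, ih (a / 2) (by omega) (b / 2)]
      have h2 : (a &&& b = b) ↔ ((a % 2) &&& (b % 2) = b % 2) ∧ (a / 2 &&& b / 2 = b / 2) := by
        rw [← Nat.and_div_two, show (a % 2) &&& (b % 2) = (a &&& b) % 2 from
          (Nat.and_mod_two_pow (n := 1)).symm]
        constructor
        · intro h; rw [h]; simp
        · rintro ⟨h, h'⟩; omega
      rcases Nat.mod_two_eq_zero_or_one a with ha2 | ha2 <;>
        rcases Nat.mod_two_eq_zero_or_one b with hb2 | hb2 <;> simp [h2, ha2, hb2]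

theorem bit_le_of_and_eq {a b : ℕ} (h : a &&& b = b) (u : ℕ) : b / 2 ^ u % 2 ≤ a / 2 ^ u % 2 := by
  have h1 := congrArg (fun n => n.testBit u) h
  simp only [Nat.testBit_and] at h1
  have h2 : b.testBit u → a.testBit u := by
    intro hb; rw [hb] at h1; simpa using h1
  simp only [Nat.testBit_eq_decide_div_mod_eq, decide_eq_true_eq] at h2
  omega

theorem two_pow_dvd_of_bits {n t : ℕ} (h : ∀ u < t, n / 2 ^ u % 2 = 0) : 2 ^ t ∣ n := by
  induction t with
  | zero => simp
  | succ t ih =>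
    obtain ⟨m, rfl⟩ := ih fun u hu => h u (by omega)
    have := h t (by omega)
    rw [Nat.mul_div_cancel_left _ (by positivity)] at this
    rw [pow_succ]
    exact Nat.mul_dvd_mul_left _ (Nat.dvd_of_mod_eq_zero this)

theorem add_mul_bit_of_lt (a m : ℕ) {t u : ℕ} (h : u < t) :
    (a + 2 ^ t * m) / 2 ^ u % 2 = a / 2 ^ u % 2 := by
  obtain ⟨d, rfl⟩ := Nat.exists_eq_add_of_lt h
  rw [show 2 ^ (u + d + 1) * m = 2 ^ u * (2 * (2 ^ d * m)) by ring,
    Nat.add_mul_div_left _ _ (by positivity)]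
  omega

theorem add_mul_bit_of_ge {a : ℕ} (m : ℕ) {t u : ℕ} (ha : a < 2 ^ t) (h : t ≤ u) :
    (a + 2 ^ t * m) / 2 ^ u % 2 = m / 2 ^ (u - t) % 2 := by
  obtain ⟨d, rfl⟩ := Nat.exists_eq_add_of_le h
  rw [pow_add, ← Nat.div_div_eq_div_mul, Nat.add_mul_div_left _ _ (by positivity),
    Nat.div_eq_of_lt ha]
  simp

theorem om_add_smul_of_lt (x z : Fin k → ℕ) {r u : ℕ} (h : u < r) :
    om (x + 2 ^ r • z) u = om x u := by
  simp only [om, Pi.add_apply, Pi.smul_apply, smul_eq_mul, add_mul_bit_of_lt _ _ h]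

/-- The bound on `x` prevents a carry, so the rows from `r` on are those of `z`. -/
theorem om_add_smul_of_ge {x : Fin k → ℕ} (z : Fin k → ℕ) {r u : ℕ} (hx : ∀ i, x i < 2 ^ r)
    (h : r ≤ u) : om (x + 2 ^ r • z) u = om z (u - r) := by
  simp only [om, Pi.add_apply, Pi.smul_apply, smul_eq_mul, add_mul_bit_of_ge _ (hx _) h]

/-- The exponent vectors of the monomials that occur in `Sqᵖ` of the monomial `e`. -/
def sqSupp (p : ℕ) (e : Fin k → ℕ) : Set (Fin k → ℕ) :=
  {c | ∃ l : Fin k → ℕ, dg l = p ∧ (∀ i, e i &&& l i = l i) ∧ c = e + l}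

theorem sq_xp_mem (p : ℕ) (e : Fin k → ℕ) : sq k p (xp e) ∈ xspan (sqSupp p e) := by
  rw [sq_xp]
  refine Submodule.sum_mem _ fun l hl => ?_
  rw [Finset.mem_finsuppAntidiag] at hl
  have h1 : (∏ i, ((e i).choose (l i) : PolyAlg k)) =
      C (∏ i, ((e i).choose (l i) : ZMod 2)) := by simp
  rw [h1, ← smul_eq_C_mul]
  by_cases h : ∀ i, e i &&& l i = l i
  · exact Submodule.smul_mem _ _ (xp_mem_xspan ⟨l, hl.1, h, rfl⟩)
  · push Not at h
    obtain ⟨i, hi⟩ := h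
    rw [Finset.prod_eq_zero (Finset.mem_univ i), zero_smul]
    · exact Submodule.zero_mem _
    · rw [choose_cast_eq, if_neg hi]

theorem dg_of_mem_sqSupp {p : ℕ} {e c : Fin k → ℕ} (h : c ∈ sqSupp p e) : dg c = dg e + p := by
  obtain ⟨l, rfl, -, rfl⟩ := h
  exact dg_add e l

/-- Let `t` be the lowest binary position used by the increment `l`. Below `t` nothing changes. At
`t` every digit `1` of `l i` meets a digit `1` of `e i`, because the digits of `l i` are among those
of `e i`, and turns it into `0`. So the weight drops first at `t`, and `e i < 2^r` forces `t < r`.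
-/
theorem PLt_of_mem_sqSupp {p r : ℕ} (hp : p ≠ 0) {e c : Fin k → ℕ} (he : ∀ i, e i < 2 ^ r)
    (h : c ∈ sqSupp p e) : PLt r c e := by
  obtain ⟨l, rfl, hl, rfl⟩ := h
  have hex : ∃ u, ∃ i, l i / 2 ^ u % 2 = 1 := by
    obtain ⟨i, -, hi⟩ := Finset.exists_ne_zero_of_sum_ne_zero hp
    by_contra hno
    push Not at hno
    have h0 : ∀ t, 2 ^ t ∣ l i := fun t => two_pow_dvd_of_bits fun u _ => by
      have := hno u i; omega
    have := Nat.le_of_dvd (Nat.pos_of_ne_zero hi) (h0 (l i))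
    exact absurd this (not_le.2 Nat.lt_two_pow_self)
  classical
  obtain ⟨i₀, hi₀⟩ := Nat.find_spec hex
  have hmin : ∀ i, ∀ u < Nat.find hex, l i / 2 ^ u % 2 = 0 := by
    intro i u hu
    have := Nat.find_min hex hu
    push Not at this
    have := this i
    omega
  generalize Nat.find hex = t at hi₀ hmin
  have hdvd : ∀ i, ∃ m, l i = 2 ^ t * m := fun i => two_pow_dvd_of_bits (hmin i)
  choose m hm using hdvd
  have hlm : l = 2 ^ t • m := by ext i; simp [hm]
  have hbit := bit_le_of_and_eq (hl i₀) t
  refine ⟨t, ?_, ?_, ?_⟩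
  · by_contra hge
    have : e i₀ / 2 ^ t = 0 :=
      Nat.div_eq_of_lt ((he i₀).trans_le (Nat.pow_le_pow_right (by norm_num) (not_lt.1 hge)))
    omega
  · intro u hu
    rw [hlm, om_add_smul_of_lt _ _ hu]
  · have key : ∀ i, (e + l) i / 2 ^ t % 2 ≤ e i / 2 ^ t % 2 ∧
        (l i / 2 ^ t % 2 = 1 → (e + l) i / 2 ^ t % 2 < e i / 2 ^ t % 2) := by
      intro i
      have h1 := bit_le_of_and_eq (hl i) t
      have h2 : (e + l) i / 2 ^ t = e i / 2 ^ t + l i / 2 ^ t := by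
        rw [Pi.add_apply, hm i, Nat.add_mul_div_left _ _ (by positivity),
          Nat.mul_div_cancel_left _ (by positivity)]
      omega
    exact Finset.sum_lt_sum (fun i _ => (key i).1) ⟨i₀, Finset.mem_univ _, (key i₀).2 hi₀⟩

theorem sq_mem_xspan {d p : ℕ} {f : PolyAlg k} (hf : f ∈ xspan {e | dg e = d}) :
    sq k p f ∈ xspan {e | dg e = d + p} := by
  have : xspan {e : Fin k → ℕ | dg e = d} ≤ (xspan {e | dg e = d + p}).comap (sq k p) :=
    xspan_le.2 fun e he =>
      xspan_mono (fun c hc => by rw [Set.mem_ofPred_eq, dg_of_mem_sqSupp hc, he]) (sq_xp_mem p e)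
  exact this hf

/-- `Sq^{2^r p} (x f^{2^r})` agrees with `x (Sqᵖ f)^{2^r}` up to monomials of smaller weight. -/
theorem sq_mulPow_sub_mem {r p d : ℕ} {x : Fin k → ℕ} (hx : ∀ i, x i < 2 ^ r)
    {f : PolyAlg k} (hf : f ∈ xspan {e | dg e = d}) :
    sq k (2 ^ r * p) (mulPow (xp x) r f) - mulPow (xp x) r (sq k p f) ∈
      xspan {b | dg b = dg x + 2 ^ r * (d + p) ∧ PLt r b x} := by
  -- The Cartan term `(0, 2^r p)` is `x (Sq^p f)^(2^r)`. Any other term vanishes if its second index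
  -- is not divisible by `2^r`, and otherwise contains `Sq^i x` with `i > 0`, whose weight is
  -- smaller within the first `r` rows.
  have h0 : (0, 2 ^ r * p) ∈ Finset.HasAntidiagonal.antidiagonal (2 ^ r * p) := by simp
  rw [mulPow_apply, mulPow_apply, sq_mul, ← Finset.add_sum_erase _ _ h0]
  simp only [sq_zero, sq_pow_two_pow, dvd_mul_right, if_true]
  rw [Nat.mul_div_cancel_left _ (by positivity), add_sub_cancel_left]
  refine Submodule.sum_mem _ ?_
  rintro ⟨i, j⟩ hij
  simp only [Finset.mem_erase, Finset.HasAntidiagonal.mem_antidiagonal, ne_eq, Prod.mk.injEq] at hij ⊢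
  have hi : i ≠ 0 := by rintro rfl; exact hij.1 ⟨rfl, by omega⟩
  split_ifs with hj
  · obtain ⟨j, rfl⟩ := hj
    rw [Nat.mul_div_cancel_left _ (by positivity)]
    refine mul_mem_xspan ?_ (sq_xp_mem i x)
      (pow_mem_xspan (r := r) (U := {z | ∃ a : Fin k → ℕ, dg a = d + j ∧ z = 2 ^ r • a})
        (fun a ha => ⟨a, ha, rfl⟩) (sq_mem_xspan hf))
    rintro c hc _ ⟨z, hz, rfl⟩
    refine ⟨?_, ?_⟩
    · rw [dg_add, dg_smul, dg_of_mem_sqSupp hc, hz, mul_add, mul_add]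
      have := hij.2
      omega
    · obtain ⟨t, ht, h1, h2⟩ := PLt_of_mem_sqSupp hi hx hc
      refine ⟨t, ht, fun u hu => ?_, ?_⟩
      · rw [om_add_smul_of_lt _ _ (hu.trans ht), h1 u hu]
      · rwa [om_add_smul_of_lt _ _ ht]
  · rw [mul_zero]
    exact Submodule.zero_mem _

/-- Exponent vectors of monomials below `w` for reasons visible in the first `s` binary digits. -/
def below (s : ℕ) (w : Fin k → ℕ) : Set (Fin k → ℕ) :=
  {b | dg b = dg w ∧ (PLt s b w ∨
    ((∀ u < s, om b u = om w u) ∧ (∀ i, b i < 2 ^ s) ∧ (∀ i, w i < 2 ^ s) ∧ val b < val w))}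

/-- Rows below `r` are those of `x` on both sides. A first drop of weight at row `t` of the block
becomes one at row `r + t`; carries out of the block only affect later rows. In the tie case both
blocks have entries below `2^s`, so the rows of `y` are undisturbed, and `val` is additive. -/
theorem below_context {r s : ℕ} {x w y b : Fin k → ℕ} (hx : ∀ i, x i < 2 ^ r)
    (hb : b ∈ below s w) :
    dg (x + 2 ^ r • (b + 2 ^ s • y)) = dg (x + 2 ^ r • (w + 2 ^ s • y)) ∧
      Lt (x + 2 ^ r • (b + 2 ^ s • y)) (x + 2 ^ r • (w + 2 ^ s • y)) := by
  obtain ⟨hdeg, hb⟩ := hb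
  refine ⟨by simp only [dg_add, dg_smul, hdeg], ?_⟩
  rcases hb with ⟨t, ht, h1, h2⟩ | ⟨h1, h2, h3, h4⟩
  · refine Or.inl ⟨r + t, fun u hu => ?_, ?_⟩
    · by_cases hur : u < r
      · rw [om_add_smul_of_lt _ _ hur, om_add_smul_of_lt _ _ hur]
      · rw [om_add_smul_of_ge _ hx (by omega), om_add_smul_of_ge _ hx (by omega),
          om_add_smul_of_lt _ _ (by omega), om_add_smul_of_lt _ _ (by omega), h1 _ (by omega)]
    · rw [om_add_smul_of_ge _ hx (by omega), om_add_smul_of_ge _ hx (by omega),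
        om_add_smul_of_lt _ _ (by omega), om_add_smul_of_lt _ _ (by omega)]
      simpa using h2
  · refine Or.inr ⟨fun u => ?_, ?_⟩
    · by_cases hur : u < r
      · rw [om_add_smul_of_lt _ _ hur, om_add_smul_of_lt _ _ hur]
      · rw [om_add_smul_of_ge _ hx (by omega), om_add_smul_of_ge _ hx (by omega)]
        by_cases hus : u - r < s
        · rw [om_add_smul_of_lt _ _ hus, om_add_smul_of_lt _ _ hus, h1 _ hus]
        · rw [om_add_smul_of_ge _ h2 (by omega), om_add_smul_of_ge _ h3 (by omega)]
    · simp only [val_add, val_smul]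
      have := Nat.mul_lt_mul_of_pos_left h4 (show 0 < 2 ^ r by positivity)
      rw [mul_add, mul_add]
      omega

/-- A strictly inadmissible monomial `w` stays inadmissible after insertion into a larger one. -/
theorem xp_context_mem {r s : ℕ} {x w y : Fin k → ℕ} (hx : ∀ i, x i < 2 ^ r)
    (L : List (ℕ × (Fin k → ℕ)))
    (hL : ∀ c ∈ L, c.1 ≠ 0 ∧ c.1 < 2 ^ s ∧ dg c.2 + c.1 = dg w)
    (hw : xp w + (L.map fun c => sq k c.1 (xp c.2)).sum ∈ xspan (below s w)) :
    xp (x + 2 ^ r • (w + 2 ^ s • y)) ∈ hit k ⊔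
      xspan {b | dg b = dg (x + 2 ^ r • (w + 2 ^ s • y)) ∧
        Lt b (x + 2 ^ r • (w + 2 ^ s • y))} := by
  set a := x + 2 ^ r • (w + 2 ^ s • y) with ha
  set T := hit k ⊔ xspan {b | dg b = dg a ∧ Lt b a} with hT
  -- `φ` is the insertion `f ↦ x (f y^(2^s))^(2^r)`; it is linear over `𝔽₂`.
  let φ : PolyAlg k →ₗ[ZMod 2] PolyAlg k :=
    (mulPow (xp x) r).comp (LinearMap.mulRight (ZMod 2) (xp y ^ 2 ^ s))
  have hφ : ∀ f, φ f = mulPow (xp x) r (f * xp y ^ 2 ^ s) := fun f => rfl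
  have hφx : ∀ b, φ (xp b) = xp (x + 2 ^ r • (b + 2 ^ s • y)) := fun b => by
    rw [hφ, mulPow_apply, ← xp_smul, ← xp_add, ← xp_smul, ← xp_add]
  have h1 : φ (xp w + (L.map fun c => sq k c.1 (xp c.2)).sum) ∈ T := by
    have : xspan (below s w) ≤ T.comap φ := xspan_le.2 fun b hb => by
      rw [Submodule.mem_comap, hφx]
      exact Submodule.mem_sup_right (xp_mem_xspan (below_context hx hb))
    exact this hw
  have h2 : ∀ c ∈ L, φ (sq k c.1 (xp c.2)) ∈ T := by
    intro c hc
    obtain ⟨hc0, hcs, hcd⟩ := hL c hc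
    -- A positive square of index below `2^s` annihilates `y^(2^s)`, so `Sq^c` commutes with
    -- multiplication by this power. This is the reason for the bound `c.1 < 2 ^ s`.
    have e1 : sq k c.1 (xp c.2 * xp y ^ 2 ^ s) = sq k c.1 (xp c.2) * xp y ^ 2 ^ s := by
      rw [sq_mul, Finset.sum_eq_single (c.1, 0)]
      · rw [sq_zero]
      · rintro ⟨i, j⟩ hij hne
        rw [Finset.HasAntidiagonal.mem_antidiagonal] at hij
        simp only at hij ⊢
        rw [sq_pow_two_pow, if_neg, mul_zero]
        intro hd
        have hj : j ≠ 0 := by rintro rfl; exact hne (by ext <;> simp <;> omega)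
        have := Nat.le_of_dvd (Nat.pos_of_ne_zero hj) hd
        omega
      · intro h; exact absurd (by simp) h
    have e2 : xp c.2 * xp y ^ 2 ^ s ∈ xspan {e | dg e = dg (c.2 + 2 ^ s • y)} := by
      rw [← xp_smul, ← xp_add]
      exact xp_mem_xspan rfl
    -- The insertion of `Sq^c h` agrees with `Sq^(2^r c)` of the insertion of `h`, which is hit, up
    -- to monomials that are smaller already in the rows of `x`.
    have e3 := sq_mulPow_sub_mem (p := c.1) hx e2
    rw [hφ, ← e1]
    have e4 : sq k (2 ^ r * c.1) (mulPow (xp x) r (xp c.2 * xp y ^ 2 ^ s)) ∈ hit k :=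
      sq_mem_hit (by positivity) _
    have e5 : xspan {b | dg b = dg x + 2 ^ r * (dg (c.2 + 2 ^ s • y) + c.1) ∧ PLt r b x} ≤ T := by
      refine le_trans (xspan_mono ?_) le_sup_right
      rintro b ⟨hb1, t, ht, hb2, hb3⟩
      refine ⟨?_, Or.inl ⟨t, fun u hu => ?_, ?_⟩⟩
      · simp only [hb1, ha, dg_add, dg_smul, ← hcd]
        ring
      · rw [hb2 u hu, ha, om_add_smul_of_lt _ _ (hu.trans ht)]
      · rwa [ha, om_add_smul_of_lt _ _ ht]
    have := T.sub_mem (Submodule.mem_sup_left e4) (e5 e3)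
    rwa [sub_sub_cancel] at this
  have h3 : φ (L.map fun c => sq k c.1 (xp c.2)).sum ∈ T := by
    rw [map_list_sum, List.map_map]
    refine T.list_sum_mem ?_
    simp only [List.mem_map, Function.comp]
    rintro _ ⟨c, hc, rfl⟩
    exact h2 c hc
  rw [map_add] at h1
  have := (T.add_mem_iff_left h3).1 h1
  rwa [hφx] at this

end PolyAlg

/-! ### Monomials coded in base `64`, and verification of hit equations. -/

namespace PolyAlg

open MvPolynomial

/-- The exponent vector with code `n`, read off in base `64`. -/
def dig (n : ℕ) : Fin 5 → ℕ := fun i => n / 64 ^ (i : ℕ) % 64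

theorem val_dig {n : ℕ} (hn : n < 64 ^ 5) : val (dig n) = n := by
  simp only [val, dig, Fin.sum_univ_five, Fin.val_zero, Fin.val_one, Fin.val_two]
  simp
  omega

theorem dig_val {e : Fin 5 → ℕ} (he : ∀ i, e i < 64) : dig (val e) = e := by
  have h0 := he 0
  have h1 := he 1
  have h2 := he 2
  have h3 := he 3
  have h4 := he 4
  funext i
  simp only [val, dig, Fin.sum_univ_five]
  fin_cases i <;> simp <;> omega

theorem val_lt {e : Fin 5 → ℕ} (he : ∀ i, e i < 64) : val e < 64 ^ 5 := by
  have h0 := he 0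
  have h1 := he 1
  have h2 := he 2
  have h3 := he 3
  have h4 := he 4
  simp only [val, Fin.sum_univ_five]
  simp
  omega

/-- The hypothesis excludes a carry into the next base `64` digit. -/
theorem dig_add_shift (n b : ℕ) (k : Fin 5) (h : dig n k + b < 64) :
    dig (n + b * 64 ^ (k : ℕ)) = dig n + Pi.single k b := by
  funext i
  simp only [dig] at h
  simp only [dig, Pi.add_apply]
  fin_cases k <;> fin_cases i <;> simp at h ⊢ <;> omega

theorem xp_single (k : Fin 5) (b : ℕ) : xp (Pi.single k b) = X k ^ b := by
  rw [xp, Finset.prod_eq_single k]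
  · simp
  · intro i _ hi; simp [hi]
  · simp

theorem dg_single (k : Fin 5) (b : ℕ) : dg (Pi.single k b : Fin 5 → ℕ) = b := by
  simp [dg]

/-- The sum of the base `64` digits. -/
noncomputable def dgN (n : ℕ) : ℕ :=
  Nat.add (Nat.land n 63) (Nat.add (Nat.land (Nat.shiftRight n 6) 63)
    (Nat.add (Nat.land (Nat.shiftRight n 12) 63) (Nat.add (Nat.land (Nat.shiftRight n 18) 63)
      (Nat.land (Nat.shiftRight n 24) 63))))

theorem shift_land (n j : ℕ) : Nat.land (Nat.shiftRight n j) 63 = n / 2 ^ j % 64 := by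
  change (n >>> j) &&& 63 = _
  rw [Nat.shiftRight_eq_div_pow]
  exact Nat.and_two_pow_sub_one_eq_mod _ 6

theorem dgN_eq (n : ℕ) : dgN n = dg (dig n) := by
  have h0 : Nat.land n 63 = n % 64 := Nat.and_two_pow_sub_one_eq_mod _ 6
  simp only [dgN, h0, shift_land, dg, dig, Fin.sum_univ_five]
  simp only [Nat.add_eq]
  norm_num
  omega

/-- The numbers `b ≤ p` whose binary digits are among those of `a`. -/
noncomputable def upto (a p : ℕ) : List ℕ :=
  Nat.rec [0] (fun b ih => Bool.rec ih (Nat.succ b :: ih)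
    (Nat.beq (Nat.land a (Nat.succ b)) (Nat.succ b))) p

/-- A version of `upto` whose evaluation normalises the arguments first. -/
noncomputable def subsF (a p : ℕ) : List ℕ :=
  Nat.rec (upto 0 p) (fun m _ => Nat.rec (upto (Nat.succ m) 0)
    (fun q _ => upto (Nat.succ m) (Nat.succ q)) p) a

theorem subsF_eq (a p : ℕ) : subsF a p = upto a p := by
  cases a <;> cases p <;> rfl

theorem upto_succ (a p : ℕ) : upto a (p + 1) =
    if a &&& (p + 1) = p + 1 then (p + 1) :: upto a p else upto a p := by
  change (Bool.rec (upto a p) ((p + 1) :: upto a p) (Nat.beq (a &&& (p + 1)) (p + 1)) : List ℕ) = _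
  cases h : Nat.beq (a &&& (p + 1)) (p + 1)
  · rw [if_neg (Nat.ne_of_beq_eq_false h)]
  · rw [if_pos (Nat.eq_of_beq_eq_true h)]

theorem mem_upto {a p b : ℕ} : b ∈ upto a p → b ≤ p ∧ a &&& b = b := by
  induction p with
  | zero => intro h; simp [upto] at h; simp [h]
  | succ p ih =>
    rw [upto_succ]
    split_ifs with hc
    · rw [List.mem_cons]
      rintro (rfl | h)
      · exact ⟨le_rfl, hc⟩
      · exact ⟨(ih h).1.trans (Nat.le_succ p), (ih h).2⟩
    · exact fun h => ⟨(ih h).1.trans (Nat.le_succ p), (ih h).2⟩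

theorem sum_upto {M : Type*} [AddCommMonoid M] (a p : ℕ) (f : ℕ → M) :
    ((upto a p).map f).sum = ∑ b ∈ Finset.range (p + 1), if a &&& b = b then f b else 0 := by
  induction p with
  | zero => simp [upto]
  | succ p ih =>
    rw [Finset.sum_range_succ, ← ih, upto_succ]
    split_ifs <;> simp [add_comm]

/-- The codes of the terms of `Sqᵖ` of the monomial with code `n`, with multiplicities reduced;
only the digits below `k` are varied. -/
noncomputable def allT (n : ℕ) : ℕ → ℕ → ℕ → List ℕ
  | 0, p, x => if p = 0 then [x] else []
  | k + 1, p, x =>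
    (upto (n / 64 ^ k % 64) p).flatMap fun b => allT n k (p - b) (x + b * 64 ^ k)

/-- The part of `allT` selected by `g`, in front of `rest`. -/
noncomputable def sqT (g : ℕ → Bool) (n k : ℕ) : ℕ → ℕ → List ℕ → List ℕ :=
  Nat.rec (motive := fun _ => ℕ → ℕ → List ℕ → List ℕ)
    (fun p x rest => Bool.rec rest (Bool.rec rest (x :: rest) (g x)) (Nat.beq p 0))
    (fun k ih p x rest =>
      List.rec rest (fun b _ ihl =>
          ih (Nat.sub p b) (Nat.add x (Nat.shiftLeft b (Nat.mul 6 k))) ihl)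
        (subsF (Nat.land (Nat.shiftRight n (Nat.mul 6 k)) 63) p)) k

/-- Terms rejected by `g` are dropped as soon as the expansion reaches them; the accumulator `rest`
stands for the end of the list. -/
theorem sqT_eq (g : ℕ → Bool) (n k p x : ℕ) (rest : List ℕ) :
    sqT g n k p x rest = (allT n k p x).filter g ++ rest := by
  induction k generalizing p x rest with
  | zero =>
    change (Bool.rec rest (Bool.rec rest (x :: rest) (g x)) (Nat.beq p 0) : List ℕ) = _
    cases h : Nat.beq p 0
    · simp [allT, Nat.ne_of_beq_eq_false h]
    · cases h' : g x <;> simp [allT, Nat.eq_of_beq_eq_true h, h']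
  | succ k ih =>
    have e1 : Nat.land (Nat.shiftRight n (Nat.mul 6 k)) 63 = n / 64 ^ k % 64 := by
      rw [shift_land]
      change n / 2 ^ (6 * k) % 64 = _
      rw [pow_mul]; norm_num
    change (List.rec rest (fun b _ ihl =>
      sqT g n k (Nat.sub p b) (Nat.add x (Nat.shiftLeft b (Nat.mul 6 k))) ihl)
        (subsF (Nat.land (Nat.shiftRight n (Nat.mul 6 k)) 63) p) : List ℕ) = _
    rw [e1, subsF_eq, allT]
    induction upto (n / 64 ^ k % 64) p with
    | nil => simp
    | cons b l ihl =>
      have e2 : Nat.add x (Nat.shiftLeft b (Nat.mul 6 k)) = x + b * 64 ^ k := by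
        change x + b <<< (6 * k) = _
        rw [Nat.shiftLeft_eq, pow_mul]; norm_num
      simp only [e2, ih, List.flatMap_cons, List.filter_append, List.append_assoc] at ihl ⊢
      rw [← ihl]
      rfl

/-- The product of the factors `(1 + x_j t)^{d_j}` over the digits below `k`. -/
noncomputable def sqFactor (n : ℕ) (k : ℕ) : Polynomial (PolyAlg 5) :=
  ∏ i : Fin 5, if (i : ℕ) < k then (1 + Polynomial.C (X i) * Polynomial.X) ^ dig n i else 1

theorem sqFactor_succ (n : ℕ) (k : Fin 5) : sqFactor n (k + 1) =
    (1 + Polynomial.C (X k) * Polynomial.X) ^ dig n k * sqFactor n k := by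
  rw [sqFactor, sqFactor, ← Finset.mul_prod_erase _ _ (Finset.mem_univ k),
    ← Finset.mul_prod_erase _ (fun i : Fin 5 => if (i : ℕ) < k then
      (1 + Polynomial.C (X i : PolyAlg 5) * Polynomial.X) ^ dig n i else 1) (Finset.mem_univ k)]
  simp only [Nat.lt_succ_self, if_true, lt_irrefl, if_false, one_mul]
  congr 1
  refine Finset.prod_congr rfl fun i hi => ?_
  have : (i : ℕ) ≠ k := fun h => Finset.ne_of_mem_erase hi (Fin.ext h)
  by_cases h : (i : ℕ) < k
  · rw [if_pos h, if_pos (by omega)]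
  · rw [if_neg h, if_neg (by omega)]

theorem sum_flatMap {α M : Type*} [AddCommMonoid M] (l : List α) (f : α → List M) :
    (l.flatMap f).sum = (l.map fun a => (f a).sum).sum := by
  induction l with
  | nil => rfl
  | cons a l ih => rw [List.flatMap_cons, List.sum_append, ih, List.map_cons, List.sum_cons]

theorem natCast_choose_eq (a b : ℕ) :
    (a.choose b : PolyAlg 5) = if a &&& b = b then 1 else 0 := by
  have h := congrArg (algebraMap (ZMod 2) (PolyAlg 5)) (choose_cast_eq a b)
  rw [map_natCast] at h
  rw [h]
  split_ifs <;> simp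

theorem le_of_and_eq {a b : ℕ} (h : a &&& b = b) : b ≤ a := h ▸ Nat.and_le_left

/-- Induction over the variables: choosing the share `b` of the index `p` that goes to the last
variable is the convolution formula for a coefficient of the product `sqFactor`. As `b` is at most
the exponent it is added to, exponents below `32` leave no room for carries in base `64`. -/
theorem sum_allT (n : ℕ) (hn : ∀ i, dig n i < 32) (k : ℕ) (hk : k ≤ 5) (p x : ℕ)
    (hx : ∀ i : Fin 5, (i : ℕ) < k → dig x i = dig n i) :
    ((allT n k p x).map fun y => xp (dig y)).sum = xp (dig x) * (sqFactor n k).coeff p ∧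
      ∀ y ∈ allT n k p x, dg (dig y) = dg (dig x) + p := by
  induction k generalizing p x with
  | zero =>
    have : sqFactor n 0 = 1 := by simp [sqFactor]
    rw [this, Polynomial.coeff_one, allT]
    split_ifs with h <;> simp [h]
  | succ k ih =>
    obtain ⟨j, rfl⟩ : ∃ j : Fin 5, (j : ℕ) = k := ⟨⟨k, by omega⟩, rfl⟩
    have hb : ∀ b ∈ upto (dig n j) p,
        dig (x + b * 64 ^ (j : ℕ)) = dig x + Pi.single j b := by
      intro b hb
      apply dig_add_shift
      have h1 := le_of_and_eq (mem_upto hb).2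
      have h2 := hn j
      rw [hx j (by omega)]
      omega
    have hb' : ∀ b ∈ upto (dig n j) p, ∀ i : Fin 5, (i : ℕ) < j →
        dig (x + b * 64 ^ (j : ℕ)) i = dig n i := by
      intro b hbm i hi
      rw [hb b hbm, Pi.add_apply, Pi.single_eq_of_ne (fun h => by rw [h] at hi; omega), add_zero]
      exact hx i (by omega)
    have hdef : allT n (j + 1) p x =
        (upto (dig n j) p).flatMap fun b => allT n j (p - b) (x + b * 64 ^ (j : ℕ)) := rfl
    rw [hdef]
    refine ⟨?_, ?_⟩
    · rw [List.map_flatMap, sum_flatMap, sqFactor_succ, Polynomial.coeff_mul,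
        Finset.Nat.sum_antidiagonal_eq_sum_range_succ_mk]
      rw [List.map_congr_left (g := fun b => xp (dig x) *
        (X j ^ b * (sqFactor n j).coeff (p - b))) (fun b hbm => by
          rw [(ih (by omega) (p - b) _ (hb' b hbm)).1, hb b hbm, xp_add, xp_single]; ring),
        sum_upto, Finset.mul_sum]
      refine Finset.sum_congr rfl fun b _ => ?_
      rw [coeff_one_add_C_mul_X_pow, natCast_choose_eq]
      split_ifs <;> simp
    · intro y hy
      obtain ⟨b, hbm, hy⟩ := List.mem_flatMap.1 hy
      rw [(ih (by omega) (p - b) _ (hb' b hbm)).2 y hy, hb b hbm, dg_add, dg_single]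
      have := (mem_upto hbm).1
      omega

theorem sq_xp_dig (n : ℕ) (hn : ∀ i, dig n i < 32) (p : ℕ) :
    sq 5 p (xp (dig n)) = ((allT n 5 p n).map fun y => xp (dig y)).sum := by
  have h : sqFactor n 5 =
      ∏ i : Fin 5, (1 + Polynomial.C (X i : PolyAlg 5) * Polynomial.X) ^ dig n i :=
    Finset.prod_congr rfl fun i _ => if_pos i.2
  rw [(sum_allT n hn 5 le_rfl p n fun _ _ => rfl).1, sq_apply, totalSq_xp, Polynomial.coeff_C_mul,
    h]

/-- Symmetric difference of two lists sorted in decreasing order. -/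
noncomputable def mrg (l : List ℕ) : List ℕ → List ℕ :=
  List.rec (motive := fun _ => List ℕ → List ℕ) (fun m => m)
    (fun a t ih m => List.rec (motive := fun _ => List ℕ) (a :: t)
      (fun b m' ihm => Bool.rec (Bool.rec (b :: ihm) (a :: ih (b :: m')) (Nat.ble b a))
        (ih m') (Nat.beq a b)) m) l

/-- Equal heads are deleted in pairs, which changes nothing in characteristic `2`. No sortedness is
needed here; it only affects how many pairs are found. -/
theorem sum_mrg {M : Type*} [CommRing M] [CharP M 2] (f : ℕ → M) (l m : List ℕ) :
    ((mrg l m).map f).sum = (l.map f).sum + (m.map f).sum := by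
  induction l generalizing m with
  | nil => simp [mrg]
  | cons a t ih =>
    induction m with
    | nil => simp [mrg]
    | cons b m' ihm =>
      change ((Bool.rec (Bool.rec (b :: mrg (a :: t) m') (a :: mrg t (b :: m')) (Nat.ble b a))
        (mrg t m') (Nat.beq a b) : List ℕ).map f).sum = _
      cases h : Nat.beq a b
      · cases h' : Nat.ble b a
        · simp only [List.map_cons, List.sum_cons, ihm]
          ring
        · simp only [List.map_cons, List.sum_cons, ih]
          ring
      · obtain rfl := Nat.eq_of_beq_eq_true h
        simp only [ih, List.map_cons, List.sum_cons]
        linear_combination -(f a) * (CharTwo.two_eq_zero : (2 : M) = 0)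

/-- The `u`-th entry of the weight vector of the monomial with code `n`. -/
noncomputable def wt (n u : ℕ) : ℕ := Nat.mod (Nat.land (Nat.shiftRight n u) 17043521) 63

theorem land_spread (m c q : ℕ) (hc : c < 64) :
    m &&& (c + 64 * q) = ((m % 64) &&& c) + 64 * ((m / 64) &&& q) := by
  have h1 := Nat.and_div_two_pow (a := m) (b := c + 64 * q) (n := 6)
  have h2 := Nat.and_mod_two_pow (a := m) (b := c + 64 * q) (n := 6)
  norm_num at h1 h2
  rw [show (c + 64 * q) / 64 = q by omega] at h1
  rw [Nat.mod_eq_of_lt hc] at h2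
  omega

/-- `17043521 = 1 + 64 + 64² + 64³ + 64⁴`, so its product with a six-bit number `c` repeats the
pattern `c` in each of the five exponent slots. -/
theorem land_mask (m c : ℕ) (hc : c < 64) : m &&& (17043521 * c) =
    ((m % 64) &&& c) + 64 * (((m / 64 % 64) &&& c) + 64 * (((m / 64 ^ 2 % 64) &&& c) +
      64 * (((m / 64 ^ 3 % 64) &&& c) + 64 * ((m / 64 ^ 4 % 64) &&& c)))) := by
  rw [show 17043521 * c = c + 64 * (c + 64 * (c + 64 * (c + 64 * (c + 64 * 0)))) by ring,
    land_spread _ _ _ hc, land_spread _ _ _ hc, land_spread _ _ _ hc, land_spread _ _ _ hc,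
    land_spread _ _ _ hc]
  simp only [Nat.div_div_eq_div_mul, Nat.and_zero]
  norm_num

/-- The shift brings the `u`-th binary digit of every exponent to the bottom of its slot, and the
mask isolates these five digits. Since `64 ≡ 1` modulo `63`, the remainder is their sum. -/
theorem wt_eq (n : ℕ) {u : ℕ} (hu : u < 6) : wt n u = om (dig n) u := by
  change ((n >>> u) &&& 17043521) % 63 = _
  rw [show 17043521 = 17043521 * 1 from rfl, land_mask _ _ (by norm_num),
    Nat.shiftRight_eq_div_pow]
  simp only [Nat.and_one_is_mod, om, dig, Fin.sum_univ_five]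
  have key : ∀ m, m / 2 ^ u % 64 % 2 = m % 64 / 2 ^ u % 2 := by
    intro m; interval_cases u <;> omega
  simp only [Nat.div_right_comm _ (2 ^ u), key]
  have h0 := Nat.mod_two_eq_zero_or_one (n % 64 / 2 ^ u)
  simp only [Fin.val_zero, Fin.val_one, Fin.val_two, pow_zero, Nat.div_one, pow_one]
  change _ = _ + _ + _ + n / 64 ^ 3 % 64 / 2 ^ u % 2 + n / 64 ^ 4 % 64 / 2 ^ u % 2
  omega

/-- Among six bits, `64 - 2^s` has exactly the bits `s, …, 5`, so the mask tests the high bits of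
all five exponents at once. -/
theorem dig_lt_of_land {n s : ℕ} (hs : s ≤ 6)
    (h : n &&& (17043521 * (64 - 2 ^ s)) = 0) (i : Fin 5) : dig n i < 2 ^ s := by
  have hp : 0 < 2 ^ s := by positivity
  rw [land_mask _ _ (by omega)] at h
  have key : ∀ s ≤ 6, ∀ d < 64, d &&& (64 - 2 ^ s) = 0 → d < 2 ^ s := by decide
  refine key s hs _ (Nat.mod_lt _ (by norm_num)) ?_
  simp only [Nat.add_eq_zero_iff, Nat.mul_eq_zero, OfNat.ofNat_ne_zero, false_or] at h
  obtain ⟨h0, h1, h2, h3, h4⟩ := h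
  fin_cases i
  · simpa [dig] using h0
  · simpa [dig] using h1
  · simpa [dig] using h2
  · simpa [dig] using h3
  · simpa [dig] using h4

/-- Whether the monomial with code `x` is not visibly below the one with code `w`. -/
noncomputable def bigB (s w x : ℕ) : Bool :=
  Nat.rec (motive := fun _ => ℕ → Bool)
    (fun _ => Bool.rec true (Nat.ble w x)
      (Nat.beq (Nat.land (Nat.lor x w) (Nat.mul 17043521 (Nat.sub 64 (Nat.pow 2 s)))) 0))
    (fun _ ih u => Bool.rec (Nat.ble (wt w u) (wt x u)) (ih (Nat.succ u))
      (Nat.beq (wt x u) (wt w u))) s 0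

/-- Weights are compared row by row. If all `s` of them agree and no exponent has further rows, the
codes are compared, and these are the values of `val`. -/
theorem mem_below_of_bigB {s w x : ℕ} (hs : s ≤ 6) (hw : w < 64 ^ 5)
    (hdeg : dg (dig x) = dg (dig w)) (h : bigB s w x = false) : dig x ∈ below s (dig w) := by
  let F : Bool := Bool.rec true (Nat.ble w x)
    (Nat.beq (Nat.land (Nat.lor x w) (Nat.mul 17043521 (Nat.sub 64 (Nat.pow 2 s)))) 0)
  -- The rows before `u` are known to agree, and `f` rows are still to be compared.
  have key : ∀ f u, f + u = s → (∀ v < u, om (dig x) v = om (dig w) v) →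
      (Nat.rec (motive := fun _ => ℕ → Bool) (fun _ => F)
        (fun _ ih u => Bool.rec (Nat.ble (wt w u) (wt x u)) (ih (Nat.succ u))
          (Nat.beq (wt x u) (wt w u))) f u) = false → dig x ∈ below s (dig w) := by
    intro f
    induction f with
    | zero =>
      intro u hu hv hF
      change F = false at hF
      refine ⟨hdeg, Or.inr ?_⟩
      rw [zero_add] at hu
      subst hu
      dsimp only [F] at hF
      cases h1 : Nat.beq (Nat.land (Nat.lor x w)
        (Nat.mul 17043521 (Nat.sub 64 (Nat.pow 2 u)))) 0
      · rw [h1] at hF; exact absurd hF (by simp)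
      · rw [h1] at hF
        have h2 : (x ||| w) &&& (17043521 * (64 - 2 ^ u)) = 0 := Nat.eq_of_beq_eq_true h1
        rw [Nat.and_or_distrib_right, Nat.or_eq_zero_iff] at h2
        have h3 : ¬ w ≤ x := fun hle => by
          rw [Nat.ble_eq_true_of_le hle] at hF; simp at hF
        refine ⟨hv, dig_lt_of_land hs h2.1, dig_lt_of_land hs h2.2, ?_⟩
        rw [val_dig hw, val_dig (by omega)]
        omega
    | succ f ih =>
      intro u hu hv hF
      change (Bool.rec (Nat.ble (wt w u) (wt x u)) (Nat.rec (motive := fun _ => ℕ → Bool)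
        (fun _ => F) (fun _ ih u => Bool.rec (Nat.ble (wt w u) (wt x u)) (ih (Nat.succ u))
          (Nat.beq (wt x u) (wt w u))) f (Nat.succ u)) (Nat.beq (wt x u) (wt w u)) : Bool) =
            false at hF
      cases h1 : Nat.beq (wt x u) (wt w u)
      · rw [h1] at hF
        have h2 : ¬ wt w u ≤ wt x u := fun hle => by
          rw [Nat.ble_eq_true_of_le hle] at hF; simp at hF
        rw [wt_eq _ (by omega), wt_eq _ (by omega)] at h2
        exact ⟨hdeg, Or.inl ⟨u, by omega, hv, by omega⟩⟩
      · rw [h1] at hF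
        have h2 := Nat.eq_of_beq_eq_true h1
        rw [wt_eq _ (by omega), wt_eq _ (by omega)] at h2
        refine ih (u + 1) (by omega) (fun v hv' => ?_) hF
        rcases Nat.lt_succ_iff_lt_or_eq.1 hv' with h | rfl
        · exact hv v h
        · exact h2
  exact key s 0 rfl (fun v hv => absurd hv (by omega)) h

/-- Conjunction by means of the recursor. -/
noncomputable def andB (a b : Bool) : Bool := Bool.rec false b a

theorem andB_eq_true {a b : Bool} : andB a b = true ↔ a = true ∧ b = true := by
  cases a <;> simp [andB]

/-- `List.all` by means of the recursor. -/
noncomputable def allB {α : Type} (f : α → Bool) (l : List α) : Bool :=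
  List.rec true (fun c _ ih => andB (f c) ih) l

theorem allB_eq_true {α : Type} {f : α → Bool} {l : List α} :
    allB f l = true ↔ ∀ c ∈ l, f c = true := by
  induction l with
  | nil => simp [allB]
  | cons a l ih =>
    change andB (f a) (allB f l) = true ↔ _
    rw [andB_eq_true, ih]
    simp

/-- The data of a hit equation: the code of a monomial `w`, the number `s` of binary digits that
matter, and pairs `(p, h)` such that `w + ∑ Sqᵖ h` is a sum of monomials below `w`. -/
abbrev Cert := ℕ × ℕ × List (ℕ × ℕ)

/-- Verification of a hit equation. -/
noncomputable def chkCert (c : Cert) : Bool :=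
  Prod.rec (fun w c => Prod.rec (fun s hs =>
    andB (andB (Nat.ble s 6) (Nat.blt w 1073741824))
    (andB (allB (fun ph => andB (andB (Nat.blt 0 ph.1) (Nat.blt ph.1 (Nat.pow 2 s)))
        (andB (Nat.beq (Nat.land ph.2 545392672) 0)
          (Nat.beq (Nat.add (dgN ph.2) ph.1) (dgN w)))) hs)
      (List.rec false (fun v t _ => List.rec (Nat.beq v w) (fun _ _ _ => false) t)
        (List.rec (motive := fun _ => List ℕ) []
          (fun ph _ ih => mrg (sqT (bigB s w) ph.2 5 ph.1 ph.2 []) ih) hs)))) c) c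

theorem chkCert_sound {w s : ℕ} {hs : List (ℕ × ℕ)} (h : chkCert (w, s, hs) = true)
    {r : ℕ} {x : Fin 5 → ℕ} (hx : ∀ i, x i < 2 ^ r) (y : Fin 5 → ℕ) :
    xp (x + 2 ^ r • (dig w + 2 ^ s • y)) ∈ hit 5 ⊔
      xspan {b | dg b = dg (x + 2 ^ r • (dig w + 2 ^ s • y)) ∧
        Lt b (x + 2 ^ r • (dig w + 2 ^ s • y))} := by
  change andB (andB (Nat.ble s 6) (Nat.blt w 1073741824))
    (andB (allB (fun ph => andB (andB (Nat.blt 0 ph.1) (Nat.blt ph.1 (Nat.pow 2 s)))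
        (andB (Nat.beq (Nat.land ph.2 545392672) 0)
          (Nat.beq (Nat.add (dgN ph.2) ph.1) (dgN w)))) hs)
      (List.rec false (fun v t _ => List.rec (Nat.beq v w) (fun _ _ _ => false) t)
        (List.rec (motive := fun _ => List ℕ) []
          (fun ph _ ih => mrg (sqT (bigB s w) ph.2 5 ph.1 ph.2 []) ih) hs) : Bool)) = true at h
  rw [andB_eq_true, andB_eq_true, andB_eq_true, allB_eq_true] at h
  obtain ⟨⟨hs6, hw⟩, hall, hlist⟩ := h
  replace hs6 := Nat.le_of_ble_eq_true hs6
  replace hw : w < 64 ^ 5 := Nat.le_of_ble_eq_true hw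
  have hall' : ∀ c ∈ hs, c.1 ≠ 0 ∧ c.1 < 2 ^ s ∧ (∀ i, dig c.2 i < 32) ∧
      dg (dig c.2) + c.1 = dg (dig w) := by
    intro c hc
    have := hall c hc
    simp only [andB_eq_true] at this
    obtain ⟨⟨h1, h2⟩, h3, h4⟩ := this
    have h1 : 0 < c.1 := Nat.le_of_ble_eq_true h1
    have h2 : c.1 < 2 ^ s := Nat.le_of_ble_eq_true h2
    -- `545392672 = 17043521 * 32`, so the test says that all exponents are below `32`, as
    -- `sum_allT` requires.
    have h3 : c.2 &&& 17043521 * (64 - 2 ^ 5) = 0 := Nat.eq_of_beq_eq_true h3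
    have h4 : dgN c.2 + c.1 = dgN w := Nat.eq_of_beq_eq_true h4
    rw [dgN_eq, dgN_eq] at h4
    exact ⟨h1.ne', h2, fun i => dig_lt_of_land (by norm_num) h3 i, h4⟩
  clear hall
  -- Modulo the span of `below`, the sum of the squares is represented by the merged list, which
  -- keeps only the terms not visibly below `w`.
  have hsum : ∀ l : List (ℕ × ℕ), (∀ c ∈ l, c ∈ hs) →
      (l.map fun c => sq 5 c.1 (xp (dig c.2))).sum -
        ((List.rec (motive := fun _ => List ℕ) []
          (fun ph _ ih => mrg (sqT (bigB s w) ph.2 5 ph.1 ph.2 []) ih) l).map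
            fun y => xp (dig y)).sum ∈ xspan (below s (dig w)) := by
    intro l
    induction l with
    | nil => intro _; simp
    | cons c l ih =>
      intro hl
      have ih' := ih fun c hc => hl c (List.mem_cons_of_mem _ hc)
      obtain ⟨-, -, h3, h4⟩ := hall' c (hl c List.mem_cons_self)
      rw [List.map_cons, List.sum_cons, sum_mrg, sqT_eq, List.append_nil, add_sub_add_comm]
      refine Submodule.add_mem _ ?_ ih'
      rw [sq_xp_dig _ h3]
      have hdeg := (sum_allT c.2 h3 5 le_rfl c.1 c.2 fun _ _ => rfl).2
      generalize allT c.2 5 c.1 c.2 = L at hdeg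
      induction L with
      | nil => simp
      | cons y L ihL =>
        have ihL' := ihL fun z hz => hdeg z (List.mem_cons_of_mem _ hz)
        cases hy : bigB s w y
        · rw [List.filter_cons_of_neg (by simp [hy]), List.map_cons, List.sum_cons, add_sub_assoc]
          refine Submodule.add_mem _ (xp_mem_xspan (mem_below_of_bigB hs6 hw ?_ hy)) ihL'
          rw [hdeg y List.mem_cons_self, h4]
        · rw [List.filter_cons_of_pos hy]
          simpa using ihL'
  have hres := hsum hs fun c hc => hc
  refine xp_context_mem hx (hs.map fun c => (c.1, dig c.2)) ?_ ?_
  · simp only [List.mem_map]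
    rintro _ ⟨c, hc, rfl⟩
    obtain ⟨h1, h2, -, h4⟩ := hall' c hc
    exact ⟨h1, h2, h4⟩
  · rw [List.map_map]
    generalize (List.rec (motive := fun _ => List ℕ) []
      (fun ph _ ih => mrg (sqT (bigB s w) ph.2 5 ph.1 ph.2 []) ih) hs : List ℕ) = R at hres hlist
    -- The check found the one-element list `[w]`, so adding `w` to the squares leaves only
    -- monomials in `below`.
    match R, hlist with
    | [v], hv =>
      obtain rfl : v = w := Nat.eq_of_beq_eq_true hv
      rw [List.map_singleton, List.sum_singleton, CharTwo.sub_eq_add] at hres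
      rw [add_comm]
      exact hres

end PolyAlg

/-! ### Enumeration of the monomials that avoid all reducible blocks of rows. -/

namespace PolyAlg

open MvPolynomial

/-- The exponent vector of the square-free monomial whose variables are the binary digits of `S`. -/
def bits (S : ℕ) : Fin 5 → ℕ := fun i => S / 2 ^ (i : ℕ) % 2

/-- The exponent vector whose rows of binary digits are the last `s` base `32` digits of `idx`. -/
def vOf : ℕ → ℕ → Fin 5 → ℕ
  | _, 0 => 0
  | idx, s + 1 => vOf (idx / 32) s + 2 ^ s • bits (idx % 32)

theorem bits_lt (S : ℕ) (i : Fin 5) : bits S i < 2 := Nat.mod_lt _ (by norm_num)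

theorem vOf_lt (idx s : ℕ) (i : Fin 5) : vOf idx s i < 2 ^ s := by
  induction s generalizing idx with
  | zero => simp [vOf]
  | succ s ih =>
    have h1 := ih (idx / 32)
    have h2 := bits_lt (idx % 32) i
    simp only [vOf, Pi.add_apply, Pi.smul_apply, smul_eq_mul, pow_succ]
    nlinarith [show 0 < 2 ^ s by positivity]

/-- New rows are appended at the end of `idx`: the last base `32` digits are the most significant
binary rows, the leading ones the least significant. -/
theorem vOf_add (idx r s : ℕ) :
    vOf idx (r + s) = vOf (idx / 32 ^ s) r + 2 ^ r • vOf (idx % 32 ^ s) s := by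
  induction s generalizing idx with
  | zero => simp [vOf]
  | succ s ih =>
    have e1 : idx / 32 / 32 ^ s = idx / 32 ^ (s + 1) := by rw [Nat.div_div_eq_div_mul, pow_succ']
    have e2 : idx % 32 ^ (s + 1) / 32 = idx / 32 % 32 ^ s := by
      rw [pow_succ', Nat.mod_mul_right_div_self]
    have e3 : idx % 32 ^ (s + 1) % 32 = idx % 32 :=
      Nat.mod_mod_of_dvd _ (dvd_pow_self _ (by omega))
    rw [← add_assoc, vOf, vOf, ih, e1, e2, e3, smul_add, smul_smul, ← pow_add, add_assoc]

/-- The code of `vOf idx s`. -/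
noncomputable def wOf (idx s : ℕ) : ℕ :=
  Nat.rec (motive := fun _ => ℕ → ℕ) (fun _ => 0)
    (fun s ih idx => Nat.add (ih (Nat.shiftRight idx 5))
      (Nat.shiftLeft (Nat.land (Nat.mul (Nat.land idx 31) 1082401) 17043521) s)) s idx

theorem wOf_eq (idx s : ℕ) : wOf idx s = val (vOf idx s) := by
  induction s generalizing idx with
  | zero => simp [wOf, vOf, val]
  | succ s ih =>
    -- `1082401 = 1 + 2^5 + 2^10 + 2^15 + 2^20` puts five copies of the five-bit number `S` side by
    -- side. Bit `6 i` of the product is bit `i` of the `i`-th copy, so the mask spreads the bits of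
    -- `S` over the exponent slots.
    have h1 : ∀ S < 32, (S * 1082401) &&& 17043521 = val (bits S) := by decide
    have h2 : Nat.land idx 31 = idx % 32 := Nat.and_two_pow_sub_one_eq_mod _ 5
    have h3 : Nat.shiftRight idx 5 = idx / 32 := Nat.shiftRight_eq_div_pow _ _
    change wOf (Nat.shiftRight idx 5) s +
      ((Nat.land idx 31 * 1082401) &&& 17043521) <<< s = _
    rw [h2, h3, ih, vOf, val_add, val_smul, h1 _ (Nat.mod_lt _ (by norm_num)), Nat.shiftLeft_eq,
      mul_comm]

theorem dig_wOf (idx : ℕ) {s : ℕ} (hs : s ≤ 6) : dig (wOf idx s) = vOf idx s := by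
  rw [wOf_eq]
  exact dig_val fun i => (vOf_lt idx s i).trans_le (Nat.pow_le_pow_right (by norm_num) hs)

/-- Evaluation of the argument before application. -/
noncomputable def force {α : Type} (x : ℕ) (f : ℕ → α) : α :=
  Nat.rec (f 0) (fun m _ => f (Nat.succ m)) x

theorem force_eq {α : Type} (x : ℕ) (f : ℕ → α) : force x f = f x := by
  cases x <;> rfl

/-- Disjunction by means of the recursor. -/
noncomputable def orB (a b : Bool) : Bool := Bool.rec b true a

/-- The `i`-th binary digit of `T`. -/
noncomputable def testB (T i : ℕ) : Bool := Nat.beq (Nat.land (Nat.shiftRight T i) 1) 1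

theorem testB_eq (T i : ℕ) : testB T i = T.testBit i := by
  change Nat.beq ((T >>> i) &&& 1) 1 = _
  rw [Nat.testBit_eq_decide_div_mod_eq, Nat.shiftRight_eq_div_pow, Nat.and_one_is_mod,
    Bool.eq_iff_iff, decide_eq_true_eq, Nat.beq_eq]

/-- A monomial that is a sum of smaller monomials modulo hit polynomials. -/
def Red (a : Fin 5 → ℕ) : Prop := xp a ∈ hit 5 ⊔ xspan {b | dg b = dg a ∧ Lt b a}

/-- `T` holds only for blocks of `s` rows that make every monomial containing them reducible. -/
def BadTable (s : ℕ) (T : ℕ → Bool) : Prop := ∀ idx, T idx = true → ∀ (r : ℕ) (x y : Fin 5 → ℕ),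
  (∀ i, x i < 2 ^ r) → Red (x + 2 ^ r • (vOf idx s + 2 ^ s • y))

/-- Whether one of the tables rejects the rows in `idx`. -/
noncomputable def badB (tabs : List (ℕ × (ℕ → Bool))) (lev idx : ℕ) : Bool :=
  List.rec false (fun t _ ih => orB (andB (Nat.ble t.1 lev)
    (t.2 (Nat.land idx (Nat.sub (Nat.pow 2 (Nat.mul 5 t.1)) 1)))) ih) tabs

/-- The table is asked about the last `t.1` rows chosen. `vOf_add` splits them off: the earlier rows
are the lower context, and the rows `a`, still undetermined, are the upper one. -/
theorem red_of_badB {tabs : List (ℕ × (ℕ → Bool))} (htabs : ∀ t ∈ tabs, BadTable t.1 t.2)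
    {lev idx : ℕ} (h : badB tabs lev idx = true) (a : Fin 5 → ℕ) :
    Red (vOf idx lev + 2 ^ lev • a) := by
  induction tabs with
  | nil => simp [badB] at h
  | cons t tabs ih =>
    change orB (andB (Nat.ble t.1 lev) (t.2 (idx &&& (2 ^ (5 * t.1) - 1))))
      (badB tabs lev idx) = true at h
    cases hb : badB tabs lev idx
    · rw [hb] at h
      cases hc : andB (Nat.ble t.1 lev) (t.2 (idx &&& (2 ^ (5 * t.1) - 1)))
      · rw [hc] at h; exact absurd h (by simp [orB])
      · rw [andB_eq_true, Nat.and_two_pow_sub_one_eq_mod, pow_mul] at hc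
        norm_num at hc
        obtain ⟨r, rfl⟩ := Nat.exists_eq_add_of_le' hc.1
        have := htabs t List.mem_cons_self _ hc.2 r (vOf (idx / 32 ^ t.1) r) a (vOf_lt _ _)
        rwa [smul_add, smul_smul, ← pow_add, ← add_assoc, ← vOf_add] at this
    · exact ih (fun t ht => htabs t (List.mem_cons_of_mem _ ht)) hb

/-- The number of binary digits `1` of `S < 32`. -/
noncomputable def popc (S : ℕ) : ℕ :=
  Nat.mod (Nat.land (Nat.mul S 1082401) 17043521) 63

/-- The numbers below `32`. -/
noncomputable def rows32 : List ℕ :=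
  Nat.rec (motive := fun _ => List ℕ → List ℕ) (fun l => l) (fun n ih l => ih (n :: l)) 32 []

theorem rows32_eq : rows32 = List.range 32 := rfl

/-- `m` if `b` is false, and `l` if `b` is true. -/
noncomputable def condB (b : Bool) (l m : List ℕ) : List ℕ := Bool.rec m l b

/-- One step of `search`: the branch in which the next row is `S`, continued by `k`. -/
noncomputable def branch (tabs : List (ℕ × (ℕ → Bool))) (k : ℕ → ℕ → ℕ → List ℕ → List ℕ)
    (lev hist rem S : ℕ) (rest : List ℕ) : List ℕ :=
  condB (andB (Nat.ble (popc S) rem) (Nat.beq (Nat.land (Nat.sub rem (popc S)) 1) 0))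
    (force (Nat.add (Nat.shiftLeft hist 5) S) fun idx =>
      force (Nat.succ lev) fun lev' =>
        condB (badB tabs lev' idx) rest
          (force (Nat.shiftRight (Nat.sub rem (popc S)) 1) fun rem' => k lev' idx rem' rest))
    rest

/-- The codes of the monomials of degree `2 ^ lev * rem` more than `vOf hist lev` that extend it and
whose rows pass the tables; the next row is taken from `rows`. -/
noncomputable def search (tabs : List (ℕ × (ℕ → Bool))) (fuel : ℕ) :
    List ℕ → ℕ → ℕ → ℕ → List ℕ → List ℕ :=
  Nat.rec (motive := fun _ => List ℕ → ℕ → ℕ → ℕ → List ℕ → List ℕ)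
    (fun _ lev hist _ rest => wOf hist lev :: rest)
    (fun _ ih rows lev hist rem rest =>
      Bool.rec
        (List.rec (motive := fun _ => List ℕ) rest
          (fun S _ ihl => branch tabs (ih rows32) lev hist rem S ihl) rows)
        (wOf hist lev :: rest) (Nat.beq rem 0)) fuel

theorem popc_eq {S : ℕ} (hS : S < 32) : popc S = dg (bits S) := by
  revert S; decide

/-- The row of lowest binary digits. -/
def row0 (a : Fin 5 → ℕ) : ℕ := ∑ i : Fin 5, a i % 2 * 2 ^ (i : ℕ)

theorem row0_lt (a : Fin 5 → ℕ) : row0 a < 32 := by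
  simp only [row0, Fin.sum_univ_five]
  have := fun i => Nat.mod_lt (a i) (show 2 > 0 by norm_num)
  have h0 := this 0
  have h1 := this 1
  have h2 := this 2
  have h3 := this 3
  have h4 := this 4
  simp
  omega

theorem bits_row0 (a : Fin 5 → ℕ) : a = bits (row0 a) + 2 • fun i => a i / 2 := by
  funext i
  simp only [row0, Fin.sum_univ_five, bits, Pi.add_apply, Pi.smul_apply, smul_eq_mul]
  have := fun i => Nat.mod_lt (a i) (show 2 > 0 by norm_num)
  have h0 := this 0
  have h1 := this 1
  have h2 := this 2
  have h3 := this 3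
  have h4 := this 4
  fin_cases i <;> simp <;> omega

theorem dg_bits_row0 (a : Fin 5 → ℕ) : dg (bits (row0 a)) = om a 0 := by
  simp only [dg, om]
  refine Finset.sum_congr rfl fun i _ => ?_
  have := congrFun (bits_row0 a) i
  have h2 := bits_lt (row0 a) i
  simp only [Pi.add_apply, Pi.smul_apply, smul_eq_mul] at this
  simp only [pow_zero, Nat.div_one]
  omega

theorem branch_of_red {tabs : List (ℕ × (ℕ → Bool))} {k : ℕ → ℕ → ℕ → List ℕ → List ℕ}
    {lev hist rem S : ℕ} {rest : List ℕ}
    (h1 : popc S ≤ rem) (h2 : (rem - popc S) % 2 = 0)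
    (h : badB tabs (lev + 1) (32 * hist + S) = false) :
    branch tabs k lev hist rem S rest =
      k (lev + 1) (32 * hist + S) ((rem - popc S) / 2) rest := by
  delta branch
  generalize popc S = q at h1 h2
  have e1 : Nat.add (Nat.shiftLeft hist 5) S = 32 * hist + S := by
    have h5 : Nat.shiftLeft hist 5 = hist * 2 ^ 5 := Nat.shiftLeft_eq _ _
    rw [h5, Nat.add_eq]
    omega
  have e2 : Nat.shiftRight (Nat.sub rem q) 1 = (rem - q) / 2 :=
    Nat.shiftRight_eq_div_pow _ _
  have e3 : Nat.land (Nat.sub rem q) 1 = 0 := by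
    rw [← h2]; exact Nat.and_one_is_mod _
  rw [e3, Nat.ble_eq_true_of_le h1, force_eq, force_eq, force_eq, e1, e2]
  have h' : badB tabs (Nat.succ lev) (32 * hist + S) = false := h
  rw [h']
  rfl

theorem subset_condB {l m n : List ℕ} (hm : l ⊆ m) (hn : l ⊆ n) (b : Bool) :
    l ⊆ condB b m n := by
  cases b
  · exact hn
  · exact hm

theorem subset_branch {tabs : List (ℕ × (ℕ → Bool))} {k : ℕ → ℕ → ℕ → List ℕ → List ℕ}
    (hk : ∀ lev hist rem l, l ⊆ k lev hist rem l) (lev hist rem S : ℕ) (rest : List ℕ) :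
    rest ⊆ branch tabs k lev hist rem S rest := by
  delta branch
  rw [force_eq, force_eq, force_eq]
  exact subset_condB (subset_condB (List.Subset.refl _) (hk _ _ _ _) _) (List.Subset.refl _) _

theorem search_succ (tabs : List (ℕ × (ℕ → Bool))) (fuel : ℕ) (rows : List ℕ) (lev hist rem : ℕ)
    (rest : List ℕ) : search tabs (fuel + 1) rows lev hist rem rest =
      if rem = 0 then wOf hist lev :: rest else
        rows.foldr (branch tabs (search tabs fuel rows32) lev hist rem) rest := by
  have h0 : (List.rec (motive := fun _ => List ℕ) rest (fun S _ ihl =>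
      branch tabs (search tabs fuel rows32) lev hist rem S ihl) rows : List ℕ) =
      rows.foldr (branch tabs (search tabs fuel rows32) lev hist rem) rest := by
    induction rows with
    | nil => rfl
    | cons S rows ih => rw [List.foldr_cons, ← ih]
  rw [← h0]
  change (Bool.rec _ _ (Nat.beq rem 0) : List ℕ) = _
  cases h : Nat.beq rem 0
  · rw [if_neg (Nat.ne_of_beq_eq_false h)]
    rfl
  · rw [if_pos (Nat.eq_of_beq_eq_true h)]

theorem subset_search (tabs : List (ℕ × (ℕ → Bool))) (fuel : ℕ) (rows : List ℕ) (lev hist rem : ℕ)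
    (rest : List ℕ) : rest ⊆ search tabs fuel rows lev hist rem rest := by
  induction fuel generalizing rows lev hist rem rest with
  | zero =>
    have h : search tabs 0 rows lev hist rem rest = wOf hist lev :: rest := rfl
    rw [h]
    exact List.subset_cons_self _ _
  | succ fuel ih =>
    rw [search_succ]
    split_ifs
    · exact List.subset_cons_self _ _
    · have h : ∀ lev hist rem l, l ⊆ search tabs fuel rows32 lev hist rem l := ih rows32
      generalize search tabs fuel rows32 = k at h
      induction rows with
      | nil => exact List.Subset.refl _
      | cons S rows ihr =>
        rw [List.foldr_cons]
        exact List.Subset.trans ihr (subset_branch h _ _ _ _ _)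

/-- A monomial is built from its lowest binary row upwards. With remaining degree `rem`, the next
row has size at most `rem` and of the same parity, and half of the difference remains afterwards;
hence `rem < 2 ^ fuel` provides enough steps. When a table rejects the rows chosen so far, the
monomial is reducible whatever rows follow. -/
theorem search_spec {tabs : List (ℕ × (ℕ → Bool))} (htabs : ∀ t ∈ tabs, BadTable t.1 t.2) (fuel : ℕ)
    (rows : List ℕ) (lev hist rem : ℕ) (rest : List ℕ) (a : Fin 5 → ℕ) (hrem : dg a = rem)
    (hfuel : rem < 2 ^ fuel) (hrow : row0 a ∈ rows) :
    val (vOf hist lev + 2 ^ lev • a) ∈ search tabs fuel rows lev hist rem rest ∨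
      Red (vOf hist lev + 2 ^ lev • a) := by
  have hzero : dg a = 0 → vOf hist lev + 2 ^ lev • a = vOf hist lev := fun h => by
    have : a = 0 := funext fun i => (Finset.sum_eq_zero_iff.1 h) i (Finset.mem_univ i)
    rw [this, smul_zero, add_zero]
  induction fuel generalizing rows lev hist rem rest a with
  | zero =>
    rw [hzero (by rw [hrem]; simpa using hfuel), ← wOf_eq]
    exact Or.inl List.mem_cons_self
  | succ fuel ih =>
    rw [search_succ]
    split_ifs with h0
    · rw [hzero (hrem.trans h0), ← wOf_eq]
      exact Or.inl List.mem_cons_self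
    set S := row0 a with hS
    set a' : Fin 5 → ℕ := fun i => a i / 2 with ha'
    have hS32 : S < 32 := row0_lt a
    have ha : a = bits S + 2 • a' := bits_row0 a
    have hdeg : popc S + 2 * dg a' = rem := by
      rw [popc_eq hS32, ← hrem]
      conv_rhs => rw [ha, dg_add, dg_smul]
    have hv : vOf hist lev + 2 ^ lev • a =
        vOf (32 * hist + S) (lev + 1) + 2 ^ (lev + 1) • a' := by
      rw [vOf, show (32 * hist + S) / 32 = hist by omega,
        show (32 * hist + S) % 32 = S by omega, ha, smul_add, smul_smul, ← pow_succ, add_assoc]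
    rw [hv]
    cases hbad : badB tabs (lev + 1) (32 * hist + S)
    · refine or_iff_not_imp_right.2 fun hred => ?_
      clear_value S
      induction rows with
      | nil => simp at hrow
      | cons S' rows ihr =>
        rw [List.foldr_cons]
        rcases List.mem_cons.1 hrow with h | h
        · subst h
          rw [branch_of_red (by omega) (by omega) hbad]
          refine (ih rows32 (lev + 1) _ ((rem - popc S) / 2) _ a' (by omega) ?_ ?_ ?_).resolve_right
            hred
          · rw [pow_succ] at hfuel; omega
          · rw [rows32_eq, List.mem_range]; exact row0_lt a'
          · intro h
            have : a' = 0 := funext fun i => (Finset.sum_eq_zero_iff.1 h) i (Finset.mem_univ i)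
            rw [this, smul_zero, add_zero]
        -- The branch of another row only adds to what the remaining rows produce.
        · exact subset_branch (fun _ _ _ _ => subset_search _ _ _ _ _ _ _) _ _ _ _ _ (ihr h)
    · exact Or.inr (red_of_badB htabs hbad a')

/-- The table of the blocks of `s` rows that occur in `D`. -/
noncomputable def mkTab (s : ℕ) (D : List Cert) : ℕ :=
  List.rec 0 (fun c _ ih => Bool.rec ih (Nat.lor (Nat.shiftLeft 1 c.1) ih) (Nat.beq c.2.1 s)) D

theorem mkTab_spec {s i : ℕ} {D : List Cert} (h : (mkTab s D).testBit i) :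
    ∃ hs, (i, s, hs) ∈ D := by
  induction D with
  | nil => simp [mkTab] at h
  | cons c D ih =>
    change (Bool.rec (mkTab s D) (1 <<< c.1 ||| mkTab s D) (Nat.beq c.2.1 s) : ℕ).testBit i at h
    cases hc : Nat.beq c.2.1 s
    · rw [hc] at h
      obtain ⟨hs, hs'⟩ := ih h
      exact ⟨hs, List.mem_cons_of_mem _ hs'⟩
    · rw [hc] at h
      simp only [Nat.testBit_or, Bool.or_eq_true] at h
      rcases h with h | h
      · rw [Nat.one_shiftLeft, Nat.testBit_two_pow, decide_eq_true_eq] at h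
        obtain rfl := Nat.eq_of_beq_eq_true hc
        subst h
        exact ⟨c.2.2, List.mem_cons_self⟩
      · obtain ⟨hs, hs'⟩ := ih h
        exact ⟨hs, List.mem_cons_of_mem _ hs'⟩

/-- Membership in the list of the blocks of `s` rows that occur in `D`. -/
noncomputable def memTab (s : ℕ) (D : List Cert) (i : ℕ) : Bool :=
  List.rec false (fun c _ ih => orB (Nat.beq c i) ih)
    (List.rec [] (fun c _ ih => Bool.rec ih (c.1 :: ih) (Nat.beq c.2.1 s)) D)

theorem memTab_spec {s i : ℕ} {D : List Cert} (h : memTab s D i = true) :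
    ∃ hs, (i, s, hs) ∈ D := by
  induction D with
  | nil => simp [memTab] at h
  | cons c D ih =>
    rw [memTab] at h
    change (List.rec false (fun c _ ih => orB (Nat.beq c i) ih)
      (Bool.rec (List.rec [] (fun c _ ih => Bool.rec ih (c.1 :: ih) (Nat.beq c.2.1 s)) D)
        (c.1 :: (List.rec [] (fun c _ ih => Bool.rec ih (c.1 :: ih) (Nat.beq c.2.1 s)) D))
          (Nat.beq c.2.1 s)) : Bool) = true at h
    cases hc : Nat.beq c.2.1 s
    · rw [hc] at h
      obtain ⟨hs, hs'⟩ := ih h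
      exact ⟨hs, List.mem_cons_of_mem _ hs'⟩
    · rw [hc] at h
      change orB (Nat.beq c.1 i) (memTab s D i) = true at h
      cases hi : Nat.beq c.1 i
      · rw [hi] at h
        obtain ⟨hs, hs'⟩ := ih h
        exact ⟨hs, List.mem_cons_of_mem _ hs'⟩
      · obtain rfl := Nat.eq_of_beq_eq_true hc
        obtain rfl := Nat.eq_of_beq_eq_true hi
        exact ⟨c.2.2, List.mem_cons_self⟩

/-- The tables for blocks of two, three and four rows. -/
noncomputable def mkTabs (D : List Cert) : List (ℕ × (ℕ → Bool)) :=
  force (mkTab 2 D) fun t2 => force (mkTab 3 D) fun t3 =>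
    -- Blocks of two and three rows are stored as bits of a number. There are `32^4` possible blocks
    -- of four rows, and for these a list is kept instead.
    [(2, testB t2), (3, testB t3), (4, memTab 4 D)]

/-- Verification of a list of hit equations for blocks of rows. -/
noncomputable def chkBlock (c : Cert) : Bool :=
  andB (Nat.ble c.2.1 6) (chkCert (wOf c.1 c.2.1, c.2))

/-- Every table entry comes from a verified hit equation, and `chkCert_sound` inserts that equation
into an arbitrary context. -/
theorem badTable_mkTabs {D : List Cert} (hD : allB chkBlock D = true) :
    ∀ t ∈ mkTabs D, BadTable t.1 t.2 := by
  have key : ∀ s idx, (∃ hs, (idx, s, hs) ∈ D) → ∀ (r : ℕ) (x y : Fin 5 → ℕ),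
      (∀ i, x i < 2 ^ r) → Red (x + 2 ^ r • (vOf idx s + 2 ^ s • y)) := by
    rintro s idx ⟨hs, hmem⟩ r x y hx
    have := allB_eq_true.1 hD _ hmem
    rw [chkBlock, andB_eq_true] at this
    rw [Red, ← dig_wOf idx (Nat.le_of_ble_eq_true this.1)]
    exact chkCert_sound this.2 hx y
  intro t ht
  simp only [mkTabs, force_eq, List.mem_cons, List.not_mem_nil, or_false] at ht
  rcases ht with rfl | rfl | rfl
  · exact fun idx h => key 2 idx (mkTab_spec ((testB_eq _ _).symm.trans h))
  · exact fun idx h => key 3 idx (mkTab_spec ((testB_eq _ _).symm.trans h))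
  · exact fun idx h => key 4 idx (memTab_spec h)

/-- This is the case of an empty context on both sides. -/
theorem red_of_chkCert {c : Cert} (hc : chkCert c = true) : Red (dig c.1) := by
  have := chkCert_sound (r := 0) (x := 0) hc (by simp) 0
  simpa [Red] using this

/-- `k E'` if `E = x :: E'`, and `d` otherwise. -/
noncomputable def popHead (x : ℕ) (E : List ℕ) (k : List ℕ → Bool) (d : Bool) : Bool :=
  List.rec d (fun e E' _ => Bool.rec d (k E') (Nat.beq x e)) E

theorem popHead_eq_true {x : ℕ} {E : List ℕ} {k : List ℕ → Bool} {d : Bool}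
    (h : popHead x E k d = true) : (∃ E', E = x :: E' ∧ k E' = true) ∨ d = true := by
  cases E with
  | nil => exact Or.inr h
  | cons e E' =>
    change (Bool.rec d (k E') (Nat.beq x e) : Bool) = true at h
    cases hx : Nat.beq x e
    · rw [hx] at h; exact Or.inr h
    · rw [hx] at h; exact Or.inl ⟨E', by rw [Nat.eq_of_beq_eq_true hx], h⟩

/-- Whether `L` is a shuffle of initial segments of the three other lists. -/
noncomputable def coverB (L : List ℕ) : List ℕ → List ℕ → List ℕ → Bool :=
  List.rec (motive := fun _ => List ℕ → List ℕ → List ℕ → Bool) (fun _ _ _ => true)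
    (fun x _ ih E A B => popHead x E (fun E' => ih E' A B)
      (popHead x A (fun A' => ih E A' B) (popHead x B (fun B' => ih E A B') false))) L

/-- At each step the head of `L` is also the head of one of the three lists, which is then
shortened; a single pass suffices when the lists follow the order of the search. -/
theorem coverB_spec {L E A B : List ℕ} (h : coverB L E A B = true) :
    ∀ x ∈ L, x ∈ E ∨ x ∈ A ∨ x ∈ B := by
  induction L generalizing E A B with
  | nil => simp
  | cons z L ih =>
    intro x hx
    have hmem : ∀ {l : List ℕ}, x ∈ l → x ∈ z :: l := List.mem_cons_of_mem z
    change popHead z E (fun E' => coverB L E' A B)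
      (popHead z A (fun A' => coverB L E A' B)
        (popHead z B (fun B' => coverB L E A B') false)) = true at h
    rcases popHead_eq_true h with ⟨E', rfl, h'⟩ | h
    · rcases List.mem_cons.1 hx with rfl | hx
      · exact Or.inl List.mem_cons_self
      · exact (ih h' x hx).imp_left hmem
    rcases popHead_eq_true h with ⟨A', rfl, h'⟩ | h
    · rcases List.mem_cons.1 hx with rfl | hx
      · exact Or.inr (Or.inl List.mem_cons_self)
      · exact (ih h' x hx).imp_right (Or.imp_left hmem)
    rcases popHead_eq_true h with ⟨B', rfl, h'⟩ | h
    · rcases List.mem_cons.1 hx with rfl | hx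
      · exact Or.inr (Or.inr List.mem_cons_self)
      · exact (ih h' x hx).imp_right (Or.imp_right hmem)
    · simp at h

theorem Lt.irrefl (a : Fin 5 → ℕ) : ¬ Lt a a := by
  rintro (⟨t, -, h⟩ | ⟨-, h⟩) <;> exact lt_irrefl _ h

theorem Lt.trans {a b c : Fin 5 → ℕ} (h1 : Lt a b) (h2 : Lt b c) : Lt a c := by
  rcases h1 with ⟨t, h1, h1'⟩ | ⟨h1, h1'⟩ <;> rcases h2 with ⟨u, h2, h2'⟩ | ⟨h2, h2'⟩
  · rcases lt_trichotomy t u with h | rfl | h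
    · exact Or.inl ⟨t, fun v hv => (h1 v hv).trans (h2 v (hv.trans h)), h2 t h ▸ h1'⟩
    · exact Or.inl ⟨t, fun v hv => (h1 v hv).trans (h2 v hv), h1'.trans h2'⟩
    · exact Or.inl ⟨u, fun v hv => (h1 v (hv.trans h)).trans (h2 v hv), (h1 u h).symm ▸ h2'⟩
  · exact Or.inl ⟨t, fun v hv => (h1 v hv).trans (h2 v), h2 t ▸ h1'⟩
  · exact Or.inl ⟨u, fun v hv => (h1 v).trans (h2 v hv), (h1 u).symm ▸ h2'⟩
  · exact Or.inr ⟨fun v => (h1 v).trans (h2 v), h1'.trans h2'⟩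

theorem finite_dg (d : ℕ) : Finite {a : Fin 5 → ℕ // dg a = d} := by
  refine Finite.of_injective (β := Fin 5 → Fin (d + 1)) (fun a i => ⟨a.1 i, ?_⟩) ?_
  · have h := Finset.single_le_sum (f := a.1) (fun _ _ => Nat.zero_le _) (Finset.mem_univ i)
    have h2 : ∑ i, a.1 i = d := a.2
    omega
  · intro a b h
    ext i
    simpa using congrFun h i

/-- Elimination of reducible monomials, in a family closed under passage to smaller ones. -/
theorem xp_mem_of_red {d : ℕ} {W : Submodule (ZMod 2) (PolyAlg 5)} (hW : hit 5 ≤ W)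
    (P : (Fin 5 → ℕ) → Prop) (hP : ∀ a b, P a → dg a = d → dg b = d → Lt b a → P b)
    (h : ∀ a, P a → dg a = d → xp a ∈ W ∨ Red a) (a : Fin 5 → ℕ) (ha : P a) (had : dg a = d) :
    xp a ∈ W := by
  have := finite_dg d
  let R : {a : Fin 5 → ℕ // dg a = d} → {a : Fin 5 → ℕ // dg a = d} → Prop := fun b a => Lt b.1 a.1
  have : IsTrans _ R := ⟨fun _ _ _ h1 h2 => Lt.trans h1 h2⟩
  have : Std.Irrefl R := ⟨fun _ => Lt.irrefl _⟩
  -- There are finitely many monomials of degree `d`, and on a finite set a transitive irreflexive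
  -- relation is well-founded.
  have hwf : WellFounded R := Finite.wellFounded_of_trans_of_irrefl R
  have key : ∀ z : {a : Fin 5 → ℕ // dg a = d}, P z.1 → xp z.1 ∈ W := by
    intro z
    induction z using hwf.induction with
    | _ z ih =>
      intro hz
      rcases h z.1 hz z.2 with h | h
      · exact h
      · refine sup_le hW (xspan_le.2 fun b hb => ?_) h
        have hbd : dg b = d := hb.1.trans z.2
        exact ih ⟨b, hbd⟩ hb.2 (hP z.1 b hz z.2 hbd hb.2)
  exact key ⟨a, had⟩ ha

/-- This makes "some exponent is even", that is `om a 0 < 5`, inherited by smaller monomials, as the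
elimination inside `low` requires. -/
theorem om_zero_le_of_lt {a b : Fin 5 → ℕ} (h : Lt b a) : om b 0 ≤ om a 0 := by
  rcases h with ⟨t, h, h'⟩ | ⟨h, -⟩
  · rcases Nat.eq_zero_or_pos t with rfl | ht
    · exact h'.le
    · exact (h 0 ht).le
  · exact (h 0).le

/-- The masks `S` that have `p` true of their number of digits `1`. -/
noncomputable def topRows (p : ℕ → Bool) : List ℕ :=
  List.rec [] (fun S _ ih => Bool.rec ih (S :: ih) (p (popc S))) rows32

theorem mem_topRows {p : ℕ → Bool} {a : Fin 5 → ℕ} (h : p (om a 0) = true) :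
    row0 a ∈ topRows p := by
  have key : ∀ l : List ℕ, ∀ S ∈ l, p (popc S) = true →
      S ∈ (List.rec [] (fun S _ ih => Bool.rec ih (S :: ih) (p (popc S))) l : List ℕ) := by
    intro l
    induction l with
    | nil => simp
    | cons z l ih =>
      intro S hS hp
      change S ∈ (Bool.rec (List.rec [] (fun S _ ih => Bool.rec ih (S :: ih) (p (popc S))) l)
        (z :: List.rec [] (fun S _ ih => Bool.rec ih (S :: ih) (p (popc S))) l) (p (popc z)) :
          List ℕ)
      rcases List.mem_cons.1 hS with rfl | hS
      · rw [hp]; exact List.mem_cons_self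
      · cases p (popc z)
        · exact ih S hS hp
        · exact List.mem_cons_of_mem _ (ih S hS hp)
  refine key rows32 _ ?_ ?_
  · rw [rows32_eq, List.mem_range]; exact row0_lt a
  · rwa [popc_eq (row0_lt a), dg_bits_row0]

/-- The monomials of degree `d` whose first row satisfies `p` are spanned by the listed ones, modulo
hits and smaller monomials. -/
theorem mem_or_red_of_search {D E : List Cert} {A B : List ℕ} {d : ℕ} {p : ℕ → Bool}
    (hD : allB chkBlock D = true) (hE : allB chkCert E = true) (hd : d < 64)
    (h : coverB (search (mkTabs D) 6 (topRows p) 0 0 d []) (E.map Prod.fst) A B = true)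
    (a : Fin 5 → ℕ) (ha : dg a = d) (hp : p (om a 0) = true) :
    (val a ∈ A ∨ val a ∈ B) ∨ Red a := by
  have hs := search_spec (badTable_mkTabs hD) 6 (topRows p) 0 0 d [] a ha hd (mem_topRows hp)
  simp only [vOf, pow_zero, one_smul, zero_add] at hs
  rcases hs with hs | hs
  · rcases coverB_spec h _ hs with h | h
    · right
      obtain ⟨c, hc, hv⟩ := List.mem_map.1 h
      have := red_of_chkCert (allB_eq_true.1 hE c hc)
      rwa [hv, dig_val] at this
      intro i
      have h := Finset.single_le_sum (f := a) (fun _ _ => Nat.zero_le _) (Finset.mem_univ i)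
      have h2 : ∑ i, a i = d := ha
      omega
    · exact Or.inl h
  · exact Or.inr hs

end PolyAlg

/-! ### Data for the upper bounds: hit equations and the candidate bases. -/

namespace PolyAlg

section

set_option maxRecDepth 100000

/-- Hit equations for blocks of two, three and four rows. -/
noncomputable def blockData : List Cert := [
  (1, 2, [(1, 1)]), (2, 2, [(1, 64)]), (3, 2, [(1, 66)]), (4, 2, [(1, 4096)]), (5, 2, [(1, 4098)]),
  (6, 2, [(1, 4224)]), (7, 2, [(1, 4226)]), (8, 2, [(1, 262144)]), (9, 2, [(1, 262146)]),
  (10, 2, [(1, 262272)]), (11, 2, [(1, 262274)]), (12, 2, [(1, 270336)]), (13, 2, [(1, 270338)]),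
  (14, 2, [(1, 270464)]), (15, 2, [(1, 270466)]), (16, 2, [(1, 16777216)]),
  (17, 2, [(1, 16777218)]), (18, 2, [(1, 16777344)]), (19, 2, [(1, 16777346)]),
  (20, 2, [(1, 16785408)]), (21, 2, [(1, 16785410)]), (22, 2, [(1, 16785536)]),
  (23, 2, [(1, 16785538)]), (24, 2, [(1, 17301504)]), (25, 2, [(1, 17301506)]),
  (26, 2, [(1, 17301632)]), (27, 2, [(1, 17301634)]), (28, 2, [(1, 17309696)]),
  (29, 2, [(1, 17309698)]), (30, 2, [(1, 17309824)]), (34, 2, [(1, 65)]), (35, 2, [(1, 67)]),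
  (36, 2, [(1, 4097)]), (37, 2, [(1, 4099)]), (38, 2, [(1, 4225)]), (39, 2, [(1, 4227)]),
  (40, 2, [(1, 262145)]), (41, 2, [(1, 262147)]), (42, 2, [(1, 262273)]), (43, 2, [(1, 262275)]),
  (44, 2, [(1, 270337)]), (45, 2, [(1, 270339)]), (46, 2, [(1, 270465)]), (48, 2, [(1, 16777217)]),
  (49, 2, [(1, 16777219)]), (50, 2, [(1, 16777345)]), (51, 2, [(1, 16777347)]),
  (52, 2, [(1, 16785409)]), (53, 2, [(1, 16785411)]), (54, 2, [(1, 16785537)]),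
  (56, 2, [(1, 17301505)]), (57, 2, [(1, 17301507)]), (58, 2, [(1, 17301633)]),
  (60, 2, [(1, 17309697)]), (63, 2, [(1, 17309827)]), (67, 2, [(1, 193)]), (68, 2, [(1, 4160)]),
  (69, 2, [(1, 4162)]), (70, 2, [(1, 4288)]), (71, 2, [(1, 4290)]), (72, 2, [(1, 262208)]),
  (73, 2, [(1, 262210)]), (74, 2, [(1, 262336)]), (75, 2, [(1, 262338)]), (76, 2, [(1, 270400)]),
  (77, 2, [(1, 270402)]), (78, 2, [(1, 270528)]), (80, 2, [(1, 16777280)]),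
  (81, 2, [(1, 16777282)]), (82, 2, [(1, 16777408)]), (83, 2, [(1, 16777410)]),
  (84, 2, [(1, 16785472)]), (85, 2, [(1, 16785474)]), (86, 2, [(1, 16785600)]),
  (88, 2, [(1, 17301568)]), (89, 2, [(1, 17301570)]), (90, 2, [(1, 17301696)]),
  (92, 2, [(1, 17309760)]), (95, 2, [(1, 17309890)]), (100, 2, [(1, 4161)]), (101, 2, [(1, 4163)]),
  (102, 2, [(1, 4289)]), (103, 2, [(1, 4291)]), (104, 2, [(1, 262209)]), (105, 2, [(1, 262211)]),
  (106, 2, [(1, 262337)]), (107, 2, [(1, 262339)]), (108, 2, [(1, 270401)]),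
  (109, 2, [(1, 270403)]), (110, 2, [(1, 270529)]), (112, 2, [(1, 16777281)]),
  (113, 2, [(1, 16777283)]), (114, 2, [(1, 16777409)]), (115, 2, [(1, 16777411)]),
  (116, 2, [(1, 16785473)]), (117, 2, [(1, 16785475)]), (118, 2, [(1, 16785601)]),
  (120, 2, [(1, 17301569)]), (121, 2, [(1, 17301571)]), (122, 2, [(1, 17301697)]),
  (124, 2, [(1, 17309761)]), (127, 2, [(1, 17309891)]), (131, 2, [(2, 4161), (1, 8257)]),
  (133, 2, [(1, 12289)]), (134, 2, [(1, 12352)]), (135, 2, [(1, 12354)]), (136, 2, [(1, 266240)]),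
  (137, 2, [(1, 266242)]), (138, 2, [(1, 266368)]), (139, 2, [(1, 266370)]),
  (140, 2, [(1, 274432)]), (141, 2, [(1, 274434)]), (142, 2, [(1, 274560)]),
  (144, 2, [(1, 16781312)]), (145, 2, [(1, 16781314)]), (146, 2, [(1, 16781440)]),
  (147, 2, [(1, 16781442)]), (148, 2, [(1, 16789504)]), (149, 2, [(1, 16789506)]),
  (150, 2, [(1, 16789632)]), (152, 2, [(1, 17305600)]), (153, 2, [(1, 17305602)]),
  (154, 2, [(1, 17305728)]), (156, 2, [(1, 17313792)]), (159, 2, [(1, 17313922)]),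
  (166, 2, [(1, 12353)]), (167, 2, [(1, 12355)]), (168, 2, [(1, 266241)]), (169, 2, [(1, 266243)]),
  (170, 2, [(1, 266369)]), (171, 2, [(1, 266371)]), (172, 2, [(1, 274433)]),
  (173, 2, [(1, 274435)]), (174, 2, [(1, 274561)]), (176, 2, [(1, 16781313)]),
  (177, 2, [(1, 16781315)]), (178, 2, [(1, 16781441)]), (179, 2, [(1, 16781443)]),
  (180, 2, [(1, 16789505)]), (181, 2, [(1, 16789507)]), (182, 2, [(1, 16789633)]),
  (184, 2, [(1, 17305601)]), (185, 2, [(1, 17305603)]), (186, 2, [(1, 17305729)]),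
  (188, 2, [(1, 17313793)]), (191, 2, [(1, 17313923)]), (199, 2, [(1, 12481)]),
  (200, 2, [(1, 266304)]), (201, 2, [(1, 266306)]), (202, 2, [(1, 266432)]),
  (203, 2, [(1, 266434)]), (204, 2, [(1, 274496)]), (205, 2, [(1, 274498)]),
  (206, 2, [(1, 274624)]), (208, 2, [(1, 16781376)]), (209, 2, [(1, 16781378)]),
  (210, 2, [(1, 16781504)]), (211, 2, [(1, 16781506)]), (212, 2, [(1, 16789568)]),
  (213, 2, [(1, 16789570)]), (214, 2, [(1, 16789696)]), (216, 2, [(1, 17305664)]),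
  (217, 2, [(1, 17305666)]), (218, 2, [(1, 17305792)]), (220, 2, [(1, 17313856)]),
  (223, 2, [(1, 17313986)]), (232, 2, [(1, 266305)]), (233, 2, [(1, 266307)]),
  (234, 2, [(1, 266433)]), (236, 2, [(1, 274497)]), (239, 2, [(1, 274627)]),
  (240, 2, [(1, 16781377)]), (241, 2, [(1, 16781379)]), (242, 2, [(1, 16781505)]),
  (244, 2, [(1, 16789569)]), (247, 2, [(1, 16789699)]), (248, 2, [(1, 17305665)]),
  (251, 2, [(1, 17305795)]), (253, 2, [(1, 17313859)]), (254, 2, [(1, 17313985)]),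
  (259, 2, [(2, 262209), (1, 524353)]), (261, 2, [(2, 266241), (1, 528385)]),
  (262, 2, [(2, 266304), (1, 528448)]), (265, 2, [(1, 786433)]), (266, 2, [(1, 786496)]),
  (267, 2, [(1, 786498)]), (268, 2, [(1, 790528)]), (269, 2, [(1, 790530)]),
  (270, 2, [(1, 790656)]), (272, 2, [(1, 17039360)]), (273, 2, [(1, 17039362)]),
  (274, 2, [(1, 17039488)]), (275, 2, [(1, 17039490)]), (276, 2, [(1, 17047552)]),
  (277, 2, [(1, 17047554)]), (278, 2, [(1, 17047680)]), (280, 2, [(1, 17563648)]),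
  (281, 2, [(1, 17563650)]), (282, 2, [(1, 17563776)]), (284, 2, [(1, 17571840)]),
  (287, 2, [(1, 17571970)]), (294, 2, [(2, 266305), (1, 528449)]), (298, 2, [(1, 786497)]),
  (299, 2, [(1, 786499)]), (300, 2, [(1, 790529)]), (301, 2, [(1, 790531)]),
  (302, 2, [(1, 790657)]), (304, 2, [(1, 17039361)]), (305, 2, [(1, 17039363)]),
  (306, 2, [(1, 17039489)]), (307, 2, [(1, 17039491)]), (308, 2, [(1, 17047553)]),
  (309, 2, [(1, 17047555)]), (310, 2, [(1, 17047681)]), (312, 2, [(1, 17563649)]),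
  (313, 2, [(1, 17563651)]), (314, 2, [(1, 17563777)]), (316, 2, [(1, 17571841)]),
  (319, 2, [(1, 17571971)]), (331, 2, [(1, 786625)]), (332, 2, [(1, 790592)]),
  (333, 2, [(1, 790594)]), (334, 2, [(1, 790720)]), (336, 2, [(1, 17039424)]),
  (337, 2, [(1, 17039426)]), (338, 2, [(1, 17039552)]), (339, 2, [(1, 17039554)]),
  (340, 2, [(1, 17047616)]), (341, 2, [(1, 17047618)]), (342, 2, [(1, 17047744)]),
  (344, 2, [(1, 17563712)]), (345, 2, [(1, 17563714)]), (346, 2, [(1, 17563840)]),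
  (348, 2, [(1, 17571904)]), (351, 2, [(1, 17572034)]), (364, 2, [(1, 790593)]),
  (367, 2, [(1, 790723)]), (368, 2, [(1, 17039425)]), (369, 2, [(1, 17039427)]),
  (370, 2, [(1, 17039553)]), (372, 2, [(1, 17047617)]), (375, 2, [(1, 17047747)]),
  (376, 2, [(1, 17563713)]), (379, 2, [(1, 17563843)]), (381, 2, [(1, 17571907)]),
  (382, 2, [(1, 17572033)]), (397, 2, [(1, 798721)]), (398, 2, [(1, 798784)]),
  (400, 2, [(1, 17043456)]), (401, 2, [(1, 17043458)]), (402, 2, [(1, 17043584)]),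
  (403, 2, [(1, 17043586)]), (404, 2, [(1, 17051648)]), (405, 2, [(1, 17051650)]),
  (406, 2, [(1, 17051776)]), (408, 2, [(1, 17567744)]), (409, 2, [(1, 17567746)]),
  (410, 2, [(1, 17567872)]), (412, 2, [(1, 17575936)]), (415, 2, [(1, 17576066)]),
  (431, 2, [(1, 798787)]), (432, 2, [(1, 17043457)]), (433, 2, [(1, 17043459)]),
  (434, 2, [(1, 17043585)]), (436, 2, [(1, 17051649)]), (439, 2, [(1, 17051779)]),
  (440, 2, [(1, 17567745)]), (443, 2, [(1, 17567875)]), (445, 2, [(1, 17575939)]),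
  (446, 2, [(1, 17576065)]), (463, 2, [(1, 798913)]), (464, 2, [(1, 17043520)]),
  (465, 2, [(1, 17043522)]), (466, 2, [(1, 17043648)]), (468, 2, [(1, 17051712)]),
  (471, 2, [(1, 17051842)]), (472, 2, [(1, 17567808)]), (475, 2, [(1, 17567938)]),
  (477, 2, [(1, 17576002)]), (478, 2, [(1, 17576128)]), (496, 2, [(1, 17043521)]),
  (497, 2, [(1, 17043523)]), (498, 2, [(1, 17043649)]), (500, 2, [(1, 17051713)]),
  (503, 2, [(1, 17051843)]), (504, 2, [(1, 17567809)]), (507, 2, [(1, 17567939)]),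
  (509, 2, [(1, 17576003)]), (510, 2, [(1, 17576129)]), (515, 2, [(2, 16777281), (1, 33554497)]),
  (517, 2, [(2, 16781313), (1, 33558529)]), (518, 2, [(2, 16781376), (1, 33558592)]),
  (521, 2, [(2, 17039361), (1, 33816577)]), (522, 2, [(2, 17039424), (1, 33816640)]),
  (524, 2, [(2, 17043456), (1, 33820672)]), (529, 2, [(1, 50331649)]), (530, 2, [(1, 50331712)]),
  (531, 2, [(1, 50331714)]), (532, 2, [(1, 50335744)]), (533, 2, [(1, 50335746)]),
  (534, 2, [(1, 50335872)]), (536, 2, [(1, 50593792)]), (537, 2, [(1, 50593794)]),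
  (538, 2, [(1, 50593920)]), (540, 2, [(1, 50601984)]), (543, 2, [(1, 50602114)]),
  (550, 2, [(2, 16781377), (1, 33558593)]), (554, 2, [(2, 17039425), (1, 33816641)]),
  (556, 2, [(2, 17043457), (1, 33820673)]), (562, 2, [(1, 50331713)]), (563, 2, [(1, 50331715)]),
  (564, 2, [(1, 50335745)]), (565, 2, [(1, 50335747)]), (566, 2, [(1, 50335873)]),
  (568, 2, [(1, 50593793)]), (569, 2, [(1, 50593795)]), (570, 2, [(1, 50593921)]),
  (572, 2, [(1, 50601985)]), (575, 2, [(1, 50602115)]), (588, 2, [(2, 17043520), (1, 33820736)]),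
  (595, 2, [(1, 50331841)]), (596, 2, [(1, 50335808)]), (597, 2, [(1, 50335810)]),
  (598, 2, [(1, 50335936)]), (600, 2, [(1, 50593856)]), (601, 2, [(1, 50593858)]),
  (602, 2, [(1, 50593984)]), (604, 2, [(1, 50602048)]), (607, 2, [(1, 50602178)]),
  (620, 2, [(2, 17043521), (1, 33820737)]), (628, 2, [(1, 50335809)]), (631, 2, [(1, 50335939)]),
  (632, 2, [(1, 50593857)]), (635, 2, [(1, 50593987)]), (637, 2, [(1, 50602051)]),
  (638, 2, [(1, 50602177)]), (661, 2, [(1, 50343937)]), (662, 2, [(1, 50344000)]),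
  (664, 2, [(1, 50597888)]), (665, 2, [(1, 50597890)]), (666, 2, [(1, 50598016)]),
  (668, 2, [(1, 50606080)]), (671, 2, [(1, 50606210)]), (695, 2, [(1, 50344003)]),
  (696, 2, [(1, 50597889)]), (699, 2, [(1, 50598019)]), (701, 2, [(1, 50606083)]),
  (702, 2, [(1, 50606209)]), (727, 2, [(1, 50344129)]), (728, 2, [(1, 50597952)]),
  (731, 2, [(1, 50598082)]), (733, 2, [(1, 50606146)]), (734, 2, [(1, 50606272)]),
  (760, 2, [(1, 50597953)]), (763, 2, [(1, 50598083)]), (765, 2, [(1, 50606147)]),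
  (766, 2, [(1, 50606273)]), (793, 2, [(1, 51118081)]), (794, 2, [(1, 51118144)]),
  (796, 2, [(1, 51122176)]), (799, 2, [(1, 51122306)]), (827, 2, [(1, 51118147)]),
  (829, 2, [(1, 51122179)]), (830, 2, [(1, 51122305)]), (859, 2, [(1, 51118273)]),
  (861, 2, [(1, 51122242)]), (862, 2, [(1, 51122368)]), (893, 2, [(1, 51122243)]),
  (894, 2, [(1, 51122369)]), (925, 2, [(1, 51130369)]), (926, 2, [(1, 51130432)]),
  (2113, 3, [(1, 195), (2, 131)]), (4225, 3, [(1, 12291), (2, 8195)]), (4226, 3, [(1, 12480),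
  (2, 8384)]), (8419, 3, [(2, 266566), (2, 266440), (1, 528710)]), (8421, 3, [(2, 282694),
  (2, 274504), (1, 544838)]), (8422, 3, [(2, 283009), (2, 274945), (1, 545153)]),
  (8449, 3, [(1, 786435), (2, 524291)]), (8450, 3, [(1, 786624), (2, 524480)]),
  (8452, 3, [(1, 798720), (2, 536576)]), (8455, 3, [(1, 798980), (2, 536836)]),
  (9443, 3, [(2, 266567), (2, 266441), (1, 528711)]), (9445, 3, [(2, 282695), (2, 274505),
  (1, 544839)]), (9446, 3, [(1, 283011), (2, 536963), (1, 1061187), (1, 274821)]),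
  (9479, 3, [(4, 794883), (1, 791043), (2, 1319171)]), (10467, 3, [(2, 266693), (2, 266819),
  (1, 528837)]), (10469, 3, [(1, 282822), (2, 536774), (1, 1061061), (1, 274758)]),
  (10470, 3, [(2, 283073), (2, 275009), (1, 545217)]), (10503, 3, [(4, 794820), (1, 790728),
  (2, 1319108)]), (11559, 3, [(4, 794823), (1, 790731), (2, 1319111)]), (11591, 3, [(4, 795075),
  (1, 791235), (2, 1319363)]), (12517, 3, [(2, 290885), (2, 299075), (1, 553029)]),
  (12518, 3, [(2, 291137), (2, 299201), (1, 553281)]), (12551, 3, [(4, 798852), (1, 798792),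
  (2, 1323140)]), (12649, 3, [(2, 1839173), (2, 2363459), (1, 1843269)]), (12650, 3, [(2, 1839425),
  (2, 2363585), (1, 1843521)]), (13607, 3, [(4, 798855), (1, 798795), (2, 1323143)]),
  (13639, 3, [(4, 799107), (1, 799299), (2, 1323395)]), (13703, 3, [(4, 815235), (1, 831555),
  (2, 1339523)]), (13707, 3, [(4, 1847427), (1, 2895939), (2, 1855619)]), (14631, 3, [(4, 798918),
  (1, 798921), (2, 1323206)]), (14663, 3, [(4, 799170), (1, 799425), (2, 1323458)]),
  (14727, 3, [(4, 815298), (1, 831681), (2, 1339586)]), (14731, 3, [(4, 1847490), (1, 2896065),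
  (2, 1855682)]), (16611, 3, [(2, 16781638), (2, 16781512), (1, 33558854)]),
  (16613, 3, [(2, 16797766), (2, 16789576), (1, 33574982)]), (16614, 3, [(2, 16798081),
  (2, 16790017), (1, 33575297)]), (16739, 3, [(2, 17039686), (2, 17039560), (1, 33816902)]),
  (16741, 3, [(2, 17055814), (2, 17047624), (1, 33833030)]), (16742, 3, [(2, 17056129),
  (2, 17048065), (1, 33833345)]), (16745, 3, [(2, 18088006), (2, 17563720), (1, 34865222)]),
  (16746, 3, [(2, 18088321), (2, 17564161), (1, 34865537)]), (16803, 3, [(2, 17043718),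
  (2, 17043592), (1, 33820934)]), (16805, 3, [(2, 17059846), (2, 17051656), (1, 33837062)]),
  (16806, 3, [(2, 17064193), (2, 17072257), (1, 33841409)]), (16809, 3, [(2, 18092038),
  (2, 17567752), (1, 34869254)]), (16810, 3, [(2, 18354433), (2, 18878593), (1, 35131649)]),
  (16812, 3, [(2, 18112513), (2, 17596417), (1, 34889729)]), (16835, 3, [(2, 17043844),
  (2, 17043970), (1, 33821060)]), (16837, 3, [(2, 17064004), (2, 17072194), (1, 33841220)]),
  (16838, 3, [(2, 17060224), (2, 17052160), (1, 33837440)]), (16841, 3, [(2, 18354244),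
  (2, 18878530), (1, 35131460)]), (16842, 3, [(2, 18092416), (2, 17568256), (1, 34869632)]),
  (16844, 3, [(2, 18112576), (2, 17596480), (1, 34889792)]), (16897, 3, [(1, 50331651),
  (2, 33554435)]), (16898, 3, [(1, 50331840), (2, 33554624)]), (16900, 3, [(1, 50343936),
  (2, 33566720)]), (16903, 3, [(1, 50344196), (2, 33566980)]), (16904, 3, [(1, 51118080),
  (2, 34340864)]), (16907, 3, [(1, 51118340), (2, 34341124)]), (16909, 3, [(1, 51134468),
  (2, 34357252)]), (16910, 3, [(1, 51134720), (2, 34357504)]), (17635, 3, [(2, 16781639),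
  (2, 16781513), (1, 33558855)]), (17637, 3, [(2, 16797767), (2, 16789577), (1, 33574983)]),
  (17638, 3, [(1, 16798083), (2, 33567107), (1, 67121475), (1, 16789893)]),
  (17927, 3, [(4, 50340099), (1, 50336259), (2, 83894531)]), (17931, 3, [(4, 50856195),
  (1, 50594307), (2, 84410627)]), (17933, 3, [(4, 50872323), (1, 50626563), (2, 84426755)]),
  (17934, 3, [(2, 50872577), (1, 84164865), (2, 100933889), (2, 50610434)]),
  (18659, 3, [(2, 16781765), (2, 16781891), (1, 33558981)]), (18661, 3, [(1, 16797894),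
  (2, 33566918), (1, 67121349), (1, 16789830)]), (18662, 3, [(2, 16798145), (2, 16790081),
  (1, 33575361)]), (18951, 3, [(4, 50340036), (1, 50335944), (2, 83894468)]),
  (18955, 3, [(4, 50856132), (1, 50593992), (2, 84410564)]), (18957, 3, [(2, 50872388),
  (1, 84164676), (2, 100933700), (2, 50610308)]), (18958, 3, [(4, 50872512), (1, 50626752),
  (2, 84426944)]), (19940, 3, [(1, 17322179), (2, 34091203), (1, 67383491), (1, 17838275),
  (1, 17314115), (1, 17313989)]), (19941, 3, [(1, 17322183), (2, 34091207), (1, 67383495),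
  (1, 17838279), (1, 17314119)]), (19942, 3, [(1, 17322435), (2, 34091459), (1, 67383747),
  (1, 17838531), (1, 17314245)]), (19944, 3, [(1, 18096323), (2, 34349251), (1, 67899587),
  (1, 17580227), (1, 17572163), (1, 17572037)]), (19945, 3, [(1, 18096327), (2, 34349255),
  (1, 67899591), (1, 17580231), (1, 17572167)]), (19946, 3, [(1, 18096579), (2, 34349507),
  (1, 67899843), (1, 17580483), (1, 17572293)]), (19948, 3, [(1, 18112707), (2, 34365635),
  (1, 67915971), (1, 17588547), (1, 17588421)]), (20007, 3, [(4, 50340039), (1, 50335947),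
  (2, 83894471)]), (20011, 3, [(4, 50856135), (1, 50593995), (2, 84410567)]),
  (20013, 3, [(2, 50872391), (1, 84164679), (2, 100933703), (2, 50610311)]),
  (20014, 3, [(4, 50872515), (1, 50626755), (2, 84426947)]), (20039, 3, [(4, 50340291),
  (1, 50336451), (2, 83894723)]), (20043, 3, [(4, 50856387), (1, 50594499), (2, 84410819)]),
  (20045, 3, [(4, 50864325), (1, 50602185), (4, 50602182), (2, 84418757), (2, 84156614)]),
  (20046, 3, [(2, 50872769), (1, 84165057), (2, 100934081), (2, 50610626)]),
  (20709, 3, [(2, 16805957), (2, 16814147), (1, 33583173)]), (20710, 3, [(2, 16806209),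
  (2, 16814273), (1, 33583425)]), (20841, 3, [(2, 18354245), (2, 18878531), (1, 35131461),
  (2, 18096197), (2, 17580101), (1, 34873413), (1, 34357317)]), (20842, 3, [(2, 18354497),
  (2, 18878657), (1, 35131713), (2, 18096449), (2, 17580353), (1, 34873665), (1, 34357569)]),
  (20999, 3, [(4, 50344068), (1, 50344008), (2, 83898500)]), (21003, 3, [(2, 50860292),
  (1, 84152580), (2, 100929668), (2, 50602244)]), (21005, 3, [(4, 50868228), (1, 50606088),
  (2, 84422660)]), (21006, 3, [(4, 50868480), (1, 50606592), (2, 84422912)]),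
  (21097, 3, [(1, 51384453), (4, 50864259), (2, 84418691), (1, 51396675), (1, 51384579)]),
  (21098, 3, [(1, 51384642), (4, 50864322), (2, 84418754), (1, 51396801), (1, 51384516)]),
  (21105, 3, [(2, 117444677), (2, 150999107), (1, 117448773)]), (21106, 3, [(2, 117444929),
  (2, 150999233), (1, 117449025)]), (21899, 3, [(2, 18362501), (2, 18108485), (1, 34885701),
  (2, 18374723), (2, 18362438)]), (21990, 3, [(1, 17330499), (2, 34107587), (1, 67399875),
  (1, 17854659), (1, 17330373)]), (21992, 3, [(1, 18100355), (2, 34353283), (1, 67907651),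
  (1, 17584259), (1, 17576195), (1, 17576069)]), (21993, 3, [(1, 18100359), (2, 34353287),
  (1, 67907655), (1, 17584263), (1, 17576199)]), (21994, 3, [(1, 18100611), (2, 34353539),
  (1, 67907907), (1, 17584515), (1, 17576325)]), (21996, 3, [(1, 18116739), (2, 34369667),
  (1, 67924035), (1, 17592579), (1, 17592453)]), (22055, 3, [(4, 50344071), (1, 50344011),
  (2, 83898503)]), (22059, 3, [(2, 50860295), (1, 84152583), (2, 100929671), (2, 50602247)]),
  (22061, 3, [(4, 50868231), (1, 50606091), (2, 84422663)]), (22062, 3, [(4, 50868483),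
  (1, 50606595), (2, 84422915)]), (22087, 3, [(4, 50344323), (1, 50344515), (2, 83898755)]),
  (22091, 3, [(2, 50860421), (1, 84152709), (2, 100929923), (2, 50602373), (2, 50598278)]),
  (22093, 3, [(4, 50868357), (1, 50606217), (4, 50606214), (2, 84422789), (2, 84160646)]),
  (22094, 3, [(2, 50876801), (1, 84169089), (2, 100938113), (2, 50618753), (2, 50614658)]),
  (22151, 3, [(4, 50360451), (1, 50376771), (2, 83914883)]), (22155, 3, [(4, 51392643),
  (1, 52441155), (2, 84947075), (4, 50876547), (1, 50630787), (4, 50618499), (2, 84430979),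
  (2, 84172931)]), (22157, 3, [(4, 50884611), (1, 50638851), (2, 84439043)]),
  (22158, 3, [(2, 50884865), (1, 84177153), (2, 100954241), (2, 50622722)]),
  (22163, 3, [(4, 117452931), (1, 184561731), (2, 117461123)]), (22923, 3, [(2, 18362690),
  (2, 18108737), (1, 34885953), (2, 18374849), (2, 18362753)]), (23016, 3, [(1, 18100418),
  (2, 34353346), (1, 67907777), (1, 17584322), (1, 17576258), (1, 17576132)]),
  (23017, 3, [(1, 18100422), (2, 34353350), (1, 67907781), (1, 17584326), (1, 17576262)]),
  (23018, 3, [(1, 18100674), (2, 34353602), (1, 67908033), (1, 17584578), (1, 17576388)]),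
  (23020, 3, [(1, 18116802), (2, 34369730), (1, 67924161), (1, 17592642), (1, 17592516)]),
  (23079, 3, [(4, 50344134), (1, 50344137), (2, 83898566)]), (23083, 3, [(2, 50860358),
  (1, 84152646), (2, 100929734), (2, 50602310), (2, 50598278)]), (23085, 3, [(2, 50876486),
  (1, 84168774), (2, 100937798), (2, 50618438), (2, 50614406)]), (23086, 3, [(4, 51392706),
  (1, 52441281), (2, 84947138)]), (23111, 3, [(4, 50344386), (1, 50344641), (2, 83898818)]),
  (23115, 3, [(2, 50860484), (1, 84152772), (2, 100929986), (2, 50602436)]),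
  (23117, 3, [(4, 50868420), (1, 50606280), (2, 84422852)]), (23118, 3, [(4, 50868672),
  (1, 50606784), (2, 84423104)]), (23175, 3, [(4, 50360514), (1, 50376897), (2, 83914946)]),
  (23179, 3, [(4, 51392706), (1, 52441281), (2, 84947138), (4, 50876610), (1, 50630850),
  (4, 50618562), (2, 84431042), (2, 84172994)]), (23181, 3, [(2, 50884676), (1, 84176964),
  (2, 100954178), (2, 50622596)]), (23182, 3, [(4, 50884800), (1, 50639040), (2, 84439232)]),
  (23187, 3, [(4, 117452994), (1, 184561857), (2, 117461186)]), (24296, 3, [(1, 51130563),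
  (2, 34353347)]), (24937, 3, [(2, 18612293), (2, 19136579), (1, 35389509)]),
  (24938, 3, [(2, 18612545), (2, 19136705), (1, 35389761)]), (25099, 3, [(4, 51118212),
  (1, 51118152), (2, 84672644)]), (25101, 3, [(4, 51126276), (1, 51122184), (2, 84680708)]),
  (25102, 3, [(4, 51126528), (1, 51122688), (2, 84680960)]), (25201, 3, [(2, 117702725),
  (2, 151257155), (1, 117964869)]), (25202, 3, [(2, 117702977), (2, 151257281), (1, 117965121)]),
  (26090, 3, [(1, 18620739), (2, 35397827), (1, 68948163), (1, 18628803), (1, 18620613)]),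
  (26092, 3, [(1, 18632835), (2, 35401859), (1, 68956227), (1, 18624771), (1, 18624645)]),
  (26155, 3, [(4, 51118215), (1, 51118155), (2, 84672647)]), (26157, 3, [(4, 51126279),
  (1, 51122187), (2, 84680711)]), (26158, 3, [(4, 51126531), (1, 51122691), (2, 84680963)]),
  (26187, 3, [(4, 51118467), (1, 51118659), (2, 84672899)]), (26189, 3, [(4, 51126405),
  (1, 51122313), (4, 51122310), (2, 84680837), (2, 84676742)]), (26190, 3, [(2, 51650945),
  (1, 85201281), (2, 101454209), (2, 51908993), (2, 51646850)]), (26253, 3, [(4, 51142659),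
  (1, 51154947), (2, 84697091)]), (26254, 3, [(2, 51667073), (1, 85221441), (2, 101474369),
  (2, 51929153), (2, 51667010)]), (26354, 3, [(1, 117711171), (2, 117973187), (1, 118493379),
  (1, 117719235), (1, 117711045)]), (26356, 3, [(1, 117723267), (2, 117977219), (1, 118501443),
  (1, 117715203), (1, 117715077)]), (26379, 3, [(4, 52166787), (1, 53215299), (2, 85721219)]),
  (26381, 3, [(4, 52174851), (1, 53219331), (2, 85729283)]), (26382, 3, [(2, 52175105),
  (1, 85725441), (2, 102502529), (2, 52171010)]), (26387, 3, [(4, 118227075), (1, 185335875),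
  (2, 118751363)]), (26389, 3, [(4, 118235139), (1, 185339907), (2, 118759427)]),
  (26390, 3, [(2, 118235393), (1, 118755585), (2, 119017601), (2, 118231298)]),
  (27116, 3, [(1, 18632898), (2, 35401922), (1, 68956353), (1, 18624834), (1, 18624708)]),
  (27179, 3, [(4, 51118278), (1, 51118281), (2, 84672710)]), (27181, 3, [(2, 51650630),
  (1, 85200966), (2, 101453894), (2, 51908678), (2, 51646598)]), (27182, 3, [(4, 51134658),
  (1, 51151041), (2, 84689090)]), (27211, 3, [(4, 51118530), (1, 51118785), (2, 84672962)]),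
  (27213, 3, [(4, 51126468), (1, 51122376), (2, 84680900)]), (27214, 3, [(4, 51126720),
  (1, 51122880), (2, 84681152)]), (27277, 3, [(4, 51142722), (1, 51155010), (4, 51138690),
  (2, 84697154), (2, 84693122)]), (27278, 3, [(4, 51142848), (1, 51155136), (2, 84697280)]),
  (27380, 3, [(1, 117723330), (2, 117977282), (1, 118501569), (1, 117715266), (1, 117715140)]),
  (27403, 3, [(4, 52166850), (1, 53215425), (2, 85721282)]), (27405, 3, [(2, 52174916),
  (1, 85725252), (2, 102502466), (2, 52170884)]), (27406, 3, [(4, 52175040), (1, 53219520),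
  (2, 85729472)]), (27411, 3, [(4, 118227138), (1, 185336001), (2, 118751426)]),
  (27413, 3, [(2, 118235204), (1, 118755396), (2, 119017538), (2, 118231172)]),
  (27414, 3, [(4, 118235328), (1, 185340096), (2, 118759616)]), (29227, 3, [(2, 51646598),
  (1, 85201029), (2, 101978243), (1, 85201155), (2, 85463171), (2, 85205123), (2, 84689027),
  (2, 51134723), (2, 84689027), (4, 51134595), (1, 51150915), (2, 51134597)]),
  (29229, 3, [(4, 51130374), (1, 51130377), (2, 84684806)]), (29230, 3, [(4, 51130626),
  (1, 51130881), (2, 84685058)]), (29259, 3, [(2, 51646850), (1, 85201218), (2, 101978306),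
  (1, 85201092), (2, 85463234), (2, 85205186), (2, 51658946), (2, 51134786), (2, 84689090),
  (4, 51134658), (1, 51151041), (2, 51134786)]), (29261, 3, [(4, 51130500), (1, 51130440),
  (2, 84684932)]), (29262, 3, [(4, 51130752), (1, 51130944), (2, 84685184)]),
  (29325, 3, [(4, 51146754), (1, 51163137), (2, 84701186)]), (29326, 3, [(4, 51146880),
  (1, 51163200), (2, 84701312)]), (29453, 3, [(4, 52178946), (1, 53227521), (2, 85733378)]),
  (29454, 3, [(4, 52179072), (1, 53227584), (2, 85733504)]), (29461, 3, [(4, 118239234),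
  (1, 185348097), (2, 118763522)]), (29462, 3, [(4, 118239360), (1, 185348160), (2, 118763648)]),
  (168001, 4, [(4, 12423), (1, 12363), (2, 20615), (2, 8267)]), (168002, 4, [(1, 12993),
  (4, 12738), (2, 20930), (2, 8897)]), (200769, 4, [(4, 12486), (1, 12489), (2, 20678),
  (2, 8393)]), (303169, 4, [(4, 786567), (1, 786507), (2, 1310855), (2, 524363)]),
  (303170, 4, [(1, 787137), (4, 786882), (2, 1311170), (2, 524993)]), (303233, 4, [(4, 794631),
  (1, 790539), (2, 1318919), (2, 528395)]), (303234, 4, [(2, 795137), (1, 1315329), (2, 1577345),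
  (4, 1053057), (2, 791042), (2, 529025)]), (303236, 4, [(1, 831489), (4, 815106), (2, 1339394),
  (2, 569345)]), (335937, 4, [(4, 786630), (1, 786633), (2, 1310918), (2, 524489)]),
  (336001, 4, [(2, 794696), (1, 1314888), (2, 1577030), (4, 1052742), (2, 790664), (2, 528458)]),
  (336002, 4, [(4, 795072), (1, 791232), (2, 1319360), (2, 529088)]), (336004, 4, [(1, 831552),
  (4, 815232), (2, 1339520), (2, 569408)]), (401537, 4, [(4, 798726), (1, 798729), (2, 1323014),
  (2, 536585)]), (401538, 4, [(4, 799104), (1, 799296), (2, 1323392), (2, 537152)]),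
  (573505, 4, [(4, 50331783), (1, 50331723), (2, 83886215), (2, 33554507)]),
  (573506, 4, [(1, 50332353), (4, 50332098), (2, 83886530), (2, 33555137)]),
  (573569, 4, [(4, 50339847), (1, 50335755), (2, 83894279), (2, 33558539)]),
  (573570, 4, [(2, 50340353), (1, 83890689), (2, 100667777), (4, 67113345), (2, 50336258),
  (2, 33559169)]), (573572, 4, [(1, 50376705), (4, 50360322), (2, 83914754), (2, 33599489)]),
  (573697, 4, [(4, 50855943), (1, 50593803), (2, 84410375), (2, 33816587)]),
  (573698, 4, [(2, 50856449), (1, 84148737), (2, 100925825), (4, 67371393), (2, 50594306),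
  (2, 33817217)]), (573700, 4, [(2, 50888705), (1, 84180993), (2, 100950017), (4, 67395585),
  (2, 50626562), (2, 33857537)]), (573704, 4, [(1, 53215233), (4, 52166658), (2, 85721090),
  (2, 36438017)]), (606273, 4, [(4, 50331846), (1, 50331849), (2, 83886278), (2, 33554633)]),
  (606337, 4, [(2, 50339912), (1, 83890248), (2, 100667462), (4, 67113030), (2, 50335880),
  (2, 33558602)]), (606338, 4, [(4, 50340288), (1, 50336448), (2, 83894720), (2, 33559232)]),
  (606340, 4, [(1, 50376768), (4, 50360448), (2, 83914880), (2, 33599552)]),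
  (606465, 4, [(2, 50856008), (1, 84148296), (2, 100925510), (4, 67371078), (2, 50593928),
  (2, 33816650)]), (606466, 4, [(4, 50856384), (1, 50594496), (2, 84410816), (2, 33817280)]),
  (606468, 4, [(2, 50888768), (1, 84181056), (2, 100950080), (4, 67395648), (2, 50626688),
  (2, 33857600)]), (606472, 4, [(1, 53215296), (4, 52166784), (2, 85721216), (2, 36438080)]),
  (671873, 4, [(4, 50343942), (1, 50343945), (2, 83898374), (2, 33566729)]),
  (671874, 4, [(4, 50344320), (1, 50344512), (2, 83898752), (2, 33567296)]),
  (672001, 4, [(2, 50860040), (1, 84152328), (2, 100929542), (4, 67375110), (2, 50601992),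
  (2, 33820682)]), (672002, 4, [(2, 50860544), (1, 84152832), (2, 100929920), (4, 67375488),
  (2, 50602496), (2, 33821312)]), (672004, 4, [(4, 50884608), (1, 50638848), (2, 84439040),
  (2, 33861632)]), (672008, 4, [(1, 53219328), (4, 52174848), (2, 85729280), (2, 36442112)]),
  (803073, 4, [(4, 51118086), (1, 51118089), (2, 84672518), (2, 34340873)]),
  (803074, 4, [(4, 51118464), (1, 51118656), (2, 84672896), (2, 34341440)]),
  (803076, 4, [(4, 51142656), (1, 51154944), (2, 84697088), (2, 34377728)])]

/-- Hit equations for single monomials of degree `35`. -/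
noncomputable def monoData : List Cert := [
  (803411, 6, [(1, 790747), (2, 528603), (2, 1319127), (4, 794839), (4, 819535), (8, 803151)]),
  (804419, 6, [(1, 792259), (2, 530115), (2, 1320387), (4, 796099), (4, 820165), (8, 803781)]),
  (901187, 6, [(1, 897091), (2, 634947), (2, 1405059), (4, 848389), (4, 880771), (8, 848133)]),
  (803537, 6, [(1, 791251), (2, 529107), (2, 1319379), (4, 795091), (4, 819661), (8, 803277)]),
  (901313, 6, [(1, 897217), (2, 635073), (2, 1405122), (4, 848452), (4, 880834), (8, 848196)]),
  (807443, 6, [(1, 798811), (2, 536667), (2, 1323159), (4, 798871), (4, 823567), (8, 807183)]),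
  (808451, 6, [(1, 800323), (2, 538179), (2, 1324419), (4, 800131), (4, 824197), (8, 807813)]),
  (807569, 6, [(1, 799315), (2, 537171), (2, 1323411), (4, 799123), (4, 823693), (8, 807309)]),
  (815633, 6, [(1, 815191), (2, 553047), (2, 1339539), (4, 802903), (4, 807061), (4, 807187),
  (4, 831631), (4, 831757), (8, 815247), (8, 815373)]), (816641, 6, [(1, 816577), (2, 554433),
  (2, 1340610), (4, 804289), (4, 808132), (4, 808258), (4, 832324), (4, 832450), (8, 815940),
  (8, 816066)]), (1847825, 6, [(1, 1847383), (2, 1843287), (2, 1855635), (4, 1060951),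
  (4, 1318999), (4, 1323157), (4, 1323283), (4, 2896015), (4, 2896141), (8, 1847439),
  (8, 1847565)]), (1848833, 6, [(1, 1848769), (2, 1844673), (2, 1856706), (4, 1062337),
  (4, 1320385), (4, 1324228), (4, 1324354), (4, 2896708), (4, 2896834), (8, 1848132),
  (8, 1848258)]), (807506, 6, [(1, 798937), (2, 536793), (2, 1323222), (4, 798934), (4, 823630),
  (8, 807246)]), (808514, 6, [(1, 800449), (2, 538305), (2, 1324482), (4, 800194), (4, 824260),
  (8, 807876)]), (807632, 6, [(1, 799441), (2, 537297), (2, 1323474), (4, 799186), (4, 823756),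
  (8, 807372)]), (815696, 6, [(1, 831697), (2, 569553), (2, 1339602), (4, 803029), (4, 807124),
  (4, 807250), (4, 815314), (4, 815377), (4, 831820), (4, 835789), (8, 815436), (8, 819405)]),
  (1847888, 6, [(1, 1855825), (2, 1847634), (2, 1847697), (2, 1859793), (2, 2891985), (4, 1319125),
  (4, 1323346), (4, 1323409), (4, 1335505), (4, 1843537), (4, 1851601), (4, 2896204), (4, 3416269),
  (8, 1847628), (8, 2367693)]), (17310671, 6, [(1, 33821647), (2, 17044179), (2, 17044431),
  (4, 17044303), (4, 17044429), (8, 17044173)]), (18375119, 6, [(1, 18112975), (1, 67916239),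
  (2, 34365903)]), (18375623, 6, [(1, 18371527), (1, 68432839), (2, 35140551)]),
  (18407879, 6, [(1, 18145735), (1, 67948999), (2, 34398663)]), (20472263, 6, [(1, 20210119),
  (1, 70013383), (2, 36463047)]), (50348627, 6, [(1, 50335963), (2, 33558747), (2, 83894487),
  (4, 50340055), (4, 50364751), (8, 50348367)]), (50349635, 6, [(1, 50337475), (2, 33560259),
  (2, 83895747), (4, 50341315), (4, 50365381), (8, 50348997)]), (50446403, 6, [(1, 50442307),
  (2, 33665091), (2, 83980419), (4, 50393605), (4, 50425987), (8, 50393349)]),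
  (51380819, 6, [(1, 50594011), (2, 33816795), (2, 84410583), (4, 50856151), (4, 52429135),
  (8, 51380559)]), (51381827, 6, [(1, 50595523), (2, 33818307), (2, 84411843), (4, 50857411),
  (4, 52429765), (8, 51381189)]), (51413075, 6, [(1, 50602075), (2, 33824859), (2, 84156567),
  (2, 84418647), (4, 50602135), (4, 50610703), (4, 50864215), (4, 52445263), (8, 50610447),
  (8, 51396687)]), (51414083, 6, [(1, 50692291), (2, 33915075), (2, 84492483), (4, 50905417),
  (4, 50938051), (4, 52478149), (4, 52478275), (8, 50905413), (8, 51413193), (8, 51413571),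
  (8, 51429573), (8, 51429699)]), (51478595, 6, [(1, 84222025), (1, 84246595), (2, 33923139),
  (2, 50667594), (2, 50667657), (2, 50692227), (2, 50929737), (2, 50954307), (2, 101015619),
  (4, 67461187), (4, 168091717), (8, 100982853)]), (51413579, 6, [(1, 84181579), (2, 50627211),
  (2, 50889291), (2, 100934727), (4, 168051271), (8, 100942407)]), (57671747, 6, [(1, 57409603),
  (2, 40632387), (2, 89915523), (4, 54264325), (4, 56361091), (8, 54264069)]),
  (50348753, 6, [(1, 50336467), (2, 33559251), (2, 83894739), (4, 50340307), (4, 50364877),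
  (8, 50348493)]), (50446529, 6, [(1, 50442433), (2, 33665217), (2, 83980482), (4, 50393668),
  (4, 50426050), (8, 50393412)]), (51380945, 6, [(1, 50594515), (2, 33817299), (2, 84410835),
  (4, 50856403), (4, 52429261), (8, 51380685)]), (51413201, 6, [(1, 84157009), (1, 84181201),
  (2, 33824985), (2, 50602578), (2, 50602641), (2, 50626770), (2, 50864721), (2, 50888913),
  (2, 168042705), (4, 67379413), (4, 100933969), (4, 100942033), (4, 201597133), (8, 134488269)]),
  (51414209, 6, [(1, 50603713), (2, 33826497), (2, 84157890), (2, 84420033), (4, 50603458),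
  (4, 50611144), (4, 50865601), (4, 51397825), (4, 51413953), (8, 50611140), (8, 51397569)]),
  (51478721, 6, [(1, 84190273), (1, 84246721), (2, 33923265), (2, 50635842), (2, 50635905),
  (2, 50692290), (2, 50897985), (2, 50954433), (2, 101015745), (4, 67461313), (4, 168091969),
  (8, 100966977), (8, 100983105)]), (51413705, 6, [(1, 84181705), (2, 50627274), (2, 50889417),
  (2, 100934097), (4, 168051145), (8, 100942281)]), (57671873, 6, [(1, 57409729), (2, 40632513),
  (2, 89915586), (4, 54264388), (4, 56361154), (8, 54264132)]), (17330957, 6, [(1, 33870157),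
  (2, 17092941), (2, 17330829), (2, 17346957), (2, 17871054), (2, 17883339), (2, 18903435),
  (4, 17330386), (4, 17346766), (4, 17359051), (4, 17375431), (4, 17854861)]),
  (18362897, 6, [(1, 34902097), (2, 18124881), (2, 18358359), (2, 18362454), (2, 18374739),
  (2, 19411089), (4, 17834071), (4, 17838166), (4, 17838229), (4, 17850451), (4, 18362641),
  (4, 18370705), (4, 19415119), (4, 19419214), (4, 19423309), (4, 19935373), (8, 18366543),
  (8, 18370638), (8, 18374733), (8, 18886797)]), (18363905, 6, [(1, 34903105), (2, 18359745),
  (2, 18363777), (2, 18375873), (2, 19412034), (4, 17601601), (4, 17835457), (4, 17839426),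
  (4, 17839489), (4, 17851585), (4, 18363460), (4, 18371650), (4, 19416001), (4, 19420033),
  (4, 19424065), (4, 19936066), (8, 18367425), (8, 18371457), (8, 18375489), (8, 18887490)]),
  (17314703, 6, [(1, 33829711), (2, 17060307), (2, 17060559), (4, 17052115), (4, 17052367),
  (4, 17052493), (8, 17052237)]), (17330831, 6, [(1, 33845839), (1, 33853903), (2, 17068497),
  (2, 17068623), (2, 17076687), (4, 17326543)]), (17363087, 6, [(1, 33878095), (2, 17084499),
  (2, 17100879), (4, 17092687), (4, 17100877), (8, 17084493)]), (18379151, 6, [(1, 18117007),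
  (1, 67924303), (2, 34369935)]), (18379655, 6, [(1, 18117511), (1, 67924807), (2, 34370439)]),
  (18411911, 6, [(1, 18149767), (1, 67957063), (2, 34402695)]), (20476295, 6, [(1, 20476231),
  (1, 70545607), (2, 37253319)]), (50352659, 6, [(1, 50344027), (2, 33566811), (2, 83898519),
  (4, 50344087), (4, 50368783), (8, 50352399)]), (50353667, 6, [(1, 50345539), (2, 33568323),
  (2, 83899779), (4, 50345347), (4, 50369413), (8, 50353029)]), (51384851, 6, [(1, 50598043),
  (2, 33820827), (2, 84156567), (2, 84414615), (4, 50602135), (4, 50626831), (4, 50860183),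
  (4, 52433167), (8, 50610447), (8, 51384591)]), (51385859, 6, [(1, 50599555), (2, 33822339),
  (2, 84157827), (2, 84415875), (4, 50603395), (4, 50627461), (4, 50861443), (4, 52433797),
  (8, 50611077), (8, 51385221)]), (51417107, 6, [(1, 50606107), (2, 33828891), (2, 84422679),
  (4, 50868247), (4, 52449295), (8, 51400719)]), (51418115, 6, [(1, 50607619), (2, 33830403),
  (2, 84423939), (4, 50869507), (4, 50893573), (4, 52441861), (4, 52450051), (8, 50877189),
  (8, 51393285), (8, 51401475)]), (51482627, 6, [(1, 50704387), (2, 33927171), (2, 84504579),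
  (4, 50950147), (4, 52490245), (8, 51441669)]), (51417611, 6, [(1, 84169735), (2, 50619399),
  (2, 50877447), (2, 100938759), (4, 52449799), (8, 51401223)]), (57675779, 6, [(1, 57413635),
  (2, 40636419), (2, 89923587), (4, 54296581), (4, 56369155), (8, 54280197)]),
  (50352785, 6, [(1, 50344531), (2, 33567315), (2, 83898771), (4, 50344339), (4, 50368909),
  (8, 50352525)]), (51384977, 6, [(1, 50598547), (2, 33821331), (2, 84156819), (2, 84414867),
  (4, 50602387), (4, 50626957), (4, 50860435), (4, 52433293), (8, 50610573), (8, 51384717)]),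
  (51417233, 6, [(1, 51417169), (1, 84181075), (1, 84189265), (2, 33857619), (2, 50626707),
  (2, 50634834), (2, 50634897), (2, 50888787), (2, 50896977), (2, 100950099), (4, 67395667),
  (4, 168058957), (8, 100950093)]), (51418241, 6, [(1, 50607745), (2, 33830529), (2, 84161922),
  (2, 84424065), (4, 50607490), (4, 50615176), (4, 50869633), (4, 52450177), (8, 50615172),
  (8, 51401601)]), (51482753, 6, [(1, 84226561), (1, 84250753), (2, 33927297), (2, 50672130),
  (2, 50696322), (2, 50700417), (2, 50934273), (2, 50958465), (2, 101019777), (4, 67465345),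
  (4, 168096001), (8, 100987137)]), (51417737, 6, [(1, 84185737), (2, 50631306), (2, 50635401),
  (2, 50893449), (2, 100938129), (4, 168055177), (8, 100946313)]), (57675905, 6, [(1, 57413761),
  (2, 40636545), (2, 89919618), (2, 89923713), (4, 54268168), (4, 54296833), (4, 56365186),
  (4, 56369281), (8, 54268164), (8, 54280449)]), (50360849, 6, [(1, 50360407), (2, 33583191),
  (2, 83914899), (4, 50348119), (4, 50352277), (4, 50352403), (4, 50376847), (4, 50376973),
  (8, 50360463), (8, 50360589)]), (50361857, 6, [(1, 50361793), (2, 33584577), (2, 83915970),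
  (4, 50349505), (4, 50353348), (4, 50353474), (4, 50377540), (4, 50377666), (8, 50361156),
  (8, 50361282)]), (51393041, 6, [(1, 50602075), (1, 67383385), (1, 84181075), (1, 84189265),
  (1, 84430933), (1, 84947029), (2, 33824859), (2, 33828954), (2, 33829017), (2, 33857619),
  (2, 50626707), (2, 50634834), (2, 50634897), (2, 50868312), (2, 50868753), (2, 50888787),
  (2, 84156567), (2, 84418647), (2, 84422742), (2, 84422805), (2, 100950099), (2, 101199957),
  (4, 50602135), (4, 50610703), (4, 50864215), (4, 52445263), (4, 67395667), (4, 67645525),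
  (4, 84435025), (4, 84451405), (4, 151531789), (4, 168058957), (8, 50610447), (8, 51396687),
  (8, 84422925), (8, 84435021), (8, 100950093)]), (51394049, 6, [(1, 50603713), (1, 50606800),
  (1, 50607682), (1, 50615620), (1, 52442305), (2, 33826497), (2, 33829584), (2, 33830466),
  (2, 35665089), (2, 84157890), (2, 84161922), (2, 84420033), (2, 84423120), (2, 84424002),
  (2, 84948162), (4, 50603458), (4, 50607490), (4, 50611144), (4, 50635588), (4, 50865601),
  (4, 50868688), (4, 50869570), (4, 51393730), (4, 51393793), (4, 51413953), (4, 52449736),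
  (4, 52449988), (8, 50611140), (8, 50619204), (8, 51397569), (8, 51401160), (8, 51401412)]),
  (51425297, 6, [(1, 50638867), (2, 33861651), (2, 84439059), (4, 50884627), (4, 52457485),
  (8, 51408909)]), (51426305, 6, [(1, 84186241), (1, 84194305), (2, 33862785), (2, 50631810),
  (2, 50635905), (2, 50639874), (2, 50893953), (2, 50902017), (2, 100955265), (4, 67400833),
  (4, 168063745), (8, 100954881)]), (51425801, 6, [(1, 50639875), (2, 84440067), (4, 50885635),
  (4, 52457989), (8, 51409413)]), (57683969, 6, [(1, 57421825), (2, 40644609), (2, 89927682),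
  (4, 54300676), (4, 56373250), (8, 54284292)]), (117453329, 6, [(1, 117452887), (2, 117448791),
  (2, 117461139), (4, 67121239), (4, 83894359), (4, 83898517), (4, 83898643), (4, 184561807),
  (4, 184561933), (8, 117452943), (8, 117453069)]), (117454337, 6, [(1, 117454273), (2, 117450177),
  (2, 117462210), (4, 67122625), (4, 83895745), (4, 83899588), (4, 83899714), (4, 184562500),
  (4, 184562626), (8, 117453636), (8, 117453762)]), (17331020, 6, [(1, 33870661), (2, 17331018),
  (2, 17347398), (2, 17871747), (2, 17883843), (2, 18903750), (4, 17331331), (4, 17347459),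
  (4, 17359555), (4, 17375683), (4, 17855302), (16, 17068483)]), (18362960, 6, [(1, 34885969),
  (2, 17584530), (2, 17588562), (2, 17588625), (2, 18108753), (2, 18362706), (2, 18362769),
  (2, 18374865), (2, 19407057), (4, 17584780), (4, 17604940), (4, 17834197), (4, 17838418),
  (4, 17838481), (4, 17850577), (4, 18358609), (4, 18366673), (4, 19411276), (4, 19931341),
  (8, 17584524), (8, 17588556), (8, 18362700), (8, 18882765)]), (17314766, 6, [(1, 33829837),
  (2, 17060307), (2, 17060811), (4, 17052115), (4, 17052619), (8, 17052237), (8, 17052363)]),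
  (17363150, 6, [(1, 33870031), (1, 33878221), (2, 17084751), (2, 17101131), (4, 17084623),
  (4, 17092813), (4, 17101003), (8, 17084619)]), (17331146, 6, [(1, 33846217), (1, 33854407),
  (2, 17069001), (2, 17069127), (2, 17077191), (4, 17327047)]), (17363402, 6, [(1, 33878473),
  (1, 33878599), (2, 17101257), (2, 17101383), (2, 17109447), (4, 17363335)]),
  (17363906, 6, [(1, 33878977), (2, 17085633), (2, 17101761), (4, 17093569), (4, 17101633),
  (8, 17085249)]), (18379214, 6, [(1, 18117070), (1, 67924429), (2, 34369998)]),
  (18379718, 6, [(1, 18117574), (1, 67924933), (2, 34370502)]), (18411974, 6, [(1, 18149830),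
  (1, 67957189), (2, 34402758)]), (20476358, 6, [(1, 20214214), (1, 70021573), (2, 36467142)]),
  (50352722, 6, [(1, 50344153), (2, 33566937), (2, 83898582), (4, 50344150), (4, 50368846),
  (8, 50352462)]), (50353730, 6, [(1, 50345665), (2, 33568449), (2, 83899842), (4, 50345410),
  (4, 50369476), (8, 50353092)]), (51384914, 6, [(1, 50598106), (2, 33820890), (2, 84156630),
  (2, 84414678), (4, 50602198), (4, 50626894), (4, 50860246), (4, 52433230), (8, 50610510),
  (8, 51384654)]), (51385922, 6, [(1, 50599618), (2, 33822402), (2, 84157890), (2, 84415938),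
  (4, 50603458), (4, 50627524), (4, 50861506), (4, 52433860), (8, 50611140), (8, 51385284)]),
  (51417170, 6, [(1, 50606170), (2, 33828954), (2, 84160662), (2, 84422742), (4, 50606230),
  (4, 50630926), (4, 50868310), (4, 52449358), (8, 50614542), (8, 51400782)]),
  (51418178, 6, [(1, 50607682), (1, 50615620), (2, 33830466), (2, 84161922), (2, 84424002),
  (4, 50607490), (4, 50635588), (4, 50869570), (4, 52441924), (4, 52450114), (8, 50619204),
  (8, 51393348), (8, 51401538)]), (51482690, 6, [(1, 50704450), (2, 33927234), (2, 84242562),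
  (2, 84504642), (4, 50655748), (4, 50688130), (4, 50950210), (4, 52490308), (8, 50655492),
  (8, 51441732)]), (51417674, 6, [(1, 84185674), (2, 50631306), (2, 50635338), (2, 50893386),
  (2, 100938822), (4, 168055366), (8, 100946502)]), (57675842, 6, [(1, 57413698), (2, 40636482),
  (2, 89919618), (2, 89923650), (4, 54268420), (4, 54296644), (4, 56365186), (4, 56369218),
  (8, 54268164), (8, 54280260)]), (50352848, 6, [(1, 50344657), (2, 33567441), (2, 83898834),
  (4, 50344402), (4, 50368972), (8, 50352588)]), (51385040, 6, [(1, 50598610), (2, 33821394),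
  (2, 84156882), (2, 84414930), (4, 50602450), (4, 50627020), (4, 50860498), (4, 52433356),
  (8, 50610636), (8, 51384780)]), (51417296, 6, [(1, 50606296), (2, 33829080), (2, 84422868),
  (4, 50868436), (4, 50893132), (4, 52441420), (4, 52449484), (8, 50876748), (8, 51392844),
  (8, 51400908)]), (51418304, 6, [(1, 50607808), (2, 33830592), (2, 84424128), (4, 50869696),
  (4, 52450240), (8, 51401664)]), (51482816, 6, [(1, 50704576), (2, 33927360), (2, 84504768),
  (4, 50950336), (4, 52490560), (8, 51441984)]), (51417800, 6, [(1, 50606800), (2, 84423120),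
  (4, 50868688), (4, 52449736), (8, 51401160)]), (57675968, 6, [(1, 57413824), (2, 40636608),
  (2, 89923776), (4, 54296896), (4, 56369344), (8, 54280512)]), (50360912, 6, [(1, 50376913),
  (2, 33599697), (2, 83914962), (4, 50348245), (4, 50352340), (4, 50352466), (4, 50360530),
  (4, 50360593), (4, 50377036), (4, 50381005), (8, 50360652), (8, 50364621)]),
  (51393104, 6, [(1, 84157009), (1, 84169042), (1, 84169105), (1, 84947281), (1, 100946257),
  (1, 134492497), (2, 33824985), (2, 33829458), (2, 33829521), (2, 33857745), (2, 50602578),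
  (2, 50602641), (2, 50618706), (2, 50618769), (2, 50864721), (2, 50868753), (2, 50868816),
  (2, 84422994), (2, 84423057), (2, 100950225), (2, 101200209), (2, 168042705), (4, 50618956),
  (4, 67379413), (4, 67383634), (4, 67383697), (4, 67395793), (4, 84422992), (4, 84423244),
  (4, 100933969), (4, 100942033), (4, 201597133), (8, 50618700), (8, 84422988), (8, 134488269)]),
  (51425360, 6, [(1, 50638930), (2, 33861714), (2, 84177042), (2, 84439122), (4, 50622610),
  (4, 50622988), (4, 50884690), (4, 52457548), (8, 50622732), (8, 51408972)]),
  (51426368, 6, [(1, 50640064), (2, 33862848), (2, 84440256), (4, 50885824), (4, 52458304),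
  (8, 51409728)]), (51425864, 6, [(1, 50639056), (2, 84439248), (4, 50884816), (4, 52457800),
  (8, 51409224)]), (57684032, 6, [(1, 57421888), (2, 40644672), (2, 89927808), (4, 54300928),
  (4, 56373376), (8, 54284544)]), (117453392, 6, [(1, 117461329), (2, 117453138), (2, 117453201),
  (2, 117465297), (2, 184557777), (4, 83894485), (4, 83898706), (4, 83898769), (4, 83910865),
  (4, 117449041), (4, 117457105), (4, 184561996), (4, 218112205), (8, 117453132), (8, 151003341)]),
  (17589005, 6, [(1, 34353367), (1, 34361683), (1, 34877653), (2, 17576151), (2, 17584467),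
  (2, 18100437), (2, 18113163), (4, 17576149), (4, 17576527), (4, 17600719), (4, 17605003),
  (4, 19149007), (4, 19411150), (8, 17576271), (8, 17584335), (8, 17588619), (8, 18100431),
  (8, 18362574)]), (18621197, 6, [(1, 18620629), (1, 18620755), (1, 18628819), (1, 19144915),
  (1, 68948179), (2, 18629259), (2, 35397843), (4, 18358483), (4, 19669198), (4, 19669387),
  (8, 18620622), (8, 18620811)]), (18653453, 6, [(1, 19681549), (1, 137113675), (2, 36458763),
  (2, 36459015), (2, 36475143), (2, 137638023), (4, 18632974), (4, 18637069), (4, 36983047),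
  (4, 70013191), (4, 137113735)]), (18653957, 6, [(1, 18633481), (1, 18649861), (1, 137114179),
  (2, 36458889), (2, 36459141), (2, 36475269), (2, 137638275), (4, 35410693), (4, 36983173),
  (4, 70013317), (4, 137113987)]), (17572751, 6, [(1, 34345807), (2, 18092499), (2, 18092751),
  (4, 17568211), (4, 17568463), (4, 17568589), (8, 17568333)]), (17588879, 6, [(1, 34361935),
  (2, 18100563), (2, 18100815), (4, 17576275), (4, 17576527), (4, 17600845), (8, 17584461)]),
  (17621135, 6, [(1, 34394191), (2, 18116691), (2, 18133071), (4, 17592403), (4, 17608783),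
  (4, 17616973), (8, 17600589)]), (17589131, 6, [(1, 34378189), (1, 34378567), (2, 18125259),
  (2, 18125511), (4, 17584717), (4, 17584969), (4, 17588686), (4, 17589127), (4, 17600971),
  (4, 17601223), (8, 17584713)]), (17621387, 6, [(1, 34370125), (1, 34394695), (2, 18117195),
  (2, 18133575), (4, 17592907), (4, 17600845), (4, 17609287), (4, 17617225), (4, 17621383),
  (8, 17600841)]), (17621891, 6, [(1, 34370377), (1, 34394821), (1, 34394947), (2, 18117321),
  (2, 18117699), (2, 18133701), (2, 18133827), (4, 17593033), (4, 17593411), (4, 17601349),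
  (4, 17609413), (4, 17609539)]), (18621071, 6, [(1, 35394127), (1, 35918287), (2, 18616785),
  (2, 18616911), (2, 19141071), (4, 18358735)]), (18653327, 6, [(1, 35426383), (1, 35942479),
  (2, 18640977), (2, 18649167), (2, 19165263), (4, 18378895)]), (20717711, 6, [(1, 37490767),
  (2, 19664979), (2, 20713551), (4, 20189263), (4, 20713549), (8, 19664973)]),
  (18637199, 6, [(1, 18633103), (1, 68956495), (2, 35402127)]), (18637703, 6, [(1, 18637639),
  (1, 68965063), (2, 35414727)]), (18669959, 6, [(1, 18665863), (1, 68989255), (2, 35434887)]),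
  (20734343, 6, [(1, 20734279), (1, 71061703), (2, 37511367)]), (51642899, 6, [(1, 51118171),
  (2, 34340955), (2, 84672663), (4, 51118231), (4, 52691215), (8, 51642639)]),
  (51643907, 6, [(1, 51119683), (2, 34342467), (2, 84673923), (4, 51119491), (4, 52691845),
  (8, 51643269)]), (51675155, 6, [(1, 51122203), (2, 34344987), (2, 84680727), (4, 51126295),
  (4, 52707343), (8, 51658767)]), (51676163, 6, [(1, 51123715), (2, 34346499), (2, 84681987),
  (4, 51127555), (4, 51151621), (4, 52699909), (4, 52708099), (8, 51135237), (8, 51651333),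
  (8, 51659523)]), (51740675, 6, [(1, 51220483), (2, 34443267), (2, 84762627), (4, 51208195),
  (4, 52748293), (8, 51699717)]), (51675659, 6, [(1, 85201927), (2, 51651591), (2, 51909639),
  (2, 101454855), (4, 52707847), (8, 51659271)]), (51643025, 6, [(1, 51118675), (2, 34341459),
  (2, 84672915), (4, 51118483), (4, 52691341), (8, 51642765)]), (51675281, 6, [(1, 51122329),
  (2, 34345113), (2, 84676758), (2, 84680853), (4, 51122326), (4, 51126421), (4, 51151117),
  (4, 51646738), (4, 51646990), (4, 52699405), (4, 52707469), (8, 51134733), (8, 51646734),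
  (8, 51650829), (8, 51658893)]), (51676289, 6, [(1, 51123841), (2, 34346625), (2, 51123588),
  (2, 51123714), (2, 51647874), (2, 84682113), (4, 51123586), (4, 51127681), (4, 51647368),
  (4, 51647620), (4, 52708225), (8, 51647364), (8, 51659649)]), (51740801, 6, [(1, 51740737),
  (1, 84770881), (1, 85286977), (2, 34447425), (2, 51208260), (2, 51208449), (2, 51994689),
  (2, 84762690), (2, 84762753), (2, 101539905), (4, 51470401), (4, 52748356), (4, 52748545),
  (4, 67985473), (8, 51699780), (8, 51699969)]), (51675785, 6, [(1, 51675721), (1, 52756675),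
  (2, 85524675), (4, 51970243), (4, 52986181), (8, 51937605)]), (50619149, 6, [(1, 50868439),
  (1, 50868565), (1, 50876629), (1, 50876755), (2, 50606295), (2, 50606421), (2, 50614485),
  (2, 50614611), (2, 50619021), (2, 50619147), (4, 50606293), (4, 50606671), (4, 50606734),
  (4, 50630863), (4, 50634958), (4, 50635147), (4, 151269583), (8, 50606415), (8, 50606478),
  (8, 50614479), (8, 50618574), (8, 50618763), (8, 84160719)]), (51683345, 6, [(1, 51154963),
  (2, 34377747), (2, 84697107), (4, 51142675), (4, 52715533), (8, 51666957)]),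
  (51684353, 6, [(1, 51155152), (1, 51676225), (1, 84706369), (1, 85222465), (2, 34377936),
  (2, 34382913), (2, 51143748), (2, 51160065), (2, 51930177), (2, 84697296), (2, 84698178),
  (2, 84698241), (2, 101475393), (4, 51142864), (4, 51405889), (4, 52715848), (4, 52716100),
  (4, 67920961), (4, 151806721), (8, 51667272), (8, 51667524), (8, 84697857)]),
  (51683849, 6, [(1, 51155971), (2, 84698115), (4, 51143683), (4, 52716037), (8, 51667461)]),
  (51651341, 6, [(1, 51122707), (1, 51123211), (1, 51126487), (1, 51134803), (1, 51908821),
  (1, 101454163), (2, 51122391), (2, 51126675), (2, 51135117), (2, 51135243), (2, 51646677),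
  (2, 51659403), (2, 84676947), (4, 51122389), (4, 51122767), (4, 51126673), (4, 51127051),
  (4, 52695247), (4, 52699342), (4, 52699531), (4, 151785679), (8, 51122511), (8, 51126669),
  (8, 51646671), (8, 51650766), (8, 51650955), (8, 84676815)]), (51683597, 6, [(1, 51130456),
  (1, 51130519), (1, 51130645), (1, 51925075), (1, 101462101), (2, 51130455), (2, 51130518),
  (2, 51662931), (2, 84684885), (2, 86270091), (4, 51130453), (4, 51155023), (4, 51155086),
  (4, 51667213), (4, 51683467), (4, 52703311), (4, 52703374), (4, 151793743), (8, 51138639),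
  (8, 51138702), (8, 51654735), (8, 51654798), (8, 51667083), (8, 84684879)]),
  (51684101, 6, [(1, 51131653), (1, 51131779), (1, 51926083), (1, 101463109), (2, 51131526),
  (2, 51131715), (2, 51663939), (2, 84685578), (2, 84685893), (2, 86270595), (4, 51131020),
  (4, 51131209), (4, 51155590), (4, 51155779), (4, 51667717), (4, 51683971), (4, 52703878),
  (4, 52704067), (4, 151794499), (8, 51131016), (8, 51131205), (8, 51139206), (8, 51139395),
  (8, 51655302), (8, 51655491), (8, 51667587), (8, 84685635)]), (117711629, 6, [(1, 117711061),
  (1, 117711187), (1, 117719251), (1, 118493395), (2, 117719691), (2, 117973203), (4, 84418771),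
  (4, 184819918), (4, 184820107), (8, 117711054), (8, 117711243)]), (117743885, 6, [(1, 117723661),
  (1, 117739789), (1, 186658891), (2, 117985803), (2, 118001931), (2, 118002183), (2, 220213383),
  (4, 119558407), (4, 185618695), (4, 186658951), (8, 118509831)]), (117744389, 6, [(1, 117723913),
  (1, 117740293), (1, 186659395), (2, 117985929), (2, 118002057), (2, 118002309), (2, 220213635),
  (4, 119558533), (4, 185618821), (4, 186659203), (8, 118509957)]), (50602895, 6, [(1, 50860879),
  (2, 84152787), (2, 84153039), (4, 50598355), (4, 50598607), (4, 50598733), (8, 50598477)]),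
  (50619023, 6, [(1, 50877007), (2, 84160851), (2, 84161103), (4, 50606419), (4, 50606671),
  (4, 50630989), (8, 50614605)]), (50651279, 6, [(1, 50909263), (2, 84176979), (2, 84193359),
  (4, 50622547), (4, 50638927), (4, 50647117), (8, 50630733)]), (50619275, 6, [(1, 50893261),
  (1, 50893639), (2, 84185547), (2, 84185799), (4, 50614861), (4, 50615113), (4, 50618830),
  (4, 50619271), (4, 50631115), (4, 50631367), (8, 50614857)]), (50651531, 6, [(1, 50885197),
  (1, 50909767), (2, 84177483), (2, 84193863), (4, 50623051), (4, 50630989), (4, 50639431),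
  (4, 50647369), (4, 50651527), (8, 50630985)]), (50652035, 6, [(1, 50885449), (1, 50909893),
  (1, 50910019), (2, 84177609), (2, 84177987), (2, 84193989), (2, 84194115), (4, 50623177),
  (4, 50623555), (4, 50631493), (4, 50639557), (4, 50639683)]), (51651215, 6, [(1, 51909199),
  (2, 84676947), (2, 84677199), (4, 51122515), (4, 51122767), (4, 52695373), (8, 51646797)]),
  (51683471, 6, [(1, 51941455), (2, 84693075), (2, 84709455), (4, 51138643), (4, 51155023),
  (4, 52711501), (8, 51662925)]), (53747855, 6, [(1, 54005839), (2, 85725267), (2, 86773839),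
  (4, 52170835), (4, 53219407), (4, 53743693), (8, 52695117)]), (51651467, 6, [(1, 52957645),
  (1, 52958023), (2, 86249931), (2, 86250183), (4, 51647053), (4, 51647305), (4, 51651022),
  (4, 51651463), (4, 52695499), (4, 52695751), (8, 51647049)]), (51683723, 6, [(1, 51941581),
  (1, 101486923), (2, 51159435), (2, 51187911), (2, 51679437), (2, 84709707), (4, 51155149),
  (4, 51155527), (4, 52728007), (4, 151818439), (8, 51155145), (8, 51155271), (8, 51679431),
  (8, 84709575)]), (51684227, 6, [(1, 51941833), (1, 51942085), (1, 51942211), (2, 84694083),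
  (2, 84709833), (2, 84710085), (2, 84710211), (4, 51139651), (4, 51155401), (4, 51155653),
  (4, 51155779), (4, 52712005), (8, 51663429)]), (53748107, 6, [(1, 54006343), (2, 85725771),
  (2, 86774343), (4, 52171339), (4, 52695373), (4, 53219911), (4, 53743945), (4, 53748103),
  (8, 52695369)]), (53748611, 6, [(1, 169611973), (1, 169612099), (2, 52175562), (2, 53224134),
  (2, 53224323), (2, 152834757), (2, 152834883), (2, 153359043), (4, 85729990), (4, 85730179)]),
  (51667595, 6, [(1, 51917389), (1, 101470795), (2, 51131463), (2, 51143307), (2, 51655245),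
  (2, 84693579), (4, 51130957), (4, 51155527), (4, 52703815), (4, 151794247), (8, 51130953),
  (8, 51139143), (8, 51655239), (8, 84685383)]), (51699851, 6, [(1, 52981837), (1, 53006407),
  (2, 86274123), (2, 86290503), (4, 51671182), (4, 51679309), (4, 51695689), (4, 51699847),
  (4, 52719691), (4, 52736071), (8, 51679305)]), (51700355, 6, [(1, 51933769), (1, 51950149),
  (1, 51958339), (2, 84701769), (2, 84718149), (2, 84726339), (2, 84742467), (4, 51147337),
  (4, 51163717), (4, 51171907), (4, 51188035), (4, 52728133), (8, 51679557)]),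
  (53764235, 6, [(1, 54038599), (2, 85758027), (2, 86806599), (4, 52203595), (4, 52711501),
  (4, 53252167), (4, 53760073), (4, 53764231), (8, 52711497)]), (53764739, 6, [(1, 169620037),
  (1, 169628227), (2, 52179594), (2, 52208259), (2, 53228166), (2, 53240451), (2, 152842821),
  (2, 152851011), (2, 153367107), (4, 85734022), (4, 85746307)]), (53796995, 6, [(1, 169652293),
  (1, 169660483), (2, 52211850), (2, 53260422), (2, 53272707), (2, 152875077), (2, 152883267),
  (2, 153399363), (4, 85766278), (4, 85778563)]), (51667847, 6, [(1, 51667405), (1, 51667783),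
  (1, 51691975), (1, 53498311), (1, 118247884), (1, 118248199), (1, 118776265), (1, 118776391),
  (1, 118784455), (1, 119558599), (2, 51929547), (2, 51929799), (2, 51945927), (2, 52978119),
  (2, 118251978), (2, 118252167), (2, 119038407), (4, 85483975)]), (51700103, 6, [(1, 51671437),
  (1, 51671815), (1, 51696007), (1, 53506375), (1, 118255948), (1, 118276423), (1, 118780297),
  (1, 118780423), (1, 118788487), (1, 119566663), (2, 51933579), (2, 51933831), (2, 51949959),
  (2, 52982151), (2, 118256010), (2, 118268295), (2, 119042439), (4, 85488007)]),
  (53764487, 6, [(1, 152850823), (1, 203174215), (2, 52191627), (2, 52191879), (2, 52208007),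
  (2, 53240199), (2, 169619847), (4, 85746055)]), (117711503, 6, [(1, 117711439), (1, 117719503),
  (1, 118493647), (2, 117973455), (4, 84419023)]), (117743759, 6, [(1, 117731599), (1, 117739663),
  (1, 118517839), (2, 117993615), (4, 84439183)]), (119808143, 6, [(1, 119279887), (1, 119291983),
  (2, 119283855), (4, 85729423)]), (251928719, 6, [(1, 252186703), (2, 184815699), (2, 251924559),
  (4, 218370127), (4, 251924557), (8, 184815693)]), (117727631, 6, [(1, 117723535), (1, 118501711),
  (2, 117977487)]), (117728135, 6, [(1, 117724039), (1, 118502215), (2, 117977991)]),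
  (117760391, 6, [(1, 117760327), (1, 118542535), (2, 118022343)]), (251945351, 6, [(1, 251941255),
  (1, 252719431), (2, 252195207)]), (51135245, 6, [(1, 51122770), (1, 51151435), (1, 85201549),
  (1, 85201675), (2, 51122958), (2, 51135117), (2, 51135243), (2, 85205643), (2, 85463691),
  (2, 101978763), (4, 51122830), (4, 51126610), (4, 51135115)]), (51167501, 6, [(1, 51155026),
  (1, 51183691), (1, 85233805), (1, 85233931), (2, 51155214), (2, 51167373), (2, 51167499),
  (2, 85237899), (2, 85495947), (2, 102011019), (4, 51142738), (4, 51155086), (4, 51167371)]),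
  (51168005, 6, [(1, 51155152), (1, 51155530), (1, 51183817), (1, 51184195), (1, 85234309),
  (1, 85234435), (2, 51155718), (2, 51167877), (2, 51168003), (2, 84713676), (2, 84713802),
  (2, 84721866), (2, 85238403), (2, 85496451), (2, 102011523), (4, 51155590), (4, 51159244),
  (4, 51159370), (4, 51167434), (4, 51167875)]), (52167185, 6, [(1, 52166743), (2, 35389527),
  (2, 85721235), (4, 51380311), (4, 51642517), (4, 51642643), (4, 53215375), (4, 53215501),
  (8, 52166799), (8, 52166925)]), (52168193, 6, [(1, 52168129), (2, 35390913), (2, 85722306),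
  (4, 51381697), (4, 51643588), (4, 51643714), (4, 53216068), (4, 53216194), (8, 52167492),
  (8, 52167618)]), (52199441, 6, [(1, 52170775), (2, 35393559), (2, 85729299), (4, 51384343),
  (4, 51650581), (4, 51658771), (4, 53223439), (4, 53231629), (8, 52174863), (8, 52183053)]),
  (52200449, 6, [(1, 53220481), (2, 36443265), (2, 85726338), (2, 85730433), (4, 51385729),
  (4, 51647620), (4, 51647746), (4, 51651841), (4, 51659905), (4, 52171906), (4, 52176001),
  (4, 53220100), (4, 53232385), (4, 53482369), (8, 52171524), (8, 52183809), (8, 52433793)]),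
  (52264961, 6, [(1, 52260865), (2, 35483649), (2, 85798914), (4, 51474433), (4, 51720196),
  (4, 51728386), (4, 53268484), (4, 53276674), (8, 52219908), (8, 52228098)]),
  (52199945, 6, [(1, 53280835), (2, 85786755), (4, 52232323), (4, 53248261), (8, 52199685)]),
  (118227473, 6, [(1, 118227031), (2, 117964887), (2, 118751379), (4, 67895383), (4, 84410455),
  (4, 84672661), (4, 84672787), (4, 185335951), (4, 185336077), (8, 118227087), (8, 118227213)]),
  (118228481, 6, [(1, 118228417), (2, 117966273), (2, 118752450), (4, 67896769), (4, 84411841),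
  (4, 84673732), (4, 84673858), (4, 185336644), (4, 185336770), (8, 118227780), (8, 118227906)]),
  (118259729, 6, [(1, 118231063), (2, 117968919), (2, 118759443), (4, 67899415), (4, 84414487),
  (4, 84680725), (4, 84688915), (4, 185344015), (4, 185352205), (8, 118235151), (8, 118243341)]),
  (118260737, 6, [(1, 118756609), (2, 117970305), (2, 118232322), (2, 118236417), (2, 119018625),
  (4, 84415873), (4, 84677890), (4, 84681985), (4, 85464193), (4, 185340676), (4, 185352961),
  (4, 185602945), (8, 118231812), (8, 118244097), (8, 118494081)]), (118325249, 6, [(1, 118321153),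
  (2, 118059009), (2, 118829058), (4, 67989505), (4, 84504577), (4, 84750340), (4, 84758530),
  (4, 185389060), (4, 185397250), (8, 118280196), (8, 118288386)]), (118260233, 6, [(1, 185340931),
  (2, 118760451), (4, 118236163), (4, 185352709), (8, 118243845)]), (17589068, 6, [(1, 34354627),
  (1, 34362565), (1, 34878787), (2, 17577411), (2, 17585349), (2, 18101571), (2, 18113226),
  (4, 17576905), (4, 17577283), (4, 17601475), (4, 17605318), (4, 19149763), (4, 19411843),
  (8, 17576901), (8, 17585091), (8, 17588934), (8, 18101187), (8, 18363267)]),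
  (18621260, 6, [(1, 18621637), (1, 18621763), (1, 18629827), (1, 19145923), (1, 68949187),
  (2, 18629322), (2, 35398851), (4, 18359491), (4, 19669702), (4, 19669891), (8, 18621126),
  (8, 18621315)]), (18653516, 6, [(1, 18633292), (1, 18649420), (1, 137113801), (2, 36458826),
  (2, 36459078), (2, 36475206), (2, 137638086), (4, 35410252), (4, 36983110), (4, 70013254),
  (4, 137113798)]), (18654020, 6, [(1, 19682116), (1, 137114305), (2, 36458952), (2, 36459204),
  (2, 36475332), (2, 137638338), (4, 18633604), (4, 18637636), (4, 36983236), (4, 70013380),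
  (4, 137114050)]), (17572814, 6, [(1, 34345933), (2, 18092499), (2, 18093003), (4, 17568211),
  (4, 17568715), (8, 17568333), (8, 17568459)]), (17621198, 6, [(1, 34394317), (1, 34394443),
  (1, 34394695), (2, 18116817), (2, 18133197), (2, 18133323), (2, 18133575), (4, 17592529),
  (4, 17608909), (4, 17609035), (4, 17609287), (4, 17617225), (4, 17621383), (8, 17600841)]),
  (17589194, 6, [(1, 34362313), (2, 18100689), (2, 18101193), (4, 17576401), (4, 17576905),
  (8, 17576649), (8, 17584713)]), (17621450, 6, [(1, 34370377), (1, 34394569), (2, 18117321),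
  (2, 18133449), (4, 17593033), (4, 17601349), (4, 17609161), (4, 17617477), (8, 17601093)]),
  (17621954, 6, [(1, 34395073), (2, 18117825), (2, 18133953), (4, 17593537), (4, 17609665),
  (4, 17617729), (8, 17601345)]), (18653390, 6, [(1, 18641545), (1, 18641671), (1, 18649735),
  (1, 18653389), (1, 18653515), (1, 18661579), (1, 19165831), (1, 68973127), (1, 68980939),
  (2, 35418759), (2, 35430603), (4, 18379399), (4, 19685767), (8, 18637191)]),
  (20717774, 6, [(1, 36966607), (1, 37490893), (2, 19665231), (2, 20713803), (4, 19665103),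
  (4, 20189389), (4, 20713675), (8, 19665099)]), (18621386, 6, [(1, 35394505), (1, 35918791),
  (2, 18617289), (2, 18617415), (2, 19141575), (4, 18359239)]), (18653642, 6, [(1, 35418697),
  (1, 35426761), (1, 35942857), (2, 18641481), (2, 18649545), (2, 19165641), (4, 18379210)]),
  (18654146, 6, [(1, 35427265), (1, 35943361), (2, 18641985), (2, 18650049), (2, 19166145),
  (4, 18379714)]), (20718026, 6, [(1, 37491145), (1, 37491271), (2, 20713929), (2, 20714055),
  (2, 21238215), (4, 20717959)]), (20718530, 6, [(1, 37491649), (2, 19666113), (2, 20714433),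
  (4, 20190145), (4, 20714305), (8, 19665729)]), (18637262, 6, [(1, 18637261), (1, 68964811),
  (2, 35414475)]), (18637766, 6, [(1, 18633670), (1, 68957125), (2, 35402694)]),
  (18670022, 6, [(1, 18665926), (1, 68989381), (2, 35434950)]), (20734406, 6, [(1, 20730310),
  (1, 71053765), (2, 37499334)]), (51642962, 6, [(1, 51118297), (2, 34341081), (2, 84672726),
  (4, 51118294), (4, 52691278), (8, 51642702)]), (51643970, 6, [(1, 51119809), (2, 34342593),
  (2, 84673986), (4, 51119554), (4, 52691908), (8, 51643332)]), (51675218, 6, [(1, 51122266),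
  (2, 34345050), (2, 84676758), (2, 84680790), (4, 51122326), (4, 51126358), (4, 52695310),
  (4, 52707406), (8, 51646734), (8, 51658830)]), (51676226, 6, [(1, 51216577), (2, 34439361),
  (2, 84754626), (4, 51167812), (4, 51200194), (4, 52740292), (4, 52740418), (8, 51167556),
  (8, 51675336), (8, 51675714), (8, 51691716), (8, 51691842)]), (51740738, 6, [(1, 51220546),
  (2, 34443330), (2, 84758658), (2, 84762690), (4, 51171844), (4, 51204226), (4, 51208258),
  (4, 52744324), (4, 52744450), (4, 52748356), (8, 51171588), (8, 51695748), (8, 51695874),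
  (8, 51699780)]), (51675722, 6, [(1, 51151057), (2, 84689106), (4, 51134674), (4, 51675340),
  (4, 52707658), (8, 51134796), (8, 51658956), (8, 51659082)]), (51643088, 6, [(1, 51118801),
  (2, 34341585), (2, 84672978), (4, 51118546), (4, 52691404), (8, 51642828)]),
  (51675344, 6, [(1, 51122392), (2, 34345176), (2, 84680916), (4, 51126484), (4, 51151180),
  (4, 52699468), (4, 52707532), (8, 51134796), (8, 51650892), (8, 51658956)]),
  (51676352, 6, [(1, 51123904), (2, 34346688), (2, 84682176), (4, 51127744), (4, 52708288),
  (8, 51659712)]), (51740864, 6, [(1, 51220672), (2, 34443456), (2, 84762816), (4, 51208384),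
  (4, 52748608), (8, 51700032)]), (51675848, 6, [(1, 51122896), (2, 84681168), (4, 51126736),
  (4, 52707784), (8, 51659208)]), (50619212, 6, [(1, 50869573), (1, 50869699), (1, 50877637),
  (1, 50877763), (2, 50607429), (2, 50607555), (2, 50615493), (2, 50615619), (2, 84173514),
  (4, 50606986), (4, 50607049), (4, 50607427), (4, 50631619), (4, 50635462), (4, 50635651),
  (4, 151270339), (8, 50606982), (8, 50607045), (8, 50615235), (8, 50619078), (8, 50619267),
  (8, 84161475)]), (51683408, 6, [(1, 51155971), (1, 51675217), (1, 84705361), (1, 85221457),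
  (2, 34378755), (2, 34381905), (2, 51150930), (2, 51150993), (2, 51667026), (2, 51667089),
  (2, 51929169), (2, 84698115), (2, 101474385), (4, 51143683), (4, 51404881), (4, 52715596),
  (4, 52715785), (4, 52716037), (4, 67919953), (8, 51667020), (8, 51667209), (8, 51667461)]),
  (51684416, 6, [(1, 51156160), (2, 34378944), (2, 84698304), (4, 51143872), (4, 52716352),
  (8, 51667776)]), (51683912, 6, [(1, 51155152), (2, 84697296), (4, 51142864), (4, 52715848),
  (8, 51667272)]), (51651404, 6, [(1, 51127747), (1, 51135685), (1, 51909955), (1, 84677830),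
  (1, 84681925), (2, 51123651), (2, 51127494), (2, 51647811), (2, 84677829), (2, 84689610),
  (4, 51123145), (4, 51123523), (4, 51126988), (4, 51127366), (4, 52696003), (4, 52699846),
  (4, 52700035), (4, 151786435), (8, 51123141), (8, 51126984), (8, 51127110), (8, 51647427),
  (8, 51651270), (8, 51651459), (8, 84677571)]), (51683660, 6, [(1, 51130582), (1, 51130708),
  (1, 51130897), (1, 51925201), (1, 101462353), (2, 51130581), (2, 51130770), (2, 51663057),
  (2, 84685137), (2, 84685452), (2, 84685578), (2, 86270154), (4, 51130957), (4, 51155149),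
  (4, 51155338), (4, 51667276), (4, 51683530), (4, 52703437), (4, 52703626), (4, 151793869),
  (8, 51130701), (8, 51138765), (8, 51138954), (8, 51654861), (8, 51655050), (8, 51667146),
  (8, 84685005)]), (51684164, 6, [(1, 51131842), (1, 51144001), (1, 51656002), (1, 51656065),
  (1, 51926209), (2, 51131841), (2, 51139905), (2, 51656001), (2, 51664065), (2, 86270658),
  (4, 51131713), (4, 51155842), (4, 51155905), (4, 51667780), (4, 51684034), (4, 52704130),
  (4, 52704193), (4, 151794625), (8, 51139458), (8, 51139521), (8, 51655554), (8, 51655617),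
  (8, 51667650), (8, 84685761)]), (117711692, 6, [(1, 117712069), (1, 117712195), (1, 117720259),
  (1, 118494403), (2, 117719754), (2, 117974211), (4, 84419779), (4, 184820422), (4, 184820611),
  (8, 117711558), (8, 117711747)]), (117743948, 6, [(1, 117723724), (1, 117739852), (1, 186659017),
  (2, 117985866), (2, 118001994), (2, 118002246), (2, 220213446), (4, 119558470), (4, 185618758),
  (4, 186659014), (8, 118509894)]), (117744452, 6, [(1, 117723976), (1, 117740356), (1, 186659521),
  (2, 117985992), (2, 118002120), (2, 118002372), (2, 220213698), (4, 119558596), (4, 185618884),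
  (4, 186659266), (8, 118510020)]), (50602958, 6, [(1, 50861005), (2, 84152787), (2, 84153291),
  (4, 50598355), (4, 50598859), (8, 50598477), (8, 50598603)]), (50651342, 6, [(1, 50909389),
  (1, 50909515), (1, 50909767), (2, 84177105), (2, 84193485), (2, 84193611), (2, 84193863),
  (4, 50622673), (4, 50639053), (4, 50639179), (4, 50639431), (4, 50647369), (4, 50651527),
  (8, 50630985)]), (50619338, 6, [(1, 50877385), (2, 84160977), (2, 84161481), (4, 50606545),
  (4, 50607049), (8, 50606793), (8, 50614857)]), (50651594, 6, [(1, 50885449), (1, 50909641),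
  (2, 84177609), (2, 84193737), (4, 50623177), (4, 50631493), (4, 50639305), (4, 50647621),
  (8, 50631237)]), (50652098, 6, [(1, 50910145), (2, 84178113), (2, 84194241), (4, 50623681),
  (4, 50639809), (4, 50647873), (8, 50631489)]), (51683534, 6, [(1, 51941581), (1, 51941707),
  (1, 51941959), (2, 84693201), (2, 84709581), (2, 84709707), (2, 84709959), (4, 51138769),
  (4, 51155149), (4, 51155275), (4, 51155527), (4, 52711753), (4, 52715911), (8, 51663177),
  (8, 51667335)]), (53747918, 6, [(1, 54005965), (1, 54006091), (1, 54006343), (2, 85725393),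
  (2, 86773965), (2, 86774091), (2, 86774343), (4, 52170961), (4, 53219533), (4, 53219659),
  (4, 53219911), (4, 53743945), (4, 53748103), (8, 52695369)]), (51651530, 6, [(1, 51909577),
  (2, 84677073), (2, 84677577), (4, 51122641), (4, 51123145), (8, 51122889), (8, 51647049)]),
  (51683786, 6, [(1, 51942085), (1, 52990405), (2, 84694083), (2, 84710211), (2, 85234371),
  (2, 86282691), (4, 51139651), (4, 51155779), (4, 51663433), (4, 51679939), (4, 51683782),
  (4, 52728259), (8, 51663429)]), (51684290, 6, [(1, 51942337), (2, 84694209), (2, 84710337),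
  (4, 51139777), (4, 51155905), (4, 52712257), (8, 51663681)]), (53748170, 6, [(1, 54006217),
  (2, 85725897), (2, 86774217), (4, 52171465), (4, 52695877), (4, 53219785), (4, 53744197),
  (8, 52695621)]), (53748674, 6, [(1, 54006721), (2, 85726401), (2, 86774721), (4, 52171969),
  (4, 53220289), (4, 53744449), (8, 52695873)]), (51667658, 6, [(1, 51917641), (1, 101470921),
  (2, 51131589), (2, 51143370), (2, 51655497), (2, 84693705), (4, 51131461), (4, 51155653),
  (4, 52703941), (4, 151794373), (8, 51131205), (8, 51139269), (8, 51655365), (8, 84685509)]),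
  (51699914, 6, [(1, 51933769), (1, 51949897), (1, 51957961), (2, 84701769), (2, 84717897),
  (2, 84725961), (2, 84742341), (4, 51147337), (4, 51163465), (4, 51171529), (4, 51187909),
  (4, 52728133), (8, 51679557)]), (51700418, 6, [(1, 52982593), (1, 53006785), (2, 86274753),
  (2, 86290881), (4, 51671938), (4, 51680065), (4, 51696193), (4, 51700162), (4, 52720321),
  (4, 52736449), (8, 51679809)]), (53764298, 6, [(1, 169619785), (1, 169627849), (2, 52179594),
  (2, 52207818), (2, 53227914), (2, 53240010), (2, 152842569), (2, 152850633), (2, 153366729),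
  (4, 85733770), (4, 85745866)]), (53764802, 6, [(1, 54038977), (2, 85758657), (2, 86806977),
  (4, 52204225), (4, 52712257), (4, 53252545), (4, 53760577), (4, 53764546), (8, 52712001)]),
  (53797058, 6, [(1, 169652545), (1, 169660609), (2, 52212354), (2, 53260674), (2, 53272770),
  (2, 152875329), (2, 152883393), (2, 153399489), (4, 85766530), (4, 85778626)]),
  (51700166, 6, [(1, 51671500), (1, 51671878), (1, 51696070), (1, 53506501), (1, 118256389),
  (1, 118276549), (1, 118780360), (1, 118780486), (1, 118788550), (1, 119566789), (2, 51933642),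
  (2, 51933894), (2, 51950022), (2, 52982214), (2, 118256262), (2, 118268358), (2, 119042502),
  (4, 85488070)]), (53764550, 6, [(1, 152850886), (1, 203174341), (2, 52191690), (2, 52191942),
  (2, 52208070), (2, 53240262), (2, 169619910), (4, 85746118)]), (117743822, 6, [(1, 117731977),
  (1, 117732103), (1, 117740167), (1, 117743821), (1, 117743947), (1, 117752011), (1, 118518343),
  (1, 118526155), (2, 117994119), (2, 118005963), (4, 84439687), (4, 184836487), (8, 117727623)]),
  (119808206, 6, [(1, 119280391), (1, 119292487), (1, 119808205), (1, 119808331), (1, 119816395),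
  (1, 120590539), (2, 119284359), (2, 120070347), (4, 85729927), (4, 185868679), (8, 118759815)]),
  (251928782, 6, [(1, 252186829), (2, 184815951), (2, 251924811), (4, 184815823), (4, 218370253),
  (4, 251924683), (8, 184815819)]), (117711818, 6, [(1, 117711817), (1, 117720007), (1, 118494151),
  (2, 117973959), (4, 84419527)]), (117744074, 6, [(1, 117731788), (1, 117731914), (1, 117739978),
  (1, 118518217), (2, 117993930), (4, 84439498)]), (117744578, 6, [(1, 117732292), (1, 117740482),
  (1, 118518721), (2, 117994434), (4, 84440002)]), (119808458, 6, [(1, 119280076), (1, 119292361),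
  (2, 119284170), (4, 85729738)]), (119808962, 6, [(1, 119280580), (1, 119292865), (2, 119284674),
  (4, 85730242)]), (251929034, 6, [(1, 252187081), (1, 252187207), (2, 251924937), (2, 251925063),
  (2, 285479367), (4, 251928967)]), (251929538, 6, [(1, 252187585), (2, 184816833), (2, 251925441),
  (4, 218371009), (4, 251925313), (8, 184816449)]), (117727694, 6, [(1, 117723598), (1, 118501837),
  (2, 117977550)]), (117728198, 6, [(1, 117724102), (1, 118502341), (2, 117978054)]),
  (117760454, 6, [(1, 117760453), (1, 118542787), (2, 118022595)]), (251945414, 6, [(1, 251945413),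
  (1, 252727747), (2, 252207555)]), (51135308, 6, [(1, 51123400), (1, 51123526), (1, 51151561),
  (2, 85205706), (4, 51123082), (4, 51126988), (4, 51127366), (4, 51135178), (8, 51123078),
  (8, 51126984), (8, 51127110)]), (51167564, 6, [(1, 51130960), (1, 51131401), (1, 51155152),
  (1, 51155530), (1, 51183817), (2, 84685452), (2, 84685578), (2, 84693642), (2, 84713676),
  (2, 84713802), (2, 84721866), (4, 51131020), (4, 51131146), (4, 51139210), (4, 51159244),
  (4, 51159370), (4, 51167434)]), (51168068, 6, [(1, 51155656), (1, 51156034), (1, 51184321),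
  (2, 84714180), (2, 84714306), (2, 84722370), (4, 51139714), (4, 51159748), (4, 51159874),
  (4, 51167938)]), (52167248, 6, [(1, 53215441), (2, 36438225), (2, 85721298), (4, 51380437),
  (4, 51642580), (4, 51642706), (4, 52166866), (4, 52166929), (4, 53215564), (4, 53477581),
  (8, 52166988), (8, 52429005)]), (52199504, 6, [(1, 52170838), (2, 35393622), (2, 85725330),
  (2, 85729362), (4, 51384406), (4, 51646612), (4, 51646738), (4, 51650644), (4, 51658834),
  (4, 53219470), (4, 53219596), (4, 53223502), (4, 53231692), (8, 52170894), (8, 52171020),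
  (8, 52174926), (8, 52183116)]), (52200512, 6, [(1, 52172224), (2, 35395008), (2, 85730496),
  (4, 51385792), (4, 51651904), (4, 51659968), (4, 53224384), (4, 53232448), (8, 52175808),
  (8, 52183872)]), (52265024, 6, [(1, 52260928), (2, 35483712), (2, 85799040), (4, 51474496),
  (4, 51720448), (4, 51728512), (4, 53268736), (4, 53276800), (8, 52220160), (8, 52228224)]),
  (52200008, 6, [(1, 53219536), (2, 85729488), (4, 52175056), (4, 53231944), (8, 52183368)]),
  (118227536, 6, [(1, 118751569), (2, 118227282), (2, 118227345), (2, 119013585), (2, 185073873),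
  (4, 84410581), (4, 84672850), (4, 84672913), (4, 85459153), (4, 117965137), (4, 118489297),
  (4, 185336140), (4, 218628301), (8, 118227276), (8, 151519437)]), (118259792, 6, [(1, 118755412),
  (2, 117968982), (2, 118231188), (2, 118235220), (2, 119017554), (4, 84414550), (4, 84676756),
  (4, 84680788), (4, 85463122), (4, 185340172), (4, 185352268), (4, 185602126), (8, 118231308),
  (8, 118243404), (8, 118493262)]), (118260800, 6, [(1, 118232512), (2, 117970368), (2, 118760640),
  (4, 67900864), (4, 84415936), (4, 84682048), (4, 84690112), (4, 185344960), (4, 185353024),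
  (8, 118236096), (8, 118244160)]), (118325312, 6, [(1, 118321216), (2, 118059072), (2, 118829184),
  (4, 67989568), (4, 84504640), (4, 84750592), (4, 84758656), (4, 185389312), (4, 185397376),
  (8, 118280448), (8, 118288512)]), (118260296, 6, [(1, 185401537), (2, 118816962), (4, 118292674),
  (4, 185368900), (8, 118260036)]), (17593100, 6, [(1, 34419013), (1, 34435267), (1, 34951363),
  (2, 17593098), (2, 17617542), (2, 17641797), (2, 17658051), (2, 18174147), (2, 19165830),
  (4, 17609098), (4, 17625289), (4, 17625667), (4, 17649859), (4, 18117382), (4, 19198147),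
  (4, 19456195), (8, 17609094), (8, 17625285), (8, 17625411), (8, 18149571), (8, 18407619)]),
  (18625292, 6, [(1, 38547781), (1, 39080131), (1, 39596227), (2, 18625164), (2, 18649482),
  (2, 20197770), (2, 21770565), (2, 22302915), (2, 22819011), (4, 18633100), (4, 19673734),
  (4, 20488387), (4, 20721865), (4, 20722243), (4, 20746435), (4, 22294723), (8, 19673478),
  (8, 20472003), (8, 20721861), (8, 20721987), (8, 20730051)]), (18657548, 6, [(1, 35467333),
  (1, 35475523), (1, 35991619), (2, 18665610), (2, 18690117), (2, 18698307), (2, 19214403),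
  (4, 18428035), (4, 19705990), (4, 19718275), (8, 18657414), (8, 18669699)]),
  (18658052, 6, [(1, 18690244), (1, 18690370), (1, 18698434), (1, 19214530), (1, 69021889),
  (2, 18666114), (2, 35467458), (4, 18428098), (4, 19706242), (4, 19718338), (8, 18657666),
  (8, 18669762)]), (17576846, 6, [(1, 34353997), (1, 34362187), (1, 34378567), (2, 18100689),
  (2, 18100941), (2, 18109131), (2, 18125511), (4, 17576401), (4, 17576653), (4, 17584843),
  (4, 17584969), (4, 17589127), (4, 17601223), (8, 17584713)]), (17625230, 6, [(1, 34402381),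
  (2, 18116691), (2, 18149451), (4, 17592403), (4, 17625163), (8, 17600589), (8, 17608779)]),
  (17625482, 6, [(1, 34402633), (2, 18116817), (2, 18149577), (4, 17592529), (4, 17625289),
  (8, 17600841), (8, 17608905)]), (17625986, 6, [(1, 34403137), (2, 18117825), (2, 18150081),
  (4, 17593537), (4, 17625793), (8, 17601345), (8, 17609409)]), (20721806, 6, [(1, 36974671),
  (1, 37498957), (2, 19681359), (2, 20729931), (4, 19673167), (4, 20197453), (4, 20721739),
  (8, 19673163)]), (20722058, 6, [(1, 37499209), (2, 18632913), (2, 20730057), (4, 18624721),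
  (4, 20721865), (8, 19149129), (8, 19673289)]), (20722562, 6, [(1, 36975553), (1, 37499713),
  (2, 19682241), (2, 20730561), (4, 19674049), (4, 20198209), (4, 20722369), (8, 19673793)]),
  (18641546, 6, [(1, 35418697), (2, 17609289), (2, 17633481), (2, 18641481), (2, 19697865),
  (4, 17617225), (4, 18117193), (4, 18157765), (4, 18649417), (4, 20222149), (8, 19173573)]),
  (18673802, 6, [(1, 35450953), (1, 35975239), (2, 18673737), (2, 18681927), (2, 19198023),
  (4, 18411655)]), (18674306, 6, [(1, 35451457), (1, 35975617), (2, 18674241), (2, 18682305),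
  (2, 19198401), (4, 18411970)]), (20738186, 6, [(1, 37515337), (1, 37523527), (2, 20738121),
  (2, 20746311), (2, 21262407), (4, 20734087)]), (20738690, 6, [(1, 37515841), (1, 37523905),
  (2, 20738625), (2, 20746689), (2, 21262785), (4, 20734402)]), (20770946, 6, [(1, 37548097),
  (2, 19738689), (2, 20770881), (4, 20246593), (4, 20762689), (8, 19714113)]),
  (18641294, 6, [(1, 18641293), (1, 68972875), (2, 35418507)]), (18641798, 6, [(1, 18641734),
  (1, 68973253), (2, 35418822)]), (18674054, 6, [(1, 18673990), (1, 69005509), (2, 35451078)]),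
  (20738438, 6, [(1, 20738374), (1, 71069893), (2, 37515462)]), (51646994, 6, [(1, 51150931),
  (1, 51646741), (1, 52695187), (2, 34373715), (2, 35917971), (2, 84680979), (2, 84681231),
  (2, 84705423), (2, 85463187), (2, 86253711), (4, 51126547), (4, 51126799), (4, 51150991),
  (4, 51151117), (4, 51384469), (4, 51384595), (4, 51646612), (4, 51646738), (4, 51646990),
  (4, 51650833), (4, 51658897), (4, 51659023), (4, 51908755), (4, 52699279), (8, 51134733),
  (8, 51646734)]), (51648002, 6, [(1, 51152065), (1, 51647812), (1, 52696258), (2, 34374849),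
  (2, 35919042), (2, 84681672), (2, 84681924), (2, 84706242), (2, 85464258), (2, 86254530),
  (4, 51127240), (4, 51127492), (4, 51151684), (4, 51151810), (4, 51385540), (4, 51385666),
  (4, 51647746), (4, 51651652), (4, 51659716), (4, 51659842), (4, 51909826), (4, 52695940),
  (4, 52700098), (8, 51135300), (8, 51647364)]), (51679250, 6, [(1, 51130393), (2, 34353177),
  (2, 84684822), (4, 51130390), (4, 52711438), (8, 51662862)]), (51680258, 6, [(1, 51131905),
  (2, 34354689), (2, 84686082), (4, 51131650), (4, 51155716), (4, 52704004), (4, 52712194),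
  (8, 51139332), (8, 51655428), (8, 51663618)]), (51744770, 6, [(1, 51228673), (2, 34451457),
  (2, 84766722), (4, 51212290), (4, 52752388), (8, 51703812)]), (51679754, 6, [(1, 51130897),
  (2, 51138834), (2, 51654930), (4, 51130642), (4, 52711690), (4, 84685324), (8, 51663114),
  (8, 84685068)]), (51647120, 6, [(1, 51151057), (1, 51646804), (1, 52695250), (2, 34373841),
  (2, 35918034), (2, 84689106), (2, 85205202), (2, 85463250), (4, 51134674), (4, 51135052),
  (4, 51384532), (4, 51384658), (4, 51646738), (4, 51646864), (4, 51647116), (4, 51650770),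
  (4, 51908818), (8, 51134796), (8, 51646860)]), (51679376, 6, [(1, 51130456), (2, 34353240),
  (2, 84684948), (4, 51130516), (4, 51155212), (4, 52703500), (4, 52711564), (8, 51138828),
  (8, 51654924), (8, 51662988)]), (51680384, 6, [(1, 51131968), (2, 34354752), (2, 84686208),
  (4, 51131776), (4, 52712320), (8, 51663744)]), (51744896, 6, [(1, 51228736), (2, 34451520),
  (2, 84766848), (4, 51212416), (4, 52752640), (8, 51704064)]), (51679880, 6, [(1, 51130960),
  (2, 84685200), (4, 51130768), (4, 52711816), (8, 51663240)]), (50623244, 6, [(1, 50934085),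
  (1, 50942149), (1, 50942275), (1, 50950339), (2, 50623242), (2, 50639622), (2, 50671941),
  (2, 50680005), (2, 50680131), (2, 50688195), (2, 84193926), (2, 151286406), (4, 50639242),
  (4, 50651338), (4, 50651779), (4, 50655433), (4, 50655811), (4, 50680003), (4, 84177670),
  (4, 151318723), (8, 50639238), (8, 50651334), (8, 50651523), (8, 50655429), (8, 50655555),
  (8, 84209859)]), (51687440, 6, [(1, 51163153), (2, 34385937), (2, 84701202), (4, 51146770),
  (4, 52719628), (8, 51671052)]), (51688448, 6, [(1, 51164224), (2, 34387008), (2, 84702336),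
  (4, 51147904), (4, 52720384), (8, 51671808)]), (51687944, 6, [(1, 51163216), (2, 84701328),
  (4, 51146896), (4, 52719880), (8, 51671304)]), (51655436, 6, [(1, 51130582), (1, 51130708),
  (1, 51130897), (1, 51131653), (1, 51131779), (1, 51183817), (1, 51925201), (1, 51926083),
  (1, 52703440), (1, 54800710), (1, 54808774), (1, 55071043), (1, 55587013), (1, 56111299),
  (1, 85233868), (1, 85233994), (1, 101462353), (1, 101463109), (1, 105132229), (2, 51130581),
  (2, 51130770), (2, 51131526), (2, 51131715), (2, 51663057), (2, 51663939), (2, 51679626),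
  (2, 51691722), (2, 52715724), (2, 52715850), (2, 54808899), (2, 55062726), (2, 55849155),
  (2, 84685137), (2, 84685452), (2, 84685893), (2, 84721866), (2, 85237962), (2, 85496010),
  (2, 86258058), (2, 86270154), (2, 88355013), (2, 102011082), (4, 51130957), (4, 51131020),
  (4, 51131209), (4, 51155149), (4, 51155338), (4, 51155590), (4, 51155779), (4, 51167434),
  (4, 51663244), (4, 51683530), (4, 51683971), (4, 52703437), (4, 52703626), (4, 52704067),
  (4, 52732102), (4, 52732291), (4, 53752009), (4, 53752387), (4, 53776579), (4, 151793869),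
  (4, 151794499), (4, 154415299), (8, 51130701), (8, 51131016), (8, 51131205), (8, 51138765),
  (8, 51138954), (8, 51139206), (8, 51139395), (8, 51654861), (8, 51655050), (8, 51655302),
  (8, 51655491), (8, 51667146), (8, 51667587), (8, 52703622), (8, 52715718), (8, 52715907),
  (8, 52965576), (8, 53752005), (8, 53752131), (8, 53760195), (8, 84685005), (8, 84685635),
  (8, 87306435)]), (51687692, 6, [(1, 51204166), (1, 51204229), (1, 51212419), (1, 51728515),
  (1, 51732547), (1, 51982405), (2, 51204165), (2, 51212355), (2, 51720261), (2, 51728451),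
  (2, 84717708), (2, 84717834), (4, 51179593), (4, 51187846), (4, 51204163), (4, 52736134),
  (4, 52748419), (4, 52752451), (4, 151842883), (8, 51171462), (8, 51179589), (8, 51687558),
  (8, 51699843), (8, 51703875), (8, 84734019)]), (51688196, 6, [(1, 51208513), (1, 51212482),
  (1, 51728578), (1, 51732673), (1, 51982657), (2, 51204417), (2, 51212481), (2, 51720513),
  (2, 51728577), (2, 84718212), (2, 84718338), (4, 51180097), (4, 51188098), (4, 51204289),
  (4, 52736386), (4, 52748482), (4, 52752577), (4, 151843009), (8, 51171714), (8, 51179841),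
  (8, 51687810), (8, 51699906), (8, 51704001), (8, 84734145)]), (117715724, 6, [(1, 117977425),
  (1, 117978181), (1, 168046801), (1, 168047683), (1, 252195145), (1, 252195397), (1, 302264521),
  (1, 302264899), (2, 117715596), (2, 117723345), (2, 117724227), (2, 117739914), (2, 184824204),
  (2, 184832394), (2, 218386761), (2, 218387013), (2, 251928780), (2, 251928969), (2, 251929032),
  (2, 251929221), (2, 251937222), (2, 251937411), (2, 251941065), (2, 251941254), (2, 251941443),
  (4, 117715153), (4, 117716035), (4, 117723532), (4, 184824202), (4, 251928778), (4, 251929219),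
  (4, 251932873), (4, 251933062), (4, 251933251), (4, 319037638), (4, 319037827), (8, 117715338),
  (8, 117715590), (8, 151269705), (8, 151269957), (8, 151531722), (8, 151532163), (8, 184824009),
  (8, 184824198), (8, 184824387)]), (117747980, 6, [(1, 117780613), (1, 117780739), (1, 117788803),
  (1, 118566979), (2, 117756042), (2, 118042755), (4, 84488323), (4, 184856710), (4, 184868995),
  (8, 117747846), (8, 117760131)]), (117748484, 6, [(1, 117780676), (1, 117780802), (1, 117788866),
  (1, 118567105), (2, 117756546), (2, 118042818), (4, 84488386), (4, 184856962), (4, 184869058),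
  (8, 117748098), (8, 117760194)]), (50606990, 6, [(1, 50869069), (1, 50877259), (1, 50893639),
  (2, 84160977), (2, 84161229), (2, 84169419), (2, 84185799), (4, 50606545), (4, 50606797),
  (4, 50614987), (4, 50615113), (4, 50619271), (4, 50631367), (8, 50614857)]),
  (50655374, 6, [(1, 50917453), (2, 84176979), (2, 84209739), (4, 50622547), (4, 50655307),
  (8, 50630733), (8, 50638923)]), (50655626, 6, [(1, 50917705), (2, 84177105), (2, 84209865),
  (4, 50622673), (4, 50655433), (8, 50630985), (8, 50639049)]), (50656130, 6, [(1, 50918209),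
  (2, 84178113), (2, 84210369), (4, 50623681), (4, 50655937), (8, 50631489), (8, 50639553)]),
  (53751950, 6, [(1, 54014029), (1, 54022219), (1, 54038599), (2, 85733457), (2, 86782029),
  (2, 86790219), (2, 86806599), (4, 52179025), (4, 53227597), (4, 53235787), (4, 53252167),
  (4, 53760073), (4, 53764231), (8, 52711497)]), (53752202, 6, [(1, 54014281), (2, 85758153),
  (2, 86790345), (2, 87306441), (2, 88355013), (4, 52203721), (4, 52712005), (4, 53235913),
  (4, 53752009), (4, 54800581), (8, 52711749)]), (53752706, 6, [(1, 54014785), (1, 54022849),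
  (1, 54038977), (2, 85734465), (2, 86782785), (2, 86790849), (2, 86806977), (4, 52180033),
  (4, 53228353), (4, 53236417), (4, 53252545), (4, 53760577), (4, 53764546), (8, 52712001)]),
  (51671690, 6, [(1, 51949897), (1, 52982089), (2, 84725961), (2, 84742341), (2, 85242057),
  (2, 86274249), (4, 51171529), (4, 51187909), (4, 51671434), (4, 51679813), (4, 51687625),
  (4, 52719817), (8, 51679557)]), (51703946, 6, [(1, 51966025), (2, 84701265), (2, 84734025),
  (4, 51146833), (4, 51179593), (8, 51163209), (8, 51679305)]), (51704450, 6, [(1, 51966529),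
  (2, 84702273), (2, 84734529), (4, 51147841), (4, 51180097), (8, 51163713), (8, 51679809)]),
  (53768330, 6, [(1, 54030409), (2, 85766217), (2, 86798409), (4, 52211785), (4, 52744261),
  (4, 53243977), (4, 53776453), (8, 52727877)]), (53768834, 6, [(1, 54030913), (2, 85766721),
  (2, 86798913), (4, 52212289), (4, 52744513), (4, 53244481), (4, 53776705), (8, 52728129)]),
  (53801090, 6, [(1, 54063169), (2, 85798977), (2, 86831169), (4, 52244545), (4, 53276737),
  (4, 53792833), (8, 52744257)]), (53768582, 6, [(1, 152858950), (1, 203190469), (2, 52195722),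
  (2, 52195974), (2, 52212102), (2, 53244294), (2, 169636038), (4, 85750150)]),
  (119812238, 6, [(1, 119312647), (1, 119324743), (1, 119812237), (1, 119812363), (1, 119820427),
  (1, 120598603), (2, 119316615), (2, 120074379), (4, 85762183), (4, 185884807), (8, 118775943)]),
  (251932814, 6, [(1, 252194893), (2, 184832079), (2, 251940939), (4, 184823887), (4, 218378317),
  (4, 251932747), (8, 184823883)]), (119812490, 6, [(1, 120074821), (1, 120082633), (1, 120099013),
  (2, 118264137), (2, 118264389), (2, 118764105), (2, 119812677), (2, 119820489), (2, 119836869),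
  (4, 151818565), (4, 152318533), (4, 153374917), (4, 185872774), (4, 185880901), (4, 185884870),
  (8, 118763910), (8, 118772037), (8, 118776006)]), (119812994, 6, [(1, 119312836), (1, 119325121),
  (1, 119812804), (1, 119812930), (1, 119820994), (1, 120599233), (2, 119316930), (2, 120074946),
  (4, 85762498), (4, 185885122), (8, 118776258)]), (251933066, 6, [(1, 252195145), (2, 117723345),
  (2, 251941065), (4, 117715153), (4, 251932873), (8, 151269705), (8, 184824009)]),
  (251933570, 6, [(1, 252195649), (2, 184832961), (2, 251941569), (4, 184824769), (4, 218379073),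
  (4, 251933377), (8, 184824513)]), (117731978, 6, [(1, 117994057), (2, 50639433), (2, 50663625),
  (2, 117731913), (2, 184848585), (4, 50647369), (4, 84177481), (4, 84218053), (4, 117739849),
  (4, 218403013), (8, 151294149)]), (117764234, 6, [(1, 117764233), (1, 117764359), (1, 118550599),
  (2, 118026375), (4, 84471943)]), (117764738, 6, [(1, 117764548), (1, 117764674), (1, 118550977),
  (2, 118026690), (4, 84472258)]), (119828618, 6, [(1, 119304268), (1, 119304457), (2, 119304330),
  (4, 85749898)]), (119829122, 6, [(1, 119304772), (1, 119304961), (2, 119304834), (4, 85750402)]),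
  (119861378, 6, [(1, 119337028), (1, 119337217), (2, 119337090), (4, 85782658)]),
  (251949194, 6, [(1, 252211273), (1, 252219463), (2, 251949129), (2, 251957319), (2, 285503559),
  (4, 251945095)]), (251949698, 6, [(1, 252211777), (1, 252219841), (2, 251949633), (2, 251957697),
  (2, 285503937), (4, 251945410)]), (251981954, 6, [(1, 252244033), (2, 184889409), (2, 251981889),
  (4, 218427457), (4, 251973697), (8, 184864833)]), (117731726, 6, [(1, 117731662), (1, 118517965),
  (2, 117993678)]), (117732230, 6, [(1, 117732166), (1, 118518469), (2, 117994182)]),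
  (117764486, 6, [(1, 117764422), (1, 118550725), (2, 118026438)]), (251949446, 6, [(1, 251949382),
  (1, 252735685), (2, 252211398)]), (51139340, 6, [(1, 51130582), (1, 51130708), (1, 51130897),
  (1, 51131401), (1, 51131653), (1, 51131779), (1, 51155152), (1, 51155530), (1, 51155593),
  (1, 51188038), (1, 51192133), (1, 51200323), (1, 51208387), (1, 51712198), (1, 51716293),
  (1, 51925201), (1, 51926083), (1, 84742531), (1, 84746563), (1, 85221961), (1, 101462353),
  (1, 101463109), (2, 51130581), (2, 51130770), (2, 51131526), (2, 51131715), (2, 51192195),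
  (2, 51204291), (2, 51663057), (2, 51663939), (2, 51667530), (2, 51667593), (2, 51712197),
  (2, 51929673), (2, 84685137), (2, 84685452), (2, 84685578), (2, 84685893), (2, 84693642),
  (2, 84713676), (2, 84713802), (2, 84722307), (2, 84742467), (2, 85237962), (2, 86270154),
  (2, 86270595), (2, 101474889), (4, 51130957), (4, 51131020), (4, 51131146), (4, 51131209),
  (4, 51139210), (4, 51155149), (4, 51155779), (4, 51159244), (4, 51159370), (4, 51159685),
  (4, 51159811), (4, 51171529), (4, 51171907), (4, 51667276), (4, 51667717), (4, 51683530),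
  (4, 51683971), (4, 52703437), (4, 52703626), (4, 52703878), (4, 52704067), (4, 52732102),
  (4, 52732291), (4, 52744387), (4, 151793869), (4, 151794499), (4, 151834819), (8, 51130701),
  (8, 51131016), (8, 51131205), (8, 51138765), (8, 51138954), (8, 51139206), (8, 51139395),
  (8, 51155334), (8, 51159555), (8, 51171525), (8, 51171651), (8, 51654861), (8, 51655050),
  (8, 51655302), (8, 51655491), (8, 51667146), (8, 51667587), (8, 51683526), (8, 51683715),
  (8, 51695811), (8, 84685005), (8, 84685635), (8, 84725955)]), (51171596, 6, [(1, 51163216),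
  (1, 51163657), (1, 51204166), (2, 84717708), (2, 84717834), (2, 84725898), (4, 51163276),
  (4, 51163402), (4, 51175498), (4, 51187846), (8, 51171462), (8, 51175494)]),
  (51172100, 6, [(1, 51163720), (1, 51164161), (1, 51204418), (2, 84718212), (2, 84718338),
  (2, 84726402), (4, 51163780), (4, 51163906), (4, 51176002), (4, 51188098), (8, 51171714),
  (8, 51175746)]), (52203536, 6, [(1, 53227537), (2, 36450321), (2, 85733394), (4, 51392533),
  (4, 51654676), (4, 51662866), (4, 52178962), (4, 52183057), (4, 53235724), (4, 53489677),
  (8, 52187148), (8, 52441101)]), (52204544, 6, [(1, 53228608), (2, 36451392), (2, 85734528),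
  (4, 51393856), (4, 51655936), (4, 51664000), (4, 52180096), (4, 52184128), (4, 53236480),
  (4, 53490496), (8, 52187904), (8, 52441920)]), (52204040, 6, [(1, 53227600), (2, 85733520),
  (4, 52179088), (4, 53235976), (8, 52187400)]), (52171532, 6, [(1, 55320901), (1, 55841155),
  (1, 55845187), (1, 56103109), (1, 56369347), (1, 85725961), (1, 87298693), (1, 87298819),
  (2, 52171530), (2, 52175625), (2, 53220102), (2, 53232261), (2, 53232387), (2, 55316805),
  (2, 55840965), (2, 55841091), (2, 56365251), (2, 85754499), (2, 87302787), (2, 87560835),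
  (2, 102503049), (2, 104075907), (4, 52183813), (4, 52200067), (4, 53219722), (4, 53232259),
  (4, 53747914), (4, 53748355), (4, 54268105), (4, 54268483), (4, 55840963), (4, 154931395),
  (8, 53219718), (8, 53747910), (8, 53748099), (8, 54268101), (8, 54268227), (8, 87822531)]),
  (52203788, 6, [(1, 55337029), (1, 56111173), (1, 56119363), (1, 56373379), (2, 55332933),
  (2, 55849029), (2, 55857219), (2, 56373315), (2, 85758090), (2, 86782092), (2, 86782218),
  (2, 86790282), (2, 87306378), (4, 52203658), (4, 53235850), (4, 53252230), (4, 53751946),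
  (4, 53780611), (4, 54276169), (4, 54300739), (4, 55849027), (4, 154939459), (8, 53235846),
  (8, 53751942), (8, 53764227), (8, 54276165), (8, 54284355), (8, 87830595)]),
  (52204292, 6, [(1, 53228545), (1, 55324996), (1, 56119489), (1, 56373442), (1, 105656641),
  (2, 55325058), (2, 55857345), (2, 56373441), (2, 85758594), (2, 86782596), (2, 86782722),
  (2, 86790786), (2, 87306882), (2, 88879425), (4, 52204162), (4, 53236354), (4, 53252482),
  (4, 53752450), (4, 53780674), (4, 54276673), (4, 54300865), (4, 55849153), (4, 154939585),
  (8, 53228034), (8, 53236098), (8, 53752194), (8, 53764290), (8, 54276417), (8, 54284481),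
  (8, 87830721)]), (118263824, 6, [(1, 118771729), (2, 118247442), (2, 118251537), (2, 119025681),
  (2, 185085969), (4, 84422677), (4, 84693010), (4, 84697105), (4, 85471249), (4, 117985297),
  (4, 118501393), (4, 185356300), (4, 218640397), (8, 118247436), (8, 151531533)]),
  (118264832, 6, [(1, 118772800), (2, 118248576), (2, 118252608), (2, 119026752), (2, 185087040),
  (4, 84424000), (4, 84694144), (4, 84698176), (4, 85472320), (4, 117986368), (4, 118502464),
  (4, 185357056), (4, 218641216), (8, 118248192), (8, 151532352)]), (118264328, 6, [(1, 185348176),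
  (2, 118763664), (4, 118239376), (4, 185356552), (8, 118247688)]), (118231820, 6, [(1, 118232134),
  (1, 118232197), (1, 118235473), (1, 151790659), (1, 168562897), (1, 251924812), (1, 251925253),
  (1, 252453193), (1, 252453445), (1, 286007875), (1, 302780617), (2, 118231692), (2, 118755537),
  (2, 118755978), (2, 118756419), (2, 119804550), (2, 218894982), (2, 219418953), (2, 219419205),
  (2, 251924874), (2, 251925126), (2, 251936970), (2, 251937411), (2, 252186828), (2, 252187017),
  (2, 252187206), (2, 252187269), (2, 252711114), (2, 252973257), (2, 252973446), (2, 252973635),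
  (4, 118231249), (4, 118232131), (4, 118756102), (4, 185340550), (4, 251928778), (4, 251929219),
  (4, 252448969), (4, 252449158), (4, 252449347), (4, 319037638), (4, 319037827), (8, 118231434),
  (8, 118231686), (8, 151785801), (8, 151786053), (8, 151789770), (8, 168563331), (8, 185340105),
  (8, 185340294), (8, 185340483)]), (118264076, 6, [(1, 118788361), (1, 185373187), (1, 319566085),
  (1, 320360515), (1, 369897541), (1, 386674819), (2, 118247946), (2, 118252041), (2, 118263948),
  (2, 118264326), (2, 118268421), (2, 118792707), (2, 119050377), (2, 119812236), (2, 119812362),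
  (2, 119812614), (2, 119836806), (2, 186933381), (2, 186933507), (2, 218902794), (2, 319565958),
  (2, 320098371), (2, 353120325), (2, 386674755), (4, 118268419), (4, 118771852), (4, 119824645),
  (4, 185348236), (4, 185372806), (4, 185880838), (4, 185884933), (4, 185901187), (4, 186921094),
  (4, 252457033), (4, 252481603), (4, 254029891), (4, 353120323), (8, 118771974), (8, 118776069),
  (8, 185348232), (8, 185356422), (8, 185872518), (8, 185884803), (8, 252457029), (8, 252465219),
  (8, 252981315)]), (118264580, 6, [(1, 118788676), (1, 185372872), (1, 319566148), (1, 320360641),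
  (1, 369897793), (1, 386674882), (2, 118248072), (2, 118252104), (2, 118264200), (2, 118264452),
  (2, 118268232), (2, 118788738), (2, 118792392), (2, 119050818), (2, 119812488), (2, 119820930),
  (2, 119837058), (2, 186933444), (2, 186933570), (2, 218903172), (2, 319566210), (2, 320098497),
  (2, 353120577), (2, 386674881), (4, 118268104), (4, 118772482), (4, 119824708), (4, 185348866),
  (4, 185373058), (4, 185880964), (4, 185884996), (4, 185901250), (4, 186921346), (4, 252457537),
  (4, 252481729), (4, 254030017), (4, 353120449), (8, 118772100), (8, 118776132), (8, 185348610),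
  (8, 185356674), (8, 185872770), (8, 185884866), (8, 252457281), (8, 252465345), (8, 252981441)]),
  (120328460, 6, [(1, 122425477), (1, 122425603), (1, 122437699), (1, 122949763), (2, 120852618),
  (2, 122429571), (4, 88875139), (4, 187437190), (4, 188223619), (8, 120328326), (8, 121114755)]),
  (120328964, 6, [(1, 122425540), (1, 122425666), (1, 122437825), (1, 122949826), (2, 120853122),
  (2, 122429634), (4, 88875202), (4, 187437442), (4, 188223682), (8, 120328578), (8, 121114818)]),
  (51123086, 6, [(1, 51127117), (1, 51909451), (1, 52958023), (2, 84677073), (2, 84677325),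
  (2, 85201611), (2, 86250183), (4, 51122641), (4, 51122893), (4, 51647179), (4, 51647305),
  (4, 51651463), (4, 52695751), (8, 51647049)]), (51171470, 6, [(1, 51175501), (1, 51957835),
  (1, 53006407), (2, 84701265), (2, 84717645), (2, 85241931), (2, 86290503), (4, 51146833),
  (4, 51163213), (4, 51687499), (4, 51695689), (4, 51699847), (4, 52736071), (8, 51679305)]),
  (51172226, 6, [(1, 51176257), (1, 51958465), (1, 53006785), (2, 84702273), (2, 84718401),
  (2, 85242561), (2, 86290881), (4, 51147841), (4, 51163969), (4, 51688129), (4, 51696193),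
  (4, 51700162), (4, 52736449), (8, 51679809)]), (54268046, 6, [(1, 54272077), (2, 86773839),
  (2, 87822411), (4, 53219407), (4, 53743693), (4, 54267979), (8, 53219403)]),
  (54268298, 6, [(1, 54272329), (2, 85725393), (2, 87822537), (4, 52170961), (4, 54268105),
  (8, 52695369), (8, 53219529)]), (54268802, 6, [(1, 54272833), (2, 86774721), (2, 87823041),
  (4, 53220289), (4, 53744449), (4, 54268609), (8, 53220033)]), (54284426, 6, [(1, 54288457),
  (2, 85733457), (2, 87830601), (4, 52179025), (4, 54276169), (8, 52711497), (8, 53227593)]),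
  (54284930, 6, [(1, 54288961), (2, 85734465), (2, 87831105), (4, 52180033), (4, 54276673),
  (8, 52712001), (8, 53228097)]), (54317186, 6, [(1, 54321217), (2, 86831169), (2, 87863361),
  (4, 53276737), (4, 53792833), (4, 54308929), (8, 53260353)]), (252448910, 6, [(1, 252452941),
  (2, 185864271), (2, 252973131), (4, 185339983), (4, 218894413), (4, 252448843), (8, 185339979)]),
  (252449162, 6, [(1, 252453193), (2, 118755537), (2, 252973257), (4, 118231249), (4, 252448969),
  (8, 151785801), (8, 185340105)]), (252449666, 6, [(1, 252453697), (2, 185865153), (2, 252973761),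
  (4, 185340865), (4, 218895169), (4, 252449473), (8, 185340609)]), (252465290, 6, [(1, 252469321),
  (2, 118763601), (2, 252981321), (4, 118239313), (4, 252457033), (8, 151801929), (8, 185348169)]),
  (252465794, 6, [(1, 252469825), (2, 118764609), (2, 252981825), (4, 118240321), (4, 252457537),
  (8, 151802433), (8, 185348673)]), (252498050, 6, [(1, 252502081), (2, 185921601), (2, 253014081),
  (4, 185397313), (4, 218943553), (4, 252489793), (8, 185380929)]), (119280266, 6, [(1, 119284297),
  (2, 53219913), (2, 54792393), (2, 119280201), (2, 186912969), (4, 53743945), (4, 85725769),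
  (4, 88346821), (4, 119804233), (4, 220467397), (8, 153358533)]), (119312522, 6, [(1, 119316553),
  (2, 53252169), (2, 54800457), (2, 119312457), (2, 121909317), (4, 53760073), (4, 85758025),
  (4, 88354885), (4, 119820361), (4, 119836741), (8, 119820357)]), (119313026, 6, [(1, 119317057),
  (2, 53252673), (2, 54800961), (2, 119312961), (2, 186921537), (4, 53760577), (4, 85758529),
  (4, 88355137), (4, 119820865), (4, 220475713), (8, 153366849)]), (121376906, 6, [(1, 121376905),
  (1, 121377031), (1, 121389127), (2, 121380999), (4, 87826567)]), (121377410, 6, [(1, 121377220),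
  (1, 121377346), (1, 121389505), (2, 121381314), (4, 87826882)]), (121409666, 6, [(1, 121401412),
  (1, 121401601), (2, 121401474), (4, 87847042)]), (253497482, 6, [(1, 253497481), (1, 253497607),
  (1, 253509703), (2, 253501575), (4, 252977287)]), (253497986, 6, [(1, 253497796), (1, 253497922),
  (1, 253510081), (2, 253501890), (4, 252977602)]), (253530242, 6, [(1, 253521988), (1, 253522177),
  (2, 253522050), (4, 252997762)]), (255594626, 6, [(1, 255598657), (2, 189534273), (2, 255594561),
  (4, 222040129), (4, 255070273), (8, 187961409)]), (119280014, 6, [(1, 119279950), (1, 119292109),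
  (2, 119283918)]), (119280518, 6, [(1, 119280454), (1, 119292613), (2, 119284422)]),
  (119312774, 6, [(1, 119312773), (1, 119324995), (2, 119316867)]), (121377158, 6, [(1, 121377094),
  (1, 121389253), (2, 121381062)]), (253497734, 6, [(1, 253497670), (1, 253509829),
  (2, 253501638)])]

/-- The codes of the admissible monomials of degree `5` with an even exponent. -/
noncomputable def adm5 : List ℕ := [
  4163, 4289, 12353, 262211, 262337, 270401, 786497, 266243, 266369, 274433, 790529, 266306,
  266432, 274496, 790592, 16777283, 16777409, 16785473, 17301569, 50331713, 16781315, 16781441,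
  16789505, 17305601, 50335745, 16781378, 16781504, 16789568, 17305664, 50335808, 17039363,
  17039489, 17047553, 17563649, 50593793, 17039426, 17039552, 17047616, 17563712, 50593856,
  17043458, 17043584, 17051648, 17567744, 50597888]

/-- The codes of the admissible monomials of degree `15` with an even exponent. -/
noncomputable def adm15 : List ℕ := [
  15, 78, 960, 4110, 4236, 4992, 61440, 4551, 12615, 28743, 12741, 28869, 29121, 262158, 262284,
  263040, 270348, 270600, 271104, 319488, 3932160, 262599, 270663, 286791, 270789, 286917, 287169,
  786759, 802887, 1835079, 786885, 803013, 803265, 1835205, 1835457, 266631, 274695, 290823,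
  274821, 290949, 291201, 790791, 806919, 1839111, 790917, 807045, 807297, 1839237, 1839489,
  798981, 815109, 815361, 1847301, 1847553, 1863681, 266694, 274758, 290886, 274884, 291012,
  291264, 790854, 806982, 1839174, 790980, 807108, 807360, 1839300, 1839552, 799044, 815172,
  815424, 1847364, 1847616, 1863744, 16777230, 16777356, 16778112, 16785420, 16785672, 16786176,
  16834560, 17301516, 17301768, 17302272, 17317896, 17318400, 17350656, 17318148, 20447232,
  251658240, 16777671, 16785735, 16801863, 16785861, 16801989, 16802241, 17301831, 17317959,
  18350151, 17301957, 17318085, 17318337, 18350277, 18350529, 17309895, 17310147, 50331975,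
  50348103, 51380295, 117440583, 50332101, 50348229, 50348481, 51380421, 51380673, 117440709,
  117440961, 16781703, 16789767, 16805895, 16789893, 16806021, 16806273, 17305863, 17321991,
  18354183, 17305989, 17322117, 17322369, 18354309, 18354561, 17314053, 17330181, 17330433,
  18362373, 18362625, 18378753, 17313927, 17314179, 17330307, 50336007, 50352135, 51384327,
  117444615, 50336133, 50352261, 50352513, 51384453, 51384705, 117444741, 117444993, 50344197,
  50360325, 50360577, 51392517, 51392769, 51408897, 117452805, 117453057, 117469185, 16781766,
  16789830, 16805958, 16789956, 16806084, 16806336, 17305926, 17322054, 18354246, 17306052,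
  17322180, 17322432, 18354372, 18354624, 17314116, 17330244, 17330496, 18362436, 18362688,
  18378816, 17313990, 17314242, 17330370, 50336070, 50352198, 51384390, 117444678, 50336196,
  50352324, 50352576, 51384516, 51384768, 117444804, 117445056, 50344260, 50360388, 50360640,
  51392580, 51392832, 51408960, 117452868, 117453120, 117469248, 17039751, 17047815, 17063943,
  17047941, 17064069, 17064321, 17563911, 17580039, 18612231, 17564037, 17580165, 17580417,
  18612357, 18612609, 17572101, 17588229, 17588481, 18620421, 18620673, 18636801, 17571975,
  17572227, 17588355, 18620547, 50594055, 50610183, 51642375, 117702663, 50594181, 50610309,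
  50610561, 51642501, 51642753, 117702789, 117703041, 50602245, 50618373, 50618625, 51650565,
  51650817, 51666945, 117710853, 117711105, 117727233, 50602119, 50602371, 50618499, 51650691,
  117710979, 51118341, 51134469, 51134721, 52166661, 52166913, 52183041, 118226949, 118227201,
  118243329, 119275521, 17039814, 17047878, 17064006, 17048004, 17064132, 17064384, 17563974,
  17580102, 18612294, 17564100, 17580228, 17580480, 18612420, 18612672, 17572164, 17588292,
  17588544, 18620484, 18620736, 18636864, 17572038, 17572290, 17588418, 18620610, 50594118,
  50610246, 51642438, 117702726, 50594244, 50610372, 50610624, 51642564, 51642816, 117702852,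
  117703104, 50602308, 50618436, 50618688, 51650628, 51650880, 51667008, 117710916, 117711168,
  117727296, 50602182, 50602434, 50618562, 51650754, 117711042, 51118404, 51134532, 51134784,
  52166724, 52166976, 52183104, 118227012, 118227264, 118243392, 119275584, 17043846, 17051910,
  17068038, 17052036, 17068164, 17068416, 17568006, 17584134, 18616326, 17568132, 17584260,
  17584512, 18616452, 18616704, 17576196, 17592324, 17592576, 18624516, 18624768, 18640896,
  17576070, 17576322, 17592450, 18624642, 50598150, 50614278, 51646470, 117706758, 50598276,
  50614404, 50614656, 51646596, 51646848, 117706884, 117707136, 50606340, 50622468, 50622720,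
  51654660, 51654912, 51671040, 117714948, 117715200, 117731328, 50606214, 50606466, 50622594,
  51654786, 117715074, 51122436, 51138564, 51138816, 52170756, 52171008, 52187136, 118231044,
  118231296, 118247424, 119279616, 51122310, 51122562, 51138690, 52170882, 118231170]

/-- The rows of the admissible monomials with weight vector `(3, 2, 1, 1, 1)`. -/
noncomputable def adm35A : List ℕ := [
  7439393, 7440417, 7440450, 7504929, 7505953, 7505986, 7508001, 7508100, 7537697, 7538721,
  7538754, 7540769, 7540802, 7540868, 11633697, 11634721, 11634754, 11699233, 11700257, 11700290,
  11702305, 11702404, 11732001, 11733025, 11733058, 11735073, 11735106, 11735172, 11830305,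
  11831329, 11831362, 11833377, 11837473, 11837704, 11863073, 11864097, 11864130, 11866145,
  11866178, 11870241, 11870274, 11870472, 13730849, 13731873, 13731906, 13796385, 13797409,
  13797442, 13799457, 13799556, 13829153, 13830177, 13830210, 13832225, 13832258, 13832324,
  13927457, 13928481, 13928514, 13930529, 13930628, 13934625, 13934856, 13960225, 13961249,
  13961282, 13963297, 13963330, 13963396, 13967393, 13967426, 13967624, 14025761, 14026785,
  14026818, 14028833, 14028932, 14032929, 14033028, 14033160, 14779425, 14780449, 14780482,
  14844961, 14845985, 14846018, 14848033, 14848132, 14877729, 14878753, 14878786, 14880801,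
  14880834, 14880900, 14976033, 14977057, 14977090, 14979105, 14979204, 14983201, 14983432,
  15008801, 15009825, 15009858, 15011873, 15011906, 15011972, 15015969, 15016002, 15016200,
  15074337, 15075361, 15075394, 15077409, 15077442, 15077508, 15081505, 15081538, 15081604,
  15081736, 20022305, 20023329, 20023362, 20087841, 20088865, 20088898, 20090913, 20091012,
  20120609, 20121633, 20121666, 20123681, 20123714, 20123780, 20218913, 20219937, 20219970,
  20221985, 20222017, 20222018, 20222084, 20226081, 20226312, 20251681, 20252705, 20252738,
  20254753, 20254785, 20254786, 20254852, 20258849, 20258882, 20259080, 20481057, 20482081,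
  20482114, 20484129, 20488225, 20496417, 20496912, 20513825, 20514849, 20514882, 20516897,
  20516930, 20520993, 20521026, 20529185, 20529218, 20529680, 22119457, 22120481, 22120514,
  22184993, 22186017, 22186050, 22188065, 22188164, 22217761, 22218785, 22218818, 22220833,
  22220866, 22220932, 22316065, 22317089, 22317122, 22319137, 22319169, 22319170, 22319236,
  22323233, 22323464, 22348833, 22349857, 22349890, 22351905, 22351937, 22351938, 22352004,
  22356001, 22356034, 22356232, 22414369, 22415393, 22415426, 22417441, 22417473, 22417474,
  22417540, 22421537, 22421636, 22421768, 22578209, 22579233, 22579266, 22581281, 22581380,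
  22585377, 22593569, 22594064, 22610977, 22612001, 22612034, 22614049, 22614082, 22614148,
  22618145, 22618178, 22626337, 22626370, 22626832, 22676513, 22677537, 22677570, 22679585,
  22679684, 22683681, 22683780, 22691873, 22691972, 22692368, 23168033, 23169057, 23169090,
  23233569, 23234593, 23234626, 23236641, 23236740, 23266337, 23267361, 23267394, 23269409,
  23269442, 23269508, 23364641, 23365665, 23365698, 23367713, 23367745, 23367746, 23367812,
  23371809, 23372040, 23397409, 23398433, 23398466, 23400481, 23400513, 23400514, 23400580,
  23404577, 23404610, 23404808, 23462945, 23463969, 23464002, 23466017, 23466049, 23466050,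
  23466116, 23470113, 23470146, 23470212, 23470344, 23626785, 23627809, 23627842, 23629857,
  23629956, 23633953, 23642145, 23642640, 23659553, 23660577, 23660610, 23662625, 23662658,
  23662724, 23666721, 23666754, 23674913, 23674946, 23675408, 23725089, 23726113, 23726146,
  23728161, 23728194, 23728260, 23732257, 23732290, 23732356, 23740449, 23740482, 23740548,
  23740944, 26313761, 26314785, 26314818, 26379297, 26380321, 26380354, 26382369, 26382468,
  26412065, 26413089, 26413122, 26415137, 26415170, 26415236, 26510369, 26511393, 26511426,
  26513441, 26513473, 26513474, 26513540, 26517537, 26517768, 26543137, 26544161, 26544194,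
  26546209, 26546241, 26546242, 26546308, 26550305, 26550338, 26550536, 26608673, 26609697,
  26609730, 26611745, 26611777, 26611778, 26611844, 26615841, 26615873, 26615874, 26615940,
  26616072, 26772513, 26773537, 26773570, 26775585, 26775617, 26775618, 26775684, 26779681,
  26779912, 26787873, 26788368, 26805281, 26806305, 26806338, 26808353, 26808385, 26808386,
  26808452, 26812449, 26812482, 26812680, 26820641, 26820674, 26821136, 26870817, 26871841,
  26871874, 26873889, 26873921, 26873922, 26873988, 26877985, 26878017, 26878018, 26878084,
  26878216, 26886177, 26886209, 26886210, 26886276, 26886672, 27001889, 27002913, 27002946,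
  27004961, 27004993, 27004994, 27005060, 27009057, 27009288, 27017249, 27017480, 27017744,
  27362337, 27363361, 27363394, 27427873, 27428897, 27428930, 27430945, 27431044, 27460641,
  27461665, 27461698, 27463713, 27463746, 27463812, 27558945, 27559969, 27560002, 27562017,
  27562049, 27562050, 27562116, 27566113, 27566344, 27591713, 27592737, 27592770, 27594785,
  27594817, 27594818, 27594884, 27598881, 27598914, 27599112, 27657249, 27658273, 27658306,
  27660321, 27660353, 27660354, 27660420, 27664417, 27664449, 27664450, 27664516, 27664648,
  27821089, 27822113, 27822146, 27824161, 27824193, 27824194, 27824260, 27828257, 27828488,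
  27836449, 27836944, 27853857, 27854881, 27854914, 27856929, 27856961, 27856962, 27857028,
  27861025, 27861058, 27861256, 27869217, 27869250, 27869712, 27919393, 27920417, 27920450,
  27922465, 27922497, 27922498, 27922564, 27926561, 27926593, 27926594, 27926660, 27926792,
  27934753, 27934785, 27934786, 27934852, 27935248, 28050465, 28051489, 28051522, 28053537,
  28053569, 28053570, 28053636, 28057633, 28057666, 28057864, 28065825, 28065858, 28066056,
  28066320, 29459489, 29460513, 29460546, 29525025, 29526049, 29526082, 29528097, 29528196,
  29557793, 29558817, 29558850, 29560865, 29560898, 29560964, 29656097, 29657121, 29657154,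
  29659169, 29659201, 29659202, 29659268, 29663265, 29663496, 29688865, 29689889, 29689922,
  29691937, 29691969, 29691970, 29692036, 29696033, 29696066, 29696264, 29754401, 29755425,
  29755458, 29757473, 29757505, 29757506, 29757572, 29761569, 29761601, 29761602, 29761668,
  29761800, 29918241, 29919265, 29919298, 29921313, 29921345, 29921346, 29921412, 29925409,
  29925640, 29933601, 29934096, 29951009, 29952033, 29952066, 29954081, 29954113, 29954114,
  29954180, 29958177, 29958210, 29958408, 29966369, 29966402, 29966864, 30016545, 30017569,
  30017602, 30019617, 30019649, 30019650, 30019716, 30023713, 30023745, 30023746, 30023812,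
  30023944, 30031905, 30031937, 30031938, 30032004, 30032400, 30147617, 30148641, 30148674,
  30150689, 30150721, 30150722, 30150788, 30154785, 30154817, 30154818, 30154884, 30155016,
  30162977, 30163009, 30163010, 30163076, 30163208, 30163472]

/-- The codes of the admissible monomials of degree `35` with weight vector `(3, 4, …)`. -/
noncomputable def adm35B : List ℕ := [
  17330894, 51667343, 17588942, 18621134, 50619086, 51651278, 51667406, 51667910, 117711566,
  17592974, 17593226, 18625166, 18657422, 18625418, 18657674, 18658178, 50623118, 50623370,
  51655310, 51687566, 51655562, 51687818, 51688322, 51671438, 51671942, 51704198, 117715598,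
  117747854, 117715850, 117748106, 117748610, 51139214, 51139466, 51171722, 52171406, 52203662,
  52171658, 52203914, 52204418, 52187786, 52220042, 52220546, 52187534, 52188038, 52220294,
  54284678, 118231694, 118263950, 120328334, 118231946, 118264202, 118264706, 120328586, 120329090,
  118248074, 118280330, 118280834, 120344714, 120345218, 120377474, 118247822, 118248326,
  118280582, 120344966, 252465542]

theorem blockData_valid : allB chkBlock blockData = true := by decide +kernel

theorem monoData_valid : allB chkCert monoData = true := by decide +kernel

/-- A first row of fewer than five variables means that some exponent is even. The block equations
alone leave only members of `adm5`; no equations for single monomials are used. -/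
theorem cover5 : coverB (search (mkTabs blockData) 6 (topRows fun n => Nat.blt n 5) 0 0 5 [])
    (([] : List Cert).map Prod.fst) adm5 [] = true := by decide +kernel

theorem cover15 : coverB (search (mkTabs blockData) 6 (topRows fun n => Nat.blt n 5) 0 0 15 [])
    (([] : List Cert).map Prod.fst) adm15 [] = true := by decide +kernel

/-- Only first rows of size three are searched: the first weight is odd and below five, and first
weight one is settled by Wood's argument. Survivors of the block equations outside the two candidate
lists are removed by `monoData`. -/
theorem cover35 : coverB (search (mkTabs blockData) 6 (topRows fun n => Nat.beq n 3) 0 0 35 [])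
    (monoData.map Prod.fst) (adm35A.map fun i => wOf i 5) adm35B = true := by decide +kernel

end

end PolyAlg

/-! ### Linear functionals that vanish on the hit polynomials. -/

namespace PolyAlg

open MvPolynomial

variable {k : ℕ}

/-- A polynomial on which the total square is `g ↦ g + g² t`. -/
def IsLin (g : PolyAlg k) : Prop :=
  totalSq k g = Polynomial.C g + Polynomial.C (g ^ 2) * Polynomial.X

theorem isLin_X (i : Fin k) : IsLin (X i : PolyAlg k) := by simp [IsLin, totalSq]

theorem IsLin.zero : IsLin (0 : PolyAlg k) := by simp [IsLin]

theorem IsLin.add {f g : PolyAlg k} (hf : IsLin f) (hg : IsLin g) : IsLin (f + g) := by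
  rw [IsLin, map_add, hf, hg, CharTwo.add_sq, Polynomial.C_add, Polynomial.C_add]
  ring

/-- Total square and substitution are algebra homomorphisms, so they need only be compared on the
variables, where `IsLin` is the required identity. Linear substitutions therefore turn functionals
vanishing on hits into further ones. -/
theorem sq_aeval {g : Fin k → PolyAlg k} (hg : ∀ i, IsLin (g i)) (p : ℕ) (f : PolyAlg k) :
    sq k p (aeval g f) = aeval g (sq k p f) := by
  have h : (totalSq k).comp (aeval g) = (Polynomial.mapAlgHom (aeval g)).comp (totalSq k) := by
    refine MvPolynomial.algHom_ext fun i => ?_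
    rw [AlgHom.comp_apply, aeval_X, (hg i : totalSq k (g i) = _)]
    simp [totalSq]
  have h2 := congrArg (fun F => F.coeff p) (AlgHom.congr_fun h f)
  simpa [sq_apply] using h2

theorem hit_le_comap_aeval {g : Fin k → PolyAlg k} (hg : ∀ i, IsLin (g i)) :
    hit k ≤ (hit k).comap (aeval g : PolyAlg k →ₐ[ZMod 2] PolyAlg k).toLinearMap :=
  hit_le_of_sq_mem fun i hi f => by
    change aeval g (sq k i f) ∈ hit k
    rw [← sq_aeval hg]
    exact sq_mem_hit hi _

theorem coeff_xp (e n : Fin k → ℕ) [Decidable (n = e)] :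
    coeff (Finsupp.equivFunOnFinite.symm n) (xp e) = if n = e then 1 else 0 := by
  classical
  rw [xp_eq_monomial, coeff_monomial]
  simp only [EmbeddingLike.apply_eq_iff_eq, eq_comm (a := e)]

theorem xspan_univ : xspan (Set.univ : Set (Fin k → ℕ)) = ⊤ := by
  rw [eq_top_iff]
  intro f _
  rw [f.as_sum]
  refine Submodule.sum_mem _ fun s _ => ?_
  have : monomial s (coeff s f) = coeff s f • xp (⇑s) := by
    rw [xp_eq_monomial, smul_monomial, smul_eq_mul, mul_one, Finsupp.equivFunOnFinite_symm_coe]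
  rw [this]
  exact Submodule.smul_mem _ _ (xp_mem_xspan (Set.mem_univ _))

open Classical in
-- Only the increment `l = n - e` contributes to the coefficient at `n`, and by Lucas its product of
-- binomial coefficients is `0` or `1`.
theorem coeff_sq_xp (p : ℕ) (e n : Fin k → ℕ) :
    coeff (Finsupp.equivFunOnFinite.symm n) (sq k p (xp e)) =
      if n ∈ sqSupp p e then 1 else 0 := by
  have key : ∀ l : Fin k →₀ ℕ, coeff (Finsupp.equivFunOnFinite.symm n)
      ((∏ i, ((e i).choose (l i) : PolyAlg k)) * xp (e + ⇑l)) =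
      if n = e + ⇑l ∧ ∀ i, e i &&& l i = l i then 1 else 0 := by
    intro l
    have h1 : (∏ i, ((e i).choose (l i) : PolyAlg k)) =
        C (∏ i, ((e i).choose (l i) : ZMod 2)) := by simp
    rw [h1, coeff_C_mul, coeff_xp]
    by_cases h : ∀ i, e i &&& l i = l i
    · rw [Finset.prod_congr rfl fun i _ => (choose_cast_eq (e i) (l i)).trans (if_pos (h i))]
      simp [h]
    · rw [if_neg (show ¬(n = e + ⇑l ∧ ∀ i, e i &&& l i = l i) from fun h' => h h'.2)]
      push Not at h
      obtain ⟨i, hi⟩ := h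
      rw [Finset.prod_eq_zero (Finset.mem_univ i), zero_mul]
      rw [choose_cast_eq, if_neg hi]
  rw [sq_xp, coeff_sum]
  simp only [key]
  split_ifs with h
  · obtain ⟨l, hl, hl2, rfl⟩ := h
    rw [Finset.sum_eq_single (Finsupp.equivFunOnFinite.symm l), if_pos]
    · exact ⟨rfl, hl2⟩
    · intro l' _ hne
      rw [if_neg]
      rintro ⟨h, -⟩
      apply hne
      ext i
      have := congrFun h i
      simp at this
      simp [this]
    · intro h
      exact absurd (Finset.mem_finsuppAntidiag.2 ⟨by simpa [dg] using hl, Finset.subset_univ _⟩) h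
  · refine Finset.sum_eq_zero fun l hl => if_neg ?_
    rintro ⟨h1, h2⟩
    exact h ⟨l, (Finset.mem_finsuppAntidiag.1 hl).1, h2, h1⟩

theorem val_injective_of_lt {e f : Fin 5 → ℕ} (he : ∀ i, e i < 64) (hf : ∀ i, f i < 64)
    (h : val e = val f) : e = f := by
  rw [← dig_val he, h, dig_val hf]

theorem val_single (j : Fin 5) (b : ℕ) : val (Pi.single j b : Fin 5 → ℕ) = b * 64 ^ (j : ℕ) := by
  rw [val, Finset.sum_eq_single j]
  · simp
  · intro i _ hi; simp [hi]
  · simp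

theorem val_lt_of_support {l : Fin 5 → ℕ} (hl : ∀ i, l i < 64) {j : ℕ}
    (h : ∀ i : Fin 5, j ≤ i → l i = 0) : val l < 64 ^ j := by
  have h0 := hl 0
  have h1 := hl 1
  have h2 := hl 2
  have h3 := hl 3
  have h4 := hl 4
  have g0 := h 0
  have g1 := h 1
  have g2 := h 2
  have g3 := h 3
  have g4 := h 4
  rcases Nat.lt_or_ge j 5 with hj | hj
  · simp only [val, Fin.sum_univ_five]
    interval_cases j <;> simp at * <;> omega
  · exact (val_lt hl).trans_le (Nat.pow_le_pow_right (by norm_num) hj)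

/-- The numbers `b ≤ p` for which `Sqᵇ x^{v-b} = x^v`. -/
noncomputable def cand (v p : ℕ) : List ℕ :=
  Nat.rec [0] (fun b ih => Bool.rec ih (Nat.succ b :: ih)
    (Nat.beq (Nat.land (Nat.sub v (Nat.succ b)) (Nat.succ b)) (Nat.succ b))) p

theorem cand_succ (v p : ℕ) : cand v (p + 1) =
    if (v - (p + 1)) &&& (p + 1) = p + 1 then (p + 1) :: cand v p else cand v p := by
  change (Bool.rec (cand v p) ((p + 1) :: cand v p)
    (Nat.beq ((v - (p + 1)) &&& (p + 1)) (p + 1)) : List ℕ) = _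
  cases h : Nat.beq ((v - (p + 1)) &&& (p + 1)) (p + 1)
  · rw [if_neg (Nat.ne_of_beq_eq_false h)]
  · rw [if_pos (Nat.eq_of_beq_eq_true h)]

theorem mem_cand {v p b : ℕ} : b ∈ cand v p ↔ b ≤ p ∧ (v - b) &&& b = b := by
  induction p with
  | zero =>
    change b ∈ [0] ↔ _
    simp only [List.mem_singleton, Nat.le_zero_eq]
    exact ⟨fun h => by simp [h], fun h => h.1⟩
  | succ p ih =>
    rw [cand_succ]
    split_ifs with hc
    · rw [List.mem_cons, ih]
      constructor
      · rintro (rfl | h)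
        · exact ⟨le_rfl, hc⟩
        · exact ⟨h.1.trans (Nat.le_succ p), h.2⟩
      · rintro ⟨h1, h2⟩
        rcases Nat.le_succ_iff.1 h1 with h | h
        · exact Or.inr ⟨h, h2⟩
        · exact Or.inl h
    · rw [ih]
      refine ⟨fun h => ⟨h.1.trans (Nat.le_succ p), h.2⟩, fun h => ⟨?_, h.2⟩⟩
      rcases Nat.le_succ_iff.1 h.1 with h' | rfl
      · exact h'
      · exact absurd h.2 hc

theorem nodup_cand (v p : ℕ) : (cand v p).Nodup := by
  induction p with
  | zero => exact List.nodup_singleton 0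
  | succ p ih =>
    rw [cand_succ]
    split_ifs
    · refine List.nodup_cons.2 ⟨fun h => ?_, ih⟩
      have := (mem_cand.1 h).1
      omega
    · exact ih

/-- The numbers `x + val l` with `l` supported on the first `k` entries, of degree `p`, for which
`Sqᵖ` of the monomial `n - l` contains `n`. -/
noncomputable def preL (n : ℕ) : ℕ → ℕ → ℕ → List ℕ
  | 0, p, x => if p = 0 then [x] else []
  | k + 1, p, x =>
    (cand (n / 64 ^ k % 64) p).flatMap fun b => preL n k (p - b) (x + b * 64 ^ k)

/-- A version of `preL` for evaluation. -/
noncomputable def preT (n k : ℕ) : ℕ → ℕ → List ℕ → List ℕ :=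
  Nat.rec (motive := fun _ => ℕ → ℕ → List ℕ → List ℕ)
    (fun p x rest => Bool.rec rest (x :: rest) (Nat.beq p 0))
    (fun k ih p x rest =>
      List.rec rest (fun b _ ihl =>
          ih (Nat.sub p b) (Nat.add x (Nat.shiftLeft b (Nat.mul 6 k))) ihl)
        (force (Nat.land (Nat.shiftRight n (Nat.mul 6 k)) 63) fun v => force p (cand v))) k

theorem preT_eq (n k p x : ℕ) (rest : List ℕ) : preT n k p x rest = preL n k p x ++ rest := by
  induction k generalizing p x rest with
  | zero =>
    change (Bool.rec rest (x :: rest) (Nat.beq p 0) : List ℕ) = _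
    cases h : Nat.beq p 0
    · simp [preL, Nat.ne_of_beq_eq_false h]
    · simp [preL, Nat.eq_of_beq_eq_true h]
  | succ k ih =>
    have e1 : Nat.land (Nat.shiftRight n (Nat.mul 6 k)) 63 = n / 64 ^ k % 64 := by
      rw [shift_land]
      change n / 2 ^ (6 * k) % 64 = _
      rw [pow_mul]; norm_num
    change (List.rec rest (fun b _ ihl =>
      preT n k (Nat.sub p b) (Nat.add x (Nat.shiftLeft b (Nat.mul 6 k))) ihl)
        (force (Nat.land (Nat.shiftRight n (Nat.mul 6 k)) 63) fun v => force p (cand v)) :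
          List ℕ) = _
    rw [e1, force_eq, force_eq, preL]
    induction cand (n / 64 ^ k % 64) p with
    | nil => simp
    | cons b l ihl =>
      have e2 : Nat.add x (Nat.shiftLeft b (Nat.mul 6 k)) = x + b * 64 ^ k := by
        change x + b <<< (6 * k) = _
        rw [Nat.shiftLeft_eq, pow_mul]; norm_num
      simp only [e2, ih, List.flatMap_cons, List.append_assoc] at ihl ⊢
      rw [← ihl]
      rfl

/-- The list runs `Sq^p` backwards from the monomial `n`: an increment `l` is recorded when its
digits are among those of `n - l`. Induction separates the share of the last variable. -/
theorem mem_preL {n k p x z : ℕ} (hk : k ≤ 5) : z ∈ preL n k p x ↔ ∃ l : Fin 5 → ℕ,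
    (∀ i : Fin 5, k ≤ i → l i = 0) ∧ dg l = p ∧ (∀ i, (dig n i - l i) &&& l i = l i) ∧
      z = x + val l := by
  induction k generalizing p x with
  | zero =>
    have : z ∈ preL n 0 p x ↔ p = 0 ∧ z = x := by
      rw [preL]; split_ifs with h <;> simp [h]
    rw [this]
    constructor
    · rintro ⟨rfl, rfl⟩
      exact ⟨0, by simp, by simp [dg], by simp, by simp [val]⟩
    · rintro ⟨l, h, rfl, -, rfl⟩
      obtain rfl : l = 0 := funext fun i => h i (Nat.zero_le _)
      simp [dg, val]
  | succ k ih =>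
    obtain ⟨j, rfl⟩ : ∃ j : Fin 5, (j : ℕ) = k := ⟨⟨k, by omega⟩, rfl⟩
    have hdef : preL n (j + 1) p x =
        (cand (dig n j) p).flatMap fun b => preL n j (p - b) (x + b * 64 ^ (j : ℕ)) := rfl
    rw [hdef, List.mem_flatMap]
    constructor
    · rintro ⟨b, hb, hz⟩
      obtain ⟨l, h1, h2, h3, rfl⟩ := (ih (by omega)).1 hz
      obtain ⟨hb1, hb2⟩ := mem_cand.1 hb
      refine ⟨l + Pi.single j b, fun i hi => ?_, ?_, fun i => ?_, ?_⟩
      · rw [Pi.add_apply, h1 i (by omega), Pi.single_eq_of_ne (fun h => by rw [h] at hi; omega),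
          add_zero]
      · rw [dg_add, h2, dg_single]; omega
      · by_cases hi : i = j
        · subst hi
          rw [Pi.add_apply, h1 i le_rfl, Pi.single_eq_same, zero_add]
          exact hb2
        · rw [Pi.add_apply, Pi.single_eq_of_ne hi, add_zero]
          exact h3 i
      · rw [val_add, val_single]; omega
    · rintro ⟨l, h1, h2, h3, rfl⟩
      have hl : l = Function.update l j 0 + Pi.single j (l j) := by
        funext i
        by_cases hi : i = j
        · subst hi; simp
        · simp [hi]
      have hdeg : p = dg (Function.update l j 0) + l j := by
        rw [← h2]; conv_lhs => rw [hl, dg_add, dg_single]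
      refine ⟨l j, mem_cand.2 ⟨by omega, h3 j⟩, (ih (by omega)).2
        ⟨Function.update l j 0, fun i hi => ?_, by omega, fun i => ?_, ?_⟩⟩
      · by_cases hij : i = j
        · subst hij; simp
        · rw [Function.update_of_ne hij]
          exact h1 i (by have : (i : ℕ) ≠ j := fun h => hij (Fin.ext h); omega)
      · by_cases hij : i = j
        · subst hij; simp
        · rw [Function.update_of_ne hij]
          exact h3 i
      · conv_lhs => rw [hl, val_add, val_single]
        ring

theorem le_of_sub_and_eq {v b : ℕ} (h : (v - b) &&& b = b) : b ≤ v := by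
  by_contra hlt
  rw [Nat.sub_eq_zero_of_le (by omega), Nat.zero_and] at h
  omega

/-- Different shares `b` of the last variable give codes in disjoint intervals of length `64 ^ k`,
since the lower digits contribute less than that. Without repetitions, multiplicity modulo two is
the indicator function. -/
theorem nodup_preL {n k p x : ℕ} (hk : k ≤ 5) : (preL n k p x).Nodup := by
  induction k generalizing p x with
  | zero => rw [preL]; split_ifs <;> simp
  | succ k ih =>
    rw [preL, List.nodup_flatMap]
    refine ⟨fun b _ => ih (by omega), (nodup_cand _ _).imp ?_⟩
    intro b c hbc z hb hc
    have key : ∀ l : Fin 5 → ℕ, (∀ i : Fin 5, k ≤ i → l i = 0) →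
        (∀ i, (dig n i - l i) &&& l i = l i) → val l < 64 ^ k := fun l h1 h2 =>
      val_lt_of_support (fun i => (le_of_sub_and_eq (h2 i)).trans_lt (Nat.mod_lt _ (by norm_num))) h1
    obtain ⟨l, h1, -, h2, rfl⟩ := (mem_preL (by omega)).1 hb
    obtain ⟨l', h1', -, h2', h⟩ := (mem_preL (by omega)).1 hc
    have g1 := key l h1 h2
    have g2 := key l' h1' h2'
    apply hbc
    rcases lt_trichotomy b c with h' | h' | h'
    · nlinarith
    · exact h'
    · nlinarith

/-- The sum of the coefficients at the monomials with codes in `F`. -/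
noncomputable def cf (F : List ℕ) : PolyAlg 5 →ₗ[ZMod 2] ZMod 2 :=
  (F.map fun x => lcoeff (ZMod 2) (Finsupp.equivFunOnFinite.symm (dig x))).sum

theorem cf_apply (F : List ℕ) (u : PolyAlg 5) :
    cf F u = (F.map fun x => coeff (Finsupp.equivFunOnFinite.symm (dig x)) u).sum := by
  induction F with
  | nil => simp [cf]
  | cons x F ih =>
    rw [List.map_cons, List.sum_cons, ← ih]
    simp [cf]

/-- Verification that `cf F` vanishes on the image of `Sqᵖ`. -/
noncomputable def chkSq (F : List ℕ) (p : ℕ) : Bool :=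
  List.rec true (fun _ _ _ => false) (List.rec (motive := fun _ => List ℕ) []
    (fun x _ ih => mrg (preT x 5 p (Nat.sub 1073741823 x) []) ih) F : List ℕ)

/-- A preimage `e` is stored through the complement of its code. As `val e = x - val l`, the
complement is obtained from that of `x` by adding `val l`, so the enumeration produces decreasing
lists, as `mrg` expects. -/
theorem mem_preL_iff {x p : ℕ} (hx : x < 64 ^ 5) {e : Fin 5 → ℕ} (he : ∀ i, e i < 64) :
    64 ^ 5 - 1 - val e ∈ preL x 5 p (64 ^ 5 - 1 - x) ↔ dig x ∈ sqSupp p e := by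
  have hev := val_lt he
  rw [mem_preL le_rfl]
  constructor
  · rintro ⟨l, -, h2, h3, h4⟩
    have hle : ∀ i, l i ≤ dig x i := fun i => le_of_sub_and_eq (h3 i)
    have hx64 : ∀ i, dig x i < 64 := fun i => Nat.mod_lt _ (by norm_num)
    have e1 : dig x = (fun i => dig x i - l i) + l := by
      funext i; have := hle i; simp only [Pi.add_apply]; omega
    have e2 := val_dig hx
    rw [e1, val_add] at e2
    have e3 : e = fun i => dig x i - l i :=
      val_injective_of_lt he (fun i => (Nat.sub_le _ _).trans_lt (hx64 i)) (by omega)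
    refine ⟨l, h2, fun i => ?_, ?_⟩
    · rw [e3]; exact h3 i
    · rw [e3]; exact e1
  · rintro ⟨l, h1, h2, h3⟩
    refine ⟨l, fun i hi => absurd i.2 (by omega), h1, fun i => ?_, ?_⟩
    · rw [h3, Pi.add_apply, Nat.add_sub_cancel]; exact h2 i
    · have e2 := val_dig hx
      rw [h3, val_add] at e2
      omega

/-- This is the transposed computation: `cf F` of `Sq^p x^e` counts, modulo two, how often `e`
occurs among the preimages of the members of `F`. An empty merged list says that all preimages
cancel. -/
theorem cf_sq_eq_zero {F : List ℕ} (hF : ∀ x ∈ F, x < 64 ^ 5) {p : ℕ} (h : chkSq F p = true)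
    (e : Fin 5 → ℕ) : cf F (sq 5 p (xp e)) = 0 := by
  classical
  rw [cf_apply]
  simp only [coeff_sq_xp]
  by_cases he : ∀ i, e i < 64
  · have key : ∀ x < 64 ^ 5, (if dig x ∈ sqSupp p e then 1 else 0 : ZMod 2) =
        ((preL x 5 p (64 ^ 5 - 1 - x)).map fun z => if z = 64 ^ 5 - 1 - val e then 1 else 0).sum := by
      intro x hx
      rw [List.sum_map_ite_eq, ← mem_preL_iff hx he]
      by_cases hm : 64 ^ 5 - 1 - val e ∈ preL x 5 p (64 ^ 5 - 1 - x)
      · rw [if_pos hm, List.count_eq_one_of_mem (nodup_preL le_rfl) hm]; simp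
      · rw [if_neg hm, List.count_eq_zero_of_not_mem hm]; simp
    rw [List.map_congr_left fun x hx => key x (hF x hx)]
    have hs : ∀ G : List ℕ, (G.map fun x => ((preL x 5 p (64 ^ 5 - 1 - x)).map
        fun z => if z = 64 ^ 5 - 1 - val e then (1 : ZMod 2) else 0).sum).sum =
        ((List.rec (motive := fun _ => List ℕ) []
          (fun x _ ih => mrg (preT x 5 p (Nat.sub 1073741823 x) []) ih) G : List ℕ).map
            fun z => if z = 64 ^ 5 - 1 - val e then (1 : ZMod 2) else 0).sum := by
      intro G
      induction G with
      | nil => rfl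
      | cons x G ih =>
        rw [List.map_cons, List.sum_cons, ih, sum_mrg, preT_eq, List.append_nil]
        rfl
    rw [hs]
    unfold chkSq at h
    generalize (List.rec (motive := fun _ => List ℕ) []
      (fun x _ ih => mrg (preT x 5 p (Nat.sub 1073741823 x) []) ih) F : List ℕ) = R at h
    cases R with
    | nil => rfl
    | cons a R => exact absurd h (by simp)
  -- A square only increases exponents, so an exponent of at least `64` in `e` excludes every coded
  -- monomial.
  · refine List.sum_eq_zero fun y hy => ?_
    obtain ⟨x, -, rfl⟩ := List.mem_map.1 hy
    refine if_neg ?_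
    rintro ⟨l, -, -, hl⟩
    apply he
    intro i
    have := congrFun hl i
    have h2 : dig x i < 64 := Nat.mod_lt _ (by norm_num)
    rw [this] at h2
    exact (Nat.le_add_right _ _).trans_lt h2

/-- Verification that `cf F` vanishes on hit polynomials. -/
noncomputable def chkF (F : List ℕ) : Bool :=
  andB (allB (fun x => andB (Nat.blt x 1073741824) (Nat.blt (dgN x) 64)) F)
    (andB (chkSq F 1) (andB (chkSq F 2) (andB (chkSq F 4) (andB (chkSq F 8) (chkSq F 16)))))

theorem le_dg_of_sqSupp {p : ℕ} {e c : Fin k → ℕ} (h : c ∈ sqSupp p e) : 2 * p ≤ dg c := by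
  obtain ⟨l, rfl, hl, rfl⟩ := h
  have : dg l ≤ dg e := Finset.sum_le_sum fun i _ => le_of_and_eq (hl i)
  rw [dg_add]
  omega

/-- It suffices to treat squares of index a power of two. A monomial occurring in `Sq^p` of
something has degree at least `2 p`, so in degrees below `64` only `p = 1, 2, 4, 8, 16` can matter.
-/
theorem hit_le_ker_cf {F : List ℕ} (h : chkF F = true) : hit 5 ≤ LinearMap.ker (cf F) := by
  simp only [chkF, andB_eq_true, allB_eq_true] at h
  obtain ⟨hF, h1, h2, h4, h8, h16⟩ := h
  have hlt : ∀ x ∈ F, x < 64 ^ 5 := fun x hx => Nat.le_of_ble_eq_true (hF x hx).1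
  have key : ∀ r e, cf F (sq 5 (2 ^ r) (xp e)) = 0 := by
    intro r e
    rcases Nat.lt_or_ge r 5 with hr | hr
    · interval_cases r
      exacts [cf_sq_eq_zero hlt h1 e, cf_sq_eq_zero hlt h2 e, cf_sq_eq_zero hlt h4 e,
        cf_sq_eq_zero hlt h8 e, cf_sq_eq_zero hlt h16 e]
    · classical
      rw [cf_apply]
      refine List.sum_eq_zero fun y hy => ?_
      obtain ⟨x, hx, rfl⟩ := List.mem_map.1 hy
      rw [coeff_sq_xp, if_neg]
      intro hmem
      have g1 := le_dg_of_sqSupp hmem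
      have g2 : dgN x < 64 := Nat.le_of_ble_eq_true (hF x hx).2
      rw [dgN_eq] at g2
      have g3 := Nat.pow_le_pow_right (show 0 < 2 by norm_num) hr
      omega
  refine hit_le_of_sq_two_pow_mem fun r f => ?_
  have : (⊤ : Submodule (ZMod 2) (PolyAlg 5)) ≤
      (LinearMap.ker (cf F)).comap (sq 5 (2 ^ r)) := by
    rw [← xspan_univ, xspan_le]
    exact fun e _ => key r e
  exact this Submodule.mem_top

end PolyAlg

/-! ### Linear independence by Gaussian elimination on bit strings. -/

namespace PolyAlg

open MvPolynomial

/-- The sum of the `c j` over the `j < n` for which the binary digit of `r` at `s + j` is `1`. -/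
noncomputable def dotc (n s : ℕ) (c : ℕ → ZMod 2) (r : ℕ) : ZMod 2 :=
  ∑ j ∈ Finset.range n, if r.testBit (s + j) then c j else 0

theorem dotc_succ (n s : ℕ) (c : ℕ → ZMod 2) (r : ℕ) : dotc (n + 1) s c r =
    dotc n (s + 1) (fun j => c (j + 1)) r + if r.testBit s then c 0 else 0 := by
  rw [dotc, Finset.sum_range_succ', dotc]
  simp only [add_assoc, add_comm 1, add_zero]

theorem dotc_xor (n s : ℕ) (c : ℕ → ZMod 2) (r p : ℕ) :
    dotc n s c (r ^^^ p) = dotc n s c r + dotc n s c p := by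
  rw [dotc, dotc, dotc, ← Finset.sum_add_distrib]
  refine Finset.sum_congr rfl fun j _ => ?_
  rw [Nat.testBit_xor]
  cases r.testBit (s + j) <;> cases p.testBit (s + j) <;> simp [CharTwo.add_self_eq_zero]

/-- `List.map` followed by a continuation, with evaluation of the entries. -/
noncomputable def mapK {α : Type} (f : α → ℕ) (l : List α) : (List ℕ → Bool) → Bool :=
  List.rec (motive := fun _ => (List ℕ → Bool) → Bool) (fun c => c [])
    (fun a _ ih c => force (f a) fun y => ih fun l => c (y :: l)) l

theorem mapK_eq {α : Type} (f : α → ℕ) (l : List α) (c : List ℕ → Bool) :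
    mapK f l c = c (l.map f) := by
  induction l generalizing c with
  | nil => rfl
  | cons a l ih =>
    change force (f a) (fun y => mapK f l fun l => c (y :: l)) = _
    rw [force_eq, ih, List.map_cons]

/-- Elimination of the digit of `r` at `s` by means of `p`. -/
noncomputable def elimRow (s p r : ℕ) : ℕ := Bool.rec r (Nat.xor r p) (testB r s)

/-- Gaussian elimination with the given order of pivots, on the columns `s, …, s + n - 1`. -/
noncomputable def gauss (n : ℕ) : ℕ → List ℕ → Bool :=
  Nat.rec (motive := fun _ => ℕ → List ℕ → Bool) (fun _ _ => true)
    (fun _ ih s rows => List.rec (motive := fun _ => Bool) false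
      (fun p rest _ => Bool.rec false
        (force (Nat.succ s) fun s' => mapK (elimRow s p) rest (ih s')) (testB p s)) rows) n

/-- The order of the rows prescribes the pivots: the first row must have a `1` in the current column
and clears that column in the others. Induction makes the later coefficients zero, and the equation
of the pivot row then gives `c 0 = 0`. -/
theorem gauss_spec {n s : ℕ} {rows : List ℕ} (h : gauss n s rows = true) (c : ℕ → ZMod 2)
    (hc : ∀ r ∈ rows, dotc n s c r = 0) : ∀ j < n, c j = 0 := by
  induction n generalizing s rows c with
  | zero => intro j hj; omega
  | succ n ih =>
    cases rows with
    | nil => exact absurd h (by simp [gauss])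
    | cons p rest =>
      change (Bool.rec false (force (Nat.succ s) fun s' => mapK (elimRow s p) rest (gauss n s'))
        (testB p s) : Bool) = true at h
      cases hp : testB p s
      · rw [hp] at h; simp at h
      · rw [hp, force_eq] at h
        replace h : gauss n (s + 1) (rest.map (elimRow s p)) = true := (mapK_eq _ _ _).symm.trans h
        rw [testB_eq] at hp
        have hp0 := hc p List.mem_cons_self
        have hc' := ih h (fun j => c (j + 1)) (by
          intro r' hr'
          obtain ⟨r, hr, rfl⟩ := List.mem_map.1 hr'
          have hr0 := hc r (List.mem_cons_of_mem _ hr)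
          cases ho : testB r s
          · have e : elimRow s p r = r := by rw [elimRow, ho]
            rw [testB_eq] at ho
            rw [dotc_succ, ho] at hr0
            rw [e]
            simpa using hr0
          · have e : elimRow s p r = r ^^^ p := by rw [elimRow, ho]; rfl
            rw [testB_eq] at ho
            have h2 : dotc (n + 1) s c (r ^^^ p) = 0 := by rw [dotc_xor, hr0, hp0, add_zero]
            rw [dotc_succ, Nat.testBit_xor, ho, hp] at h2
            rw [e]
            simpa using h2)
        intro j hj
        cases j with
        | succ j => exact hc' j (by omega)
        | zero =>
          rw [dotc_succ, hp, if_pos rfl] at hp0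
          have : dotc n (s + 1) (fun j => c (j + 1)) p = 0 :=
            Finset.sum_eq_zero fun j hj => by
              simp [hc' j (Finset.mem_range.1 hj)]
          rwa [this, zero_add] at hp0

/-- The number `r`, shifted by `32` digits, with a checksum in the gap. -/
noncomputable def pad (r : ℕ) : ℕ := Nat.add (Nat.shiftLeft r 32) (Nat.mod r 4294967291)

/-- `4294967291` is below `2^32`, so the checksum stays out of the columns from `32` on, where the
elimination takes place. -/
theorem testBit_pad (r j : ℕ) : (pad r).testBit (32 + j) = r.testBit j := by
  have h1 : pad r = 2 ^ 32 * r + r % 4294967291 := by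
    change r <<< 32 + r % 4294967291 = _
    rw [Nat.shiftLeft_eq, mul_comm]
  have h2 : r % 4294967291 < 2 ^ 32 := (Nat.mod_lt _ (by norm_num)).trans (by norm_num)
  rw [h1, Nat.testBit_two_pow_mul_add _ h2, if_neg (by omega), Nat.add_sub_cancel_left]

/-- `r` lists the values on `m 0, …, m (n - 1)` of a functional that vanishes on `W`. -/
def IsRow (W : Submodule (ZMod 2) (PolyAlg 5)) (n : ℕ) (m : ℕ → PolyAlg 5) (r : ℕ) : Prop :=
  ∃ φ : PolyAlg 5 →ₗ[ZMod 2] ZMod 2, W ≤ LinearMap.ker φ ∧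
    ∀ j < n, φ (m j) = if r.testBit j then 1 else 0

/-- Each functional kills a relation modulo `W` and so yields one linear equation for its
coefficients. -/
theorem eq_zero_of_gauss {W : Submodule (ZMod 2) (PolyAlg 5)} {n : ℕ} {m : ℕ → PolyAlg 5}
    {rows : List ℕ} (hrows : ∀ r ∈ rows, IsRow W n m r) (h : gauss n 32 (rows.map pad) = true)
    {c : ℕ → ZMod 2} (hc : ∑ j ∈ Finset.range n, c j • m j ∈ W) : ∀ j < n, c j = 0 := by
  refine gauss_spec h c fun r' hr' => ?_
  obtain ⟨r, hr, rfl⟩ := List.mem_map.1 hr'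
  obtain ⟨φ, h1, h2⟩ := hrows r hr
  have h3 : φ (∑ j ∈ Finset.range n, c j • m j) = 0 := h1 hc
  rw [map_sum] at h3
  refine (Finset.sum_congr rfl fun j hj => ?_).trans h3
  rw [map_smul, h2 j (Finset.mem_range.1 hj), testBit_pad]
  split_ifs <;> simp

/-! ### Permuted sparse functionals -/

/-- Six times the image of `i` under the permutation with code `q`. -/
noncomputable def amt (q i : ℕ) : ℕ := Nat.land (Nat.shiftRight q (Nat.mul 5 i)) 31

/-- The code of the monomial with exponent vector `i ↦ x (σ i)`, `σ` being coded by `q`. -/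
noncomputable def pcode (q x : ℕ) : ℕ :=
  Nat.add (Nat.land (Nat.shiftRight x (amt q 0)) 63)
    (Nat.add (Nat.shiftLeft (Nat.land (Nat.shiftRight x (amt q 1)) 63) 6)
      (Nat.add (Nat.shiftLeft (Nat.land (Nat.shiftRight x (amt q 2)) 63) 12)
        (Nat.add (Nat.shiftLeft (Nat.land (Nat.shiftRight x (amt q 3)) 63) 18)
          (Nat.shiftLeft (Nat.land (Nat.shiftRight x (amt q 4)) 63) 24))))

/-- Whether `q` is the code of a permutation. -/
noncomputable def isPerm (q : ℕ) : Bool :=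
  Nat.beq (Nat.lor (Nat.shiftLeft 1 (amt q 0)) (Nat.lor (Nat.shiftLeft 1 (amt q 1))
    (Nat.lor (Nat.shiftLeft 1 (amt q 2)) (Nat.lor (Nat.shiftLeft 1 (amt q 3))
      (Nat.shiftLeft 1 (amt q 4)))))) 17043521

/-- The bits of `17043521` are `0, 6, 12, 18, 24`. The test says that the five shift amounts exhaust
these, so the resulting self-map of `Fin 5` is surjective, hence bijective. -/
theorem exists_perm {q : ℕ} (h : isPerm q = true) :
    ∃ σ : Equiv.Perm (Fin 5), ∀ i : Fin 5, amt q i = 6 * (σ i : ℕ) := by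
  have h1 : (1 <<< amt q 0 ||| (1 <<< amt q 1 ||| (1 <<< amt q 2 ||| (1 <<< amt q 3 |||
    1 <<< amt q 4)))) = 17043521 := Nat.eq_of_beq_eq_true h
  have h2 : ∀ t, Nat.testBit 17043521 t ↔ ∃ i : Fin 5, amt q i = t := by
    intro t
    rw [← h1]
    simp only [Nat.testBit_or, Nat.one_shiftLeft, Nat.testBit_two_pow, Bool.or_eq_true,
      decide_eq_true_eq, Fin.exists_fin_succ]
    simp
  have h3 : ∀ i : Fin 5, ∃ j : Fin 5, amt q i = 6 * (j : ℕ) := by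
    intro i
    have hlt : amt q i < 32 := by
      have : amt q i = _ % 32 := Nat.and_two_pow_sub_one_eq_mod _ 5
      omega
    have := (h2 _).2 ⟨i, rfl⟩
    revert this
    have key : ∀ a < 32, Nat.testBit 17043521 a → ∃ j : Fin 5, a = 6 * (j : ℕ) := by decide
    exact key _ hlt
  choose σ hσ using h3
  have hsurj : Function.Surjective σ := by
    intro j
    have key : ∀ j : Fin 5, Nat.testBit 17043521 (6 * (j : ℕ)) := by decide
    obtain ⟨i, hi⟩ := (h2 _).1 (key j)
    refine ⟨i, Fin.ext ?_⟩
    have := hσ i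
    omega
  exact ⟨Equiv.ofBijective σ (Finite.surjective_iff_bijective.1 hsurj), hσ⟩

theorem pcode_eq {q : ℕ} {σ : Equiv.Perm (Fin 5)} (hσ : ∀ i : Fin 5, amt q i = 6 * (σ i : ℕ))
    (x : ℕ) : pcode q x = val fun i => dig x (σ i) := by
  have key : ∀ i : Fin 5, Nat.land (Nat.shiftRight x (amt q i)) 63 = dig x (σ i) := by
    intro i
    have h64 : (2 : ℕ) ^ (6 * (σ i : ℕ)) = 64 ^ (σ i : ℕ) := by rw [pow_mul]; norm_num
    simp only [shift_land, hσ i, h64, dig]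
  have key' : ∀ (n : ℕ) (hn : n < 5),
      Nat.land (Nat.shiftRight x (amt q n)) 63 = dig x (σ ⟨n, hn⟩) := fun n hn => key ⟨n, hn⟩
  have sh : ∀ a b, Nat.shiftLeft a b = a * 2 ^ b := fun a b => Nat.shiftLeft_eq a b
  delta pcode
  rw [key' 0 (by norm_num), key' 1 (by norm_num), key' 2 (by norm_num),
    key' 3 (by norm_num), key' 4 (by norm_num), sh, sh, sh, sh, val, Fin.sum_univ_five]
  generalize dig x = d
  have e : ∀ a0 a1 a2 a3 a4 : ℕ, Nat.add a0 (Nat.add (a1 * 2 ^ 6) (Nat.add (a2 * 2 ^ 12)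
      (Nat.add (a3 * 2 ^ 18) (a4 * 2 ^ 24)))) =
        a0 * 64 ^ 0 + a1 * 64 ^ 1 + a2 * 64 ^ 2 + a3 * 64 ^ 3 + a4 * 64 ^ 4 := by
    intro a0 a1 a2 a3 a4
    simp only [Nat.add_eq]
    ring
  exact e _ _ _ _ _

theorem aeval_perm_xp (σ : Equiv.Perm (Fin 5)) (e : Fin 5 → ℕ) :
    aeval (fun i => (X (σ i) : PolyAlg 5)) (xp e) = xp (e ∘ σ.symm) := by
  simp only [xp, map_prod, map_pow, aeval_X, Function.comp]
  exact Fintype.prod_equiv σ _ _ fun i => by simp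

/-- The values, coded as digits, of a permuted sparse functional. -/
noncomputable def rowS (look : ℕ → ℕ) (q : ℕ) (F : List ℕ) : ℕ :=
  List.rec 0 (fun x _ ih => Nat.xor (look (pcode q x)) ih) F

/-- Permuting the variables commutes with the squares, so the composite still vanishes on hits; on
`xspan T` it vanishes because no member of `F` is a permutation of a member of `T`. Its value at
`mon j` is the parity of the number of `x ∈ F` whose permuted code is `mon j`, and the exclusive or
of the look-ups records this parity in bit `j`. -/
theorem isRow_rowS {T : Set (Fin 5 → ℕ)} {n : ℕ} {mon : ℕ → ℕ} {look : ℕ → ℕ}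
    (hmon : ∀ j < n, mon j < 64 ^ 5)
    (hlook : ∀ j < n, ∀ y < 64 ^ 5, (look y).testBit j = decide (y = mon j))
    {q : ℕ} (hq : isPerm q = true) {F : List ℕ} (hF : chkF F = true)
    (hT : ∀ x ∈ F, ∀ e ∈ T, ∀ σ : Equiv.Perm (Fin 5), dig x ≠ e ∘ σ) :
    IsRow (hit 5 ⊔ xspan T) n (fun j => xp (dig (mon j))) (rowS look q F) := by
  obtain ⟨σ, hσ⟩ := exists_perm hq
  let g : PolyAlg 5 →ₐ[ZMod 2] PolyAlg 5 := aeval fun i => (X (σ i) : PolyAlg 5)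
  refine ⟨(cf F).comp g.toLinearMap, sup_le (fun u hu => ?_) (xspan_le.2 fun e he => ?_),
    fun j hj => ?_⟩
  · rw [LinearMap.mem_ker]
    exact hit_le_ker_cf hF (hit_le_comap_aeval (fun i => isLin_X (σ i)) hu)
  · rw [LinearMap.mem_ker]
    change cf F (aeval (fun i => (X (σ i) : PolyAlg 5)) (xp e)) = 0
    rw [aeval_perm_xp, cf_apply]
    refine List.sum_eq_zero fun z hz => ?_
    obtain ⟨x, hx, rfl⟩ := List.mem_map.1 hz
    rw [coeff_xp, if_neg (hT x hx e he σ.symm)]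
  · change cf F (aeval (fun i => (X (σ i) : PolyAlg 5)) (xp (dig (mon j)))) = _
    rw [aeval_perm_xp, cf_apply]
    clear hF hT
    induction F with
    | nil => simp [rowS]
    | cons x F ih =>
      have hrow : rowS look q (x :: F) = look (pcode q x) ^^^ rowS look q F := rfl
      have h64 : ∀ i, dig x (σ i) < 64 := fun i => Nat.mod_lt _ (by norm_num)
      have hlt : pcode q x < 64 ^ 5 := by rw [pcode_eq hσ]; exact val_lt h64
      have hx : (dig x = dig (mon j) ∘ σ.symm) ↔ pcode q x = mon j := by
        rw [pcode_eq hσ]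
        constructor
        · intro h
          rw [h]
          simp only [Function.comp, Equiv.symm_apply_apply]
          exact val_dig (hmon j hj)
        · intro h
          rw [← h, dig_val h64]
          funext i; simp
      rw [List.map_cons, List.sum_cons, ih, hrow, Nat.testBit_xor, hlook j hj _ hlt, coeff_xp]
      simp only [hx]
      by_cases h1 : pcode q x = mon j <;> cases (rowS look q F).testBit j <;>
        simp [h1, CharTwo.add_self_eq_zero]

/-! ### Search trees -/

/-- Binary search trees. -/
inductive Tree : Type
  | leaf : Tree
  | node (l : Tree) (key v : ℕ) (r : Tree) : Tree

/-- The value stored at `y`, or `0`. -/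
noncomputable def Tree.look (t : Tree) (y : ℕ) : ℕ :=
  Tree.rec 0 (fun _ key v _ ihl ihr =>
    Bool.rec (Bool.rec ihr ihl (Nat.ble y key)) v (Nat.beq y key)) t

/-- The keys of a tree. -/
def Tree.keys : Tree → List ℕ
  | leaf => []
  | node l key _ r => key :: (l.keys ++ r.keys)

/-- No ordering of the tree is assumed: a nonzero answer is returned only at a node whose key is
`y`. That the stored answers are right is tested separately by `chkLook`. -/
theorem Tree.look_eq_zero_or (t : Tree) (y : ℕ) : t.look y = 0 ∨ y ∈ t.keys := by
  induction t with
  | leaf => exact Or.inl rfl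
  | node l key v r ihl ihr =>
    change (Bool.rec (Bool.rec (r.look y) (l.look y) (Nat.ble y key)) v (Nat.beq y key) : ℕ) = 0 ∨ _
    cases h : Nat.beq y key
    · cases Nat.ble y key
      · exact ihr.imp_right fun h => by simp [keys, h]
      · exact ihl.imp_right fun h => by simp [keys, h]
    · right
      simp [keys, Nat.eq_of_beq_eq_true h]

/-- Insertion followed by a continuation. -/
noncomputable def Tree.insK (key v : ℕ) (t : Tree) : (Tree → Bool) → Bool :=
  Tree.rec (motive := fun _ => (Tree → Bool) → Bool) (fun c => c (node leaf key v leaf))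
    (fun l key' v' r ihl ihr c => Bool.rec (ihr fun r' => c (node l key' v' r'))
      (ihl fun l' => c (node l' key' v' r)) (Nat.ble key key')) t

/-- Only the absence of foreign keys has to be known about the new tree. -/
theorem Tree.insK_eq (key v : ℕ) (t : Tree) (c : Tree → Bool) :
    ∃ t', insK key v t c = c t' ∧ t'.keys ⊆ key :: t.keys := by
  induction t generalizing c with
  | leaf => exact ⟨_, rfl, by simp [keys]⟩
  | node l key' v' r ihl ihr =>
    have h : insK key v (node l key' v' r) c = Bool.rec
      (insK key v r fun r' => c (node l key' v' r'))
      (insK key v l fun l' => c (node l' key' v' r)) (Nat.ble key key') := rfl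
    rw [h]
    cases Nat.ble key key'
    · obtain ⟨t', h1, h2⟩ := ihr fun r' => c (node l key' v' r')
      refine ⟨_, h1, fun z hz => ?_⟩
      have h3 := @h2 z
      simp only [keys, List.mem_cons, List.mem_append] at hz h3 ⊢
      tauto
    · obtain ⟨t', h1, h2⟩ := ihl fun l' => c (node l' key' v' r)
      refine ⟨_, h1, fun z hz => ?_⟩
      have h3 := @h2 z
      simp only [keys, List.mem_cons, List.mem_append] at hz h3 ⊢
      tauto

/-- An injective function that scatters the codes of monomials. -/
noncomputable def scatter (y : ℕ) : ℕ :=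
  Nat.add (Nat.shiftLeft (Nat.mod (Nat.mul y 2654435761) 4294967291) 30) y

/-- Since `64 ^ 5 = 2 ^ 30`, the low thirty bits of `scatter y` are `y` itself. -/
theorem scatter_inj {y z : ℕ} (hy : y < 64 ^ 5) (hz : z < 64 ^ 5) (h : scatter y = scatter z) :
    y = z := by
  have key : ∀ m w, Nat.add (Nat.shiftLeft m 30) w = w + 64 ^ 5 * m := fun m w => by
    change m <<< 30 + w = _
    rw [Nat.shiftLeft_eq, add_comm, mul_comm, show 2 ^ 30 = 64 ^ 5 by norm_num]
  have h2 := congrArg (· % 64 ^ 5) h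
  simp only [scatter] at h2
  rwa [key, key, Nat.add_mul_mod_self_left, Nat.add_mul_mod_self_left, Nat.mod_eq_of_lt hy,
    Nat.mod_eq_of_lt hz] at h2

/-- The tree in which the entries of `L` have the values `v, 2 v, 4 v, …`, with a continuation. -/
noncomputable def Tree.buildK (L : List ℕ) : ℕ → Tree → (Tree → Bool) → Bool :=
  List.rec (motive := fun _ => ℕ → Tree → (Tree → Bool) → Bool) (fun _ t c => c t)
    (fun m _ ih v t c => force (scatter m) fun m' => insK m' v t fun t' => force (Nat.mul 2 v) fun v' => ih v' t' c) L

theorem Tree.buildK_eq (L : List ℕ) (v : ℕ) (t : Tree) (c : Tree → Bool) :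
    ∃ t', buildK L v t c = c t' ∧ t'.keys ⊆ L.map scatter ++ t.keys := by
  induction L generalizing v t with
  | nil => exact ⟨t, rfl, by simp⟩
  | cons m L ih =>
    obtain ⟨t1, h1, h2⟩ := insK_eq (scatter m) v t fun t' => force (Nat.mul 2 v) fun v' => buildK L v' t' c
    rw [force_eq] at h1
    obtain ⟨t2, h3, h4⟩ := ih (Nat.mul 2 v) t1
    have h0 : buildK (m :: L) v t c = force (scatter m) fun m' =>
      insK m' v t fun t' => force (Nat.mul 2 v) fun v' => buildK L v' t' c := rfl
    rw [force_eq] at h0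
    refine ⟨t2, h0.trans (h1.trans h3), fun z hz => ?_⟩
    have h5 := @h2 z
    have h6 := h4 hz
    simp only [List.map_cons, List.mem_append, List.mem_cons] at h5 h6 ⊢
    tauto

/-- Whether the entries of `L` have the values `v, 2 v, 4 v, …`. -/
noncomputable def chkLook (look : ℕ → ℕ) (L : List ℕ) : ℕ → Bool :=
  List.rec (motive := fun _ => ℕ → Bool) (fun _ => true)
    (fun m _ ih v => andB (andB (Nat.blt m 1073741824) (Nat.beq (look m) v))
      (force (Nat.mul 2 v) ih)) L

theorem chkLook_spec {look : ℕ → ℕ} {L : List ℕ} {v : ℕ} (h : chkLook look L v = true) :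
    ∀ j < L.length, L.getD j 0 < 64 ^ 5 ∧ look (L.getD j 0) = 2 ^ j * v := by
  induction L generalizing v with
  | nil => simp
  | cons m L ih =>
    change andB (andB (Nat.blt m 1073741824) (Nat.beq (look m) v))
      (force (Nat.mul 2 v) (chkLook look L)) = true at h
    rw [andB_eq_true, andB_eq_true, force_eq] at h
    intro j hj
    cases j with
    | zero =>
      simp only [List.getD_cons_zero, pow_zero, one_mul]
      exact ⟨Nat.le_of_ble_eq_true h.1.1, Nat.eq_of_beq_eq_true h.1.2⟩
    | succ j =>
      obtain ⟨h1, h2⟩ := ih h.2 j (by simpa using hj)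
      simp only [List.getD_cons_succ]
      refine ⟨h1, h2.trans ?_⟩
      change 2 ^ j * (2 * v) = _
      ring

/-- The `i`-th list of `R`. -/
noncomputable def nthF (R : List (List ℕ)) : ℕ → List ℕ :=
  List.rec (motive := fun _ => ℕ → List ℕ) (fun _ => [])
    (fun F _ ih i => Nat.rec F (fun m _ => ih m) i) R

theorem nthF_mem (R : List (List ℕ)) (i : ℕ) : nthF R i = [] ∨ nthF R i ∈ R := by
  induction R generalizing i with
  | nil => exact Or.inl rfl
  | cons F R ih =>
    cases i with
    | zero => exact Or.inr List.mem_cons_self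
    | succ i => exact (ih i).imp_right (List.mem_cons_of_mem _)

/-- Look-up of a monomial in a tree. -/
noncomputable def Tree.find (t : Tree) (y : ℕ) : ℕ := force (scatter y) t.look

/-- Verification that the functionals given by `ord` are independent on the monomials in `L`. -/
noncomputable def chkIndep (R : List (List ℕ)) (ord : List (ℕ × ℕ)) (L : List ℕ) : Bool :=
  Tree.buildK L 1 Tree.leaf fun t => andB (chkLook t.find L 1)
    (andB (allB (fun c => isPerm c.2) ord)
      (mapK (fun c => rowS t.find c.2 (nthF R c.1)) ord fun rows =>
        mapK pad rows (gauss L.length 32)))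

theorem eq_zero_of_chkIndep {T : Set (Fin 5 → ℕ)} {R : List (List ℕ)} {ord : List (ℕ × ℕ)} {L : List ℕ}
    (hR : allB chkF R = true)
    (hT : ∀ F ∈ R, ∀ x ∈ F, ∀ e ∈ T, ∀ σ : Equiv.Perm (Fin 5), dig x ≠ e ∘ σ)
    (h : chkIndep R ord L = true) {c : ℕ → ZMod 2}
    (hc : ∑ j ∈ Finset.range L.length, c j • xp (dig (L.getD j 0)) ∈ hit 5 ⊔ xspan T) :
    ∀ j < L.length, c j = 0 := by
  obtain ⟨t, ht, hkeys⟩ := Tree.buildK_eq L 1 Tree.leaf fun t => andB (chkLook t.find L 1)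
    (andB (allB (fun c => isPerm c.2) ord)
      (mapK (fun c => rowS t.find c.2 (nthF R c.1)) ord fun rows =>
        mapK pad rows (gauss L.length 32)))
  rw [chkIndep, ht, andB_eq_true, andB_eq_true, mapK_eq, mapK_eq] at h
  obtain ⟨h1, h2, h3⟩ := h
  have h1' := chkLook_spec h1
  simp only [mul_one] at h1'
  refine eq_zero_of_gauss (m := fun j => xp (dig (L.getD j 0))) ?_ h3 hc
  intro r hr
  obtain ⟨⟨i, q⟩, hq, rfl⟩ := List.mem_map.1 hr
  refine isRow_rowS (fun j hj => (h1' j hj).1) ?_ (allB_eq_true.1 h2 _ hq) ?_ ?_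
  · intro j hj y hy64
    rw [Bool.eq_iff_iff, decide_eq_true_eq]
    constructor
    · intro hb
      rw [Tree.find, force_eq] at hb
      -- A nonzero answer shows that `y` is an entry of `L`, say the `i`-th. The answer is then `2 ^
      -- i`, and its bit `j` is set only for `i = j`.
      rcases t.look_eq_zero_or (scatter y) with h0 | hy
      · rw [h0] at hb; simp at hb
      · have hyL : scatter y ∈ L.map scatter := by simpa [Tree.keys] using hkeys hy
        obtain ⟨z, hzL, hz⟩ := List.mem_map.1 hyL
        obtain ⟨i, hi, rfl⟩ := List.getElem_of_mem hzL
        rw [← List.getD_eq_getElem (d := 0)] at hz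
        obtain rfl := scatter_inj (h1' i hi).1 hy64 hz
        have h4 := (h1' i hi).2
        rw [Tree.find, force_eq] at h4
        rw [h4, Nat.testBit_two_pow, decide_eq_true_eq] at hb
        rw [hb]
    · rintro rfl
      rw [(h1' j hj).2, Nat.testBit_two_pow_self]
  -- An index out of range gives the empty list, hence the zero functional, which is harmless.
  · rcases nthF_mem R i with h0 | h0
    · simp only [h0]; decide +kernel
    · exact allB_eq_true.1 hR _ h0
  · rcases nthF_mem R i with h0 | h0
    · simp only [h0]; simp
    · exact hT _ h0

end PolyAlg

/-! ### Data for the lower bounds: sparse functionals and their permutations. -/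

namespace PolyAlg

section

set_option maxRecDepth 100000

/-- Sparse functionals that vanish on the hit polynomials of degree `5`. -/
noncomputable def reps5 : List (List ℕ) := [
  [50597888], [17305664, 33820736]]

/-- Pairs of the index of a functional in `reps5` and the code of a permutation. -/
noncomputable def ord5 : List (ℕ × ℕ) := [
  (0, 6310296), (0, 6310668), (0, 6316620), (0, 6881688), (0, 6882060), (1, 805254), (0, 7078476),
  (0, 6893592), (1, 799302), (0, 6905868), (0, 7096332), (1, 798930), (0, 6894336), (0, 6906240),
  (0, 7096704), (0, 19071384), (0, 19071756), (1, 25184646), (1, 25756038), (0, 25363020),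
  (0, 19083288), (1, 25178694), (0, 19095564), (1, 25767942), (0, 25380876), (1, 25178322),
  (0, 19084032), (0, 19095936), (1, 25768128), (0, 25381248), (0, 19273752), (1, 25559622),
  (1, 25577478), (0, 19666956), (0, 25761804), (1, 25559250), (0, 19274496), (1, 25577664),
  (0, 19667328), (0, 25762176), (1, 25565202), (1, 25565760), (0, 19292352), (0, 19673280),
  (0, 25768128)]

theorem reps5_valid : allB chkF reps5 = true := by decide +kernel

theorem indep5 : chkIndep reps5 ord5 adm5 = true := by decide +kernel

/-- Sparse functionals that vanish on the hit polynomials of degree `15`. -/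
noncomputable def reps15 : List (List ℕ) := [
  [119279616], [251658240], [118247424, 118763520], [118231170, 118235202, 118235265, 118755393],
  [118243392, 118759488, 119017536, 118239360], [51667008, 51925056, 84697152, 85471296, 101470272,
  101986368], [51654786, 51916866, 51916929, 84684930, 101462082, 101462145, 51662913, 84693057],
  [51392832, 51400896, 84422976, 84431040, 100938048, 100946112, 51130752, 51142848], [117711105,
  117719169, 117969153, 117981249, 118493313, 118497345, 117973185, 117977217, 118235265,
  117707073, 117723201, 118755393], [20447232, 36962304, 53477376, 69992448, 86507520, 103022592,
  119537664, 136052736, 152567808, 169082880, 185597952, 202113024, 218628096, 235143168],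
  [51650817, 51658881, 51908865, 51920961, 84680961, 84689025, 85463169, 85467201, 101454081,
  101466177, 101978241, 101982273, 51912897, 51916929, 101458113, 101462145, 51646785, 51662913,
  84676929, 84693057], [51392769, 51400833, 51404865, 84422913, 84430977, 84435009, 100937985,
  100946049, 100950081, 51130626, 51142785, 51392706, 84422850, 84684930, 100937922, 101462082,
  101462145, 51662913, 85209153, 84684993], [17350656, 17866752, 18382848, 18898944, 19415040,
  19931136, 33865728, 34639872, 34897920, 35672064, 35930112, 36704256, 51412992, 52445184,
  67411968, 67670016, 67928064, 69218304, 69476352, 69734400, 84443136, 85991424, 100958208,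
  102764544, 134504448, 134762496, 135020544, 135278592, 135536640, 135794688, 151535616,
  152051712, 168050688, 168824832, 201596928, 201854976, 68186112, 68444160, 68702208, 68960256,
  84959232, 85475328, 101732352, 101990400, 118505472, 34123776, 34381824, 36188160, 36446208,
  50896896, 52961280, 168308736, 168566784, 185081856, 35155968, 35414016, 51929088, 101216256,
  101474304, 102248448, 102506496, 117989376, 119021568, 17092608, 18124800, 19156992, 20189184,
  84185088, 86249472, 151277568, 152309760, 218370048, 85217280, 17608704, 19673088, 50638848,
  51154944, 52703232, 53219328, 151793664, 184823808, 185339904], [17318400, 17334528, 17834496,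
  17858688, 18882816, 18890880, 33833472, 33849600, 34607616, 34635840, 35655936, 35668032,
  67379712, 67403904, 67637760, 67665984, 69210240, 69214272, 134488320, 134496384, 134746368,
  134758464, 135270528, 135274560, 17842560, 17850624, 18366720, 34619712, 34623744, 34881792,
  51396864, 67387776, 67395840, 67649856, 67653888, 67911936, 68161920, 68165952, 68169984,
  68174016, 68178048, 68182080, 68428032, 68436096, 68686080, 68698176, 84427008, 84943104,
  84951168, 100942080, 101716224, 101728320, 17310336, 17342592, 19406976, 33825408, 33857664,
  34083456, 34087488, 34091520, 34111680, 34115712, 34119744, 34349568, 34373760, 35659968,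
  35664000, 35922048, 36180096, 36184128, 50864640, 50888832, 52437120, 134750400, 134754432,
  135012480, 151527552, 168042624, 168300672, 168304704, 17326464, 18358656, 18374784, 33841536,
  34095552, 34099584, 34103616, 34107648, 34357632, 34365696, 34611648, 34615680, 34627776,
  34631808, 34873728, 34889856, 35131776, 35135808, 35139840, 35143872, 35147904, 35151936,
  35397888, 35405952, 50872704, 50880768, 51388800, 51404928, 51912960, 51921024, 67641792,
  67645824, 67657920, 67661952, 67903872, 67920000, 68690112, 68694144, 68952192, 84418944,
  84435072, 85467264, 100934016, 100950144, 101192064, 101196096, 101200128, 101204160, 101208192,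
  101212224, 101458176, 101466240, 101720256, 101724288, 101982336, 102240384, 102244416,
  117973248, 117981312, 118497408, 17044224, 17056320, 17060352, 17072448, 17076480, 17088576,
  17830464, 17862720, 18092544, 18120768, 18878784, 18894912, 19140864, 19152960, 19927104,
  67375680, 67407936, 69472320, 84152832, 84181056, 85987392, 134484288, 134500416, 135532608,
  151261440, 151273536, 152047680, 201592896, 17846592, 18104640, 18108672, 67391808, 68424000,
  68440128, 84164928, 84168960, 84939072, 84955200, 85201152, 85213248, 17048256, 17052288,
  17080512, 17084544, 17306304, 17314368, 17338560, 17346624, 17568384, 17572416, 17576448,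
  17596608, 17600640, 17604672, 18886848, 19144896, 19148928, 19402944, 19411008, 19665024,
  19669056, 33821376, 33829440, 33853632, 33861696, 34345536, 34377792, 35918016, 35926080,
  36442176, 50598528, 50602560, 50606592, 50626752, 50630784, 50634816, 50860608, 50892864,
  51122688, 51150912, 52433088, 52441152, 52695168, 52699200, 52957248, 134492352, 135008448,
  135016512, 151265472, 151269504, 151523520, 151531584, 151785600, 151789632, 168038592,
  168046656, 168562752, 184815744, 184819776, 185077824, 33837504, 33845568, 34361664, 34869696,
  34877760, 34885824, 34893888, 35393856, 35409984, 50876736, 51658944, 51662976, 51908928,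
  67383744, 67399872, 67899840, 67907904, 67915968, 67924032, 68432064, 68948160, 68956224,
  84681024, 84685056, 84947136, 85463232, 100929984, 100938048, 100946112, 100954176, 101470272,
  101986368, 102502464, 117969216, 117985344, 118493376, 118501440, 119017536, 34353600, 34369728,
  35401920, 51130752, 51142848, 117977280], [17318148, 17834244, 17842308, 17842434, 33833220,
  34607364, 34619460, 34619649, 67379460, 67387524, 67387650, 67637508, 67649604, 67649793,
  68161668, 68161794, 68165700, 68165889, 68173890, 68173953, 17309832, 17310210, 17334402,
  18882690, 33824904, 33825282, 33849474, 34082952, 34083330, 34086984, 34087425, 34111554,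
  34111617, 35655810, 35659842, 35659905, 134488194, 134746242, 134750274, 134750337, 17309958,
  17310084, 17318022, 17318274, 17326212, 17326338, 17834118, 17834370, 17850498, 18358404,
  18358530, 18366594, 33825030, 33825156, 33833094, 33833346, 33841284, 33841410, 34083078,
  34083204, 34087173, 34087236, 34091268, 34095174, 34095237, 34095300, 34095363, 34095426,
  34095489, 34099332, 34099458, 34103364, 34103553, 34349316, 34357380, 34357506, 34607238,
  34607490, 34611270, 34611333, 34611396, 34611459, 34611522, 34611585, 34615428, 34615554,
  34619523, 34619586, 34623618, 34627650, 34627713, 34873476, 34873602, 34881666, 35131524,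
  35131650, 35135556, 35135745, 35143746, 35143809, 50864388, 50872452, 50872578, 51388548,
  51388674, 51396738, 67379334, 67379586, 67395714, 67637382, 67637634, 67641414, 67641477,
  67641540, 67641603, 67641666, 67641729, 67645572, 67645698, 67649667, 67649730, 67653762,
  67657794, 67657857, 67903620, 67903746, 67911810, 68165763, 68165826, 68169858, 68427906,
  68685954, 68689986, 68690049, 84418692, 84418818, 84426882, 84942978, 100933764, 100933890,
  100941954, 101191812, 101191938, 101195844, 101196033, 101204034, 101204097, 101716098,
  101720130, 101720193, 34087047, 34087110, 34087299, 34087362, 34091142, 34091394, 34103427,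
  34103490, 34107522, 34349190, 34349442, 34365570, 35135619, 35135682, 35139714, 35397762,
  50864262, 50864514, 50880642, 51912834, 101195907, 101195970, 101200002, 101458050, 117973122,
  17043720, 17043972, 17055816, 17056257, 17072196, 17072385, 17829960, 17830401, 17858625,
  18878532, 18878721, 18890817, 67375176, 67375617, 67403841, 69210177, 134484036, 134484225,
  134496321, 135270465, 17056005, 17056068, 17060100, 17830149, 17830212, 17842245, 17842497,
  17846340, 17846529, 18092292, 18104388, 18104577, 67375365, 67375428, 67387461, 67387713,
  67391556, 67391745, 68161605, 68161857, 68177985, 68423748, 68423937, 68436033, 84152580,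
  84164676, 84164865, 84938820, 84939009, 84951105, 17043594, 17044098, 17047626, 17047689,
  17047752, 17048067, 17048130, 17048193, 17051784, 17052162, 17072259, 17072322, 17076354,
  17080386, 17080449, 17305674, 17305737, 17305800, 17306115, 17306178, 17306241, 17309769,
  17310273, 17313864, 17314305, 17334339, 17334465, 17338434, 17338497, 17342529, 17567880,
  17568258, 17571912, 17572353, 17596482, 17596545, 18878595, 18878658, 18882627, 18882753,
  18886722, 18886785, 19140738, 19144770, 19144833, 19402818, 19402881, 19406913, 33820746,
  33820809, 33820872, 33821187, 33821250, 33821313, 33824841, 33825345, 33828936, 33829377,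
  33849411, 33849537, 33853506, 33853569, 33857601, 34082889, 34083393, 34115649, 34345032,
  34345473, 34373697, 35655747, 35655873, 35663937, 35917890, 35917953, 35921985, 36180033,
  50598024, 50598402, 50602056, 50602497, 50626626, 50626689, 50860104, 50860545, 50888769,
  52432962, 52433025, 52437057, 134484099, 134484162, 134488131, 134488257, 134492226, 134492289,
  134746179, 134746305, 134754369, 135008322, 135008385, 135012417, 151261314, 151265346,
  151265409, 151523394, 151523457, 151527489, 168038466, 168038529, 168042561, 168300609, 17318211,
  17322243, 17322306, 17326401, 17580291, 17580354, 17584386, 17834181, 17838213, 17838276,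
  17850561, 18096261, 18096324, 18100356, 18358341, 18366531, 33820935, 33821124, 33829125,
  33829188, 33833031, 33833157, 33833409, 33837252, 33837378, 33841473, 33845316, 33845505,
  34345221, 34345284, 34357317, 34361412, 34607175, 34607427, 34607553, 34615617, 34623555,
  34631745, 34869381, 34869507, 34877697, 34881729, 35131461, 35393604, 35393793, 35405889,
  50610435, 50610498, 50614530, 50860293, 50860356, 50872389, 50876484, 51388485, 51388737,
  51396675, 51400833, 51646722, 51658818, 51658881, 51908676, 51920961, 67375239, 67375554,
  67379271, 67379523, 67379649, 67383492, 67383618, 67391619, 67391682, 67395777, 67399746,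
  67399809, 67637319, 67637445, 67637697, 67645509, 67653825, 67661889, 67899525, 67899651,
  67903809, 67915905, 68423811, 68423874, 68427843, 68431938, 68685891, 68948034, 68948097,
  68952129, 84156549, 84156612, 84160644, 84418629, 84422913, 84426819, 84426945, 84676740,
  84680772, 84680961, 84938883, 84938946, 84942915, 84947010, 85463106, 85467201, 100929669,
  100929795, 101191749, 101453892, 101466177, 101716035, 101978178, 101982273, 117968964,
  117969153, 117981249, 118493250, 118493313, 118497345, 17326275, 18358467, 33824967, 33825219,
  33828999, 33829314, 33841347, 33845379, 33845442, 34083015, 34083267, 34091079, 34091331,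
  34091457, 34107459, 34107585, 34345095, 34345410, 34349127, 34349253, 34349505, 34353285,
  34353348, 34353411, 34353474, 34357443, 34361538, 34365633, 34369602, 34369665, 34615491,
  34877571, 35131587, 35139651, 35393667, 35393730, 35397699, 35397825, 35401794, 35401857,
  50864451, 50868420, 50868483, 50872515, 50876547, 50880705, 51126405, 51126531, 51134595,
  51392643, 51908739, 51912771, 51916929, 67645635, 67903683, 84418755, 84680898, 84684930,
  100937859, 101191875, 101199939, 101462145, 117969027, 117969090, 117973059, 117973185,
  117977154, 117977217, 17043531, 17043657, 17044035, 17044161, 17051721, 17052225, 17076291,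
  17076417, 17084481, 17567817, 17568321, 17600577, 19140675, 19140801, 19148865, 19664961,
  50597961, 50598465, 50630721, 52695105, 151261251, 151261377, 151269441, 151785537, 184815681,
  17060037, 18092355, 18108483, 18108609, 51646785, 84152517, 84160581, 84160833, 84693057,
  85200963, 84676803, 84684867]]

/-- Pairs of the index of a functional in `reps15` and the code of a permutation. -/
noncomputable def ord15 : List (ℕ × ℕ) := [
  (1, 19273752), (9, 12780306), (1, 19274496), (9, 12804114), (12, 6316620), (9, 12804672),
  (1, 19292352), (0, 6304530), (2, 6310296), (0, 6316434), (2, 6310668), (2, 6316620),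
  (0, 6316620), (9, 13375506), (12, 7078476), (9, 13376064), (12, 7096332), (13, 805254),
  (12, 7096704), (9, 13387968), (1, 19673280), (0, 6685458), (4, 209496), (4, 411864), (4, 209682),
  (5, 221772), (4, 412422), (2, 6881688), (4, 602328), (0, 7078290), (2, 6882060), (7, 805254),
  (4, 602886), (2, 7078476), (0, 7078476), (4, 399960), (4, 215448), (0, 6709266), (7, 614790),
  (4, 221586), (4, 418374), (4, 596376), (2, 6893592), (0, 7090194), (5, 793164), (7, 418374),
  (5, 805254), (4, 792978), (4, 799302), (7, 799302), (2, 6905868), (4, 614790), (2, 7096332),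
  (4, 805254), (0, 7096332), (4, 400146), (7, 602886), (4, 418002), (4, 215820), (4, 221772),
  (0, 6709824), (7, 412422), (5, 805068), (4, 798930), (4, 596748), (7, 798930), (2, 6894336),
  (4, 793164), (0, 7090752), (7, 418002), (4, 614604), (2, 6906240), (4, 805068), (2, 7096704),
  (0, 7096704), (9, 25565202), (12, 25363020), (9, 25565760), (12, 25380876), (13, 25184646),
  (12, 25381248), (9, 25577664), (12, 25761804), (13, 25756038), (12, 25762176), (13, 25767942),
  (13, 25768128), (12, 25768128), (14, 25768128), (9, 25768128), (1, 25768128), (0, 12780306),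
  (4, 6304344), (4, 12601560), (4, 6304530), (5, 6316620), (4, 12602118), (4, 6685272),
  (8, 19273752), (4, 13172952), (4, 6685458), (10, 400146), (8, 19274496), (5, 7078476),
  (4, 13173510), (3, 12780120), (3, 12780306), (2, 19071384), (4, 18886872), (4, 19267800),
  (0, 25362834), (2, 19071756), (7, 25184646), (4, 18887430), (7, 25756038), (4, 19268358),
  (2, 25363020), (0, 25363020), (4, 12589656), (4, 6310296), (0, 12804114), (7, 18899334),
  (4, 6316434), (4, 12608070), (8, 19267800), (4, 6703128), (4, 13178904), (10, 12780306),
  (11, 614604), (10, 12804672), (10, 13369554), (11, 19667328), (10, 418002), (4, 6709266),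
  (8, 19292352), (5, 7096332), (10, 13387968), (4, 13197318), (3, 12797976), (6, 6316620),
  (3, 12804114), (4, 18880920), (2, 19083288), (4, 19273752), (0, 25374738), (5, 25172556),
  (7, 12608070), (5, 25184646), (10, 25559250), (10, 25565760), (4, 25172370), (4, 25178694),
  (7, 25178694), (2, 19095564), (4, 18899334), (7, 25767942), (11, 25768128), (4, 19292166),
  (2, 25380876), (4, 25184646), (0, 25380876), (4, 12589842), (7, 18887430), (4, 12607698),
  (4, 6310668), (4, 6316620), (0, 12804672), (11, 19071756), (10, 12804114), (11, 19666956),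
  (8, 19268358), (10, 418374), (4, 6703872), (10, 13369926), (4, 13179648), (11, 614790),
  (8, 19292166), (4, 6709824), (10, 13387782), (5, 7096704), (4, 13197504), (6, 6316434),
  (3, 12798720), (3, 12804672), (7, 12602118), (5, 25184460), (10, 25565202), (4, 25178322),
  (4, 18881292), (7, 25178322), (2, 19084032), (11, 25756038), (4, 19274496), (4, 25172556),
  (0, 25375296), (7, 12607698), (4, 18899148), (2, 19095936), (11, 25767942), (7, 25768128),
  (4, 19292352), (4, 25184460), (2, 25381248), (0, 25381248), (4, 12780120), (8, 18886872),
  (4, 12797976), (10, 12589842), (10, 12607698), (11, 19095936), (4, 6881688), (4, 6893592),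
  (0, 13375506), (7, 19661190), (10, 798930), (10, 13376064), (4, 7078290), (4, 13369926),
  (11, 805068), (7, 19673094), (11, 19673280), (4, 7090194), (8, 19673280), (4, 13387782),
  (3, 13178904), (6, 7078476), (6, 7096332), (3, 13375506), (4, 19071384), (4, 19083288),
  (2, 19273752), (0, 25565202), (5, 25363020), (10, 25178322), (10, 25559622), (7, 13369926),
  (5, 25756038), (4, 25362834), (4, 25559622), (11, 25184460), (5, 25380876), (10, 25577664),
  (7, 13387782), (10, 25768128), (5, 25767942), (4, 25374738), (8, 25768128), (4, 25577478),
  (3, 19273752), (6, 25363020), (6, 25380876), (6, 25761804), (3, 25565202), (7, 25559622),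
  (7, 25577478), (11, 25577664), (2, 19666956), (4, 19661190), (4, 19673094), (2, 25761804),
  (4, 25756038), (4, 25767942), (0, 25761804), (4, 12780306), (11, 18881292), (11, 19095564),
  (8, 18887430), (10, 12608070), (4, 12798720), (7, 19268358), (10, 13375506), (4, 13369554),
  (4, 6882060), (11, 805254), (4, 6894336), (4, 7078476), (0, 13376064), (10, 799302),
  (11, 19673094), (7, 19673280), (8, 19673094), (4, 7090752), (4, 13387968), (6, 7078290),
  (3, 13179648), (6, 7096704), (3, 13376064), (7, 13173510), (11, 25761804), (5, 25755852),
  (4, 25559250), (4, 19071756), (11, 25184646), (4, 19084032), (7, 25559250), (2, 19274496),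
  (4, 25363020), (0, 25565760), (10, 25178694), (10, 25577478), (5, 25381248), (10, 25767942),
  (7, 13387968), (5, 25768128), (8, 25767942), (4, 25375296), (4, 25577664), (6, 25362834),
  (3, 19274496), (6, 25381248), (6, 25762176), (3, 25565760), (7, 13369554), (11, 25577478),
  (7, 25577664), (4, 19661004), (2, 19667328), (4, 19673280), (4, 25755852), (2, 25762176),
  (4, 25768128), (0, 25762176), (11, 596748), (11, 18899148), (4, 12804114), (11, 18899334),
  (8, 18899334), (4, 12804672), (11, 19661004), (7, 19292166), (4, 13375506), (11, 19661190),
  (10, 805254), (7, 19292352), (8, 19661190), (4, 13376064), (11, 799302), (4, 6905868),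
  (4, 6906240), (4, 7096332), (4, 7096704), (0, 13387968), (6, 7090194), (6, 7090752),
  (3, 13197504), (3, 13387968), (11, 25755852), (7, 13197318), (5, 25761804), (4, 25565202),
  (11, 25762176), (10, 25184646), (7, 13197504), (10, 25756038), (5, 25762176), (8, 25756038),
  (4, 25565760), (11, 25178694), (4, 19095564), (4, 19095936), (7, 25565202), (7, 25565760),
  (2, 19292352), (4, 25380876), (4, 25381248), (0, 25577664), (6, 25374738), (6, 25375296),
  (3, 19292352), (6, 25768128), (3, 25577664), (11, 25559622), (7, 13375506), (7, 13376064),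
  (4, 19666956), (4, 19667328), (2, 19673280), (4, 25761804), (4, 25762176), (2, 25768128),
  (0, 25768128), (6, 25565202), (6, 25565760), (6, 25577664), (3, 19673280), (3, 25768128)]

theorem reps15_valid : allB chkF reps15 = true := by decide +kernel

theorem indep15 : chkIndep reps15 ord15 adm15 = true := by decide +kernel

/-- Sparse functionals that vanish on the hit polynomials of degree `35`. -/
noncomputable def reps35 : List (List ℕ) := [
  [252457541, 252457667, 252465542, 252469574, 252469637, 252481733, 252481859, 252981638,
  252981701, 252981827, 252989765, 252993734, 252993923, 252997829, 252997955, 253243718,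
  253243781, 253251782, 253251971, 253255877, 253256003, 253513925, 254030021, 254038211,
  254554307, 386674883], [119353409, 120377474, 120381506, 120381569, 120893570, 120901697,
  121155650, 121155713, 122449985, 186437762, 186441794, 186441857, 186445889, 187478081,
  187986050, 188248130, 188248193, 188510273, 219984002, 219992129, 221016194, 221540417,
  236761154, 236761217, 237793346, 237793409, 254570561, 320630849], [120336965, 120337091,
  120344966, 120348998, 120349061, 120361157, 120361283, 120861062, 120861125, 120861251,
  120869189, 120873158, 120873347, 120877253, 120877379, 121123142, 121123205, 121131206,
  121131395, 121135301, 121135427, 122433731, 186397253, 186397379, 186405254, 186409286,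
  186409349, 186421445, 186421571, 187969733, 187977923, 188494019, 219951494, 219951557,
  219951683, 219959621, 219963590, 219963779, 219967685, 219967811, 220999877, 221008067,
  236728646, 236728709, 236736710, 236736899, 236740805, 236740931, 254554307, 320614595],
  [119288897, 119296961, 119337281, 119345345, 120345218, 120349250, 120349313, 120361346,
  120361409, 120365378, 120365441, 120369473, 120861314, 120869441, 120873410, 120877442,
  120877505, 120885569, 120889538, 120893633, 121123394, 121123457, 121131458, 121135553,
  121139522, 121139585, 121147586, 121151681, 122433857, 122441921, 186397505, 186405506,
  186409538, 186409601, 186421634, 186421697, 186425666, 186425729, 186429761, 186437825,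
  187445825, 187470017, 187969922, 187969985, 187982018, 188232002, 188232065, 188240066,
  188244161, 188494145, 188502209, 219951746, 219951809, 219959873, 219963842, 219967874,
  219967937, 219976001, 219979970, 221000066, 221012162, 221016257, 221524289, 221532353,
  236728898, 236728961, 236736962, 236741057, 236745026, 236745089, 236753090, 236757185,
  237777218, 237777281, 237785282, 237789377, 254554433, 254562497, 320614721, 320622785],
  [52187345, 52188227, 52203914, 52204103, 52204166, 52204229, 52207946, 52208009, 52208198,
  52208261, 52211915, 52236485, 52236611, 53227727, 53228483, 53235917, 53236106, 53236295,
  53236358, 53236421, 53236547, 53240138, 53240201, 53240390, 53240453, 53244107, 53244233,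
  53244359, 53244485, 53244611, 53252297, 53252675, 53260487, 53268677, 53268803, 53760203,
  53760329, 53760455, 53760581, 53764298, 53764487, 53764550, 53764739, 53776835, 53780678,
  53780867, 53784773, 53784899, 54022346, 54022535, 54022598, 54022787, 54026441, 54026567,
  54026693, 54026819, 54038726, 54038915, 54042821, 54042947, 54300869, 54300995, 55333061,
  55333187, 85733585, 85734467, 85741775, 85742531, 85750154, 85750343, 85750406, 85750469,
  85758281, 85758407, 85758533, 85758659, 85762250, 85762439, 85762502, 85762691, 85782725,
  85782851, 86782157, 86782346, 86782535, 86782598, 86782661, 86782787, 86798663, 86798789,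
  86806727, 86810822, 86811011, 87306443, 87306569, 87306695, 87306821, 87323075, 87331013,
  87331139, 87568586, 87568775, 87568838, 87569027, 87584966, 87585155, 87847109, 87847235,
  88879301, 88879427, 102527306, 102527369, 102527558, 102527621, 102535370, 102535559, 102535622,
  102535811, 102539465, 102539591, 102539717, 102539843, 103559498, 103559561, 103559750,
  103559813, 103583942, 103584131, 103588037, 103588163, 104083658, 104083847, 104083910,
  104084099, 104100038, 104100227, 104345801, 104345927, 104346053, 104346179, 104362181,
  104362307, 119296394, 119296583, 119296646, 119296709, 119300426, 119300489, 119300678,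
  119300741, 119304521, 119304773, 120336587, 120337091, 120860873, 120861251, 120869063,
  120873158, 120873347, 120877253, 120877379, 121131206, 121131395, 121135301, 121135427,
  121393349, 121393475, 152842634, 152842823, 152842886, 152842949, 152850761, 152850887,
  152851013, 152851139, 152854730, 152854919, 152854982, 152855171, 152858825, 152858951,
  152859077, 152859203, 153891017, 153891395, 153899207, 153903302, 153903491, 153907397,
  153907523, 154415555, 154423493, 154423619, 154677446, 154677635, 154939589, 154939715,
  169619786, 169619849, 169620038, 169620101, 169627850, 169628039, 169628102, 169628291,
  169631945, 169632071, 169632197, 169632323, 170676422, 170676611, 170680517, 170680643,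
  171192518, 171192707, 171454661, 171454787, 186396875, 186397001, 186397127, 186397253,
  186405065, 186405443, 186413255, 186413507, 187445447, 187453637, 187453763, 219951431,
  219951557, 219959495, 219959747, 220999877, 221000003, 253513925, 253514051, 287060165,
  287060291]]

/-- Pairs of the index of a functional in `reps35` and the code of a permutation. -/
noncomputable def ord35 : List (ℕ × ℕ) := [
  (1, 6316620), (0, 19273752), (3, 400146), (1, 7078476), (3, 12589842), (3, 12780306),
  (2, 12780306), (0, 19274496), (1, 25363020), (3, 418002), (3, 418374), (3, 798930), (1, 7096332),
  (3, 799302), (3, 805254), (1, 7096704), (3, 12607698), (3, 12608070), (4, 25565202),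
  (3, 12804114), (4, 25565760), (4, 25577664), (3, 12804672), (2, 12804114), (2, 12804672),
  (0, 19292352), (3, 25178322), (1, 25380876), (3, 25178694), (3, 25184646), (1, 25381248),
  (4, 25374738), (4, 25375296), (4, 25381248), (3, 13369554), (3, 13375506), (3, 13369926),
  (4, 25768128), (3, 13376064), (4, 25762176), (3, 13387782), (3, 13387968), (2, 13375506),
  (2, 13376064), (2, 13387968), (0, 19673280), (3, 25559250), (3, 25565202), (1, 25761804),
  (3, 25559622), (4, 19673280), (3, 25565760), (3, 25756038), (1, 25762176), (4, 19667328),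
  (3, 25577478), (3, 25577664), (3, 25767942), (3, 25768128), (1, 25768128), (2, 25565202),
  (2, 25565760), (2, 25577664), (2, 25768128), (0, 25768128)]

theorem reps35_valid : allB chkF reps35 = true := by decide +kernel

theorem indep35 : chkIndep reps35 ord35 adm35B = true := by decide +kernel

end

end PolyAlg

/-! ### Weight `(3,2,1,1,1)` in degree `35`: the spike coefficient after linear substitutions. -/

namespace PolyAlg

open MvPolynomial

/-- The coefficient of a polynomial at the monomial with exponent vector `n`. -/
noncomputable def ev (n : Fin 5 → ℕ) : PolyAlg 5 →ₗ[ZMod 2] ZMod 2 :=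
  lcoeff (ZMod 2) (Finsupp.equivFunOnFinite.symm n)

theorem ev_xp (n e : Fin 5 → ℕ) [Decidable (n = e)] : ev n (xp e) = if n = e then 1 else 0 :=
  coeff_xp e n

/-- The linear form whose coefficients are the digits of `a`, `b`, `c` at `i`. -/
noncomputable def lam (a b c i : ℕ) : PolyAlg 5 :=
  (if a.testBit i then X 0 else 0) +
    ((if b.testBit i then X 1 else 0) + (if c.testBit i then X 2 else 0))

theorem isLin_lam (a b c i : ℕ) : IsLin (lam a b c i) := by
  have key : ∀ (t : Bool) (j : Fin 5), IsLin (if t then X j else 0 : PolyAlg 5) := by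
    intro t j
    cases t
    · simpa using IsLin.zero
    · simpa using isLin_X j
  exact (key _ _).add ((key _ _).add (key _ _))

theorem xp_single_one (j : Fin 5) : xp (Pi.single j 1) = (X j : PolyAlg 5) := by
  rw [xp_single, pow_one]

theorem lam_mem (a b c i : ℕ) : lam a b c i ∈ xspan {e | dg e = 1} := by
  have key : ∀ (t : Bool) (j : Fin 5),
      (if t then X j else 0 : PolyAlg 5) ∈ xspan {e | dg e = 1} := by
    intro t j
    cases t
    · simp
    · rw [if_pos rfl, ← xp_single_one]
      exact xp_mem_xspan (dg_single j 1)
  exact Submodule.add_mem _ (key _ _) (Submodule.add_mem _ (key _ _) (key _ _))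

theorem prod_lam_mem (a b c : ℕ) (l : List ℕ) :
    (l.map (lam a b c)).prod ∈ xspan {e | dg e = l.length} := by
  induction l with
  | nil =>
    have : (1 : PolyAlg 5) = xp 0 := by simp [xp]
    rw [List.map_nil, List.prod_nil, this]
    exact xp_mem_xspan (by simp [dg])
  | cons i l ih =>
    rw [List.map_cons, List.prod_cons]
    refine mul_mem_xspan ?_ (lam_mem a b c i) ih
    intro e he f hf
    simp only [Set.mem_ofPred_eq] at he hf ⊢
    rw [dg_add, he, hf, List.length_cons, add_comm]

/-- Addition modulo two. -/
noncomputable def xorB (p q : Bool) : Bool := Bool.rec q (Bool.rec true false q) p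

/-- The coefficient of a square-free monomial in a product of linear forms. -/
noncomputable def per (a b c : ℕ) (l : List ℕ) : ℕ → Bool :=
  List.rec (motive := fun _ => ℕ → Bool) (fun K => Nat.beq K 0)
    (fun i _ ih K => xorB (andB (andB (testB K 0) (testB a i)) (ih (Nat.sub K 1)))
      (xorB (andB (andB (testB K 1) (testB b i)) (ih (Nat.sub K 2)))
        (andB (andB (testB K 2) (testB c i)) (ih (Nat.sub K 4))))) l

/-- Dividing a square-free monomial by one of its variables clears the corresponding bit of its
mask. The bound `K < 8` restricts to the three variables that occur in `lam`. -/
theorem ev_bits_X_mul {K : ℕ} (hK : K < 8) (t : Bool) (j : Fin 3) (f : PolyAlg 5) :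
    ev (bits K) ((if t then X (j.castLE (by norm_num)) else 0) * f) =
      if K.testBit j && t then ev (bits (K - 2 ^ (j : ℕ))) f else 0 := by
  cases t
  · simp
  · have h1 : ∀ K < 8, ∀ j : Fin 3, K.testBit j = true ↔
        bits K (j.castLE (by norm_num)) ≠ 0 := by decide
    have h2 : ∀ K < 8, ∀ j : Fin 3, K.testBit j = true →
        bits K - Pi.single (j.castLE (by norm_num)) 1 = bits (K - 2 ^ (j : ℕ)) := by decide
    rw [if_pos rfl, Bool.and_true]
    change coeff _ _ = _
    rw [coeff_X_mul']
    by_cases h : K.testBit j = true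
    · rw [if_pos h, if_pos (by simpa using (h1 K hK j).1 h), ← h2 K hK j h]
      change _ = coeff _ _
      congr 1
      ext i
      by_cases hi : i = j.castLE (by norm_num)
      · subst hi; simp
      · simp [hi]
    · rw [if_neg h, if_neg]
      intro h'
      exact h ((h1 K hK j).2 (by simpa using h'))

/-- Expansion along the first factor: it supplies one variable of the monomial, which is deleted
before the remaining factors are expanded. The result is a permanent modulo two when the number of
factors is the size of `K`. -/
theorem ev_prod_lam (a b c : ℕ) (l : List ℕ) {K : ℕ} (hK : K < 8) :
    ev (bits K) (l.map (lam a b c)).prod = if per a b c l K then 1 else 0 := by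
  induction l generalizing K with
  | nil =>
    have h1 : (1 : PolyAlg 5) = xp 0 := by simp [xp]
    have h2 : ∀ K < 8, bits K = 0 ↔ Nat.beq K 0 = true := by decide
    rw [List.map_nil, List.prod_nil, h1, ev_xp]
    exact if_congr (h2 K hK) rfl rfl
  | cons i l ih =>
    have e1 := ev_bits_X_mul hK (a.testBit i) 0 (l.map (lam a b c)).prod
    have e2 := ev_bits_X_mul hK (b.testBit i) 1 (l.map (lam a b c)).prod
    have e3 := ev_bits_X_mul hK (c.testBit i) 2 (l.map (lam a b c)).prod
    rw [ih ((Nat.sub_le _ _).trans_lt hK)] at e1 e2 e3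
    have hdef : per a b c (i :: l) K =
      xorB (andB (andB (testB K 0) (testB a i)) (per a b c l (Nat.sub K 1)))
        (xorB (andB (andB (testB K 1) (testB b i)) (per a b c l (Nat.sub K 2)))
          (andB (andB (testB K 2) (testB c i)) (per a b c l (Nat.sub K 4)))) := rfl
    have hx : ∀ p q : Bool, (if xorB p q then (1 : ZMod 2) else 0) =
        (if p then 1 else 0) + if q then 1 else 0 := by
      intro p q; cases p <;> cases q <;> simp [xorB, CharTwo.add_self_eq_zero]
    have ha : ∀ p q r : Bool, (if andB (andB p q) r then (1 : ZMod 2) else 0) =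
        if p && q then (if r then 1 else 0) else 0 := by
      intro p q r; cases p <;> cases q <;> cases r <;> simp [andB]
    rw [List.map_cons, List.prod_cons, hdef, hx, hx, ha, ha, ha]
    simp only [testB_eq]
    rw [lam, add_mul, add_mul, map_add, map_add]
    exact congrArg₂ _ e1 (congrArg₂ _ e2 e3)

/-- A monomial of `u` times the square of a monomial of `v` reaches `b + 2T` only in one way,
because `b` is square-free and `u` has the degree of `b`. The coefficient therefore splits as a
product. -/
theorem ev_mul_sq {b T : Fin 5 → ℕ} (hb : ∀ i, b i < 2) {u : PolyAlg 5}
    (hu : u ∈ xspan {e | dg e = dg b}) (v : PolyAlg 5) :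
    ev (b + 2 • T) (u * v ^ 2) = ev b u * ev T v := by
  classical
  have key : ∀ a : Fin 5 → ℕ, dg a = dg b → ∀ v : PolyAlg 5,
      ev (b + 2 • T) (xp a * v ^ 2) = ev b (xp a) * ev T v := by
    intro a ha v
    have h1 : ((ev (b + 2 • T)).comp (mulPow (xp a) 1)) = ev b (xp a) • ev T := by
      refine LinearMap.ext_on xspan_univ ?_
      · rintro _ ⟨w, -, rfl⟩
        rw [LinearMap.comp_apply, mulPow_apply, LinearMap.smul_apply, ← xp_smul, ← xp_add, ev_xp,
          ev_xp, ev_xp, smul_eq_mul, pow_one]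
        -- As `b i < 2`, the congruence modulo two gives `b i ≤ a i`; equality of degrees then
        -- forces `b = a`.
        have : (b + 2 • T = a + 2 • w) ↔ b = a ∧ T = w := by
          constructor
          · intro h
            have h2 : ∀ i, b i ≤ a i := fun i => by
              have := congrFun h i
              simp only [Pi.add_apply, Pi.smul_apply, smul_eq_mul] at this
              have := hb i
              omega
            have h3 : b = a := by
              funext i
              by_contra hne
              have : dg b < dg a :=
                Finset.sum_lt_sum (fun i _ => h2 i) ⟨i, Finset.mem_univ i, by
                  have := h2 i; omega⟩
              omega
            subst h3
            refine ⟨rfl, funext fun i => ?_⟩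
            have := congrFun h i
            simp only [Pi.add_apply, Pi.smul_apply, smul_eq_mul] at this
            omega
          · rintro ⟨rfl, rfl⟩; rfl
        rw [if_congr this rfl rfl]
        by_cases h1 : b = a <;> by_cases h2 : T = w <;> simp [h1, h2]
    have := LinearMap.congr_fun h1 v
    rwa [LinearMap.comp_apply, mulPow_apply, pow_one] at this
  let W : Submodule (ZMod 2) (PolyAlg 5) := LinearMap.ker
    ((ev (b + 2 • T)).comp (LinearMap.mulRight (ZMod 2) (v ^ 2)) - (ev T v) • ev b)
  have hW : xspan {e | dg e = dg b} ≤ W := xspan_le.2 fun e he => by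
    rw [LinearMap.mem_ker, LinearMap.sub_apply, LinearMap.comp_apply, LinearMap.mulRight_apply,
      key e he, LinearMap.smul_apply, smul_eq_mul, mul_comm, sub_self]
  have := hW hu
  rw [LinearMap.mem_ker, LinearMap.sub_apply, LinearMap.comp_apply, LinearMap.mulRight_apply,
    LinearMap.smul_apply, smul_eq_mul, sub_eq_zero] at this
  rw [this, mul_comm]

/-- The sum of the powers `2 ^ i` for `i ∈ l`. -/
noncomputable def codeL (l : List ℕ) : ℕ := List.rec 0 (fun i _ ih => Nat.add (Nat.pow 2 i) ih) l

/-- The subsets of `{0, …, 4}` of size `c`, for `c = 1, 2, 3`. -/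
def subs : ℕ → List (List ℕ)
  | 1 => [[0], [1], [2], [3], [4]]
  | 2 => [[0, 1], [0, 2], [0, 3], [0, 4], [1, 2], [1, 3], [1, 4], [2, 3], [2, 4], [3, 4]]
  | 3 => [[0, 1, 2], [0, 1, 3], [0, 1, 4], [0, 2, 3], [0, 2, 4], [0, 3, 4], [1, 2, 3], [1, 2, 4],
      [1, 3, 4], [2, 3, 4]]
  | _ => []

theorem exists_subs : ∀ c < 4, c ≠ 0 → ∀ S < 32, popc S = c → ∃ l ∈ subs c, codeL l = S := by
  decide

theorem length_subs : ∀ c < 4, c ≠ 0 → ∀ l ∈ subs c, l.length = c := by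
  decide

theorem prod_bits_codeL {M : Type*} [CommMonoid M] (f : ℕ → M) {c : ℕ} {l : List ℕ}
    (hl : l ∈ subs c) : ∏ i : Fin 5, f i ^ bits (codeL l) i = (l.map f).prod := by
  have h : ∀ c < 4, ∀ l ∈ subs c, l.Nodup ∧ (∀ i ∈ l, i < 5) ∧
      ∀ i : Fin 5, bits (codeL l) i = if (i : ℕ) ∈ l then 1 else 0 := by decide
  have hc : c < 4 := by
    by_contra hc
    obtain ⟨d, rfl⟩ := Nat.exists_eq_add_of_le' (not_lt.1 hc)
    simp [subs] at hl
  obtain ⟨h1, h2, h3⟩ := h c hc l hl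
  have e1 : ∏ i : Fin 5, f i ^ bits (codeL l) i =
      ∏ i ∈ Finset.range 5, if i ∈ l then f i else 1 := by
    rw [Finset.prod_range]
    refine Finset.prod_congr rfl fun i _ => ?_
    rw [h3]
    split_ifs <;> simp
  rw [e1, ← Finset.prod_filter]
  have e2 : Finset.filter (· ∈ l) (Finset.range 5) = l.toFinset := by
    ext i
    simp only [Finset.mem_filter, Finset.mem_range, List.mem_toFinset]
    exact ⟨fun h => h.2, fun h => ⟨h2 i h, h⟩⟩
  rw [e2, List.prod_toFinset f h1]

/-- The `u`-th row of the monomial `vOf idx 5`. -/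
noncomputable def rowB (idx u : ℕ) : ℕ :=
  Nat.land (Nat.shiftRight idx (Nat.mul 5 (Nat.sub 4 u))) 31

theorem rowB_eq (idx u : ℕ) : rowB idx u = idx / 32 ^ (4 - u) % 32 := by
  have : rowB idx u = idx >>> (5 * (4 - u)) % 32 := Nat.and_two_pow_sub_one_eq_mod _ 5
  rw [this, Nat.shiftRight_eq_div_pow, pow_mul, show 2 ^ 5 = 32 by norm_num]

theorem vOf_five (idx : ℕ) : vOf idx 5 = bits (rowB idx 0) + 2 • (bits (rowB idx 1) +
    2 • (bits (rowB idx 2) + 2 • (bits (rowB idx 3) + 2 • bits (rowB idx 4)))) := by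
  simp only [vOf, rowB_eq, Nat.div_div_eq_div_mul]
  funext i
  simp only [Pi.add_apply, Pi.smul_apply, Pi.zero_apply, smul_eq_mul]
  norm_num
  ring

/-- The positions in `L` of the monomials whose `u`-th row is `S`. -/
noncomputable def mask (L : List ℕ) (u S : ℕ) : ℕ :=
  List.rec 0 (fun m _ ih => Nat.add (Nat.mul 2 ih)
    (Bool.rec 0 1 (Nat.beq (rowB m u) S))) L

theorem testBit_mask (L : List ℕ) (u S : ℕ) : ∀ j < L.length,
    ((mask L u S).testBit j = true ↔ rowB (L.getD j 0) u = S) := by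
  induction L with
  | nil => simp
  | cons m L ih =>
    have hdef : mask (m :: L) u S = 2 * mask L u S + Bool.rec 0 1 (Nat.beq (rowB m u) S) := rfl
    intro j hj
    rw [hdef]
    cases h : Nat.beq (rowB m u) S
    · cases j with
      | zero =>
        have := Nat.ne_of_beq_eq_false h
        simp [this]
      | succ j =>
        rw [Nat.testBit_succ, add_zero, Nat.mul_div_cancel_left _ (by norm_num)]
        exact ih j (by simpa using hj)
    · cases j with
      | zero =>
        have := Nat.eq_of_beq_eq_true h
        simp [this]
      | succ j =>
        rw [Nat.testBit_succ, show (2 * mask L u S + 1) / 2 = mask L u S by omega]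
        exact ih j (by simpa using hj)

/-- The subsets of size `c` with the positions of the monomials whose `u`-th row they are, with a
continuation. -/
noncomputable def groupK (L : List ℕ) (u : ℕ) (s : List (List ℕ)) :
    (List (List ℕ × ℕ) → Bool) → Bool :=
  List.rec (motive := fun _ => (List (List ℕ × ℕ) → Bool) → Bool) (fun k => k [])
    (fun l _ ih k => force (codeL l) fun S => force (mask L u S) fun M =>
      ih fun g => k ((l, M) :: g)) s

theorem groupK_eq (L : List ℕ) (u : ℕ) (s : List (List ℕ)) (k : List (List ℕ × ℕ) → Bool) :
    groupK L u s k = k (s.map fun l => (l, mask L u (codeL l))) := by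
  induction s generalizing k with
  | nil => rfl
  | cons l s ih =>
    change (force (codeL l) fun S => force (mask L u S) fun M =>
      groupK L u s fun g => k ((l, M) :: g)) = _
    rw [force_eq, force_eq, ih, List.map_cons]

/-- The union of the masks selected by `D`. -/
noncomputable def lorSel (D : List ℕ → Bool) (g : List (List ℕ × ℕ)) : ℕ :=
  List.rec 0 (fun c _ ih => Bool.rec ih (Nat.lor c.2 ih) (D c.1)) g

theorem testBit_lorSel (D : List ℕ → Bool) (g : List (List ℕ × ℕ)) (j : ℕ) :
    (lorSel D g).testBit j = true ↔ ∃ c ∈ g, D c.1 = true ∧ c.2.testBit j = true := by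
  induction g with
  | nil => simp [lorSel]
  | cons c g ih =>
    change (Bool.rec (lorSel D g) (c.2 ||| lorSel D g) (D c.1) : ℕ).testBit j = true ↔ _
    rw [List.exists_mem_cons_iff, ← ih]
    cases D c.1
    · simp
    · simp

/-- The values of the coefficient of `x₁³¹ x₂³ x₃` after the substitution with rows `t`. -/
noncomputable def rowA (g0 g1 g2 g3 g4 : List (List ℕ × ℕ)) (t : ℕ × ℕ × ℕ) : ℕ :=
  Nat.land (lorSel (fun l => per t.1 t.2.1 t.2.2 l 7) g0)
    (Nat.land (lorSel (fun l => per t.1 t.2.1 t.2.2 l 3) g1)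
      (Nat.land (lorSel (fun l => per t.1 t.2.1 t.2.2 l 1) g2)
        (Nat.land (lorSel (fun l => per t.1 t.2.1 t.2.2 l 1) g3)
          (lorSel (fun l => per t.1 t.2.1 t.2.2 l 1) g4))))

/-- Whether the rows of `vOf m 5` have sizes `3, 2, 1, 1, 1`. -/
noncomputable def chkWt (m : ℕ) : Bool :=
  andB (Nat.beq (popc (rowB m 0)) 3) (andB (Nat.beq (popc (rowB m 1)) 2)
    (andB (Nat.beq (popc (rowB m 2)) 1) (andB (Nat.beq (popc (rowB m 3)) 1)
      (Nat.beq (popc (rowB m 4)) 1))))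

/-- Verification that the substitutions `ord` give functionals independent on the monomials in
`L`. -/
noncomputable def chkSubst (ord : List (ℕ × ℕ × ℕ)) (L : List ℕ) : Bool :=
  andB (allB chkWt L) (groupK L 0 (subs 3) fun g0 => groupK L 1 (subs 2) fun g1 =>
    groupK L 2 (subs 1) fun g2 => groupK L 3 (subs 1) fun g3 => groupK L 4 (subs 1) fun g4 =>
      mapK (rowA g0 g1 g2 g3 g4) ord fun rows => mapK pad rows (gauss L.length 32))

theorem rowB_lt (idx u : ℕ) : rowB idx u < 32 := by
  rw [rowB_eq]; exact Nat.mod_lt _ (by norm_num)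

/-- The code `4319 = 31 + 3·64 + 64²` is that of `x₁³¹x₂³x₃`, whose rows have the masks `7, 3, 1, 1,
1`. A linear substitution preserves degrees, so the image of each row of a monomial of weight
`(3,2,1,1,1)` has the degree of the matching row of the spike, and `ev_mul_sq` peels off the rows
one at a time. -/
theorem ev_spike (a b c : ℕ) {m : ℕ} (hm : chkWt m = true) :
    ev (dig 4319) (aeval (fun i : Fin 5 => lam a b c i) (xp (vOf m 5))) =
      ev (bits 7) (aeval (fun i : Fin 5 => lam a b c i) (xp (bits (rowB m 0)))) *
      (ev (bits 3) (aeval (fun i : Fin 5 => lam a b c i) (xp (bits (rowB m 1)))) *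
      (ev (bits 1) (aeval (fun i : Fin 5 => lam a b c i) (xp (bits (rowB m 2)))) *
      (ev (bits 1) (aeval (fun i : Fin 5 => lam a b c i) (xp (bits (rowB m 3)))) *
      ev (bits 1) (aeval (fun i : Fin 5 => lam a b c i) (xp (bits (rowB m 4))))))) := by
  have hT : dig 4319 = bits 7 + 2 • (bits 3 + 2 • (bits 1 + 2 • (bits 1 + 2 • bits 1))) := by
    decide
  have hmem : ∀ c' < 4, c' ≠ 0 → ∀ S < 32, Nat.beq (popc S) c' = true → ∀ K, dg (bits K) = c' →
      aeval (fun i : Fin 5 => lam a b c i) (xp (bits S)) ∈ xspan {e | dg e = dg (bits K)} := by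
    intro c' hc hc0 S hS hp K hK
    obtain ⟨l, hl, rfl⟩ := exists_subs c' hc hc0 S hS (Nat.eq_of_beq_eq_true hp)
    rw [xp, map_prod]
    simp only [map_pow, aeval_X]
    rw [prod_bits_codeL (lam a b c) hl, hK, ← length_subs c' hc hc0 l hl]
    exact prod_lam_mem a b c l
  simp only [chkWt, andB_eq_true] at hm
  obtain ⟨h0, h1, h2, h3, h4⟩ := hm
  rw [hT, vOf_five]
  simp only [xp_add _ (2 • _), xp_smul, map_mul, map_pow]
  rw [ev_mul_sq (bits_lt 7) (hmem 3 (by norm_num) (by norm_num) _ (rowB_lt _ _) h0 7 (by decide)),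
    ev_mul_sq (bits_lt 3) (hmem 2 (by norm_num) (by norm_num) _ (rowB_lt _ _) h1 3 (by decide)),
    ev_mul_sq (bits_lt 1) (hmem 1 (by norm_num) (by norm_num) _ (rowB_lt _ _) h2 1 (by decide)),
    ev_mul_sq (bits_lt 1) (hmem 1 (by norm_num) (by norm_num) _ (rowB_lt _ _) h3 1 (by decide))]

/-- All exponents have the form `2^a - 1`. At the lowest digit of an increment the sum has a digit
`0`, which for such an exponent would make it smaller than the increment; so no positive square
contains this monomial. Here this is confirmed by computation. -/
theorem chkF_spike : chkF [4319] = true := by decide +kernel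

/-- The factor depends only on the row. The masks list, for each possible row, the positions where
it occurs, so the union over the rows with odd coefficient gives the factor at all positions
simultaneously. -/
theorem lorSel_eq (a b c : ℕ) {L : List ℕ} {j : ℕ} (hj : j < L.length) {u c' K : ℕ} (hK : K < 8)
    (hc : c' < 4) (hc0 : c' ≠ 0) (hp : Nat.beq (popc (rowB (L.getD j 0) u)) c' = true) :
    ev (bits K) (aeval (fun i : Fin 5 => lam a b c i) (xp (bits (rowB (L.getD j 0) u)))) =
      if (lorSel (fun l => per a b c l K) ((subs c').map fun l => (l, mask L u (codeL l)))).testBit j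
        then 1 else 0 := by
  have key : ∀ l ∈ subs c', codeL l = rowB (L.getD j 0) u →
      ev (bits K) (aeval (fun i : Fin 5 => lam a b c i) (xp (bits (rowB (L.getD j 0) u)))) =
        if per a b c l K then 1 else 0 := by
    intro l hl h
    rw [← h, xp, map_prod]
    simp only [map_pow, aeval_X]
    rw [prod_bits_codeL (lam a b c) hl, ev_prod_lam a b c l hK]
  have hiff : (lorSel (fun l => per a b c l K)
      ((subs c').map fun l => (l, mask L u (codeL l)))).testBit j = true ↔
      ∃ l ∈ subs c', per a b c l K = true ∧ codeL l = rowB (L.getD j 0) u := by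
    rw [testBit_lorSel]
    constructor
    · rintro ⟨p, hp, h1, h2⟩
      obtain ⟨l, hl, rfl⟩ := List.mem_map.1 hp
      exact ⟨l, hl, h1, ((testBit_mask L u _ j hj).1 h2).symm⟩
    · rintro ⟨l, hl, h1, h2⟩
      exact ⟨_, List.mem_map.2 ⟨l, hl, rfl⟩, h1, (testBit_mask L u _ j hj).2 h2.symm⟩
  obtain ⟨l, hl, h⟩ := exists_subs c' hc hc0 _ (rowB_lt _ u) (Nat.eq_of_beq_eq_true hp)
  split_ifs with hs
  · obtain ⟨l', hl', h1, h2⟩ := hiff.1 hs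
    rw [key l' hl' h2, if_pos h1]
  · rw [key l hl h, if_neg]
    exact fun h1 => hs (hiff.2 ⟨l, hl, h1, h⟩)

/-- The value of the functional is a product of five factors in `𝔽₂`, hence the conjunction of five
bits, which is how `rowA` computes it for all monomials together. -/
theorem eq_zero_of_chkSubst {ord : List (ℕ × ℕ × ℕ)} {L : List ℕ}
    (h : chkSubst ord L = true) {c : ℕ → ZMod 2}
    (hc : ∑ j ∈ Finset.range L.length, c j • xp (vOf (L.getD j 0) 5) ∈ hit 5) :
    ∀ j < L.length, c j = 0 := by
  rw [chkSubst, andB_eq_true, allB_eq_true] at h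
  simp only [groupK_eq, mapK_eq] at h
  obtain ⟨hwt, h⟩ := h
  refine eq_zero_of_gauss (m := fun j => xp (vOf (L.getD j 0) 5)) ?_ h hc
  intro r hr
  obtain ⟨⟨a, b, d⟩, -, rfl⟩ := List.mem_map.1 hr
  let g : PolyAlg 5 →ₐ[ZMod 2] PolyAlg 5 := aeval fun i : Fin 5 => lam a b d i
  refine ⟨(ev (dig 4319)).comp g.toLinearMap, fun u hu => ?_, fun j hj => ?_⟩
  · have h1 := hit_le_ker_cf chkF_spike (hit_le_comap_aeval (fun i => isLin_lam a b d i) hu)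
    rw [LinearMap.mem_ker, cf_apply, List.map_singleton, List.sum_singleton] at h1
    exact h1
  · have hw : chkWt (L.getD j 0) = true := by
      rw [List.getD_eq_getElem _ _ hj]
      exact hwt _ (List.getElem_mem hj)
    refine (ev_spike a b d hw).trans ?_
    simp only [chkWt, andB_eq_true] at hw
    obtain ⟨h0, h1, h2, h3, h4⟩ := hw
    rw [lorSel_eq a b d hj (by norm_num) (by norm_num) (by norm_num) h0,
      lorSel_eq a b d hj (by norm_num) (by norm_num) (by norm_num) h1,
      lorSel_eq a b d hj (by norm_num) (by norm_num) (by norm_num) h2,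
      lorSel_eq a b d hj (by norm_num) (by norm_num) (by norm_num) h3,
      lorSel_eq a b d hj (by norm_num) (by norm_num) (by norm_num) h4]
    have hl : ∀ x y : ℕ, (Nat.land x y).testBit j = (x.testBit j && y.testBit j) :=
      fun x y => Nat.testBit_and x y j
    simp only [rowA, hl]
    have hm : ∀ p q : Bool, (if p then (1 : ZMod 2) else 0) * (if q then 1 else 0) =
        if p && q then 1 else 0 := by
      intro p q; cases p <;> cases q <;> simp
    rw [hm, hm, hm, hm]

end PolyAlg

/-! ### Data: the linear substitutions for weight `(3,2,1,1,1)`. -/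

namespace PolyAlg

section

set_option maxRecDepth 100000

/-- Rows of linear substitutions. -/
noncomputable def ord35A : List (ℕ × ℕ × ℕ) := [
  (1, 2, 4), (3, 1, 4), (2, 1, 4), (1, 4, 2), (3, 4, 1), (6, 1, 2), (5, 1, 2), (4, 1, 2),
  (5, 2, 1), (7, 1, 2), (2, 4, 1), (7, 2, 1), (6, 2, 1), (4, 2, 1), (1, 2, 8), (3, 1, 8),
  (2, 1, 8), (1, 6, 8), (3, 5, 8), (6, 1, 8), (5, 3, 8), (12, 1, 2), (5, 2, 8), (7, 1, 8),
  (2, 5, 8), (7, 2, 8), (6, 3, 8), (12, 2, 1), (1, 8, 2), (3, 8, 1), (10, 1, 2), (5, 8, 2),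
  (9, 1, 2), (8, 1, 2), (9, 2, 1), (11, 1, 2), (2, 8, 1), (7, 8, 1), (6, 8, 1), (11, 2, 1),
  (10, 2, 1), (8, 2, 1), (1, 10, 4), (3, 9, 4), (10, 1, 4), (1, 4, 8), (3, 4, 8), (14, 1, 2),
  (5, 1, 8), (4, 1, 8), (5, 9, 2), (7, 9, 2), (10, 4, 1), (7, 3, 8), (14, 2, 1), (4, 3, 8),
  (1, 8, 4), (3, 8, 4), (14, 1, 4), (5, 8, 1), (12, 1, 4), (9, 1, 4), (8, 1, 4), (9, 3, 4),
  (11, 1, 4), (10, 3, 4), (7, 8, 2), (13, 2, 1), (12, 3, 4), (11, 3, 4), (13, 3, 4), (8, 3, 4),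
  (9, 4, 1), (11, 4, 1), (14, 4, 1), (13, 1, 4), (4, 8, 1), (13, 4, 1), (12, 4, 1), (8, 4, 1),
  (9, 2, 4), (11, 2, 4), (2, 9, 4), (9, 4, 2), (11, 4, 2), (6, 9, 2), (13, 1, 2), (4, 9, 2),
  (13, 2, 4), (15, 1, 2), (2, 4, 8), (15, 2, 1), (6, 2, 8), (4, 2, 8), (9, 5, 2), (11, 5, 2),
  (10, 5, 2), (13, 4, 2), (12, 5, 2), (13, 5, 2), (8, 5, 2), (14, 3, 4), (15, 1, 4), (2, 8, 4),
  (14, 5, 2), (6, 8, 2), (12, 2, 4), (15, 2, 4), (10, 2, 4), (8, 2, 4), (15, 5, 2), (15, 4, 1),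
  (10, 4, 2), (15, 4, 2), (14, 2, 4), (4, 8, 2), (15, 3, 4), (14, 4, 2), (12, 4, 2), (8, 4, 2),
  (1, 2, 16), (3, 1, 16), (2, 1, 16), (1, 6, 16), (3, 5, 16), (6, 1, 16), (5, 3, 16), (20, 1, 2),
  (5, 2, 16), (7, 1, 16), (2, 5, 16), (7, 2, 16), (6, 3, 16), (20, 2, 1), (1, 10, 16), (3, 9, 16),
  (10, 1, 16), (5, 10, 16), (7, 9, 16), (14, 1, 16), (28, 1, 2), (9, 3, 16), (24, 1, 2),
  (9, 2, 16), (11, 1, 16), (2, 9, 16), (13, 2, 16), (15, 1, 16), (6, 9, 16), (28, 2, 1),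
  (11, 2, 16), (10, 3, 16), (24, 2, 1), (1, 16, 2), (3, 16, 1), (18, 1, 2), (5, 16, 2), (9, 16, 2),
  (17, 1, 2), (16, 1, 2), (17, 2, 1), (19, 1, 2), (2, 16, 1), (7, 16, 1), (6, 16, 1), (11, 16, 1),
  (10, 16, 1), (19, 2, 1), (18, 2, 1), (16, 2, 1), (1, 18, 4), (3, 17, 4), (18, 1, 4), (1, 4, 16),
  (3, 4, 16), (22, 1, 2), (5, 1, 16), (4, 1, 16), (5, 17, 2), (7, 17, 2), (18, 4, 1), (7, 3, 16),
  (22, 2, 1), (4, 3, 16), (1, 12, 16), (3, 12, 16), (26, 1, 4), (5, 9, 16), (7, 10, 16),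
  (30, 1, 2), (12, 1, 16), (9, 5, 16), (24, 1, 4), (9, 6, 16), (11, 5, 16), (18, 9, 4),
  (13, 3, 16), (15, 2, 16), (22, 9, 2), (12, 3, 16), (11, 6, 16), (14, 3, 16), (24, 3, 4),
  (9, 4, 16), (11, 4, 16), (26, 4, 1), (13, 1, 16), (15, 4, 16), (14, 5, 16), (4, 9, 16),
  (13, 4, 16), (12, 5, 16), (24, 4, 1), (1, 16, 4), (3, 16, 4), (22, 1, 4), (5, 16, 1), (20, 1, 4),
  (9, 16, 4), (17, 1, 4), (16, 1, 4), (17, 3, 4), (19, 1, 4), (18, 3, 4), (7, 16, 2), (21, 2, 1),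
  (20, 3, 4), (11, 16, 4), (14, 16, 1), (19, 3, 4), (21, 3, 4), (16, 3, 4), (17, 4, 1), (19, 4, 1),
  (22, 4, 1), (21, 1, 4), (4, 16, 1), (13, 16, 1), (12, 16, 1), (21, 4, 1), (20, 4, 1), (16, 4, 1),
  (17, 2, 4), (19, 2, 4), (2, 17, 4), (17, 4, 2), (19, 4, 2), (6, 17, 2), (21, 1, 2), (4, 17, 2),
  (21, 2, 4), (23, 1, 2), (2, 4, 16), (23, 2, 1), (6, 2, 16), (4, 2, 16), (17, 10, 4), (19, 9, 4),
  (10, 5, 16), (21, 9, 2), (23, 9, 2), (14, 17, 2), (12, 17, 2), (13, 6, 16), (24, 5, 2),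
  (25, 2, 4), (27, 1, 4), (2, 12, 16), (29, 2, 1), (31, 1, 2), (6, 10, 16), (12, 2, 16),
  (27, 2, 4), (10, 6, 16), (24, 2, 4), (25, 4, 2), (27, 4, 1), (10, 4, 16), (13, 17, 2),
  (15, 17, 2), (14, 2, 16), (4, 10, 16), (25, 3, 4), (14, 4, 16), (12, 6, 16), (24, 4, 2),
  (17, 5, 2), (19, 5, 2), (18, 5, 2), (21, 4, 2), (20, 5, 2), (13, 16, 2), (21, 5, 2), (16, 5, 2),
  (22, 3, 4), (23, 1, 4), (2, 16, 4), (22, 5, 2), (6, 16, 2), (20, 2, 4), (15, 16, 1), (10, 16, 4),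
  (23, 2, 4), (18, 2, 4), (16, 2, 4), (23, 5, 2), (23, 4, 1), (18, 4, 2), (23, 4, 2), (22, 2, 4),
  (4, 16, 2), (15, 16, 2), (14, 16, 2), (12, 16, 2), (23, 3, 4), (22, 4, 2), (20, 4, 2),
  (16, 4, 2), (1, 18, 8), (3, 17, 8), (18, 1, 8), (1, 20, 8), (3, 20, 8), (22, 1, 8), (5, 17, 8),
  (20, 1, 8), (5, 18, 8), (7, 17, 8), (10, 17, 4), (7, 18, 8), (22, 3, 8), (20, 3, 8), (1, 8, 16),
  (3, 8, 16), (26, 1, 2), (5, 8, 16), (7, 8, 16), (30, 1, 4), (28, 1, 4), (9, 1, 16), (8, 1, 16),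
  (9, 17, 2), (11, 17, 2), (18, 8, 1), (13, 18, 4), (15, 5, 16), (22, 8, 1), (28, 3, 4),
  (11, 3, 16), (26, 2, 1), (8, 3, 16), (9, 17, 4), (11, 17, 4), (18, 5, 8), (13, 17, 4),
  (15, 3, 16), (30, 4, 1), (20, 8, 1), (13, 5, 16), (15, 6, 16), (26, 3, 4), (28, 4, 1),
  (8, 5, 16), (1, 16, 8), (3, 16, 8), (26, 1, 8), (5, 16, 8), (7, 16, 8), (30, 1, 8), (28, 1, 8),
  (9, 16, 1), (24, 1, 8), (17, 1, 8), (16, 1, 8), (17, 3, 8), (19, 1, 8), (18, 3, 8), (21, 3, 8),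
  (23, 1, 8), (22, 5, 8), (28, 3, 8), (11, 16, 2), (25, 2, 1), (24, 3, 8), (19, 3, 8), (25, 3, 8),
  (16, 3, 8), (17, 5, 8), (19, 5, 8), (26, 5, 8), (21, 1, 8), (23, 3, 8), (30, 3, 8), (20, 5, 8),
  (13, 16, 4), (15, 16, 4), (25, 5, 2), (25, 4, 1), (24, 5, 8), (21, 5, 8), (23, 5, 8), (30, 5, 8),
  (25, 5, 8), (16, 5, 8), (17, 8, 1), (19, 8, 1), (26, 8, 1), (21, 8, 1), (23, 8, 1), (30, 8, 1),
  (28, 8, 1), (25, 1, 8), (8, 16, 1), (25, 8, 1), (24, 8, 1), (16, 8, 1), (17, 2, 8), (19, 2, 8),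
  (2, 17, 8), (9, 18, 4), (11, 18, 4), (6, 17, 8), (21, 6, 8), (20, 9, 2), (21, 2, 8), (23, 2, 8),
  (2, 20, 8), (23, 6, 8), (6, 18, 8), (20, 2, 8), (17, 8, 2), (19, 8, 2), (10, 17, 2), (21, 8, 2),
  (23, 8, 2), (14, 17, 4), (28, 5, 2), (25, 1, 2), (8, 17, 2), (25, 2, 8), (27, 1, 2), (2, 8, 16),
  (29, 2, 4), (31, 1, 4), (6, 8, 16), (28, 2, 4), (27, 2, 1), (10, 2, 16), (8, 2, 16), (17, 6, 8),
  (19, 6, 8), (10, 18, 4), (29, 4, 2), (31, 2, 4), (14, 18, 4), (20, 8, 2), (29, 8, 2),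
  (15, 17, 4), (14, 6, 16), (28, 4, 2), (8, 6, 16), (17, 9, 2), (19, 9, 2), (18, 9, 2),
  (21, 10, 4), (26, 9, 4), (22, 9, 4), (28, 9, 2), (25, 8, 2), (24, 9, 2), (25, 9, 2), (16, 9, 2),
  (26, 3, 8), (27, 1, 8), (2, 16, 8), (29, 2, 8), (31, 1, 8), (6, 16, 8), (28, 2, 8), (26, 9, 2),
  (10, 16, 2), (24, 2, 8), (27, 2, 8), (18, 2, 8), (16, 2, 8), (25, 6, 8), (27, 5, 8), (18, 6, 8),
  (29, 3, 8), (31, 2, 8), (22, 2, 8), (20, 6, 8), (25, 10, 4), (23, 9, 4), (14, 16, 4), (26, 4, 2),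
  (24, 6, 8), (29, 6, 8), (31, 5, 8), (22, 6, 8), (26, 6, 8), (16, 6, 8), (27, 9, 2), (27, 8, 1),
  (18, 8, 2), (15, 18, 4), (31, 8, 1), (22, 8, 2), (28, 8, 2), (27, 8, 2), (26, 2, 8), (8, 16, 2),
  (27, 3, 8), (26, 8, 2), (24, 8, 2), (16, 8, 2), (29, 1, 2), (27, 5, 2), (26, 5, 2), (17, 4, 8),
  (19, 4, 8), (30, 2, 1), (21, 4, 8), (4, 17, 8), (29, 5, 2), (31, 2, 1), (18, 4, 8), (23, 4, 8),
  (22, 4, 8), (4, 18, 8), (17, 8, 4), (19, 8, 4), (30, 5, 2), (21, 8, 4), (23, 8, 4), (30, 3, 4),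
  (12, 17, 4), (25, 1, 4), (8, 17, 4), (29, 9, 2), (31, 5, 2), (18, 8, 4), (29, 3, 4), (31, 4, 1),
  (22, 8, 4), (12, 18, 4), (27, 8, 4), (26, 2, 4), (8, 18, 4), (25, 4, 8), (27, 4, 2), (26, 4, 8),
  (29, 1, 4), (31, 4, 2), (30, 2, 4), (4, 8, 16), (29, 4, 1), (31, 8, 2), (30, 4, 2), (12, 4, 16),
  (8, 4, 16), (17, 9, 4), (19, 10, 4), (27, 9, 4), (21, 9, 4), (27, 4, 8), (30, 9, 2), (20, 9, 4),
  (25, 8, 4), (24, 9, 4), (25, 9, 4), (16, 9, 4), (31, 9, 2), (30, 9, 4), (18, 10, 4), (29, 10, 4),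
  (31, 9, 4), (22, 10, 4), (20, 10, 4), (27, 3, 4), (26, 8, 4), (24, 10, 4), (27, 10, 4),
  (26, 10, 4), (16, 10, 4), (28, 5, 8), (23, 10, 4), (28, 6, 8), (29, 1, 8), (31, 4, 8),
  (30, 2, 8), (4, 16, 8), (28, 9, 4), (27, 6, 8), (28, 10, 4), (12, 16, 4), (24, 4, 8), (29, 4, 8),
  (31, 3, 4), (30, 4, 8), (20, 4, 8), (16, 4, 8), (29, 9, 4), (31, 10, 4), (30, 10, 4), (29, 8, 1),
  (31, 3, 8), (30, 8, 2), (20, 8, 4), (29, 8, 4), (31, 8, 4), (30, 8, 4), (28, 4, 8), (8, 16, 4),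
  (29, 5, 8), (31, 6, 8), (30, 6, 8), (28, 8, 4), (24, 8, 4), (16, 8, 4)]

theorem indep35A : chkSubst ord35A adm35A = true := by decide +kernel

end

end PolyAlg

namespace PolyAlg

open MvPolynomial

variable {k : ℕ}

/-! ### Wood's argument -/

/-- The action of the conjugates of the Steenrod squares. -/
noncomputable def conjSq (k : ℕ) : ℕ → PolyAlg k → PolyAlg k
  | 0, u => u
  | m + 1, u => ∑ j : Fin (m + 1), sq k (j + 1) (conjSq k (m - j) u)

/-- By its recursion `χ(Sq^m)` is the sum of the terms with a positive first square, so the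
remaining term doubles it. -/
theorem sum_sq_conjSq {m : ℕ} (hm : m ≠ 0) (u : PolyAlg k) :
    ∑ ij ∈ Finset.HasAntidiagonal.antidiagonal m, sq k ij.1 (conjSq k ij.2 u) = 0 := by
  obtain ⟨m, rfl⟩ := Nat.exists_eq_succ_of_ne_zero hm
  rw [Finset.Nat.sum_antidiagonal_eq_sum_range_succ_mk, Finset.sum_range_succ']
  simp only [sq_zero, Nat.succ_eq_add_one, Nat.add_sub_add_right, Nat.sub_zero]
  rw [conjSq, Finset.sum_range fun j => sq k (j + 1) (conjSq k (m - j) u)]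
  exact CharTwo.add_self_eq_zero _

/-- Both sides run over the triples with `a + b + c = n`, grouped differently. -/
theorem sum_sum_antidiagonal {M : Type*} [AddCommMonoid M] (n : ℕ) (F : ℕ → ℕ → ℕ → M) :
    ∑ ij ∈ Finset.HasAntidiagonal.antidiagonal n,
      ∑ ab ∈ Finset.HasAntidiagonal.antidiagonal ij.1, F ab.1 ij.2 ab.2 =
    ∑ ij ∈ Finset.HasAntidiagonal.antidiagonal n,
      ∑ ab ∈ Finset.HasAntidiagonal.antidiagonal ij.2, F ab.1 ab.2 ij.1 := by
  rw [Finset.sum_sigma', Finset.sum_sigma']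
  refine Finset.sum_nbij' (fun x => ⟨(x.2.2, n - x.2.2), (x.2.1, x.1.2)⟩)
      (fun x => ⟨(n - x.2.2, x.2.2), (x.2.1, x.1.1)⟩) ?_ ?_ ?_ ?_ ?_
  all_goals
    rintro ⟨⟨i, j⟩, ⟨a, b⟩⟩ h
    simp only [Finset.mem_sigma, Finset.HasAntidiagonal.mem_antidiagonal] at h ⊢
  · omega
  · omega
  · obtain rfl : i = n - j := by omega
    trivial
  · obtain rfl : j = n - i := by omega
    trivial

/-- This is the `χ`-trick. By the Cartan formula and `sum_sq_conjSq`, `∑ Sq^i(χ(Sq^j)u · v)` over `i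
+ j = n` collapses to `u · Sq^n v`. Its terms with `i > 0` are hit, and the term `i = 0` is
`χ(Sq^n)u · v`. -/
theorem mul_sq_add_mem (n : ℕ) (u v : PolyAlg k) : u * sq k n v + conjSq k n u * v ∈ hit k := by
  have h1 : ∑ ij ∈ Finset.HasAntidiagonal.antidiagonal n, sq k ij.1 (conjSq k ij.2 u * v) =
      u * sq k n v := by
    have h2 : ∀ ij : ℕ × ℕ, sq k ij.1 (conjSq k ij.2 u * v) =
        ∑ ab ∈ Finset.HasAntidiagonal.antidiagonal ij.1,
          sq k ab.1 (conjSq k ij.2 u) * sq k ab.2 v := fun ij => sq_mul _ _ _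
    rw [Finset.sum_congr rfl fun ij _ => h2 ij,
      sum_sum_antidiagonal n fun a b c => sq k a (conjSq k b u) * sq k c v]
    simp only [← Finset.sum_mul]
    rw [Finset.sum_eq_single (n, 0)]
    · simp [sq_zero, conjSq]
    · intro ij hij hne
      rw [sum_sq_conjSq, zero_mul]
      intro h
      rw [Finset.HasAntidiagonal.mem_antidiagonal] at hij
      exact hne (Prod.ext (by omega) h)
    · intro h; exact absurd (by simp) h
  have h0 : (0, n) ∈ Finset.HasAntidiagonal.antidiagonal n := by simp
  rw [← Finset.add_sum_erase _ _ h0] at h1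
  simp only [sq_zero] at h1
  rw [← h1, add_comm, ← add_assoc, CharTwo.add_self_eq_zero, zero_add]
  refine Submodule.sum_mem _ ?_
  rintro ⟨i, j⟩ hij
  simp only [Finset.mem_erase, Finset.HasAntidiagonal.mem_antidiagonal, ne_eq, Prod.mk.injEq] at hij
  exact sq_mem_hit (fun hi => hij.1 ⟨hi, by omega⟩) _

/-- An increment `l ≤ e` of the same degree as `e` must be `e`. -/
theorem sq_dg_xp (e : Fin k → ℕ) : sq k (dg e) (xp e) = xp e ^ 2 := by
  classical
  rw [← xp_smul]
  ext s
  have hs : s = Finsupp.equivFunOnFinite.symm (⇑s) := (Finsupp.equivFunOnFinite_symm_coe s).symm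
  rw [hs, coeff_sq_xp, coeff_xp]
  refine if_congr ?_ rfl rfl
  constructor
  · rintro ⟨l, h1, h2, h3⟩
    have hle : ∀ i, l i ≤ e i := fun i => le_of_and_eq (h2 i)
    have : l = e := by
      funext i
      by_contra hne
      have : dg l < dg e := Finset.sum_lt_sum (fun i _ => hle i) ⟨i, Finset.mem_univ i, by
        have := hle i; omega⟩
      omega
    rw [h3, this, two_smul]
  · intro h
    exact ⟨e, rfl, fun i => Nat.and_self _, by rw [h, two_smul]⟩

/-- The exponent vectors with powers of two at the places where `a` is odd and zeros elsewhere. -/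
def PowVec (a e : Fin k → ℕ) : Prop :=
  ∀ i, (a i % 2 = 1 → ∃ b, e i = 2 ^ b) ∧ (a i % 2 = 0 → e i = 0)

theorem two_pow_of_and_eq {b l : ℕ} (h : 2 ^ b &&& l = l) : l = 0 ∨ l = 2 ^ b := by
  rw [Nat.two_pow_and] at h
  revert h
  cases l.testBit b <;> simp <;> omega

theorem sq_mem_powVec {a : Fin k → ℕ} {d p : ℕ} {f : PolyAlg k}
    (hf : f ∈ xspan {e | dg e = d ∧ PowVec a e}) :
    sq k p f ∈ xspan {e | dg e = p + d ∧ PowVec a e} := by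
  have : xspan {e | dg e = d ∧ PowVec a e} ≤
      (xspan {e | dg e = p + d ∧ PowVec a e}).comap (sq k p) := xspan_le.2 fun e he => by
    refine xspan_mono ?_ (sq_xp_mem p e)
    rintro c hc
    refine ⟨by rw [dg_of_mem_sqSupp hc, he.1, add_comm], fun i => ?_⟩
    obtain ⟨l, -, hl, rfl⟩ := hc
    refine ⟨fun hi => ?_, fun hi => ?_⟩
    · obtain ⟨b, hb⟩ := (he.2 i).1 hi
      have := hl i
      rw [hb] at this
      rw [Pi.add_apply, hb]
      rcases two_pow_of_and_eq this with h | h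
      · exact ⟨b, by rw [h, add_zero]⟩
      · exact ⟨b + 1, by rw [h, pow_succ]; ring⟩
    · have h0 := (he.2 i).2 hi
      have := hl i
      rw [h0, Nat.zero_and] at this
      rw [Pi.add_apply, h0, ← this]
  exact this hf

theorem conjSq_mem_powVec {a : Fin k → ℕ} {d : ℕ} {u : PolyAlg k}
    (hu : u ∈ xspan {e | dg e = d ∧ PowVec a e}) (m : ℕ) :
    conjSq k m u ∈ xspan {e | dg e = m + d ∧ PowVec a e} := by
  induction m using Nat.strong_induction_on with
  | _ m ih =>
    cases m with
    | zero => simpa [conjSq] using hu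
    | succ m =>
      rw [conjSq]
      refine Submodule.sum_mem _ fun j _ => ?_
      have h := sq_mem_powVec (p := j + 1) (ih (m - j) (by omega))
      rwa [show (j : ℕ) + 1 + (m - j + d) = m + 1 + d by omega] at h

/-- Write `x^a = u y²` with `u` square-free. Since `y² = Sq^{deg y} y`, the `χ`-trick replaces `x^a`
by `χ(Sq^{deg y})u · y`. The first factor is spanned by monomials as in `PowVec`, of degree `deg y +
deg u`; the hypothesis says that there are none. -/
theorem xp_mem_hit_of_powVec {a : Fin k → ℕ}
    (h : ∀ e, PowVec a e → dg e ≠ dg (fun i => a i / 2) + om a 0) : xp a ∈ hit k := by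
  set u : Fin k → ℕ := fun i => a i % 2
  set y : Fin k → ℕ := fun i => a i / 2
  have ha : a = u + 2 • y := by
    funext i
    simp only [u, y, Pi.add_apply, Pi.smul_apply, smul_eq_mul]
    omega
  have hu : xp u ∈ xspan {e | dg e = om a 0 ∧ PowVec a e} := by
    refine xp_mem_xspan ⟨?_, fun i => ⟨fun hi => ⟨0, hi⟩, fun hi => hi⟩⟩
    simp [dg, om, u]
  have h1 := conjSq_mem_powVec hu (dg y)
  have h2 : {e : Fin k → ℕ | dg e = dg y + om a 0 ∧ PowVec a e} = ∅ :=
    Set.eq_empty_of_forall_notMem fun e he => h e he.2 he.1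
  rw [h2, xspan, Set.image_empty, Submodule.span_empty, Submodule.mem_bot] at h1
  have h3 := mul_sq_add_mem (dg y) (xp u) (xp y)
  rwa [h1, zero_mul, add_zero, sq_dg_xp, ← xp_smul, ← xp_add, ← ha] at h3

theorem dg_eq_om_add (a : Fin k → ℕ) : dg a = om a 0 + 2 * dg fun i => a i / 2 := by
  simp only [dg, om, pow_zero, Nat.div_one, Finset.mul_sum, ← Finset.sum_add_distrib]
  exact Finset.sum_congr rfl fun i _ => (Nat.mod_add_div (a i) 2).symm

theorem om_zero_eq_card (a : Fin k → ℕ) :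
    om a 0 = (Finset.univ.filter fun i => a i % 2 = 1).card := by
  rw [Finset.card_filter, om]
  refine Finset.sum_congr rfl fun i _ => ?_
  rw [pow_zero, Nat.div_one]
  split_ifs <;> omega

theorem PowVec.dg_eq {a e : Fin k → ℕ} (h : PowVec a e) :
    dg e = ∑ i ∈ Finset.univ.filter (fun i => a i % 2 = 1), e i := by
  rw [dg, Finset.sum_filter]
  refine Finset.sum_congr rfl fun i _ => ?_
  split_ifs with hi
  · rfl
  · exact (h i).2 (by omega)

theorem xp_mem_hit_of_om_one {a : Fin k → ℕ} (ha : om a 0 = 1)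
    (h : ∀ b, 2 ^ b ≠ dg (fun i => a i / 2) + 1) : xp a ∈ hit k := by
  refine xp_mem_hit_of_powVec fun e he hd => ?_
  have hc := ha
  rw [om_zero_eq_card, Finset.card_eq_one] at hc
  obtain ⟨i, hi⟩ := hc
  rw [he.dg_eq, hi, Finset.sum_singleton, ha] at hd
  have hmem : i ∈ Finset.univ.filter fun i => a i % 2 = 1 := by rw [hi]; simp
  obtain ⟨b, hb⟩ := (he i).1 (Finset.mem_filter.1 hmem).2
  exact h b (hb ▸ hd)

theorem xp_mem_hit_of_om_three {a : Fin k → ℕ} (ha : om a 0 = 3)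
    (h : ∀ b c d, 2 ^ b + 2 ^ c + 2 ^ d ≠ dg (fun i => a i / 2) + 3) : xp a ∈ hit k := by
  refine xp_mem_hit_of_powVec fun e he hd => ?_
  have hc := ha
  rw [om_zero_eq_card, Finset.card_eq_three] at hc
  obtain ⟨i, j, l, hij, hil, hjl, hs⟩ := hc
  rw [he.dg_eq, hs, Finset.sum_insert (by simp [hij, hil]), Finset.sum_pair hjl, ha] at hd
  have hmem : ∀ z, z = i ∨ z = j ∨ z = l → ∃ b, e z = 2 ^ b := by
    intro z hz
    have : z ∈ Finset.univ.filter fun i => a i % 2 = 1 := by rw [hs]; simpa using hz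
    exact (he z).1 (Finset.mem_filter.1 this).2
  obtain ⟨b, hb⟩ := hmem i (Or.inl rfl)
  obtain ⟨c, hc⟩ := hmem j (Or.inr (Or.inl rfl))
  obtain ⟨d, hd'⟩ := hmem l (Or.inr (Or.inr rfl))
  refine h b c d ?_
  rw [← hb, ← hc, ← hd', ← hd, add_assoc]

theorem two_pow_mod_eight (b : ℕ) : 2 ^ b = 1 ∨ 2 ^ b = 2 ∨ 2 ^ b = 4 ∨ 2 ^ b % 8 = 0 := by
  match b with
  | 0 => simp
  | 1 => simp
  | 2 => simp
  | b + 3 => right; right; right; rw [pow_add]; omega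

/-- With `s = t + 4` the degree is `80·2^t - 5`, which is odd, so one or three exponents are odd. If
one is, Wood's argument needs `40·2^t - 2` to be a power of two, but it is `6` modulo `8`. If three
are, it needs `40·2^t - 1` to be a sum of three powers of two; being `7` modulo `8`, this could only
be `1 + 2 + 4`, which is too small. -/
theorem low_mem_hit {s : ℕ} (hs : 4 ≤ s) {a : Fin 5 → ℕ} (hd : dg a = 5 * (2 ^ s - 1))
    (ha : om a 0 < 5) : xp a ∈ hit 5 := by
  obtain ⟨t, rfl⟩ := Nat.exists_eq_add_of_le' hs
  have hp : 2 ^ (t + 4) = 16 * 2 ^ t := by rw [pow_add]; ring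
  have ht : 0 < 2 ^ t := by positivity
  rw [hp] at hd
  have h1 := dg_eq_om_add a
  have h2 : om a 0 = 1 ∨ om a 0 = 3 := by omega
  rcases h2 with h2 | h2
  · refine xp_mem_hit_of_om_one h2 fun b hb => ?_
    rcases two_pow_mod_eight b with h | h | h | h <;> omega
  · refine xp_mem_hit_of_om_three h2 fun b c d hb => ?_
    rcases two_pow_mod_eight b with h | h | h | h <;>
      rcases two_pow_mod_eight c with h' | h' | h' | h' <;>
        rcases two_pow_mod_eight d with h'' | h'' | h'' | h'' <;> omega

end PolyAlg

namespace PolyAlg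

open MvPolynomial

variable {k : ℕ}

/-! ### Degrees -/

theorem dg_eq_degree (s : Fin k →₀ ℕ) : dg (⇑s) = s.degree :=
  (Finsupp.degree_eq_sum s).symm

theorem homogeneousSubmodule_eq_xspan (d : ℕ) :
    homogeneousSubmodule (Fin k) (ZMod 2) d = xspan {e | dg e = d} := by
  refine le_antisymm (fun f hf => ?_) (xspan_le.2 fun e he => ?_)
  · rw [f.as_sum]
    refine Submodule.sum_mem _ fun s hs => ?_
    have : monomial s (coeff s f) = coeff s f • xp (⇑s) := by
      rw [xp_eq_monomial, smul_monomial, smul_eq_mul, mul_one, Finsupp.equivFunOnFinite_symm_coe]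
    rw [this]
    refine Submodule.smul_mem _ _ (xp_mem_xspan ?_)
    have h := (mem_homogeneousSubmodule d f).1 hf (mem_support_iff.1 hs)
    exact (dg_eq_degree s).trans ((DFunLike.congr_fun Finsupp.degree_eq_weight_one s).trans h)
  · rw [mem_homogeneousSubmodule, xp_eq_monomial]
    refine isHomogeneous_monomial _ ?_
    rw [← dg_eq_degree]
    exact he

theorem homogeneousComponent_xp (d : ℕ) (e : Fin k → ℕ) :
    homogeneousComponent d (xp e) = if dg e = d then xp e else 0 := by
  have h : ∀ c, dg e = c → xp e ∈ homogeneousSubmodule (Fin k) (ZMod 2) c := fun c hc => by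
    rw [homogeneousSubmodule_eq_xspan]
    exact xp_mem_xspan hc
  rw [homogeneousComponent_of_mem (h _ rfl)]
  simp only [eq_comm]

theorem homogeneousComponent_mem_xspan {S : Set (Fin k → ℕ)} (d : ℕ) {f : PolyAlg k}
    (hf : f ∈ xspan S) : homogeneousComponent d f ∈ xspan {e | dg e = d ∧ e ∈ S} := by
  have : xspan S ≤ (xspan {e | dg e = d ∧ e ∈ S}).comap (homogeneousComponent d) :=
    xspan_le.2 fun e he => by
      rw [Submodule.mem_comap, homogeneousComponent_xp]
      split_ifs with h
      · exact xp_mem_xspan ⟨h, he⟩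
      · exact Submodule.zero_mem _
  exact this hf

theorem induction_xp {p : PolyAlg k → Prop} (f : PolyAlg k) (h0 : p 0)
    (hadd : ∀ f g, p f → p g → p (f + g)) (h : ∀ e, p (xp e)) : p f := by
  have hf : f ∈ xspan Set.univ := by rw [xspan_univ]; trivial
  rw [xspan] at hf
  induction hf using Submodule.span_induction with
  | mem x hx => obtain ⟨e, -, rfl⟩ := hx; exact h e
  | zero => exact h0
  | add x y _ _ hx hy => exact hadd x y hx hy
  | smul a x _ hx =>
    rcases (by decide : ∀ a : ZMod 2, a = 0 ∨ a = 1) a with rfl | rfl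
    · rwa [zero_smul]
    · rwa [one_smul]

/-- Each square raises degrees by a fixed amount, so the hit polynomials form a graded subspace. -/
theorem homogeneousComponent_mem_hit (d : ℕ) {f : PolyAlg k} (hf : f ∈ hit k) :
    homogeneousComponent d f ∈ hit k := by
  have : hit k ≤ (hit k).comap (homogeneousComponent d) := hit_le_of_sq_mem fun i hi f => by
    rw [Submodule.mem_comap]
    induction f using induction_xp with
    | h0 => simp
    | hadd f g hf hg => rw [map_add, map_add]; exact Submodule.add_mem _ hf hg
    | h e =>
      have h1 : sq k i (xp e) ∈ homogeneousSubmodule (Fin k) (ZMod 2) (dg e + i) := by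
        rw [homogeneousSubmodule_eq_xspan]
        exact sq_mem_xspan (xp_mem_xspan rfl)
      rw [homogeneousComponent_of_mem h1]
      split_ifs
      · exact sq_mem_hit hi _
      · exact Submodule.zero_mem _
  exact this hf

theorem finiteDimensional_xspan {d : ℕ} {S : Set (Fin 5 → ℕ)} (hS : ∀ e ∈ S, dg e = d) :
    FiniteDimensional (ZMod 2) (xspan S) := by
  have : Finite {a : Fin 5 → ℕ | dg a = d} := finite_dg d
  have h : S.Finite := Set.Finite.subset (Set.toFinite {a : Fin 5 → ℕ | dg a = d}) hS
  exact FiniteDimensional.span_of_finite _ (h.image _)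

/-- The dimension of a space of classes, from a basis. -/
theorem finrank_map_mkQ {ι : Type*} [Fintype ι] {S : Set (Fin k → ℕ)} (v : ι → PolyAlg k)
    (hv : ∀ i, v i ∈ xspan S) (hspan : ∀ e ∈ S, xp e ∈ hit k ⊔ Submodule.span (ZMod 2) (Set.range v))
    (hind : ∀ c : ι → ZMod 2, ∑ i, c i • v i ∈ hit k → ∀ i, c i = 0) :
    Module.finrank (ZMod 2) ((xspan S).map (hit k).mkQ) = Fintype.card ι := by
  have h1 : (xspan S).map (hit k).mkQ =
      Submodule.span (ZMod 2) (Set.range fun i => (hit k).mkQ (v i)) := by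
    have h2 : (Submodule.span (ZMod 2) (Set.range v)).map (hit k).mkQ =
        Submodule.span (ZMod 2) (Set.range fun i => (hit k).mkQ (v i)) := by
      rw [Submodule.map_span, ← Set.range_comp]
      rfl
    rw [← h2]
    refine le_antisymm ?_ (Submodule.map_mono (Submodule.span_le.2 ?_))
    · have h3 : xspan S ≤ hit k ⊔ Submodule.span (ZMod 2) (Set.range v) := xspan_le.2 hspan
      refine (Submodule.map_mono h3).trans ?_
      rw [Submodule.map_sup, Submodule.mkQ_map_self, bot_sup_eq]
    · rintro _ ⟨i, rfl⟩
      exact hv i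
  rw [h1]
  refine finrank_span_eq_card (Fintype.linearIndependent_iff.2 fun c hc => hind c ?_)
  rw [← Submodule.Quotient.mk_eq_zero, ← Submodule.mkQ_apply, map_sum]
  simpa only [map_smul] using hc

/-! ### Kameko's homomorphism -/

theorem om_zero_lt_iff {e : Fin 5 → ℕ} : om e 0 < 5 ↔ ¬ ∀ i, e i % 2 = 1 := by
  simp only [om, pow_zero, Nat.div_one, Fin.sum_univ_five, Fin.forall_fin_succ]
  simp
  omega

/-- Kameko's homomorphism: `x₁⋯x₅ y² ↦ y`, and the other monomials go to zero. -/
noncomputable def kameko : PolyAlg 5 →ₗ[ZMod 2] PolyAlg 5 :=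
  (basisMonomials (Fin 5) (ZMod 2)).constr (ZMod 2) fun s =>
    if om (⇑s) 0 < 5 then 0 else xp fun i => s i / 2

theorem kameko_xp (e : Fin 5 → ℕ) :
    kameko (xp e) = if om e 0 < 5 then 0 else xp fun i => e i / 2 := by
  have h := congrFun (coe_basisMonomials (Fin 5) (ZMod 2)) (Finsupp.equivFunOnFinite.symm e)
  rw [xp_eq_monomial, ← h, kameko, Module.Basis.constr_basis]
  rfl

theorem kameko_of_mem {f : PolyAlg 5} (hf : f ∈ xspan {e | om e 0 < 5}) : kameko f = 0 := by
  have : xspan {e : Fin 5 → ℕ | om e 0 < 5} ≤ LinearMap.ker kameko := xspan_le.2 fun e he => by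
    exact (kameko_xp e).trans (if_pos he)
  exact this hf

/-- The map `y ↦ x₁⋯x₅ y²`. -/
noncomputable def kamekoSection : PolyAlg 5 →ₗ[ZMod 2] PolyAlg 5 := mulPow (xp 1) 1

theorem kamekoSection_xp (e : Fin 5 → ℕ) : kamekoSection (xp e) = xp (1 + 2 • e) := by
  rw [kamekoSection, mulPow_apply, ← xp_smul, ← xp_add, pow_one]

theorem kameko_kamekoSection (f : PolyAlg 5) : kameko (kamekoSection f) = f := by
  induction f using induction_xp with
  | h0 => simp
  | hadd f g hf hg => rw [map_add, map_add, hf, hg]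
  | h e =>
    rw [kamekoSection_xp, kameko_xp, if_neg]
    · congr 1
      funext i
      simp only [Pi.add_apply, Pi.one_apply, Pi.smul_apply, smul_eq_mul]
      omega
    · rw [om_zero_lt_iff, not_not]
      intro i
      simp only [Pi.add_apply, Pi.one_apply, Pi.smul_apply, smul_eq_mul]
      omega

theorem one_add_two_smul_half {e : Fin 5 → ℕ} (h : ¬ om e 0 < 5) :
    e = 1 + 2 • fun i => e i / 2 := by
  rw [om_zero_lt_iff, not_not] at h
  funext i
  have := h i
  simp only [Pi.add_apply, Pi.one_apply, Pi.smul_apply, smul_eq_mul]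
  omega

theorem sub_kamekoSection_kameko {S : Set (Fin 5 → ℕ)} {f : PolyAlg 5} (hf : f ∈ xspan S) :
    f - kamekoSection (kameko f) ∈ xspan {e | e ∈ S ∧ om e 0 < 5} := by
  have : xspan S ≤ (xspan {e | e ∈ S ∧ om e 0 < 5}).comap
      (LinearMap.id - kamekoSection.comp kameko) := xspan_le.2 fun e he => by
    change xp e - kamekoSection (kameko (xp e)) ∈ xspan {e | e ∈ S ∧ om e 0 < 5}
    rw [kameko_xp]
    split_ifs with h
    · rw [map_zero, sub_zero]
      exact xp_mem_xspan ⟨he, h⟩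
    · rw [kamekoSection_xp, ← one_add_two_smul_half h, sub_self]
      exact Submodule.zero_mem _
  exact this hf

/-- This is `sq_mulPow_sub_mem` for `x = x₁⋯x₅` and `r = 1`. All five digits of the first row of `x`
are `1`, so smaller weight means an even exponent. -/
theorem sq_kamekoSection_sub_mem (m : ℕ) (f : PolyAlg 5) :
    sq 5 (2 * m) (kamekoSection f) - kamekoSection (sq 5 m f) ∈ xspan {e | om e 0 < 5} := by
  induction f using induction_xp with
  | h0 => simp
  | hadd f g hf hg =>
    simp only [map_add]
    rw [add_sub_add_comm]
    exact Submodule.add_mem _ hf hg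
  | h e =>
    have h := sq_mulPow_sub_mem (k := 5) (r := 1) (p := m) (x := 1) (fun i => by simp)
      (xp_mem_xspan (S := {e' | dg e' = dg e}) (e := e) rfl)
    rw [pow_one] at h
    refine xspan_mono ?_ h
    rintro b ⟨-, t, ht, -, h2⟩
    obtain rfl : t = 0 := by omega
    have h1 : om (1 : Fin 5 → ℕ) 0 = 5 := by simp [om]
    rw [h1] at h2
    exact h2

/-- The section does not preserve hit polynomials, but it does so modulo monomials with an even
exponent; this suffices to identify the kernel of Kameko's map. -/
theorem kamekoSection_mem {f : PolyAlg 5} (hf : f ∈ hit 5) :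
    kamekoSection f ∈ hit 5 ⊔ xspan {e | om e 0 < 5} := by
  have : hit 5 ≤ (hit 5 ⊔ xspan {e | om e 0 < 5}).comap kamekoSection :=
    hit_le_of_sq_mem fun i hi f => by
      have h1 := sq_kamekoSection_sub_mem i f
      have h2 : sq 5 (2 * i) (kamekoSection f) ∈ hit 5 := sq_mem_hit (by omega) _
      have := Submodule.sub_mem _ (Submodule.mem_sup_left h2)
        (Submodule.mem_sup_right (S := hit 5) h1)
      rwa [sub_sub_cancel] at this
  exact this hf

/-- If all exponents of `e + l` are odd, then each `e i` is odd and each `l i` even, because the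
last digit of `l i` is at most that of `e i`. This contradicts an odd `p` as well as an even
exponent in `e`. -/
theorem om_zero_lt_of_mem_sqSupp {p : ℕ} {e c : Fin 5 → ℕ} (h : c ∈ sqSupp p e)
    (hp : p % 2 = 1 ∨ om e 0 < 5) : om c 0 < 5 := by
  obtain ⟨l, rfl, hl, rfl⟩ := h
  have hb : ∀ i, l i % 2 ≤ e i % 2 := fun i => by
    have := bit_le_of_and_eq (hl i) 0
    simpa using this
  rw [om_zero_lt_iff] at hp ⊢
  intro hodd
  have h2 : ∀ i, e i % 2 = 1 ∧ l i % 2 = 0 := fun i => by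
    have h3 := hodd i
    have h4 := hb i
    rw [Pi.add_apply] at h3
    omega
  rcases hp with hp | hp
  · rw [dg, Finset.sum_nat_mod, Finset.sum_congr rfl fun i _ => (h2 i).2] at hp
    simp at hp
  · exact hp fun i => (h2 i).1

/-- Squares of odd index, and squares of monomials with an even exponent, produce only monomials
killed by `kameko`. In the remaining case `Sq^{2m}(x₁⋯x₅ y²)` agrees with `x₁⋯x₅ (Sq^m y)²` up to
killed monomials, and its image `Sq^m y` is hit; here `m > 0`. -/
theorem kameko_mem_hit {f : PolyAlg 5} (hf : f ∈ hit 5) : kameko f ∈ hit 5 := by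
  have : hit 5 ≤ (hit 5).comap kameko := hit_le_of_sq_mem fun i hi f => by
    rw [Submodule.mem_comap]
    induction f using induction_xp with
    | h0 => simp
    | hadd f g hf hg => rw [map_add, map_add]; exact Submodule.add_mem _ hf hg
    | h e =>
      by_cases h : i % 2 = 1 ∨ om e 0 < 5
      · rw [kameko_of_mem (xspan_mono (fun c hc => om_zero_lt_of_mem_sqSupp hc h) (sq_xp_mem i e))]
        exact Submodule.zero_mem _
      · push Not at h
        obtain ⟨m, rfl⟩ : ∃ m, i = 2 * m := ⟨i / 2, by omega⟩
        have h1 := kameko_of_mem (sq_kamekoSection_sub_mem m (xp fun i => e i / 2))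
        rw [map_sub, kameko_kamekoSection, sub_eq_zero, kamekoSection_xp,
          ← one_add_two_smul_half (not_lt.2 h.2)] at h1
        rw [h1]
        exact sq_mem_hit (by omega) _
  exact this hf

/-- Monomials of degree `d` with an even exponent. -/
def low (d : ℕ) : Set (Fin 5 → ℕ) := {e | dg e = d ∧ om e 0 < 5}

theorem map_kameko_xspan (d : ℕ) :
    (xspan {e | dg e = 2 * d + 5}).map kameko = xspan {e | dg e = d} := by
  have hdg : ∀ e : Fin 5 → ℕ, dg (1 + 2 • e) = 2 * dg e + 5 := fun e => by
    rw [dg_add, dg_smul, show dg (1 : Fin 5 → ℕ) = 5 by simp [dg]]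
    ring
  refine le_antisymm (Submodule.map_le_iff_le_comap.2 (xspan_le.2 fun e he => ?_))
    (xspan_le.2 fun e he => ?_)
  · rw [Submodule.mem_comap, kameko_xp]
    split_ifs with h
    · exact Submodule.zero_mem _
    · refine xp_mem_xspan ?_
      have h1 := hdg fun i => e i / 2
      rw [← one_add_two_smul_half h] at h1
      simp only [Set.mem_ofPred_eq] at he ⊢
      omega
  · refine ⟨kamekoSection (xp e), ?_, kameko_kamekoSection _⟩
    rw [kamekoSection_xp]
    refine xp_mem_xspan ?_
    simp only [Set.mem_ofPred_eq] at he ⊢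
    rw [hdg, he]

/-- Rank-nullity for the induced map from degree `2d + 5` to degree `d`: it is surjective because of
the section, and its kernel consists of the classes coming from `low`. -/
theorem finrank_cohitDegree_kameko (d : ℕ) :
    Module.finrank (ZMod 2) (cohitDegree 5 (2 * d + 5)) =
      Module.finrank (ZMod 2) (cohitDegree 5 d) +
        Module.finrank (ZMod 2) ((xspan (low (2 * d + 5))).map (hit 5).mkQ) := by
  let κ : Cohit 5 →ₗ[ZMod 2] Cohit 5 := (hit 5).mapQ (hit 5) kameko fun f hf => kameko_mem_hit hf
  have hκ : ∀ f, κ ((hit 5).mkQ f) = (hit 5).mkQ (kameko f) := fun f => rfl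
  have hA : cohitDegree 5 (2 * d + 5) = (xspan {e | dg e = 2 * d + 5}).map (hit 5).mkQ := by
    rw [cohitDegree, homogeneousSubmodule_eq_xspan]
  have hB : cohitDegree 5 d = (cohitDegree 5 (2 * d + 5)).map κ := by
    rw [hA, ← Submodule.map_comp, cohitDegree, homogeneousSubmodule_eq_xspan, ← map_kameko_xspan,
      ← Submodule.map_comp]
    rfl
  have hL : (xspan (low (2 * d + 5))).map (hit 5).mkQ ≤ cohitDegree 5 (2 * d + 5) := by
    rw [hA]
    exact Submodule.map_mono (xspan_mono fun e he => he.1)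
  have : FiniteDimensional (ZMod 2) (xspan {e : Fin 5 → ℕ | dg e = 2 * d + 5}) :=
    finiteDimensional_xspan fun e he => he
  have : FiniteDimensional (ZMod 2) (cohitDegree 5 (2 * d + 5)) := by
    rw [hA]
    infer_instance
  have hker : LinearMap.ker (κ.domRestrict (cohitDegree 5 (2 * d + 5))) =
      ((xspan (low (2 * d + 5))).map (hit 5).mkQ).comap (cohitDegree 5 (2 * d + 5)).subtype := by
    ext ⟨z, hz⟩
    rw [LinearMap.mem_ker, LinearMap.domRestrict_apply, Submodule.mem_comap,
      Submodule.subtype_apply]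
    constructor
    · intro h0
      rw [hA] at hz
      obtain ⟨f, hf, rfl⟩ := hz
      change (hit 5).mkQ (kameko f) = 0 at h0
      rw [Submodule.mkQ_apply, Submodule.Quotient.mk_eq_zero] at h0
      -- The section applied to `kameko f` is hit up to monomials with an even exponent, and `f`
      -- differs from it only by such monomials.
      have h1 := Submodule.add_mem _ (kamekoSection_mem h0) (Submodule.mem_sup_right (S := hit 5)
        (xspan_mono (fun e he => he.2) (sub_kamekoSection_kameko hf)))
      rw [add_sub_cancel] at h1
      obtain ⟨h, hh, l, hl, hsum⟩ := Submodule.mem_sup.1 h1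
      -- The decomposition of `f` need not be homogeneous, so its component of degree `2d + 5` is
      -- taken; that of a hit polynomial is again hit.
      have h2 : homogeneousComponent (2 * d + 5) f = f := by
        rw [homogeneousComponent_of_mem (m := 2 * d + 5), if_pos rfl]
        rwa [homogeneousSubmodule_eq_xspan]
      have h3 := congrArg (homogeneousComponent (2 * d + 5)) hsum
      rw [h2, map_add] at h3
      refine ⟨_, homogeneousComponent_mem_xspan (2 * d + 5) hl, ?_⟩
      change _ = (hit 5).mkQ f
      rw [← h3, map_add, right_eq_add, Submodule.mkQ_apply, Submodule.Quotient.mk_eq_zero]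
      exact homogeneousComponent_mem_hit _ hh
    · rintro ⟨f, hf, rfl⟩
      change κ ((hit 5).mkQ f) = 0
      rw [hκ, kameko_of_mem (xspan_mono (fun e he => he.2) hf), map_zero]
  have h := LinearMap.finrank_range_add_finrank_ker (κ.domRestrict (cohitDegree 5 (2 * d + 5)))
  rw [LinearMap.range_domRestrict, ← hB, hker,
    (Submodule.comapSubtypeEquivOfLe hL).finrank_eq] at h
  exact h.symm

theorem finrank_low_eq_zero {d : ℕ} (h : ∀ e ∈ low d, xp e ∈ hit 5) :
    Module.finrank (ZMod 2) ((xspan (low d)).map (hit 5).mkQ) = 0 := by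
  have h1 : (xspan (low d)).map (hit 5).mkQ = ⊥ := by
    rw [eq_bot_iff, Submodule.map_le_iff_le_comap, ← LinearMap.ker, Submodule.ker_mkQ]
    exact xspan_le.2 h
  rw [h1, finrank_bot]

end PolyAlg

namespace PolyAlg

open MvPolynomial

/-! ### The dimensions -/

/-- Whether the monomial with code `n` lies in `low d`. -/
noncomputable def chkLow (d n : ℕ) : Bool := andB (Nat.beq (dgN n) d) (Nat.blt (wt n 0) 5)

theorem mem_low_of_chkLow {d n : ℕ} (h : chkLow d n = true) : dig n ∈ low d := by
  rw [chkLow, andB_eq_true] at h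
  have h1 := Nat.eq_of_beq_eq_true h.1
  have h2 : wt n 0 < 5 := Nat.le_of_ble_eq_true h.2
  rw [dgN_eq] at h1
  rw [wt_eq n (by norm_num)] at h2
  exact ⟨h1, h2⟩

theorem getD_mem {L : List ℕ} {j : ℕ} (hj : j < L.length) : L.getD j 0 ∈ L := by
  rw [List.getD_eq_getElem _ _ hj]
  exact List.getElem_mem hj

/-- Spanning follows by elimination along `Lt`, which never leaves the monomials with an even
exponent; independence is the last hypothesis. -/
theorem finrank_low {d : ℕ} (hd : d < 64) {L : List ℕ} (hL : ∀ n ∈ L, chkLow d n = true)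
    (hspan : ∀ a ∈ low d, xp a ∈ hit 5 ∨ val a ∈ L ∨ Red a)
    (hind : ∀ c : ℕ → ZMod 2, ∑ j ∈ Finset.range L.length, c j • xp (dig (L.getD j 0)) ∈ hit 5 →
      ∀ j < L.length, c j = 0) :
    Module.finrank (ZMod 2) ((xspan (low d)).map (hit 5).mkQ) = L.length := by
  let v : Fin L.length → PolyAlg 5 := fun j => xp (dig (L.getD j 0))
  have h := finrank_map_mkQ (S := low d) v
    (fun j => xp_mem_xspan (mem_low_of_chkLow (hL _ (getD_mem j.2)))) ?_ ?_
  · rwa [Fintype.card_fin] at h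
  · rintro a ⟨had, ha⟩
    refine xp_mem_of_red le_sup_left (fun a => om a 0 < 5)
      (fun a b ha _ _ hba => (om_zero_le_of_lt hba).trans_lt ha) (fun a ha had => ?_) a ha had
    rcases hspan a ⟨had, ha⟩ with h | h | h
    · exact Or.inl (Submodule.mem_sup_left h)
    · left
      obtain ⟨j, hj, hja⟩ := List.getElem_of_mem h
      refine Submodule.mem_sup_right (Submodule.subset_span ⟨⟨j, hj⟩, ?_⟩)
      have hlt : ∀ i, a i < 64 := fun i => by
        have := Finset.single_le_sum (f := a) (fun _ _ => Nat.zero_le _) (Finset.mem_univ i)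
        exact (this.trans had.le).trans_lt hd
      change xp (dig (L.getD j 0)) = xp a
      rw [List.getD_eq_getElem _ _ hj, hja, dig_val hlt]
    · exact Or.inr h
  · intro c hc i
    let c' : ℕ → ZMod 2 := fun j => if hj : j < L.length then c ⟨j, hj⟩ else 0
    have h1 : ∑ j ∈ Finset.range L.length, c' j • xp (dig (L.getD j 0)) ∈ hit 5 := by
      rw [Finset.sum_range]
      simpa [c', v] using hc
    simpa [c'] using hind c' h1 i i.2

theorem finrank_low_five : Module.finrank (ZMod 2) ((xspan (low 5)).map (hit 5).mkQ) = 45 := by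
  have hL : allB (chkLow 5) adm5 = true := by decide +kernel
  have hlen : adm5.length = 45 := by decide +kernel
  rw [← hlen]
  refine finrank_low (by norm_num) (allB_eq_true.1 hL) (fun a ha => Or.inr ?_) fun c hc => ?_
  · simpa using mem_or_red_of_search blockData_valid (by rfl) (by norm_num) cover5 a ha.1
      (Nat.ble_eq_true_of_le ha.2)
  · exact eq_zero_of_chkIndep (T := ∅) reps5_valid (by simp) indep5 (Submodule.mem_sup_left hc)

theorem finrank_low_fifteen :
    Module.finrank (ZMod 2) ((xspan (low 15)).map (hit 5).mkQ) = 386 := by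
  have hL : allB (chkLow 15) adm15 = true := by decide +kernel
  have hlen : adm15.length = 386 := by decide +kernel
  rw [← hlen]
  refine finrank_low (by norm_num) (allB_eq_true.1 hL) (fun a ha => Or.inr ?_) fun c hc => ?_
  · simpa using mem_or_red_of_search blockData_valid (by rfl) (by norm_num) cover15 a ha.1
      (Nat.ble_eq_true_of_le ha.2)
  · exact eq_zero_of_chkIndep (T := ∅) reps15_valid (by simp) indep15 (Submodule.mem_sup_left hc)

theorem om_comp_perm (e : Fin 5 → ℕ) (σ : Equiv.Perm (Fin 5)) (u : ℕ) : om (e ∘ σ) u = om e u :=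
  Equiv.sum_comp σ fun i => e i / 2 ^ u % 2

theorem reps35_om {F : List ℕ} (hF : F ∈ reps35) {x : ℕ} (hx : x ∈ F) : om (dig x) 1 ≠ 2 := by
  have h : allB (allB fun x => Bool.not (Nat.beq (wt x 1) 2)) reps35 = true := by decide +kernel
  rw [← wt_eq x (by norm_num)]
  have h2 := allB_eq_true.1 (allB_eq_true.1 h F hF) x hx
  rw [Bool.not_eq_true'] at h2
  exact Nat.ne_of_beq_eq_false h2

theorem adm35A_om {i : ℕ} (hi : i ∈ adm35A) : om (dig (wOf i 5)) 1 = 2 := by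
  have h : allB (fun i => Nat.beq (wt (wOf i 5) 1) 2) adm35A = true := by decide +kernel
  rw [← wt_eq _ (by norm_num)]
  exact Nat.eq_of_beq_eq_true (allB_eq_true.1 h i hi)

/-- The functionals in `reps35` involve only monomials of second weight different from `2`, a
condition invariant under permutations, so they vanish on everything spanned by `adm35A`. They kill
the coefficients on `adm35B` first, and what remains is a relation of weight `(3,2,1,1,1)`, refuted
by the spike functionals. -/
theorem independent_of_degree_thirty_five (c : ℕ → ZMod 2)
    (hc : ∑ j ∈ Finset.range (adm35B ++ adm35A.map fun i => wOf i 5).length,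
      c j • xp (dig ((adm35B ++ adm35A.map fun i => wOf i 5).getD j 0)) ∈ hit 5) :
    ∀ j < (adm35B ++ adm35A.map fun i => wOf i 5).length, c j = 0 := by
  rw [List.length_append, List.length_map, Finset.sum_range_add] at hc
  have e1 : ∑ j ∈ Finset.range adm35B.length,
      c j • xp (dig ((adm35B ++ adm35A.map fun i => wOf i 5).getD j 0)) =
      ∑ j ∈ Finset.range adm35B.length, c j • xp (dig (adm35B.getD j 0)) :=
    Finset.sum_congr rfl fun j hj => by rw [List.getD_append _ _ _ _ (Finset.mem_range.1 hj)]
  have e2 : ∑ j ∈ Finset.range adm35A.length, c (adm35B.length + j) •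
      xp (dig ((adm35B ++ adm35A.map fun i => wOf i 5).getD (adm35B.length + j) 0)) =
      ∑ j ∈ Finset.range adm35A.length,
        c (adm35B.length + j) • xp (vOf (adm35A.getD j 0) 5) :=
    Finset.sum_congr rfl fun j hj => by
      rw [List.getD_append_right _ _ _ _ (Nat.le_add_right _ _), Nat.add_sub_cancel_left]
      have hj' := Finset.mem_range.1 hj
      rw [List.getD_eq_getElem _ _ (by simpa using hj'), List.getElem_map,
        List.getD_eq_getElem _ _ hj', dig_wOf _ (by norm_num)]
  rw [e1, e2] at hc
  have hA : ∑ j ∈ Finset.range adm35A.length, c (adm35B.length + j) •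
      xp (vOf (adm35A.getD j 0) 5) ∈ xspan {e | om e 1 = 2} :=
    Submodule.sum_mem _ fun j hj => Submodule.smul_mem _ _ (xp_mem_xspan (by
      have := adm35A_om (getD_mem (Finset.mem_range.1 hj))
      rwa [dig_wOf _ (by norm_num)] at this))
  have hB := Submodule.sub_mem _ (Submodule.mem_sup_left hc) (Submodule.mem_sup_right (S := hit 5) hA)
  rw [add_sub_cancel_right] at hB
  have h1 := eq_zero_of_chkIndep reps35_valid (fun F hF x hx e he σ h => reps35_om hF hx (by
    rw [h, om_comp_perm]; exact he)) indep35 hB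
  rw [Finset.sum_eq_zero fun j hj => by rw [h1 j (Finset.mem_range.1 hj), zero_smul],
    zero_add] at hc
  have h2 := eq_zero_of_chkSubst indep35A hc
  intro j hj
  rw [List.length_append, List.length_map] at hj
  rcases Nat.lt_or_ge j adm35B.length with h | h
  · exact h1 j h
  · obtain ⟨l, rfl⟩ := Nat.exists_eq_add_of_le h
    exact h2 l (by omega)

theorem finrank_low_thirty_five :
    Module.finrank (ZMod 2) ((xspan (low 35)).map (hit 5).mkQ) = 685 := by
  have hL : allB (chkLow 35) (adm35B ++ adm35A.map fun i => wOf i 5) = true := by decide +kernel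
  have hlen : (adm35B ++ adm35A.map fun i => wOf i 5).length = 685 := by decide +kernel
  rw [← hlen]
  refine finrank_low (by norm_num) (allB_eq_true.1 hL) (fun a ha => ?_)
    independent_of_degree_thirty_five
  obtain ⟨had, ha⟩ := ha
  have h := dg_eq_om_add a
  -- The number of odd exponents has the parity of `35` and is less than five.
  have h' : om a 0 = 1 ∨ om a 0 = 3 := by omega
  rcases h' with h' | h'
  -- Halving the exponents leaves degree `17`, and `17 + 1` is not a power of two.
  · refine Or.inl (xp_mem_hit_of_om_one h' fun b hb => ?_)
    rcases two_pow_mod_eight b with hb' | hb' | hb' | hb' <;> omega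
  · have := mem_or_red_of_search blockData_valid monoData_valid (by norm_num) cover35 a had
      (by rw [h']; rfl)
    rw [List.mem_append]
    exact Or.inr (this.imp_left Or.symm)

/-- The class of `1` spans, and it is nonzero because the constant coefficient vanishes on hit
polynomials. -/
theorem finrank_cohitDegree_zero : Module.finrank (ZMod 2) (cohitDegree 5 0) = 1 := by
  have h1 : xp (dig 0) = (1 : PolyAlg 5) := by simp [xp, dig]
  rw [cohitDegree, homogeneousSubmodule_eq_xspan]
  refine finrank_map_mkQ (ι := Unit) (fun _ => xp (dig 0)) (fun _ => xp_mem_xspan ?_) ?_ ?_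
  · simp [dg, dig]
  · intro e he
    refine Submodule.mem_sup_right (Submodule.subset_span ⟨(), ?_⟩)
    have : e = dig 0 := by
      funext i
      simpa [dig] using Finset.sum_eq_zero_iff.1 he i (Finset.mem_univ i)
    rw [this]
  · intro c hc i
    have h : chkF [0] = true := by decide +kernel
    have h2 := hit_le_ker_cf h hc
    rw [LinearMap.mem_ker, cf_apply] at h2
    have h3 : coeff (Finsupp.equivFunOnFinite.symm (dig 0)) (xp (dig 0)) = 1 := by
      rw [coeff_xp, if_pos rfl]
    simpa [h3] using h2

/-- `5(2^{s+1} - 1) = 2·5(2^s - 1) + 5`, so consecutive degrees of the family are linked by Kameko's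
map. -/
theorem finrank_cohitDegree_succ (s : ℕ) :
    Module.finrank (ZMod 2) (cohitDegree 5 (5 * (2 ^ (s + 1) - 1))) =
      Module.finrank (ZMod 2) (cohitDegree 5 (5 * (2 ^ s - 1))) + Module.finrank (ZMod 2)
        ((xspan (low (5 * (2 ^ (s + 1) - 1)))).map (hit 5).mkQ) := by
  have h : 5 * (2 ^ (s + 1) - 1) = 2 * (5 * (2 ^ s - 1)) + 5 := by
    have : 0 < 2 ^ s := by positivity
    rw [pow_succ]
    omega
  rw [h, finrank_cohitDegree_kameko]

theorem finrank_cohitDegree_one : Module.finrank (ZMod 2) (cohitDegree 5 (5 * (2 ^ 1 - 1))) = 46 := by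
  rw [finrank_cohitDegree_succ 0, show 5 * (2 ^ 0 - 1) = 0 by norm_num,
    show 5 * (2 ^ (0 + 1) - 1) = 5 by norm_num, finrank_cohitDegree_zero, finrank_low_five]

theorem finrank_cohitDegree_two :
    Module.finrank (ZMod 2) (cohitDegree 5 (5 * (2 ^ 2 - 1))) = 432 := by
  rw [finrank_cohitDegree_succ 1, finrank_cohitDegree_one,
    show 5 * (2 ^ (1 + 1) - 1) = 15 by norm_num, finrank_low_fifteen]

/-- The base case is `432 + 685`. From there on the low part vanishes, and Kameko's map is an
isomorphism between consecutive degrees. -/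
theorem finrank_cohitDegree_add_three (t : ℕ) :
    Module.finrank (ZMod 2) (cohitDegree 5 (5 * (2 ^ (t + 3) - 1))) = 1117 := by
  induction t with
  | zero =>
    rw [zero_add, finrank_cohitDegree_succ 2, finrank_cohitDegree_two,
      show 5 * (2 ^ (2 + 1) - 1) = 35 by norm_num, finrank_low_thirty_five]
  | succ t ih =>
    rw [show t + 1 + 3 = t + 3 + 1 by ring, finrank_cohitDegree_succ, ih,
      finrank_low_eq_zero fun e he => low_mem_hit (by omega) he.1 he.2]

end PolyAlg

theorem mainTheorem4 (s : ℕ) (hs : 0 < s) :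
    Module.finrank (ZMod 2) (PolyAlg.cohitDegree 5 (5 * (2 ^ s - 1))) =
      if s = 1 then 46 else if s = 2 then 432 else 1117 := by
  split_ifs with h1 h2
  · rw [h1, PolyAlg.finrank_cohitDegree_one]
  · rw [h2, PolyAlg.finrank_cohitDegree_two]
  · obtain ⟨t, rfl⟩ := Nat.exists_eq_add_of_le' (show 3 ≤ s by omega)
    exact PolyAlg.finrank_cohitDegree_add_three t
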